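/- **Setting.** Let $\mathbf A=(\mathbf{RP}^1\times\mathbf{RP}^1)\setminus\Delta$ be the split annulus, with the split structure $(\mathcal L_1,\mathcal L_2)$ given by the fibres of the two projections, and let $\mathrm I$ be the involution of $T\mathbf A$ equal to $(-1)^i$ on $T\mathcal L_i$. A metric on $\mathbf A$ is a Lorentz metric $g$ for which the lines $T\mathcal L_i$ are isotropic and $g(v_1,v_2)>0$ for every oriented frame $(v_1,v_2)$ with $v_i\in T\mathcal L_i$. Write $\omega_g(u,v)=g(u,\mathrm Iv)$ for its volume form, $\mathrm da_g$ for the corresponding area measure, $\square_g$ for its d'Alembertian, $K(g)$ for its sectional curvature (defined by $R_g=-K(g)\,\omega_g\otimes \mathrm I$) and $F_g=K(g)\,\omega_g$ for its curvature form. Any two metrics are related by $h=e^{2u}g$ for a unique function $u$, denoted $u_{g,h}$. For $c>0$, the de Sitter metric of curvature $c$ is $c^{-1}g_0$, with $g_0=\frac{2\,\mathrm dx\,\mathrm dy}{(x-y)^2}$ (that is, $g_0(\partial_x,\partial_y)=2/(x-y)^2$); a metric is uniformizing of curvature $c$ if it is $\Phi^*(c^{-1}g_0)$ for a $C^3$ split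 diffeomorphism $\Phi$ of $\mathbf A$. A polygonal curve is a closed curve in $\mathbf A$ made of finitely many alternately vertical and horizontal segments, whose vertices $(\alpha_1,\dots,\alpha_{2n})$ have cyclically oriented projections to both factors (consecutive vertices may coincide, so that a curve $P$ is represented by many sequences of vertices). Let $\mathrm{VB}(u,P)$ be the supremum of $\sum_i|u(\alpha_{2i-1})-u(\alpha_{2i})|$ over the sequences of vertices representing $P$, the segments $[\alpha_{2i-1},\alpha_{2i}]$ being the horizontal ones. Let $b$ be a $C^2$ metric with bounded curvature. A $C^2$ metric $h=e^{2u}b$ is in the $\mathcal S$-class of $b$ if $u\in L^\infty(\mathrm da_b)$, $u\to0$ at infinity in $\mathbf A$ (off compact sets), $\square_bu\in L^\infty(\mathrm da_b)\cap L^1(\mathrm da_b)$, and $\mathrm{VB}(u,P)<\infty$ for some polygonal curve $P$. For $h=e^{2u}g$ the Liouville action is $$\mathcal S(g,h)=-\tfrac12\int_{\mathbf A}u\,F_g+\tfrac14\int_{\mathbf A}u\,\mathrm d(\mathrm du\circ \mathrm I);$$ it is said to be defined if both integrals converge absolutely. **Theorem.** Let $g,h,k$ be $C^2$ metrics in a common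 $\mathcal S$-class. 1. (Chasles) If $u_{g,k}F_g$ and $u_{k,h}F_k$ are integrable, then $\mathcal S(g,k)$, $\mathcal S(k,h)$, $\mathcal S(g,h)$ are defined and $\mathcal S(g,h)=\mathcal S(g,k)+\mathcal S(k,h)$. 2. (Monotonicity) If $u=u_{g,h}$ and $uF_g$ is integrable, then $\mathcal S(g,h)$ is defined, $u(F_g+F_h)$ is integrable and $\mathcal S(g,h)=-\frac14\int_{\mathbf A}u(F_g+F_h)$. 3. (Uniformizing metrics) Let $c>0$. Every uniformizing metric of curvature $c$ is in the $\mathcal S$-class of the de Sitter metric of curvature $c$ and has constant curvature $c$. If $g$ and $h$ are $C^2$ metrics in the $\mathcal S$-class of the de Sitter metric of curvature $c$ and both have constant curvature $c$, then $\mathcal S(g,h)$ is defined and $\mathcal S(g,h)=0$. In particular this holds for any two uniformizing metrics of curvature $c$. **$\mathcal W$-volume.** Let $W=V\otimes V$ with $V=\mathbb R^2$, with the quadratic form $\langle\cdot,\cdot\rangle=-\omega\otimes\omega$ of signature $(2,2)$, where $\omega$ is the determinant on $V$, and let $\det$ be the determinant on $W$ in the basis $e_1\otimes e_1,e_1\otimes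 e_2,e_2\otimes e_1,e_2\otimes e_2$. Let $\mathbf{Ein}^{1,1}=\{[a\otimes b]\}\subset\mathbf P(W)$ be the quadric of isotropic lines, split by the fibres of $[a\otimes b]\mapsto[a]$ and $[a\otimes b]\mapsto[b]$, and let $\mathsf U=\{(x,n)\in W^2:\langle x,x\rangle=-1,\langle n,n\rangle=1,\langle x,n\rangle=0\}$. Let $\phi:\mathbf A\to\mathbf{Ein}^{1,1}$ be a smooth immersion preserving the split structures, along which the tautological line bundle is trivial. An Epstein surface of a $C^2$ metric $g$ and $\phi$ is $S=\frac{\sqrt2}2(\sigma-\eta,\sigma+\eta):\mathbf A\to\mathsf U$, where $\sigma:\mathbf A\to W$ is $C^2$ with $[\sigma]=\phi$ and $\langle D_u\sigma,D_v\sigma\rangle=g(u,v)$, and $\eta$ is determined by $\langle\eta,\sigma\rangle=1$, $\langle\eta,\eta\rangle=0$, $\langle\eta,D_u\sigma\rangle=0$; it is unique up to sign. A lens cobordism from $S$ to $\Sigma$ is a $C^1$ map $M:\mathbf A\times[0,1]\to\mathsf U$ with $M_0=S$, $M_1=\Sigma$, constant in the second variable outside a compact subset of $\mathbf A$. Its $\mathcal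 W$-volume is $\int_{\mathbf A\times[0,1]}M^*\omega-\int_{\partial(\mathbf A\times[0,1])}M^*\alpha$, where $\omega_{(x,n)}(u,v,w)=\det(x,u_1,v_1,w_1)$ and $\alpha_{(x,n)}(u,v)=\frac14\left(\det(x,n,u_2,v_1)+\det(x,n,u_1,v_2)\right)$, and the boundary is $\mathbf A\times\{0\}$ with the orientation of $\mathbf A$ together with $\mathbf A\times\{1\}$ with the opposite one (the boundary terms cancel off a compact set). 4. If $g,h$ are any two $C^2$ metrics on $\mathbf A$ that agree outside a compact set and $S,\Sigma$ are Epstein surfaces of $g,h$ with the same $\phi$, then $\mathcal S(g,h)$ is defined, there is a lens cobordism from $S$ to $\Sigma$ or to $-\Sigma$, and every such lens cobordism has $\mathcal W$-volume equal to $\mathcal S(g,h)$. -/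

import Mathlib

open MeasureTheory Filter Topology Set
open scoped ENNReal

noncomputable section

namespace SplitLiouville

/-! ### The split annulus -/

instance factPiPos : Fact (0 < Real.pi) := ⟨Real.pi_pos⟩

/-- The real projective line, as the circle `ℝ / πℤ` of angles of lines:
the class of `θ` is the line `[cos θ : sin θ]`. -/
abbrev RP1 : Type := AddCircle Real.pi

/-- The annulus `(RP¹ × RP¹) ∖ Δ`. -/
abbrev Annulus : Type := {p : RP1 × RP1 // p.1 ≠ p.2}

/-- The measure `dθ₁ dθ₂` on the annulus. -/
instance annulusMeasureSpace : MeasureSpace Annulus :=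
  ⟨Measure.comap Subtype.val (volume : Measure (RP1 × RP1))⟩

/-- The covering space `{(θ₁, θ₂) ∈ ℝ² : θ₁ ≢ θ₂ mod π}` of the annulus. -/
def coverSet : Set (ℝ × ℝ) := {q | (q.1 : RP1) ≠ (q.2 : RP1)}

/-- `q ∈ ℝ²` is a pair of angles for the point `p` of the annulus. -/
def Over (q : ℝ × ℝ) (p : Annulus) : Prop := (q.1 : RP1) = p.1.1 ∧ (q.2 : RP1) = p.1.2

/-- A pair of angles for a point of the annulus. -/
def rep (p : Annulus) : ℝ × ℝ :=
  ((AddCircle.equivIco Real.pi 0 p.1.1 : ℝ), (AddCircle.equivIco Real.pi 0 p.1.2 : ℝ))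

open Classical in
/-- A function on the annulus read in the angles `(θ₁, θ₂) ∈ coverSet` (and `0` off `coverSet`). -/
def toCover {E : Type*} [Zero E] (f : Annulus → E) (q : ℝ × ℝ) : E :=
  if h : (q.1 : RP1) ≠ (q.2 : RP1) then f ⟨((q.1 : RP1), (q.2 : RP1)), h⟩ else 0

theorem rep_over (p : Annulus) : Over (rep p) p :=
  ⟨AddCircle.coe_equivIco, AddCircle.coe_equivIco⟩

theorem toCover_of_over {E : Type*} [Zero E] (f : Annulus → E) {q : ℝ × ℝ} {p : Annulus}
    (h : Over q p) : toCover f q = f p := by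
  obtain ⟨⟨a, b⟩, hp⟩ := p
  obtain ⟨h1, h2⟩ := h
  simp only at h1 h2
  subst h1
  subst h2
  exact dif_pos hp

section Calculus

variable {E : Type*} [NormedAddCommGroup E] [NormedSpace ℝ E]

/-- The derivative of a function on the annulus, in the global frame of the tangent bundle given by
the angles `θ₁, θ₂`: every tangent space of the annulus is identified with `ℝ × ℝ`. -/
def der (f : Annulus → E) (p : Annulus) : ℝ × ℝ →L[ℝ] E := fderiv ℝ (toCover f) (rep p)

/-- The derivative does not depend on the angles chosen for the point. -/
theorem der_eq_of_over (f : Annulus → E) {q : ℝ × ℝ} {p : Annulus} (h : Over q p) :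
    fderiv ℝ (toCover f) q = der f p := by
  have hr := rep_over p
  have e1 : ((rep p).1 : RP1) = (q.1 : RP1) := hr.1.trans h.1.symm
  have e2 : ((rep p).2 : RP1) = (q.2 : RP1) := hr.2.trans h.2.symm
  set c : ℝ × ℝ := rep p - q with hc
  have c1 : ((c.1 : ℝ) : RP1) = 0 := by
    simp [hc, e1]
  have c2 : ((c.2 : ℝ) : RP1) = 0 := by
    simp [hc, e2]
  have hper : (fun x => toCover f (x + c)) = toCover f := by
    funext x
    simp only [toCover, Prod.fst_add, Prod.snd_add, AddCircle.coe_add, c1, c2, add_zero]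
  have := fderiv_comp_add_right (𝕜 := ℝ) (f := toCover f) (x := q) c
  rw [hper] at this
  rw [this, der, hc]
  congr 1
  abel

/-- The oriented split frame `(v₁, v₂)` (with indices `0, 1`). The foliation `𝓛₁` consists of the
fibres of the first projection, so `v₁ = ∂/∂θ₂`; likewise `v₂ = ∂/∂θ₁`. -/
def frame (i : Fin 2) : ℝ × ℝ := if i = 0 then (0, 1) else (1, 0)

/-- The canonical involution: `-1` on `T𝓛₁ = ℝ v₁` and `+1` on `T𝓛₂ = ℝ v₂`. -/
def splitInv (v : ℝ × ℝ) : ℝ × ℝ := (v.1, -v.2)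

/-- Partial derivatives along the frame. -/
def pd (i : Fin 2) (f : Annulus → E) (p : Annulus) : E := der f p (frame i)

/-- `C^n` functions on the annulus. -/
def IsCn (n : WithTop ℕ∞) (f : Annulus → E) : Prop := ContDiffOn ℝ n (toCover f) coverSet

end Calculus

/-! ### Lorentz metrics compatible with the split structure -/

/-- A field of Lorentz products on the annulus compatible with the split structure: the two lines of
the split structure are isotropic, and `g(v₁, v₂) > 0` for the oriented split frame. -/
structure Metric where
  form : Annulus → LinearMap.BilinForm ℝ (ℝ × ℝ)
  symm : ∀ p, (form p).IsSymm
  isotropic : ∀ p i, form p (frame i) (frame i) = 0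
  pos : ∀ p, 0 < form p (frame 0) (frame 1)

namespace Metric

variable (g h : Metric)

/-- Gram matrix of `g` in the split frame. -/
def gram (p : Annulus) : Matrix (Fin 2) (Fin 2) ℝ :=
  Matrix.of fun i j => g.form p (frame i) (frame j)

/-- `C^n` metrics. -/
def IsCn (n : WithTop ℕ∞) : Prop :=
  ∀ i j : Fin 2, SplitLiouville.IsCn n (fun p => g.gram p i j)

/-- The volume form `ω_g(u, v) = g(u, I v)`. -/
def volForm (p : Annulus) (u v : ℝ × ℝ) : ℝ := g.form p u (splitInv v)

/-- A `2`-form on the annulus is represented by its coefficient, that is, its value on the oriented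
frame `(v₁, v₂)`; its integral is the integral of the coefficient against `dθ₁ dθ₂`.
This is the coefficient of the volume form. -/
def volCoeff (p : Annulus) : ℝ := g.volForm p (frame 0) (frame 1)

/-- The area measure `da_g`. -/
def area : Measure Annulus := volume.withDensity fun p => ENNReal.ofReal (g.volCoeff p)

/-- Christoffel symbols `Γ^k_{ij}` of the Levi-Civita connection:
`∇_{v_i} v_j = ∑ₖ Γ^k_{ij} v_k`. -/
def christoffel (k i j : Fin 2) (p : Annulus) : ℝ :=
  (1 / 2) * ∑ l : Fin 2, (g.gram p)⁻¹ k l *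
    (pd i (fun x => g.gram x j l) p + pd j (fun x => g.gram x i l) p
      - pd l (fun x => g.gram x i j) p)

/-- Components of the curvature tensor `R(X, Y) = ∇_X ∇_Y - ∇_Y ∇_X - ∇_{[X, Y]}`:
`R(v_i, v_j) v_k = ∑ₗ R^l_{kij} v_l`. -/
def curvTensor (l k i j : Fin 2) (p : Annulus) : ℝ :=
  pd i (g.christoffel l j k) p - pd j (g.christoffel l i k) p
    + ∑ m : Fin 2, (g.christoffel l i m p * g.christoffel m j k p
        - g.christoffel l j m p * g.christoffel m i k p)

/-- The sectional curvature `K(g)`, defined by `R_g = - K(g) ω_g ⊗ I`: evaluate on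
`(v₁, v₂)` and `v₂`, and use `I v₂ = v₂`. -/
def curvature (p : Annulus) : ℝ := - g.curvTensor 1 1 0 1 p / g.volCoeff p

/-- The curvature form `F_g = K(g) ω_g` (its coefficient). -/
def curvForm (p : Annulus) : ℝ := g.curvature p * g.volCoeff p

/-- The d'Alembertian `□_g f = tr_g (∇ df)`. -/
def dAlembert (f : Annulus → ℝ) (p : Annulus) : ℝ :=
  ∑ i : Fin 2, ∑ j : Fin 2, (g.gram p)⁻¹ i j *
    (pd i (pd j f) p - ∑ k : Fin 2, g.christoffel k i j p * pd k f p)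

/-- The function `u` such that `h = e^{2u} g`. -/
def factor (p : Annulus) : ℝ :=
  (1 / 2) * Real.log (h.form p (frame 0) (frame 1) / g.form p (frame 0) (frame 1))

theorem form_eq_exp_factor (p : Annulus) :
    h.form p = Real.exp (2 * g.factor h p) • g.form p := by
  have hg := g.pos p
  have hh := h.pos p
  have e : Real.exp (2 * g.factor h p) =
      h.form p (frame 0) (frame 1) / g.form p (frame 0) (frame 1) := by
    have h2 : 2 * g.factor h p =
        Real.log (h.form p (frame 0) (frame 1) / g.form p (frame 0) (frame 1)) := by
      unfold factor; ring
    rw [h2, Real.exp_log (div_pos hh hg)]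
  have key : ∀ (m : Metric) (v w : ℝ × ℝ),
      m.form p v w = (v.2 * w.1 + v.1 * w.2) * m.form p (frame 0) (frame 1) := by
    intro m v w
    have hv : ∀ x : ℝ × ℝ, x = x.2 • frame 0 + x.1 • frame 1 := by
      intro x; simp [frame]
    have hs : m.form p (frame 1) (frame 0) = m.form p (frame 0) (frame 1) := by
      have := (m.symm p).eq (frame 1) (frame 0)
      simpa using this
    conv_lhs => rw [hv v, hv w]
    simp only [map_add, map_smul, LinearMap.add_apply, LinearMap.smul_apply, smul_eq_mul,
      m.isotropic, hs]
    ring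
  refine LinearMap.ext fun v => LinearMap.ext fun w => ?_
  rw [LinearMap.smul_apply, LinearMap.smul_apply, e, key h v w, key g v w, smul_eq_mul]
  field_simp

end Metric

/-- The coefficient of the `2`-form `d(du ∘ I)`. -/
def ddI (u : Annulus → ℝ) (p : Annulus) : ℝ :=
  pd 0 (fun x => der u x (splitInv (frame 1))) p - pd 1 (fun x => der u x (splitInv (frame 0))) p

/-! ### Polygonal curves and `𝓢`-classes -/

/-- The vertices of a polygonal curve, as angles: `α_i = (s i, t i)`, for `i` modulo `2k`, with
cyclically oriented projections (the angles increase by `π` in a turn), the points `α_{2i}` and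
`α_{2i+1}` bounding a vertical segment of the annulus, and `α_{2i+1}` and `α_{2i+2}` a
horizontal one. -/
structure IsVertexSeq (k : ℕ) (s t : ℤ → ℝ) : Prop where
  pos : 0 < k
  mono_fst : Monotone s
  mono_snd : Monotone t
  turn_fst : ∀ i, s (i + 2 * k) = s i + Real.pi
  turn_snd : ∀ i, t (i + 2 * k) = t i + Real.pi
  vertical : ∀ i, s (2 * i) = s (2 * i + 1)
  horizontal : ∀ i, t (2 * i + 1) = t (2 * i + 2)
  strip : ∀ i, s i < t i ∧ t i < s i + Real.pi

/-- The curve represented by a sequence of vertices, as a subset of the annulus. -/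
def polygon (s t : ℤ → ℝ) : Set Annulus :=
  {p | ∃ (i : ℤ) (q : ℝ × ℝ), Over q p ∧ q.1 ∈ Icc (s i) (s (i + 1)) ∧ q.2 ∈ Icc (t i) (t (i + 1))}

/-- A polygonal curve. -/
def IsPolygonalCurve (P : Set Annulus) : Prop :=
  ∃ (k : ℕ) (s t : ℤ → ℝ), IsVertexSeq k s t ∧ P = polygon s t

/-- `VB(u, P)`: the supremum of `∑ᵢ |u(α_{2i-1}) - u(α_{2i})|` over the sequences representing
`P`. -/
def VB (u : Annulus → ℝ) (P : Set Annulus) : ℝ≥0∞ :=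
  ⨆ (k : ℕ) (s : ℤ → ℝ) (t : ℤ → ℝ) (_ : IsVertexSeq k s t ∧ P = polygon s t),
    ∑ i ∈ Finset.range k, ENNReal.ofReal
      |toCover u (s (2 * i + 1), t (2 * i + 1)) - toCover u (s (2 * i + 2), t (2 * i + 2))|

/-- The set `𝓜_b` of `C²` metrics of bounded curvature. -/
def MemMb (g : Metric) : Prop := g.IsCn 2 ∧ MemLp g.curvature ⊤ g.area

/-- The `C²` metric `h = e^{2u} g` belongs to the `𝓢`-class of `g`. -/
structure InSClass (g h : Metric) : Prop where
  memMb : MemMb g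
  regular : h.IsCn 2
  bounded : MemLp (g.factor h) ⊤ g.area
  boundary : Tendsto (g.factor h) (cocompact Annulus) (𝓝 0)
  dAlembert_bounded : MemLp (g.dAlembert (g.factor h)) ⊤ g.area
  dAlembert_integrable : Integrable (g.dAlembert (g.factor h)) g.area
  variation : ∃ P, IsPolygonalCurve P ∧ VB (g.factor h) P ≠ ⊤

/-! ### The Liouville action -/

/-- The Liouville action `S(g, h) = -½ ∫ u F_g + ¼ ∫ u d(du ∘ I)`, with `h = e^{2u} g`. -/
def action (g h : Metric) : ℝ :=
  -(1 / 2) * (∫ p, g.factor h p * g.curvForm p)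
    + (1 / 4) * ∫ p, g.factor h p * ddI (g.factor h) p

/-- The integrals defining `S(g, h)` converge absolutely. -/
def ActionConverges (g h : Metric) : Prop :=
  Integrable (fun p => g.factor h p * g.curvForm p) ∧
    Integrable (fun p => g.factor h p * ddI (g.factor h) p)

/-! ### De Sitter metrics and uniformizing metrics -/

/-- The compatible metric with `g(∂/∂θ₁, ∂/∂θ₂) = f`, that is `g = f dθ₁ dθ₂`. -/
def Metric.ofCoeff (f : Annulus → ℝ) (hf : ∀ p, 0 < f p) : Metric where
  form p := f p •
    LinearMap.mk₂ ℝ (fun v w : ℝ × ℝ => v.1 * w.2 + v.2 * w.1)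
      (by intros; simp; ring) (by intros; simp; ring) (by intros; simp; ring)
      (by intros; simp; ring)
  symm p := ⟨fun v w => by
    simp only [LinearMap.smul_apply, LinearMap.mk₂_apply, smul_eq_mul, RingHom.id_apply]
    ring⟩
  isotropic p i := by fin_cases i <;> simp [frame]
  pos p := by simpa [frame] using hf p

theorem sin_sq_pos (p : Annulus) : 0 < Real.sin ((rep p).1 - (rep p).2) ^ 2 := by
  have h1 := (AddCircle.equivIco Real.pi 0 p.1.1).2
  have h2 := (AddCircle.equivIco Real.pi 0 p.1.2).2
  have e : Real.sin ((rep p).1 - (rep p).2) ≠ 0 := by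
    intro h0
    simp only [mem_Ico] at h1 h2
    have h3 := (Real.sin_eq_zero_iff_of_lt_of_lt (by simp only [rep]; linarith [h1.1, h2.2])
      (by simp only [rep]; linarith [h1.2, h2.1])).1 h0
    apply p.2
    rw [← (rep_over p).1, ← (rep_over p).2, sub_eq_zero.1 h3]
  positivity

/-- The de Sitter metric of curvature `c > 0`, that is `c⁻¹ g₀` with
`g₀ = 2 dθ₁ dθ₂ / sin² (θ₁ - θ₂) = 2 dx dy / (x - y)²`, where `x = tan θ₁` and `y = tan θ₂`. -/
def deSitter (c : ℝ) (hc : 0 < c) : Metric :=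
  Metric.ofCoeff (fun p => 2 / (c * Real.sin ((rep p).1 - (rep p).2) ^ 2))
    fun p => div_pos two_pos (mul_pos hc (sin_sq_pos p))

/-- `h = Φ^* g` for a `C^n` split diffeomorphism `Φ` of the annulus: near each point, `Φ` is
given in angles by a `C^n` map `F` whose differential is invertible and preserves both lines of
the split structure. -/
def IsSplitPullback (n : WithTop ℕ∞) (Φ : Annulus ≃ₜ Annulus) (g h : Metric) : Prop :=
  ∀ p : Annulus, ∃ F : ℝ × ℝ → ℝ × ℝ,
    (∀ᶠ q in 𝓝 (rep p), ∀ x : Annulus, Over q x → Over (F q) (Φ x)) ∧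
    ContDiffAt ℝ n F (rep p) ∧
    (∀ i, ∃ r : ℝ, r ≠ 0 ∧ fderiv ℝ F (rep p) (frame i) = r • frame i) ∧
    ∀ v w, h.form p v w =
      g.form (Φ p) (fderiv ℝ F (rep p) v) (fderiv ℝ F (rep p) w)

/-- Uniformizing metrics of curvature `c`: the pull-backs of the de Sitter metric of curvature `c`
by the `C³` split diffeomorphisms. -/
def IsUniformizing (c : ℝ) (hc : 0 < c) (h : Metric) : Prop :=
  ∃ Φ : Annulus ≃ₜ Annulus, IsSplitPullback 3 Φ (deSitter c hc) h

/-! ### The Einstein torus, isotropic surfaces and Epstein surfaces -/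

/-- `W = V ⊗ V` with `V = ℝ²`, in the basis `e₁⊗e₁, e₁⊗e₂, e₂⊗e₁, e₂⊗e₂`. -/
abbrev W : Type := Fin 4 → ℝ

/-- The tensor `a ⊗ b`. -/
def tensor (a b : Fin 2 → ℝ) : W := ![a 0 * b 0, a 0 * b 1, a 1 * b 0, a 1 * b 1]

/-- The symmetric bilinear form of signature `(2, 2)` on `W`. -/
def pairing (x y : W) : ℝ := -(x 0 * y 3) - x 3 * y 0 + x 1 * y 2 + x 2 * y 1

/-- It is the form `- ω ⊗ ω`, with `ω` the determinant on `V`. -/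
theorem pairing_tensor (a b a' b' : Fin 2 → ℝ) :
    pairing (tensor a b) (tensor a' b') =
      -((a 0 * a' 1 - a 1 * a' 0) * (b 0 * b' 1 - b 1 * b' 0)) := by
  simp [pairing, tensor]; ring

/-- The determinant on `W` in the basis `e₁⊗e₁, e₁⊗e₂, e₂⊗e₁, e₂⊗e₂`. -/
def det4 (a b c d : W) : ℝ := Matrix.det (Matrix.of ![a, b, c, d])

/-- `φ` is a smooth split immersion of the annulus into the Einstein torus
`{[a ⊗ b]} ⊆ P(W)`, the quadric of isotropic lines, along which the tautological line bundle is
trivial: `f` is a nowhere vanishing section of this bundle. The `i`-th foliation of the Einstein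
torus consists of the fibres of the `i`-th projection `[a ⊗ b] ↦ [a]`, `[a ⊗ b] ↦ [b]`. -/
def IsSplitImmersion (φ : Annulus → Projectivization ℝ W) : Prop :=
  ∃ f : Annulus → W, IsCn ((⊤ : ℕ∞) : WithTop ℕ∞) f ∧ ∀ p,
    (∃ hp : f p ≠ 0, φ p = Projectivization.mk ℝ (f p) hp) ∧
    LinearIndependent ℝ ![f p, pd 0 f p, pd 1 f p] ∧
    ∃ a b a' b' : Fin 2 → ℝ,
      f p = tensor a b ∧ pd 0 f p = tensor a b' ∧ pd 1 f p = tensor a' b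

/-- `σ` is an isotropic surface over `φ` whose first fundamental form at infinity is `g`. -/
def IsIsotropicSurface (φ : Annulus → Projectivization ℝ W) (g : Metric) (σ : Annulus → W) : Prop :=
  IsCn 2 σ ∧ ∀ p,
    (∃ hp : σ p ≠ 0, φ p = Projectivization.mk ℝ (σ p) hp) ∧
    pairing (σ p) (σ p) = 0 ∧
    ∀ v w, g.form p v w = pairing (der σ p v) (der σ p w)

/-- `η` is the dual isotropic surface of `σ`. -/
def IsDualSurface (σ η : Annulus → W) : Prop :=
  ∀ p, pairing (η p) (σ p) = 1 ∧ pairing (η p) (η p) = 0 ∧ ∀ v, pairing (η p) (der σ p v) = 0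

/-- The unit tangent bundle of the double cover `{q = -1}` of the anti-de Sitter space. -/
def unitTangent : Set (W × W) :=
  {z | pairing z.1 z.1 = -1 ∧ pairing z.2 z.2 = 1 ∧ pairing z.1 z.2 = 0}

/-- `S` is a `g`-Epstein surface of the immersion `φ` (there are two of them, `S` and `-S`). -/
def IsEpsteinSurface (φ : Annulus → Projectivization ℝ W) (g : Metric) (S : Annulus → W × W) :
    Prop :=
  ∃ σ η : Annulus → W, IsIsotropicSurface φ g σ ∧ IsDualSurface σ η ∧
    ∀ p, S p = ((√2 / 2) • (σ p - η p), (√2 / 2) • (σ p + η p))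

/-! ### The `𝓦`-volume -/

/-- `M : A × [0,1] → U` is a (`C¹`) lens cobordism from `S` to `S'`. -/
structure IsLensCobordism (S S' : Annulus → W × W) (M : Annulus → ℝ → W × W) : Prop where
  regular : ContDiffOn ℝ 1 (fun q : (ℝ × ℝ) × ℝ => toCover (fun p => M p q.2) q.1)
    (coverSet ×ˢ Icc (0 : ℝ) 1)
  mem : ∀ p, ∀ τ ∈ Icc (0 : ℝ) 1, M p τ ∈ unitTangent
  start : ∀ p, M p 0 = S p
  finish : ∀ p, M p 1 = S' p
  constant : ∃ K : Set Annulus, IsCompact K ∧ ∀ p ∉ K, ∀ τ ∈ Icc (0 : ℝ) 1, M p τ = M p 0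

/-- The coefficient of `S^* α`, where
`α_{(x,n)}(u, v) = ¼ (det(x, n, u₂, v₁) + det(x, n, u₁, v₂))`. -/
def alphaCoeff (S : Annulus → W × W) (p : Annulus) : ℝ :=
  (1 / 4) * (det4 (S p).1 (S p).2 (pd 0 S p).2 (pd 1 S p).1
    + det4 (S p).1 (S p).2 (pd 0 S p).1 (pd 1 S p).2)

/-- The value of `M^* ω` on `(v₁, v₂, ∂/∂τ)`, where `ω_{(x,n)}(u, v, w) = det(x, u₁, v₁, w₁)`. -/
def omegaCoeff (M : Annulus → ℝ → W × W) (p : Annulus) (τ : ℝ) : ℝ :=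
  det4 (M p τ).1 (pd 0 (fun x => M x τ) p).1 (pd 1 (fun x => M x τ) p).1
    (derivWithin (fun r => M p r) (Icc 0 1) τ).1

/-- The `𝓦`-volume `∫_{A × [0,1]} M^* ω - ∫_{∂(A × [0,1])} M^* α` of a lens cobordism. The
boundary is `A × {0}` with the orientation of `A`, and `A × {1}` with the opposite one; so
`(v₁, v₂, ∂/∂τ)` is a negative frame of `A × [0,1]`. The two boundary terms cancel outside a
compact set and are integrated together. -/
def wVolume (M : Annulus → ℝ → W × W) : ℝ :=
  -(∫ p, ∫ τ in (0 : ℝ)..1, omegaCoeff M p τ)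
    - ∫ p, (alphaCoeff (fun x => M x 0) p - alphaCoeff (fun x => M x 1) p)

end SplitLiouville

end

/-!
In the split frame a metric is `g = f dθ₁ dθ₂` with one positive coefficient `f = Metric.dens g`. Its
curvature form is `F_g = -∂₀∂₁ log f`, and `d(du ∘ I) = 2 ∂₀∂₁ u`, so that `F_h = F_g - 2 ∂₀∂₁ u` for
`h = e^{2u} g`. Every statement is about integrals of products of such functions.

*Chasles and monotonicity.* For metrics in a common `𝓢`-class, `u` tends to zero at infinity and
`∂₀∂₁ u` is integrable, which is the content of `Asymptotic`. This is enough for Green's formula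
`∫ u ∂₀∂₁ v = ∫ v ∂₀∂₁ u` (`green`): integrability of `∂₀(∂₁ v)` bounds `∫ |∂₁ v|` along the curves
`θ₂ - θ₁ = d`, while `u` is uniformly small on those near the ends. Both formulas are then algebra.

*Constant curvature.* If `g` has constant curvature `c`, the Liouville equation
`∂₀∂₁ log f = -c f` shows that the functions `f (·, t)^{-1/2}` solve one Hill equation
(`schwarzian_const`, `wronskian_const`), and the behaviour at infinity fixes the boundary values, so
`g` is the pull-back of the de Sitter metric by a map `φ × φ`, with `φ` a `C³` diffeomorphism of the
projective line (`isNormalForm_of_curvature`). Split diffeomorphisms of the annulus are of this form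
too, up to orientation (`exists_isNormalForm`). For such metrics `u` extends by zero to a `C²`
function on the torus with vanishing first derivatives on the diagonal, which gives membership in the
`𝓢`-class. The identity `cot² = 1/sin² - 1` for `φ(t) - φ(s)` expresses `u F_g`, up to exact terms, by
the function `-∂ₛu ∂ₜu`, and integrating over the torus gives action zero
(`IsNormalForm.action_deSitter`). The Chasles relation does the rest.

*Volume.* On the quadric `{q = -1}` the volume form is exact, with a primitive that is explicit in
linear coordinates (`volPrimitive`). By Stokes' theorem, proved for `C¹` functions on the torus times
an interval (`flat_stokes`, `hasStokes_jac`), the `𝓦`-volume of a lens cobordism depends only on its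
ends (`IsLensCobordism.wVolume_eq`). A metric determines its Epstein surface up to sign, which is that
of `e^v F` for a section `F` of the tautological bundle (`IsEpsteinSurface.eq_epstein`). The path of
the Epstein surfaces of `e^{v + τu} F`, `0 ≤ τ ≤ 1`, is a lens cobordism along which the form
`dα - ω` is `u ⟨η, σ₀₁⟩`, by a computation in a frame (`IsLightFrame.dAlpha_sub_vol`). Since
`⟨η, σ₀₁⟩` is `-F/2`, its integral is the Liouville action. The sign of the end of a lens cobordism is
determined, as the cobordism is constant near the ends of the annulus.
-/

noncomputable section

namespace SplitLiouville

/-! ### Topology of the annulus and of its covering space -/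

theorem coe_eq_coe_iff_sin {x y : ℝ} : (x : RP1) = (y : RP1) ↔ Real.sin (x - y) = 0 := by
  rw [← sub_eq_zero, ← AddCircle.coe_sub, AddCircle.coe_eq_zero_iff, Real.sin_eq_zero_iff]
  simp only [zsmul_eq_mul]

theorem mem_coverSet_iff {q : ℝ × ℝ} : q ∈ coverSet ↔ Real.sin (q.1 - q.2) ≠ 0 := by
  unfold coverSet
  rw [mem_ofPred_eq, Ne, coe_eq_coe_iff_sin]

theorem isOpen_coverSet : IsOpen coverSet := by
  have : coverSet = {q : ℝ × ℝ | Real.sin (q.1 - q.2) ≠ 0} := by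
    ext q; exact mem_coverSet_iff
  rw [this]
  exact isOpen_ne_fun (by fun_prop) (by fun_prop)

/-- Points of the strip `{s < t < s + π}`, in the coordinates `(s, d)` with `t = s + d`. -/
theorem strip_mem {s d : ℝ} (h0 : 0 < d) (h1 : d < Real.pi) : (s, s + d) ∈ coverSet := by
  rw [mem_coverSet_iff]
  have : Real.sin (s - (s + d)) = - Real.sin d := by
    rw [← Real.sin_neg]; congr 1; ring
  simp only [this]
  exact neg_ne_zero.2 (Real.sin_pos_of_pos_of_lt_pi h0 h1).ne'

theorem over_mem {q : ℝ × ℝ} {p : Annulus} (h : Over q p) : q ∈ coverSet := by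
  unfold coverSet
  rw [mem_ofPred_eq, h.1, h.2]
  exact p.2

theorem rep_mem (p : Annulus) : rep p ∈ coverSet := over_mem (rep_over p)

/-- A base point of the annulus. -/
def basePoint : Annulus :=
  ⟨(((0 : ℝ) : RP1), ((0 + Real.pi / 2 : ℝ) : RP1)),
    strip_mem (s := 0) (d := Real.pi / 2) (by positivity) (by linarith [Real.pi_pos])⟩

open Classical in
/-- The covering map of the annulus (with the base point as value off `coverSet`). -/
def proj (q : ℝ × ℝ) : Annulus :=
  if h : (q.1 : RP1) ≠ (q.2 : RP1) then ⟨((q.1 : RP1), (q.2 : RP1)), h⟩ else basePoint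

theorem proj_of_mem {q : ℝ × ℝ} (h : q ∈ coverSet) : proj q = ⟨((q.1 : RP1), (q.2 : RP1)), h⟩ :=
  dif_pos h

theorem over_proj {q : ℝ × ℝ} (h : q ∈ coverSet) : Over q (proj q) := by
  rw [proj_of_mem h]; exact ⟨rfl, rfl⟩

theorem proj_of_over {q : ℝ × ℝ} {p : Annulus} (h : Over q p) : proj q = p := by
  rw [proj_of_mem (over_mem h)]
  exact Subtype.ext (Prod.ext h.1 h.2)

theorem proj_rep (p : Annulus) : proj (rep p) = p := proj_of_over (rep_over p)

theorem toCover_eq {E : Type*} [Zero E] (f : Annulus → E) {q : ℝ × ℝ} (h : q ∈ coverSet) :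
    toCover f q = f (proj q) := toCover_of_over f (over_proj h)

theorem toCover_rep {E : Type*} [Zero E] (f : Annulus → E) (p : Annulus) :
    toCover f (rep p) = f p := toCover_of_over f (rep_over p)

theorem coe_add_int_mul_pi (x : ℝ) (n : ℤ) : ((x + n * Real.pi : ℝ) : RP1) = (x : RP1) := by
  rw [AddCircle.coe_add]
  have : ((n * Real.pi : ℝ) : RP1) = 0 := by
    rw [AddCircle.coe_eq_zero_iff]; exact ⟨n, by simp⟩
  rw [this, add_zero]

theorem toCover_add_int {E : Type*} [Zero E] (f : Annulus → E) (s t : ℝ) (m n : ℤ) :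
    toCover f (s + m * Real.pi, t + n * Real.pi) = toCover f (s, t) := by
  simp only [toCover, coe_add_int_mul_pi]

theorem toCover_add_pi {E : Type*} [Zero E] (f : Annulus → E) (s t : ℝ) :
    toCover f (s + Real.pi, t + Real.pi) = toCover f (s, t) := by
  simpa using toCover_add_int f s t 1 1

theorem toCover_add_pi_snd {E : Type*} [Zero E] (f : Annulus → E) (s t : ℝ) :
    toCover f (s, t + Real.pi) = toCover f (s, t) := by
  simpa using toCover_add_int f s t 0 1

theorem strip_periodic {E : Type*} [Zero E] (f : Annulus → E) (d : ℝ) :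
    Function.Periodic (fun s => toCover f (s, s + d)) Real.pi := by
  intro s
  have := toCover_add_pi f s (s + d)
  simpa [add_right_comm] using this

/-- Every point of the annulus is of the form `proj (s, s + d)` with `0 ≤ s < π`, `0 < d < π`. -/
theorem exists_strip (p : Annulus) :
    ∃ s d : ℝ, s ∈ Ico 0 Real.pi ∧ d ∈ Ioo 0 Real.pi ∧ proj (s, s + d) = p := by
  obtain ⟨s, hs, hs'⟩ := AddCircle.eq_coe_Ico p.1.1
  obtain ⟨d, hd, hd'⟩ := AddCircle.eq_coe_Ico (p.1.2 - p.1.1)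
  have e : ((s + d : ℝ) : RP1) = p.1.2 := by
    rw [AddCircle.coe_add, hs', hd']; abel
  refine ⟨s, d, hs, ⟨lt_of_le_of_ne hd.1 ?_, hd.2⟩, proj_of_over ⟨hs', e⟩⟩
  rintro rfl
  apply p.2
  rw [← hs', ← e]; simp

theorem continuousOn_proj : ContinuousOn proj coverSet := by
  rw [continuousOn_iff_continuous_domRestrict]
  have : coverSet.domRestrict proj = fun q : coverSet =>
      (⟨((q.1.1 : RP1), (q.1.2 : RP1)), q.2⟩ : Annulus) := by
    ext1 q; exact proj_of_mem q.2
  rw [this]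
  refine Continuous.subtype_mk ?_ _
  exact ((AddCircle.continuous_mk' _).comp (continuous_fst.comp continuous_subtype_val)).prodMk
    ((AddCircle.continuous_mk' _).comp (continuous_snd.comp continuous_subtype_val))

theorem isOpenQuotientMap_restrict_proj :
    IsOpenQuotientMap (fun q : coverSet => (⟨((q.1.1 : RP1), (q.1.2 : RP1)), q.2⟩ : Annulus)) := by
  refine ⟨?_, ?_, ?_⟩
  · intro p
    exact ⟨⟨rep p, rep_mem p⟩, Subtype.ext (Prod.ext (rep_over p).1 (rep_over p).2)⟩
  · refine Continuous.subtype_mk ?_ _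
    exact ((AddCircle.continuous_mk' _).comp (continuous_fst.comp continuous_subtype_val)).prodMk
      ((AddCircle.continuous_mk' _).comp (continuous_snd.comp continuous_subtype_val))
  · have h1 : IsOpenMap (Prod.map ((↑) : ℝ → RP1) ((↑) : ℝ → RP1)) :=
      QuotientAddGroup.isOpenMap_coe.prodMap QuotientAddGroup.isOpenMap_coe
    exact h1.restrictPreimage {p : RP1 × RP1 | p.1 ≠ p.2}

theorem continuous_of_continuousOn_toCover {E : Type*} [Zero E] [TopologicalSpace E]
    {f : Annulus → E} (h : ContinuousOn (toCover f) coverSet) : Continuous f := by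
  rw [isOpenQuotientMap_restrict_proj.isQuotientMap.continuous_iff]
  rw [continuousOn_iff_continuous_domRestrict] at h
  convert h using 1
  ext1 q
  exact (toCover_of_over f ⟨rfl, rfl⟩).symm

theorem continuousOn_toCover {E : Type*} [Zero E] [TopologicalSpace E]
    {f : Annulus → E} (h : Continuous f) : ContinuousOn (toCover f) coverSet :=
  (h.comp_continuousOn continuousOn_proj).congr fun _ hq => toCover_eq f hq

instance : PreconnectedSpace Annulus := by
  have h : IsPreconnected ((fun x : ℝ × ℝ => proj (x.1, x.1 + x.2)) '' (univ ×ˢ Ioo 0 Real.pi)) := by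
    apply IsPreconnected.image
    · exact (isPreconnected_univ).prod isPreconnected_Ioo
    · refine continuousOn_proj.comp (by fun_prop) ?_
      rintro ⟨s, d⟩ ⟨-, hd⟩
      exact strip_mem hd.1 hd.2
  refine ⟨?_⟩
  convert h
  symm
  rw [eq_univ_iff_forall]
  intro p
  obtain ⟨s, d, -, hd, rfl⟩ := exists_strip p
  exact ⟨(s, d), ⟨trivial, hd⟩, rfl⟩

/-- The compact sets `{ε ≤ θ₂ - θ₁ ≤ π - ε}`, which exhaust the annulus. -/
def core (ε : ℝ) : Set Annulus :=
  (fun x : ℝ × ℝ => proj (x.1, x.1 + x.2)) '' (Icc 0 Real.pi ×ˢ Icc ε (Real.pi - ε))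

theorem isCompact_core {ε : ℝ} (hε : 0 < ε) : IsCompact (core ε) := by
  apply (isCompact_Icc.prod isCompact_Icc).image_of_continuousOn
  refine continuousOn_proj.comp (by fun_prop) ?_
  rintro ⟨s, d⟩ ⟨-, hd⟩
  exact strip_mem (by linarith [hd.1]) (by linarith [hd.2])

/-- The squared sine of the angle between two lines, as a continuous positive function. -/
def sinSq (p : Annulus) : ℝ := Real.sin ((rep p).1 - (rep p).2) ^ 2

theorem sinSq_of_over {q : ℝ × ℝ} {p : Annulus} (h : Over q p) :
    sinSq p = Real.sin (q.1 - q.2) ^ 2 := by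
  have h1 : ((rep p).1 : RP1) = (q.1 : RP1) := (rep_over p).1.trans h.1.symm
  have h2 : ((rep p).2 : RP1) = (q.2 : RP1) := (rep_over p).2.trans h.2.symm
  have h3 : (((rep p).1 - (rep p).2 : ℝ) : RP1) = ((q.1 - q.2 : ℝ) : RP1) := by
    rw [AddCircle.coe_sub, AddCircle.coe_sub, h1, h2]
  rw [← sub_eq_zero, ← AddCircle.coe_sub, AddCircle.coe_eq_zero_iff] at h3
  obtain ⟨n, hn⟩ := h3
  have h4 : (rep p).1 - (rep p).2 = (q.1 - q.2) + n * Real.pi := by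
    rw [zsmul_eq_mul] at hn; linarith
  unfold sinSq
  rw [h4, Real.sin_add_int_mul_pi, mul_pow]
  have : ((-1 : ℝ) ^ n) ^ 2 = 1 := by
    rw [← zpow_natCast, ← zpow_mul, mul_comm, zpow_mul]; simp
  rw [this, one_mul]

theorem sinSq_strip {s d : ℝ} (h0 : 0 < d) (h1 : d < Real.pi) :
    sinSq (proj (s, s + d)) = Real.sin d ^ 2 := by
  rw [sinSq_of_over (over_proj (strip_mem h0 h1))]
  have : Real.sin (s - (s + d)) = - Real.sin d := by
    rw [← Real.sin_neg]; congr 1; ring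
  simp only [this]; ring

theorem toCover_sinSq {q : ℝ × ℝ} (h : q ∈ coverSet) :
    toCover sinSq q = Real.sin (q.1 - q.2) ^ 2 := by
  rw [toCover_eq _ h, sinSq_of_over (over_proj h)]

theorem continuous_sinSq : Continuous sinSq := by
  apply continuous_of_continuousOn_toCover
  refine ContinuousOn.congr (f := fun q : ℝ × ℝ => Real.sin (q.1 - q.2) ^ 2) (by fun_prop) ?_
  intro q hq
  exact toCover_sinSq hq

theorem sinSq_pos (p : Annulus) : 0 < sinSq p := sin_sq_pos p

/-- A compact set avoids a neighbourhood of the ends of the annulus. -/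
theorem exists_strip_notMem {K : Set Annulus} (hK : IsCompact K) :
    ∃ ε > 0, ε < Real.pi / 2 ∧ ∀ s d : ℝ, 0 < d → d < Real.pi → (d < ε ∨ Real.pi - ε < d) →
      proj (s, s + d) ∉ K := by
  have hm : ∃ m > 0, ∀ p ∈ K, m ≤ sinSq p := by
    rcases K.eq_empty_or_nonempty with rfl | hne
    · exact ⟨1, one_pos, by simp⟩
    · obtain ⟨p, hp, hmin⟩ := hK.exists_isMinOn hne continuous_sinSq.continuousOn
      exact ⟨sinSq p, sinSq_pos p, fun x hx => hmin hx⟩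
  obtain ⟨m, hm0, hm⟩ := hm
  have h1 : ∀ᶠ d in 𝓝 (0 : ℝ), Real.sin d ^ 2 < m := by
    have : ContinuousAt (fun d : ℝ => Real.sin d ^ 2) 0 := by fun_prop
    apply this.eventually_lt continuousAt_const
    simpa using hm0
  obtain ⟨r, hr, hr'⟩ := Metric.eventually_nhds_iff.1 h1
  refine ⟨min r (Real.pi / 4), lt_min hr (by positivity),
    (min_le_right _ _).trans_lt (by linarith [Real.pi_pos]), ?_⟩
  intro s d h0 hπ hd hmem
  have h2 := hm _ hmem
  rw [sinSq_strip h0 hπ] at h2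
  rcases hd with hd | hd
  · have := hr' (y := d) (by
      rw [Real.dist_eq, sub_zero, abs_of_pos h0]; exact hd.trans_le (min_le_left _ _))
    linarith
  · have := hr' (y := Real.pi - d) (by
      rw [Real.dist_eq, sub_zero, abs_of_pos (by linarith)]
      have := min_le_left r (Real.pi / 4)
      linarith)
    rw [Real.sin_pi_sub] at this
    linarith

theorem cocompact_le_of_strip {P : Annulus → Prop} {ε : ℝ} (hε : 0 < ε)
    (h : ∀ s ∈ Ico 0 Real.pi, ∀ d : ℝ, 0 < d → d < Real.pi → (d < ε ∨ Real.pi - ε < d) →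
      P (proj (s, s + d))) :
    ∀ᶠ p in cocompact Annulus, P p := by
  rw [Filter.eventually_iff, mem_cocompact]
  refine ⟨core ε, isCompact_core hε, ?_⟩
  intro p hp
  obtain ⟨s, d, hs, hd, rfl⟩ := exists_strip p
  apply h s hs d hd.1 hd.2
  by_contra hcon
  push Not at hcon
  exact hp ⟨(s, d), ⟨⟨hs.1, hs.2.le⟩, hcon.1, hcon.2⟩, rfl⟩

/-- A function tending to zero at infinity is uniformly small near the ends of the strip. -/
theorem exists_strip_small {u : Annulus → ℝ} (hu : Tendsto u (cocompact Annulus) (𝓝 0))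
    {δ : ℝ} (hδ : 0 < δ) :
    ∃ ε > 0, ε < Real.pi / 2 ∧ ∀ s d : ℝ, 0 < d → d < Real.pi → (d < ε ∨ Real.pi - ε < d) →
      |toCover u (s, s + d)| < δ := by
  have h := hu.eventually (Metric.ball_mem_nhds 0 hδ)
  rw [Filter.eventually_iff, mem_cocompact] at h
  obtain ⟨K, hK, hK'⟩ := h
  obtain ⟨ε, h0, h1, h2⟩ := exists_strip_notMem hK
  refine ⟨ε, h0, h1, fun s d hd0 hd1 hd => ?_⟩
  have := hK' (h2 s d hd0 hd1 hd)
  rw [toCover_eq _ (strip_mem hd0 hd1)]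
  simpa using this

theorem bounded_of_tendsto_zero {u : Annulus → ℝ} (hc : Continuous u)
    (hu : Tendsto u (cocompact Annulus) (𝓝 0)) : ∃ C, ∀ p, |u p| ≤ C := by
  have h := hu.eventually (Metric.ball_mem_nhds 0 one_pos)
  rw [Filter.eventually_iff, mem_cocompact] at h
  obtain ⟨K, hK, hK'⟩ := h
  obtain ⟨C, hC⟩ := hK.exists_bound_of_continuousOn hc.continuousOn
  refine ⟨max C 1, fun p => ?_⟩
  by_cases hp : p ∈ K
  · exact (hC p hp).trans (le_max_left _ _)
  · have := hK' hp
    simp only [mem_ofPred_eq, dist_zero_right, Real.norm_eq_abs] at this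
    exact this.le.trans (le_max_right _ _)

/-! ### Calculus on the annulus -/

section Calculus

variable {E G : Type*} [NormedAddCommGroup E] [NormedSpace ℝ E] [NormedAddCommGroup G]
  [NormedSpace ℝ G]

theorem IsCn.of_eqOn {n : WithTop ℕ∞} {f : Annulus → E} {F : ℝ × ℝ → E}
    (hF : ContDiffOn ℝ n F coverSet) (h : ∀ q ∈ coverSet, toCover f q = F q) : IsCn n f :=
  hF.congr h

theorem IsCn.of_le {m n : WithTop ℕ∞} {f : Annulus → E} (hf : IsCn n f) (h : m ≤ n) : IsCn m f :=
  ContDiffOn.of_le hf h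

theorem IsCn.continuous {n : WithTop ℕ∞} {f : Annulus → E} (hf : IsCn n f) : Continuous f :=
  continuous_of_continuousOn_toCover (ContDiffOn.continuousOn hf)

theorem IsCn.contDiffAt {n : WithTop ℕ∞} {f : Annulus → E} (hf : IsCn n f) {q : ℝ × ℝ}
    (hq : q ∈ coverSet) : ContDiffAt ℝ n (toCover f) q :=
  ContDiffOn.contDiffAt hf (isOpen_coverSet.mem_nhds hq)

theorem IsCn.differentiableAt {n : WithTop ℕ∞} {f : Annulus → E} (hf : IsCn n f) (hn : n ≠ 0)
    {q : ℝ × ℝ} (hq : q ∈ coverSet) : DifferentiableAt ℝ (toCover f) q :=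
  (hf.contDiffAt hq).differentiableAt hn

theorem IsCn.diff {n : WithTop ℕ∞} {f : Annulus → E} (hf : IsCn n f) (hn : n ≠ 0) (p : Annulus) :
    DifferentiableAt ℝ (toCover f) (rep p) := hf.differentiableAt hn (rep_mem p)

theorem IsCn.comp {n : WithTop ℕ∞} {f : Annulus → E} (hf : IsCn n f) {Φ : E → G}
    (hΦ : ∀ p, ContDiffAt ℝ n Φ (f p)) : IsCn n (fun p => Φ (f p)) := by
  refine IsCn.of_eqOn (F := fun q => Φ (toCover f q)) ?_ ?_
  · intro q hq
    have h1 := hf.contDiffAt hq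
    have h2 := hΦ (proj q)
    rw [← toCover_eq f hq] at h2
    exact (h2.comp q h1).contDiffWithinAt
  · intro q hq
    rw [toCover_eq _ hq, toCover_eq _ hq]

theorem IsCn.prodMk {n : WithTop ℕ∞} {f : Annulus → E} {g : Annulus → G} (hf : IsCn n f)
    (hg : IsCn n g) : IsCn n (fun p => (f p, g p)) := by
  refine IsCn.of_eqOn (F := fun q => (toCover f q, toCover g q)) (ContDiffOn.prodMk hf hg) ?_
  intro q hq
  simp only [toCover_eq _ hq]

theorem isCn_const {n : WithTop ℕ∞} (c : E) : IsCn n (fun _ => c) :=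
  IsCn.of_eqOn (F := fun _ => c) contDiffOn_const fun q hq => by rw [toCover_eq _ hq]

theorem IsCn.add {n : WithTop ℕ∞} {f g : Annulus → E} (hf : IsCn n f) (hg : IsCn n g) :
    IsCn n (fun p => f p + g p) :=
  (hf.prodMk hg).comp (Φ := fun x : E × E => x.1 + x.2)
    fun _ => (contDiff_fst.add contDiff_snd).contDiffAt

theorem IsCn.neg {n : WithTop ℕ∞} {f : Annulus → E} (hf : IsCn n f) :
    IsCn n (fun p => - f p) := hf.comp fun _ => contDiff_neg.contDiffAt

theorem IsCn.sub {n : WithTop ℕ∞} {f g : Annulus → E} (hf : IsCn n f) (hg : IsCn n g) :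
    IsCn n (fun p => f p - g p) := by
  simpa [sub_eq_add_neg] using hf.add hg.neg

theorem IsCn.mul {n : WithTop ℕ∞} {f g : Annulus → ℝ} (hf : IsCn n f) (hg : IsCn n g) :
    IsCn n (fun p => f p * g p) :=
  (hf.prodMk hg).comp (Φ := fun x : ℝ × ℝ => x.1 * x.2)
    fun _ => (contDiff_fst.mul contDiff_snd).contDiffAt

theorem IsCn.smul {n : WithTop ℕ∞} {f : Annulus → ℝ} {g : Annulus → E} (hf : IsCn n f)
    (hg : IsCn n g) : IsCn n (fun p => f p • g p) :=
  (hf.prodMk hg).comp (Φ := fun x : ℝ × E => x.1 • x.2)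
    fun _ => (contDiff_fst.smul contDiff_snd).contDiffAt

theorem IsCn.inv {n : WithTop ℕ∞} {f : Annulus → ℝ} (hf : IsCn n f) (h : ∀ p, f p ≠ 0) :
    IsCn n (fun p => (f p)⁻¹) := hf.comp fun p => contDiffAt_inv ℝ (h p)

theorem IsCn.div {n : WithTop ℕ∞} {f g : Annulus → ℝ} (hf : IsCn n f) (hg : IsCn n g)
    (h : ∀ p, g p ≠ 0) : IsCn n (fun p => f p / g p) := by
  simpa [div_eq_mul_inv] using hf.mul (hg.inv h)

theorem IsCn.log {n : WithTop ℕ∞} {f : Annulus → ℝ} (hf : IsCn n f) (h : ∀ p, f p ≠ 0) :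
    IsCn n (fun p => Real.log (f p)) := hf.comp fun p => Real.contDiffAt_log.2 (h p)

theorem IsCn.exp {n : WithTop ℕ∞} {f : Annulus → ℝ} (hf : IsCn n f) :
    IsCn n (fun p => Real.exp (f p)) := hf.comp fun _ => Real.contDiff_exp.contDiffAt

theorem toCover_pd (i : Fin 2) (f : Annulus → E) {q : ℝ × ℝ} (hq : q ∈ coverSet) :
    toCover (pd i f) q = fderiv ℝ (toCover f) q (frame i) := by
  rw [toCover_eq _ hq, pd, ← der_eq_of_over f (over_proj hq)]

theorem IsCn.pd {m n : WithTop ℕ∞} {f : Annulus → E} (hf : IsCn n f) (i : Fin 2)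
    (h : m + 1 ≤ n) : IsCn m (pd i f) := by
  refine IsCn.of_eqOn (F := fun q => fderiv ℝ (toCover f) q (frame i)) ?_
    fun q hq => toCover_pd i f hq
  exact (ContDiffOn.fderiv_of_isOpen hf isOpen_coverSet h).clm_apply contDiffOn_const

/-- Derivatives may be computed in the covering space. -/
theorem der_eq_of_hasFDerivAt {f : Annulus → E} {F : ℝ × ℝ → E} {F' : ℝ × ℝ →L[ℝ] E}
    (h : ∀ q ∈ coverSet, toCover f q = F q) {q : ℝ × ℝ} {p : Annulus} (hq : Over q p)
    (hF : HasFDerivAt F F' q) : der f p = F' := by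
  rw [← der_eq_of_over f hq]
  refine (hF.congr_of_eventuallyEq ?_).fderiv
  filter_upwards [isOpen_coverSet.mem_nhds (over_mem hq)] with x hx using h x hx

theorem der_comp {f : Annulus → E} {p : Annulus} (hf : DifferentiableAt ℝ (toCover f) (rep p))
    {Φ : E → G} {Φ' : E →L[ℝ] G} (hΦ : HasFDerivAt Φ Φ' (f p)) :
    der (fun x => Φ (f x)) p = Φ'.comp (der f p) := by
  refine der_eq_of_hasFDerivAt (F := fun q => Φ (toCover f q)) ?_ (rep_over p) ?_
  · intro q hq
    rw [toCover_eq _ hq, toCover_eq _ hq]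
  · rw [← toCover_rep f p] at hΦ
    exact hΦ.comp _ hf.hasFDerivAt

theorem diff_comp {f : Annulus → E} {p : Annulus} (hf : DifferentiableAt ℝ (toCover f) (rep p))
    {Φ : E → G} (hΦ : DifferentiableAt ℝ Φ (f p)) :
    DifferentiableAt ℝ (toCover (fun x => Φ (f x))) (rep p) := by
  rw [← toCover_rep f p] at hΦ
  refine (hΦ.comp _ hf).congr_of_eventuallyEq ?_
  filter_upwards [isOpen_coverSet.mem_nhds (rep_mem p)] with q hq
  simp only [Function.comp, toCover_eq _ hq]

theorem diff_prodMk {f : Annulus → E} {g : Annulus → G} {p : Annulus}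
    (hf : DifferentiableAt ℝ (toCover f) (rep p)) (hg : DifferentiableAt ℝ (toCover g) (rep p)) :
    DifferentiableAt ℝ (toCover (fun x => (f x, g x))) (rep p) := by
  refine (hf.prodMk hg).congr_of_eventuallyEq ?_
  filter_upwards [isOpen_coverSet.mem_nhds (rep_mem p)] with q hq
  simp only [toCover_eq _ hq]

theorem der_prodMk {f : Annulus → E} {g : Annulus → G} {p : Annulus}
    (hf : DifferentiableAt ℝ (toCover f) (rep p)) (hg : DifferentiableAt ℝ (toCover g) (rep p)) :
    der (fun x => (f x, g x)) p = (der f p).prod (der g p) := by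
  refine der_eq_of_hasFDerivAt (F := fun q => (toCover f q, toCover g q)) ?_ (rep_over p) ?_
  · intro q hq
    simp only [toCover_eq _ hq]
  · exact hf.hasFDerivAt.prodMk hg.hasFDerivAt

variable {p : Annulus} (i : Fin 2)

theorem pd_comp_clm {f : Annulus → E} (hf : DifferentiableAt ℝ (toCover f) (rep p))
    (L : E →L[ℝ] G) : pd i (fun x => L (f x)) p = L (pd i f p) := by
  unfold pd; rw [der_comp hf L.hasFDerivAt]; rfl

theorem pd_const (c : E) : pd i (fun _ => c) p = 0 := by
  unfold pd
  rw [der_eq_of_hasFDerivAt (F := fun _ => c) (fun q hq => toCover_eq _ hq) (rep_over p)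
    (hasFDerivAt_const _ _)]
  rfl

theorem pd_add {f g : Annulus → E} (hf : DifferentiableAt ℝ (toCover f) (rep p))
    (hg : DifferentiableAt ℝ (toCover g) (rep p)) :
    pd i (fun x => f x + g x) p = pd i f p + pd i g p := by
  have := der_comp (diff_prodMk hf hg) (Φ := fun x : E × E => x.1 + x.2)
    (hasFDerivAt_fst.add hasFDerivAt_snd)
  unfold pd
  rw [this, der_prodMk hf hg]; rfl

theorem pd_neg {f : Annulus → E} (hf : DifferentiableAt ℝ (toCover f) (rep p)) :
    pd i (fun x => - f x) p = - pd i f p :=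
  pd_comp_clm i hf (-ContinuousLinearMap.id ℝ E)

theorem pd_sub {f g : Annulus → E} (hf : DifferentiableAt ℝ (toCover f) (rep p))
    (hg : DifferentiableAt ℝ (toCover g) (rep p)) :
    pd i (fun x => f x - g x) p = pd i f p - pd i g p := by
  have := der_comp (diff_prodMk hf hg) (Φ := fun x : E × E => x.1 - x.2)
    (hasFDerivAt_fst.sub hasFDerivAt_snd)
  unfold pd
  rw [this, der_prodMk hf hg]; rfl

theorem pd_smul {f : Annulus → ℝ} {g : Annulus → E}
    (hf : DifferentiableAt ℝ (toCover f) (rep p)) (hg : DifferentiableAt ℝ (toCover g) (rep p)) :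
    pd i (fun x => f x • g x) p = f p • pd i g p + pd i f p • g p := by
  have := der_comp (diff_prodMk hf hg) (Φ := fun x : ℝ × E => x.1 • x.2)
    (hasFDerivAt_fst.smul hasFDerivAt_snd)
  unfold pd
  rw [this, der_prodMk hf hg]
  simp

theorem pd_mul {f g : Annulus → ℝ}
    (hf : DifferentiableAt ℝ (toCover f) (rep p)) (hg : DifferentiableAt ℝ (toCover g) (rep p)) :
    pd i (fun x => f x * g x) p = f p * pd i g p + pd i f p * g p :=
  pd_smul i hf hg

theorem pd_const_mul {f : Annulus → ℝ} (c : ℝ)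
    (hf : DifferentiableAt ℝ (toCover f) (rep p)) :
    pd i (fun x => c * f x) p = c * pd i f p :=
  pd_comp_clm i hf (c • ContinuousLinearMap.id ℝ ℝ)

theorem pd_comp_real {f : Annulus → ℝ} (hf : DifferentiableAt ℝ (toCover f) (rep p))
    {Φ : ℝ → ℝ} {Φ' : ℝ} (hΦ : HasDerivAt Φ Φ' (f p)) :
    pd i (fun x => Φ (f x)) p = Φ' * pd i f p := by
  unfold pd
  rw [der_comp hf hΦ.hasFDerivAt]
  simp [mul_comm]

theorem pd_log {f : Annulus → ℝ} (hf : DifferentiableAt ℝ (toCover f) (rep p)) (h : f p ≠ 0) :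
    pd i (fun x => Real.log (f x)) p = pd i f p / f p := by
  rw [pd_comp_real i hf (Real.hasDerivAt_log h)]
  rw [div_eq_inv_mul]

theorem pd_exp {f : Annulus → ℝ} (hf : DifferentiableAt ℝ (toCover f) (rep p)) :
    pd i (fun x => Real.exp (f x)) p = Real.exp (f p) * pd i f p :=
  pd_comp_real i hf (Real.hasDerivAt_exp _)

theorem pd_inv {f : Annulus → ℝ} (hf : DifferentiableAt ℝ (toCover f) (rep p)) (h : f p ≠ 0) :
    pd i (fun x => (f x)⁻¹) p = - pd i f p / f p ^ 2 := by
  rw [pd_comp_real i hf (hasDerivAt_inv h)]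
  ring

/-- Mixed partial derivatives commute. -/
theorem pd_comm {f : Annulus → E} (hf : IsCn 2 f) (i j : Fin 2) (p : Annulus) :
    pd i (pd j f) p = pd j (pd i f) p := by
  have key : ∀ i j : Fin 2, pd i (pd j f) p =
      fderiv ℝ (fderiv ℝ (toCover f)) (rep p) (frame i) (frame j) := by
    intro i j
    have h1 : DifferentiableAt ℝ (fderiv ℝ (toCover f)) (rep p) :=
      ((ContDiffOn.fderiv_of_isOpen (m := 1) hf isOpen_coverSet (by norm_num)).contDiffAt
        (isOpen_coverSet.mem_nhds (rep_mem p))).differentiableAt one_ne_zero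
    have h2 : HasFDerivAt (fun q => fderiv ℝ (toCover f) q (frame j))
        ((ContinuousLinearMap.apply ℝ E (frame j)).comp
          (fderiv ℝ (fderiv ℝ (toCover f)) (rep p))) (rep p) :=
      (ContinuousLinearMap.apply ℝ E (frame j)).hasFDerivAt.comp _ h1.hasFDerivAt
    unfold pd
    rw [der_eq_of_hasFDerivAt (f := fun x => der f x (frame j))
      (fun q hq => toCover_pd j f hq) (rep_over p) h2]
    rfl
  rw [key, key]
  have := (hf.contDiffAt (rep_mem p)).isSymmSndFDerivAt (by simp)
  exact this _ _

theorem hasDerivAt_toCover_snd {f : Annulus → E} {s t : ℝ} (hq : (s, t) ∈ coverSet)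
    (hf : DifferentiableAt ℝ (toCover f) (s, t)) :
    HasDerivAt (fun t => toCover f (s, t)) (toCover (pd 0 f) (s, t)) t := by
  rw [toCover_pd 0 f hq]
  have : HasDerivAt (fun t : ℝ => (s, t)) ((0 : ℝ), (1 : ℝ)) t :=
    (hasDerivAt_const t s).prodMk (hasDerivAt_id t)
  exact hf.hasFDerivAt.comp_hasDerivAt t this

theorem hasDerivAt_toCover_fst {f : Annulus → E} {s t : ℝ} (hq : (s, t) ∈ coverSet)
    (hf : DifferentiableAt ℝ (toCover f) (s, t)) :
    HasDerivAt (fun s => toCover f (s, t)) (toCover (pd 1 f) (s, t)) s := by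
  rw [toCover_pd 1 f hq]
  have : HasDerivAt (fun s : ℝ => (s, t)) ((1 : ℝ), (0 : ℝ)) s :=
    (hasDerivAt_id s).prodMk (hasDerivAt_const s t)
  exact hf.hasFDerivAt.comp_hasDerivAt s this

theorem hasDerivAt_strip_snd {f : Annulus → E} {s d : ℝ} (hq : (s, s + d) ∈ coverSet)
    (hf : DifferentiableAt ℝ (toCover f) (s, s + d)) :
    HasDerivAt (fun d => toCover f (s, s + d)) (toCover (pd 0 f) (s, s + d)) d := by
  rw [toCover_pd 0 f hq]
  have : HasDerivAt (fun d : ℝ => (s, s + d)) ((0 : ℝ), (1 : ℝ)) d :=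
    (hasDerivAt_const d s).prodMk ((hasDerivAt_id d).const_add s)
  exact hf.hasFDerivAt.comp_hasDerivAt d this

theorem hasDerivAt_strip_fst {f : Annulus → E} {s d : ℝ} (hq : (s, s + d) ∈ coverSet)
    (hf : DifferentiableAt ℝ (toCover f) (s, s + d)) :
    HasDerivAt (fun s => toCover f (s, s + d))
      (toCover (pd 0 f) (s, s + d) + toCover (pd 1 f) (s, s + d)) s := by
  rw [toCover_pd 0 f hq, toCover_pd 1 f hq, ← map_add]
  have : HasDerivAt (fun s : ℝ => (s, s + d)) ((1 : ℝ), (1 : ℝ)) s :=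
    (hasDerivAt_id s).prodMk ((hasDerivAt_id s).add_const d)
  have h2 := hf.hasFDerivAt.comp_hasDerivAt s this
  have e : frame 0 + frame 1 = ((1 : ℝ), (1 : ℝ)) := by simp [frame]
  rw [e]
  exact h2

end Calculus

/-! ### Integration over the annulus in the coordinates of the strip -/

open Classical in
/-- Extension of a function on the annulus by zero along the diagonal. -/
def extendZero {E : Type*} [Zero E] (f : Annulus → E) (z : RP1 × RP1) : E :=
  if h : z.1 ≠ z.2 then f ⟨z, h⟩ else 0

theorem extendZero_val {E : Type*} [Zero E] (f : Annulus → E) (p : Annulus) :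
    extendZero f p.1 = f p := dif_pos p.2

theorem extendZero_of_eq {E : Type*} [Zero E] (f : Annulus → E) {z : RP1 × RP1}
    (h : z.1 = z.2) : extendZero f z = 0 := dif_neg (not_not.2 h)

theorem measurePreserving_strip :
    MeasurePreserving (fun x : ℝ × ℝ => (((x.1 : ℝ) : RP1), ((x.1 + x.2 : ℝ) : RP1)))
      ((volume.restrict (Ioc 0 Real.pi)).prod (volume.restrict (Ioc 0 Real.pi)))
      (volume : Measure (RP1 × RP1)) := by
  have h := AddCircle.measurePreserving_mk Real.pi 0
  rw [zero_add] at h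
  have hm : Measurable ((↑) : ℝ → RP1) := AddCircle.measurable_mk'
  refine h.skew_product (g := fun s d => ((s + d : ℝ) : RP1)) ?_ ?_
  · exact hm.comp (measurable_fst.add measurable_snd)
  · refine Filter.Eventually.of_forall fun s => ?_
    have : (fun d : ℝ => ((s + d : ℝ) : RP1)) = (fun z : RP1 => (s : RP1) + z) ∘ (↑) := by
      ext d; simp
    rw [this, ← Measure.map_map (measurable_const_add _) hm, h.map_eq]
    exact map_add_left_eq_self _ _

theorem measurableSet_offDiag : MeasurableSet {z : RP1 × RP1 | z.1 ≠ z.2} :=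
  (isOpen_ne_fun continuous_fst continuous_snd).measurableSet

section Integral

variable {E : Type*} [NormedAddCommGroup E]

theorem restrict_Ioc_prod_eq :
    ((volume.restrict (Ioc 0 Real.pi)).prod (volume.restrict (Ioc 0 Real.pi)) : Measure (ℝ × ℝ)) =
      volume.restrict (Ioc 0 Real.pi ×ˢ Ioo 0 Real.pi) := by
  have h : (volume.restrict (Ioc 0 Real.pi) : Measure ℝ) = volume.restrict (Ioo 0 Real.pi) :=
    restrict_Ioo_eq_restrict_Ioc.symm
  conv_lhs => rw [h]
  conv_lhs => enter [1]; rw [← h]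
  rw [Measure.prod_restrict, ← Measure.volume_eq_prod]

theorem continuousOn_extendZero {f : Annulus → E} (hf : Continuous f) :
    ContinuousOn (extendZero f) {z : RP1 × RP1 | z.1 ≠ z.2} := by
  rw [continuousOn_iff_continuous_domRestrict]
  exact hf.congr fun p => (extendZero_val f p).symm

theorem aestronglyMeasurable_extendZero {f : Annulus → E} (hf : Continuous f) :
    AEStronglyMeasurable (extendZero f) (volume : Measure (RP1 × RP1)) := by
  have := (continuousOn_extendZero hf).aestronglyMeasurable
    (μ := (volume : Measure (RP1 × RP1))) measurableSet_offDiag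
  rw [← aestronglyMeasurable_indicator_iff measurableSet_offDiag] at this
  refine this.congr (Filter.Eventually.of_forall fun z => ?_)
  by_cases hz : z ∈ {z : RP1 × RP1 | z.1 ≠ z.2}
  · rw [indicator_of_mem hz]
  · rw [indicator_of_notMem hz]; exact (extendZero_of_eq f (not_not.1 hz)).symm

theorem integrable_annulus_iff {f : Annulus → E} (hf : Continuous f) :
    Integrable f ↔ IntegrableOn (fun x : ℝ × ℝ => toCover f (x.1, x.1 + x.2))
      (Ioc 0 Real.pi ×ˢ Ioo 0 Real.pi) := by
  have h1 : Integrable f ↔ IntegrableOn (extendZero f) {z : RP1 × RP1 | z.1 ≠ z.2} := by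
    have e : (volume : Measure Annulus).map Subtype.val =
        (volume : Measure (RP1 × RP1)).restrict {z : RP1 × RP1 | z.1 ≠ z.2} :=
      map_comap_subtype_coe measurableSet_offDiag _
    have h0 := (MeasurableEmbedding.subtype_coe measurableSet_offDiag).integrable_map_iff
      (μ := Measure.comap Subtype.val (volume : Measure (RP1 × RP1))) (g := extendZero f)
    have e3 : extendZero f ∘ Subtype.val = f := funext fun p => extendZero_val f p
    unfold IntegrableOn
    rw [← e]
    have h5 : Integrable (extendZero f ∘ Subtype.val) (volume : Measure Annulus) ↔
        Integrable f := by rw [e3]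
    exact (h0.trans h5).symm
  have h2 : IntegrableOn (extendZero f) {z : RP1 × RP1 | z.1 ≠ z.2} ↔
      Integrable (extendZero f) := by
    apply integrableOn_iff_integrable_of_support_subset
    intro z hz
    by_contra hcon
    exact hz (dif_neg hcon)
  rw [h1, h2, ← measurePreserving_strip.integrable_comp (aestronglyMeasurable_extendZero hf),
    restrict_Ioc_prod_eq]
  rfl

theorem integral_annulus [NormedSpace ℝ E] {f : Annulus → E} (hf : Continuous f) :
    ∫ p, f p = ∫ x in Ioc 0 Real.pi ×ˢ Ioo 0 Real.pi, toCover f (x.1, x.1 + x.2) := by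
  have h1 : ∫ p, f p = ∫ z in {z : RP1 × RP1 | z.1 ≠ z.2}, extendZero f z := by
    rw [← integral_subtype_comap measurableSet_offDiag]
    exact integral_congr_ae (Filter.Eventually.of_forall fun p =>
      (extendZero_val f p).symm)
  have h2 : ∫ z in {z : RP1 × RP1 | z.1 ≠ z.2}, extendZero f z = ∫ z, extendZero f z := by
    apply setIntegral_eq_integral_of_forall_compl_eq_zero
    intro z hz
    exact dif_neg hz
  rw [h1, h2, ← measurePreserving_strip.map_eq, integral_map measurePreserving_strip.aemeasurable
    (by rw [measurePreserving_strip.map_eq]; exact aestronglyMeasurable_extendZero hf),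
    restrict_Ioc_prod_eq]
  rfl

end Integral

/-! ### Metrics in the split frame -/

namespace Metric

variable (g h k : Metric)

/-- The coefficient `f = g(v₁, v₂)` of a metric `g = f dθ₁ dθ₂`. -/
def dens (p : Annulus) : ℝ := g.form p (frame 0) (frame 1)

theorem dens_pos (p : Annulus) : 0 < g.dens p := g.pos p

theorem dens_ne (p : Annulus) : g.dens p ≠ 0 := (g.pos p).ne'

theorem form_one_zero (p : Annulus) : g.form p (frame 1) (frame 0) = g.dens p := by
  have := (g.symm p).eq (frame 1) (frame 0)
  simpa [dens] using this

theorem form_apply (p : Annulus) (v w : ℝ × ℝ) :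
    g.form p v w = (v.2 * w.1 + v.1 * w.2) * g.dens p := by
  have hv : ∀ x : ℝ × ℝ, x = x.2 • frame 0 + x.1 • frame 1 := by
    intro x; simp [frame]
  conv_lhs => rw [hv v, hv w]
  simp only [map_add, map_smul, LinearMap.add_apply, LinearMap.smul_apply, smul_eq_mul,
    g.isotropic, form_one_zero]
  unfold dens
  ring

theorem gram_eq (p : Annulus) : g.gram p = !![0, g.dens p; g.dens p, 0] := by
  ext i j
  fin_cases i <;> fin_cases j <;> simp [gram, g.isotropic, form_one_zero, dens]

theorem gram_inv (p : Annulus) : (g.gram p)⁻¹ = !![0, (g.dens p)⁻¹; (g.dens p)⁻¹, 0] := by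
  have h := g.dens_ne p
  rw [gram_eq]
  apply Matrix.inv_eq_right_inv
  ext i j
  fin_cases i <;> fin_cases j <;> simp [Matrix.mul_apply, Fin.sum_univ_two, h]

theorem isCn_iff {n : WithTop ℕ∞} : g.IsCn n ↔ SplitLiouville.IsCn n g.dens := by
  constructor
  · intro h
    have := h 0 1
    exact this
  · intro h i j
    fin_cases i <;> fin_cases j
    · simpa [gram_eq] using isCn_const (n := n) (0 : ℝ)
    · simpa [gram_eq] using h
    · simpa [gram_eq] using h
    · simpa [gram_eq] using isCn_const (n := n) (0 : ℝ)

theorem volCoeff_eq (p : Annulus) : g.volCoeff p = g.dens p := by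
  unfold volCoeff volForm
  rw [form_apply]
  simp [frame, splitInv]

theorem christoffel_eq (i j l : Fin 2) :
    g.christoffel l i j = fun p => if l = i ∧ i = j then pd i g.dens p / g.dens p else 0 := by
  funext p
  unfold christoffel
  rw [gram_inv]
  have h00 : (fun x => g.gram x 0 0) = fun _ => 0 := by funext x; simp [gram_eq]
  have h11 : (fun x => g.gram x 1 1) = fun _ => 0 := by funext x; simp [gram_eq]
  have h01 : (fun x => g.gram x 0 1) = g.dens := by funext x; simp [gram_eq]
  have h10 : (fun x => g.gram x 1 0) = g.dens := by funext x; simp [gram_eq]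
  fin_cases l <;> fin_cases i <;> fin_cases j <;>
    simp [Fin.sum_univ_two, h00, h11, h01, h10, pd_const] <;> ring

theorem curvForm_eq (hg : g.IsCn 2) (p : Annulus) :
    g.curvForm p = - pd 0 (pd 1 fun x => Real.log (g.dens x)) p := by
  have h := g.dens_ne p
  have e : (pd 1 fun x => Real.log (g.dens x)) = fun x => pd 1 g.dens x / g.dens x := by
    funext x
    exact pd_log 1 ((g.isCn_iff.1 hg).diff two_ne_zero x) (g.dens_ne x)
  unfold curvForm curvature curvTensor
  rw [volCoeff_eq, div_mul_cancel₀ _ h, e]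
  simp [christoffel_eq, pd_const]

theorem dAlembert_eq {u : Annulus → ℝ} (hu : SplitLiouville.IsCn 2 u) (p : Annulus) :
    g.dAlembert u p = 2 * pd 0 (pd 1 u) p / g.dens p := by
  unfold dAlembert
  rw [gram_inv]
  simp only [Fin.sum_univ_two, christoffel_eq]
  simp [pd_comm hu 1 0]
  ring

theorem factor_eq (p : Annulus) :
    g.factor h p = (1 / 2) * (Real.log (h.dens p) - Real.log (g.dens p)) := by
  rw [← Real.log_div (h.dens_ne p) (g.dens_ne p)]; rfl

theorem factor_add (p : Annulus) : g.factor h p = g.factor k p + k.factor h p := by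
  simp only [factor_eq]; ring

theorem factor_comm (p : Annulus) : g.factor h p = - h.factor g p := by
  simp only [factor_eq]; ring

theorem dens_eq_exp_factor (p : Annulus) :
    h.dens p = Real.exp (2 * g.factor h p) * g.dens p := by
  have := g.form_eq_exp_factor h p
  unfold dens
  rw [this]; rfl

theorem isCn_factor {n : WithTop ℕ∞} (hg : g.IsCn n) (hh : h.IsCn n) :
    SplitLiouville.IsCn n (g.factor h) := by
  have : g.factor h = fun p => (1 / 2) * (Real.log (h.dens p) - Real.log (g.dens p)) :=
    funext fun p => factor_eq g h p
  rw [this]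
  exact (isCn_const (1 / 2 : ℝ)).mul
    (((h.isCn_iff.1 hh).log h.dens_ne).sub ((g.isCn_iff.1 hg).log g.dens_ne))

theorem curvForm_factor (hg : g.IsCn 2) (hh : h.IsCn 2) (p : Annulus) :
    h.curvForm p = g.curvForm p - 2 * pd 0 (pd 1 (g.factor h)) p := by
  have lg := (g.isCn_iff.1 hg).log g.dens_ne
  have lh := (h.isCn_iff.1 hh).log h.dens_ne
  have e1 : pd 1 (g.factor h) = fun p => (1 / 2) *
      (pd 1 (fun x => Real.log (h.dens x)) p - pd 1 (fun x => Real.log (g.dens x)) p) := by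
    funext x
    rw [← pd_sub 1 (lh.diff two_ne_zero x) (lg.diff two_ne_zero x),
      ← pd_const_mul 1 _ ((lh.sub lg).diff two_ne_zero x)]
    congr 1
    funext y
    exact factor_eq g h y
  have lg1 := (lg.pd (m := 1) 1 (by norm_num)).diff one_ne_zero p
  have lh1 := (lh.pd (m := 1) 1 (by norm_num)).diff one_ne_zero p
  have lgh := ((lh.pd (m := 1) 1 (by norm_num)).sub
    (lg.pd (m := 1) 1 (by norm_num))).diff one_ne_zero p
  rw [curvForm_eq _ hg, curvForm_eq _ hh, e1, pd_const_mul 0 _ lgh, pd_sub 0 lh1 lg1]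
  ring

theorem continuous_curvForm (hg : g.IsCn 2) : Continuous g.curvForm := by
  have lg := (g.isCn_iff.1 hg).log g.dens_ne
  have := ((lg.pd (m := 1) 1 (by norm_num)).pd (m := 0) 0 (by norm_num)).continuous.neg
  convert this using 1
  funext p
  exact curvForm_eq g hg p

theorem area_eq : g.area = volume.withDensity fun p => ENNReal.ofReal (g.dens p) := by
  unfold area
  simp only [volCoeff_eq]

end Metric

theorem ddI_eq {u : Annulus → ℝ} (hu : IsCn 2 u) (p : Annulus) :
    ddI u p = 2 * pd 0 (pd 1 u) p := by
  have h1 : (fun x => der u x (splitInv (frame 1))) = pd 1 u := by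
    funext x; simp [pd, splitInv, frame]
  have h0 : (fun x => der u x (splitInv (frame 0))) = fun x => - pd 0 u x := by
    funext x
    have : splitInv (frame 0) = - frame 0 := by simp [splitInv, frame]
    rw [this, map_neg]; rfl
  unfold ddI
  rw [h1, h0, pd_neg 1 ((hu.pd (m := 1) 0 (by norm_num)).diff one_ne_zero p), pd_comm hu 1 0]
  ring

theorem continuous_pd_pd {u : Annulus → ℝ} (hu : IsCn 2 u) (i j : Fin 2) :
    Continuous (pd i (pd j u)) :=
  ((hu.pd (m := 1) j (by norm_num)).pd (m := 0) i (by norm_num)).continuous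

/-- Integrability of the d'Alembertian for the area measure is integrability of the mixed second
derivative for `dθ₁ dθ₂`. -/
theorem InSClass.integrable_pd_pd {b g : Metric} (h : InSClass b g) :
    Integrable (pd 0 (pd 1 (b.factor g))) := by
  have hu : IsCn 2 (b.factor g) := b.isCn_factor g h.memMb.1 h.regular
  have hb : Continuous b.dens := (b.isCn_iff.1 h.memMb.1).continuous
  have h1 := h.dAlembert_integrable
  rw [Metric.area_eq, integrable_withDensity_iff_integrable_smul₀'
    (by exact (hb.measurable.ennreal_ofReal).aemeasurable) (by simp)] at h1
  have h2 := h1.const_mul (1 / 2)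
  refine h2.congr (Filter.Eventually.of_forall fun p => ?_)
  simp only [smul_eq_mul, ENNReal.toReal_ofReal (b.dens_pos p).le, Metric.dAlembert_eq b hu]
  field_simp [b.dens_ne p]

/-! ### Iterated integrals of continuous functions on rectangles -/

section Rect

variable {F : ℝ → ℝ → ℝ} {a b c d : ℝ}

theorem integrableOn_rect (hF : ContinuousOn (Function.uncurry F) (Icc a b ×ˢ Icc c d)) :
    IntegrableOn (Function.uncurry F) (Ioc a b ×ˢ Ioc c d) (volume.prod volume) :=
  (hF.integrableOn_compact (isCompact_Icc.prod isCompact_Icc)).mono_set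
    (prod_mono Ioc_subset_Icc_self Ioc_subset_Icc_self)

theorem setIntegral_rect (hab : a ≤ b) (hcd : c ≤ d)
    (hF : ContinuousOn (Function.uncurry F) (Icc a b ×ˢ Icc c d)) :
    ∫ z in Ioc a b ×ˢ Ioc c d, Function.uncurry F z = ∫ x in a..b, ∫ y in c..d, F x y := by
  rw [Measure.volume_eq_prod, setIntegral_prod _ (integrableOn_rect hF),
    intervalIntegral.integral_of_le hab]
  simp only [intervalIntegral.integral_of_le hcd, Function.uncurry]

theorem integral_swap_rect (hab : a ≤ b) (hcd : c ≤ d)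
    (hF : ContinuousOn (Function.uncurry F) (Icc a b ×ˢ Icc c d)) :
    ∫ x in a..b, ∫ y in c..d, F x y = ∫ y in c..d, ∫ x in a..b, F x y := by
  apply intervalIntegral_intervalIntegral_swap
  have := integrableOn_rect hF
  rw [uIoc_of_le hab, uIoc_of_le hcd]
  exact this

theorem intervalIntegrable_inner (hab : a ≤ b) (hcd : c ≤ d)
    (hF : ContinuousOn (Function.uncurry F) (Icc a b ×ˢ Icc c d)) :
    IntervalIntegrable (fun x => ∫ y in c..d, F x y) volume a b := by
  rw [intervalIntegrable_iff, uIoc_of_le hab]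
  have := integrableOn_rect hF
  rw [IntegrableOn, ← Measure.prod_restrict] at this
  have h2 := this.integral_prod_left
  simp only [intervalIntegral.integral_of_le hcd]
  exact h2

end Rect

/-! ### Stokes' formula on the strip -/

section Strip

variable {E : Type*} [NormedAddCommGroup E]

theorem continuousOn_strip {f : Annulus → E} (hf : Continuous f) :
    ContinuousOn (fun x : ℝ × ℝ => toCover f (x.1, x.1 + x.2)) (univ ×ˢ Ioo 0 Real.pi) := by
  refine (continuousOn_toCover hf).comp (by fun_prop) ?_
  rintro ⟨s, d⟩ ⟨-, hd⟩
  exact strip_mem hd.1 hd.2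

theorem continuousOn_strip_rect {f : Annulus → E} (hf : Continuous f) {a b c d : ℝ}
    (hc : 0 < c) (hd : d < Real.pi) :
    ContinuousOn (Function.uncurry fun s x => toCover f (s, s + x)) (Icc a b ×ˢ Icc c d) :=
  (continuousOn_strip hf).mono
    (prod_mono (subset_univ _) fun _ hx => ⟨hc.trans_le hx.1, hx.2.trans_lt hd⟩)

theorem continuous_strip_fst {f : Annulus → E} (hf : Continuous f) {d : ℝ} (h0 : 0 < d)
    (h1 : d < Real.pi) : Continuous fun s => toCover f (s, s + d) := by
  have := (continuousOn_strip hf).comp (f := fun s : ℝ => (s, d)) (s := univ) (by fun_prop)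
    (fun s _ => ⟨trivial, h0, h1⟩)
  exact continuousOn_univ.1 this

theorem continuousOn_strip_snd {f : Annulus → E} (hf : Continuous f) (s : ℝ) :
    ContinuousOn (fun d => toCover f (s, s + d)) (Ioo 0 Real.pi) :=
  (continuousOn_strip hf).comp (f := fun d : ℝ => (s, d)) (by fun_prop)
    (fun d hd => ⟨trivial, hd⟩)

theorem uIcc_subset_strip {a b : ℝ} (ha : a ∈ Ioo 0 Real.pi) (hb : b ∈ Ioo 0 Real.pi) :
    uIcc a b ⊆ Ioo 0 Real.pi := (ordConnected_Ioo).uIcc_subset ha hb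

theorem integral_pd_zero_snd {w : Annulus → ℝ} (hw : IsCn 1 w) {a b : ℝ} (ha : a ∈ Ioo 0 Real.pi)
    (hb : b ∈ Ioo 0 Real.pi) (s : ℝ) :
    ∫ x in a..b, toCover (pd 0 w) (s, s + x) = toCover w (s, s + b) - toCover w (s, s + a) := by
  have hsub := uIcc_subset_strip ha hb
  apply intervalIntegral.integral_eq_sub_of_hasDerivAt
  · intro x hx
    have hm := strip_mem (s := s) (hsub hx).1 (hsub hx).2
    exact hasDerivAt_strip_snd hm (hw.differentiableAt one_ne_zero hm)
  · exact ((continuousOn_strip_snd (hw.pd (m := 0) 0 (by norm_num)).continuous s).mono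
      hsub).intervalIntegrable

theorem integral_periodic_strip {w : Annulus → ℝ} (hw : IsCn 1 w) {d : ℝ} (hd : d ∈ Ioo 0 Real.pi) :
    ∫ s in (0 : ℝ)..Real.pi, (toCover (pd 0 w) (s, s + d) + toCover (pd 1 w) (s, s + d)) = 0 := by
  have h := intervalIntegral.integral_eq_sub_of_hasDerivAt (a := 0) (b := Real.pi)
    (f := fun s => toCover w (s, s + d))
    (f' := fun s => toCover (pd 0 w) (s, s + d) + toCover (pd 1 w) (s, s + d)) (fun s _ => by
      have hm := strip_mem (s := s) hd.1 hd.2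
      exact hasDerivAt_strip_fst hm (hw.differentiableAt one_ne_zero hm))
    (((continuous_strip_fst (hw.pd (m := 0) 0 (by norm_num)).continuous hd.1 hd.2).add
      (continuous_strip_fst (hw.pd (m := 0) 1 (by norm_num)).continuous
        hd.1 hd.2)).intervalIntegrable _ _)
  rw [h]
  have := strip_periodic w d 0
  simp only [zero_add] at this ⊢
  rw [this, sub_self]

variable {w : Annulus → ℝ} {a b : ℝ}

theorem stokes_zero (hw : IsCn 1 w) (ha : a ∈ Ioo 0 Real.pi) (hb : b ∈ Ioo 0 Real.pi) :
    ∫ s in (0 : ℝ)..Real.pi, ∫ x in a..b, toCover (pd 0 w) (s, s + x) =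
      ∫ s in (0 : ℝ)..Real.pi, (toCover w (s, s + b) - toCover w (s, s + a)) := by
  simp only [integral_pd_zero_snd hw ha hb]

theorem stokes_one (hw : IsCn 1 w) (ha : a ∈ Ioo 0 Real.pi) (hb : b ∈ Ioo 0 Real.pi)
    (hab : a ≤ b) :
    ∫ s in (0 : ℝ)..Real.pi, ∫ x in a..b, toCover (pd 1 w) (s, s + x) =
      - ∫ s in (0 : ℝ)..Real.pi, (toCover w (s, s + b) - toCover w (s, s + a)) := by
  rw [← stokes_zero hw ha hb, eq_neg_iff_add_eq_zero]
  have c0 := (hw.pd (m := 0) 0 (by norm_num)).continuous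
  have c1 := (hw.pd (m := 0) 1 (by norm_num)).continuous
  have r0 := continuousOn_strip_rect c0 (a := 0) (b := Real.pi) ha.1 hb.2
  have r1 := continuousOn_strip_rect c1 (a := 0) (b := Real.pi) ha.1 hb.2
  rw [integral_swap_rect Real.pi_pos.le hab r0, integral_swap_rect Real.pi_pos.le hab r1,
    ← intervalIntegral.integral_add]
  · apply intervalIntegral.integral_zero_ae
    refine Filter.Eventually.of_forall fun x hx => ?_
    rw [uIoc_of_le hab] at hx
    have hx' : x ∈ Ioo 0 Real.pi := ⟨ha.1.trans hx.1, hx.2.trans_lt hb.2⟩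
    have h := integral_periodic_strip hw hx'
    rw [intervalIntegral.integral_add
      ((continuous_strip_fst c0 hx'.1 hx'.2).intervalIntegrable _ _)
      ((continuous_strip_fst c1 hx'.1 hx'.2).intervalIntegrable _ _)] at h
    linarith
  · exact intervalIntegrable_inner hab Real.pi_pos.le (F := fun x s => toCover (pd 1 w) (s, s + x))
      (r1.comp (f := Prod.swap) (by fun_prop) (fun z hz => ⟨hz.2, hz.1⟩))
  · exact intervalIntegrable_inner hab Real.pi_pos.le (F := fun x s => toCover (pd 0 w) (s, s + x))
      (r0.comp (f := Prod.swap) (by fun_prop) (fun z hz => ⟨hz.2, hz.1⟩))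

theorem integral_rect_le_of_integrable {f : Annulus → ℝ} (hc : Continuous f) (hf : Integrable f)
    (ha : a ∈ Ioo 0 Real.pi) (hb : b ∈ Ioo 0 Real.pi) (hab : a ≤ b) :
    ∫ s in (0 : ℝ)..Real.pi, ∫ x in a..b, |toCover f (s, s + x)| ≤
      ∫ x in Ioc 0 Real.pi ×ˢ Ioo 0 Real.pi, |toCover f (x.1, x.1 + x.2)| := by
  have r := (continuousOn_strip_rect hc (a := 0) (b := Real.pi) ha.1 hb.2).abs
  rw [← setIntegral_rect Real.pi_pos.le hab (F := fun s x => |toCover f (s, s + x)|) r]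
  refine setIntegral_mono_set ((integrable_annulus_iff hc).1 hf).abs
    (Filter.Eventually.of_forall fun x => abs_nonneg _) (LE.le.eventuallyLE ?_)
  exact prod_mono le_rfl fun x hx => ⟨ha.1.trans hx.1, hx.2.trans_lt hb.2⟩

theorem pi_div_two_mem : Real.pi / 2 ∈ Ioo 0 Real.pi :=
  ⟨by positivity, by linarith [Real.pi_pos]⟩

/-- If `∂w/∂v₁` is integrable then `∫ |w| ds` is bounded along the curves `t = s + d`. -/
theorem exists_bound_of_pd_zero (hw : IsCn 1 w) (hi : Integrable (pd 0 w)) :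
    ∃ C, ∀ d ∈ Ioo 0 Real.pi, ∫ s in (0 : ℝ)..Real.pi, |toCover w (s, s + d)| ≤ C := by
  have c0 := (hw.pd (m := 0) 0 (by norm_num)).continuous
  refine ⟨(∫ s in (0 : ℝ)..Real.pi, |toCover w (s, s + Real.pi / 2)|) +
    ∫ x in Ioc 0 Real.pi ×ˢ Ioo 0 Real.pi, |toCover (pd 0 w) (x.1, x.1 + x.2)|, fun d hd => ?_⟩
  set a := min (Real.pi / 2) d with ha_def
  set b := max (Real.pi / 2) d with hb_def
  have ha : a ∈ Ioo 0 Real.pi := ⟨lt_min pi_div_two_mem.1 hd.1, (min_le_right _ _).trans_lt hd.2⟩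
  have hb : b ∈ Ioo 0 Real.pi := ⟨ha.1.trans_le min_le_max, max_lt pi_div_two_mem.2 hd.2⟩
  have hab : a ≤ b := min_le_max
  have i1 : IntervalIntegrable (fun s => |toCover w (s, s + Real.pi / 2)|) volume 0 Real.pi :=
    (continuous_strip_fst hw.continuous pi_div_two_mem.1
      pi_div_two_mem.2).abs.intervalIntegrable _ _
  have i2 : IntervalIntegrable (fun s => ∫ x in a..b, |toCover (pd 0 w) (s, s + x)|)
      volume 0 Real.pi :=
    intervalIntegrable_inner Real.pi_pos.le hab (F := fun s x => |toCover (pd 0 w) (s, s + x)|)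
      (continuousOn_strip_rect c0 (a := 0) (b := Real.pi) ha.1 hb.2).abs
  calc ∫ s in (0 : ℝ)..Real.pi, |toCover w (s, s + d)|
      ≤ ∫ s in (0 : ℝ)..Real.pi, (|toCover w (s, s + Real.pi / 2)| +
          ∫ x in a..b, |toCover (pd 0 w) (s, s + x)|) := by
        apply intervalIntegral.integral_mono_on Real.pi_pos.le
        · exact (continuous_strip_fst hw.continuous hd.1 hd.2).abs.intervalIntegrable _ _
        · exact i1.add i2
        · intro s _
          have h1 := integral_pd_zero_snd hw pi_div_two_mem hd s
          have h2 := intervalIntegral.norm_integral_le_abs_integral_norm (μ := volume)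
            (f := fun x => toCover (pd 0 w) (s, s + x)) (a := Real.pi / 2) (b := d)
          rw [h1] at h2
          have h3 : |∫ x in Real.pi / 2..d, ‖toCover (pd 0 w) (s, s + x)‖| =
              ∫ x in a..b, |toCover (pd 0 w) (s, s + x)| := by
            have hnn : 0 ≤ ∫ x in a..b, |toCover (pd 0 w) (s, s + x)| :=
              intervalIntegral.integral_nonneg hab fun _ _ => abs_nonneg _
            rcases le_total (Real.pi / 2) d with h | h
            · rw [ha_def, hb_def, min_eq_left h, max_eq_right h] at hnn ⊢
              exact abs_of_nonneg hnn
            · rw [ha_def, hb_def, min_eq_right h, max_eq_left h] at hnn ⊢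
              rw [intervalIntegral.integral_symm, abs_neg]
              exact abs_of_nonneg hnn
          rw [h3, Real.norm_eq_abs] at h2
          have h4 := abs_sub_abs_le_abs_sub (toCover w (s, s + d))
            (toCover w (s, s + Real.pi / 2))
          linarith
    _ = (∫ s in (0 : ℝ)..Real.pi, |toCover w (s, s + Real.pi / 2)|) +
          ∫ s in (0 : ℝ)..Real.pi, ∫ x in a..b, |toCover (pd 0 w) (s, s + x)| :=
        intervalIntegral.integral_add i1 i2
    _ ≤ _ := by
        have := integral_rect_le_of_integrable c0 hi ha hb hab
        linarith

end Strip

/-! ### The exchange of the two factors of the annulus -/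

/-- The involution `(x, y) ↦ (y, x)` of the annulus. -/
def swapA (p : Annulus) : Annulus := ⟨(p.1.2, p.1.1), fun h => p.2 h.symm⟩

theorem toCover_swapA {E : Type*} [Zero E] (f : Annulus → E) {q : ℝ × ℝ} :
    toCover (fun p => f (swapA p)) q = toCover f q.swap := by
  unfold toCover swapA
  by_cases h : (q.1 : RP1) = q.2
  · simp [h]
  · have h' : ¬ (q.2 : RP1) = q.1 := fun e => h e.symm
    simp [h, h']

theorem swap_mem {q : ℝ × ℝ} (h : q ∈ coverSet) : q.swap ∈ coverSet := fun e => h e.symm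

theorem IsCn.swapA {n : WithTop ℕ∞} {f : Annulus → ℝ} (hf : IsCn n f) :
    IsCn n (fun p => f (swapA p)) := by
  refine IsCn.of_eqOn (F := fun q => toCover f q.swap) ?_ fun q _ => toCover_swapA f
  exact ContDiffOn.comp (g := toCover f) (f := Prod.swap) hf
    (contDiff_snd.prodMk contDiff_fst).contDiffOn fun q hq => swap_mem hq

theorem pd_zero_swapA {f : Annulus → ℝ} (hf : IsCn 1 f) (p : Annulus) :
    pd 0 (fun x => f (swapA x)) p = pd 1 f (swapA p) := by
  have hq : (rep p).swap ∈ coverSet := swap_mem (rep_mem p)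
  have h2 := (hf.differentiableAt one_ne_zero hq).hasFDerivAt
  have h3 : HasFDerivAt (fun q : ℝ × ℝ => q.swap)
      ((ContinuousLinearMap.snd ℝ ℝ ℝ).prod (ContinuousLinearMap.fst ℝ ℝ ℝ)) (rep p) :=
    hasFDerivAt_snd.prodMk hasFDerivAt_fst
  unfold pd
  rw [der_eq_of_hasFDerivAt (fun q _ => toCover_swapA f) (rep_over p) (h2.comp (rep p) h3),
    der_eq_of_over f (p := swapA p) ⟨(rep_over p).2, (rep_over p).1⟩]
  simp [frame]

theorem swapA_strip {E : Type*} [Zero E] (f : Annulus → E) (s d : ℝ) :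
    toCover (fun p => f (swapA p)) (s, s + d) =
      toCover f (s + d, (s + d) + (Real.pi - d)) := by
  rw [toCover_swapA]
  have := toCover_add_pi_snd f (s + d) s
  rw [Prod.swap_prod_mk, ← this]
  congr 2
  ring

theorem integrable_swapA {f : Annulus → ℝ} (hf : Integrable f) :
    Integrable (fun p => f (swapA p)) := by
  have hmp : MeasurePreserving swapA (volume : Measure Annulus) volume := by
    have hm : Measurable swapA := by
      have hc : Continuous swapA := by
        apply Continuous.subtype_mk
        exact (continuous_snd.comp continuous_subtype_val).prodMk
          (continuous_fst.comp continuous_subtype_val)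
      exact hc.measurable
    refine ⟨hm, ?_⟩
    ext S hS
    rw [Measure.map_apply hm hS]
    have key : ∀ T : Set Annulus, MeasurableSet T →
        (volume : Measure Annulus) T = (volume : Measure (RP1 × RP1)) (Subtype.val '' T) :=
      fun T hT => (MeasurableEmbedding.subtype_coe measurableSet_offDiag).comap_apply volume T
    rw [key _ (hm hS), key _ hS]
    have e : Subtype.val '' (swapA ⁻¹' S) = Prod.swap ⁻¹' (Subtype.val '' S) := by
      ext z
      constructor
      · rintro ⟨p, hp, rfl⟩
        exact ⟨swapA p, hp, rfl⟩
      · rintro ⟨p, hp, hz⟩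
        refine ⟨swapA p, hp, ?_⟩
        have : z = (Prod.swap p.1) := by rw [hz]; simp
        rw [this]; rfl
    rw [e]
    have hS' : MeasurableSet (Subtype.val '' S : Set (RP1 × RP1)) :=
      (MeasurableEmbedding.subtype_coe measurableSet_offDiag).measurableSet_image.2 hS
    have : MeasurePreserving Prod.swap (volume : Measure (RP1 × RP1)) volume :=
      Measure.measurePreserving_swap
    exact this.measure_preimage hS'.nullMeasurableSet
  exact hmp.integrable_comp_of_integrable hf

/-- If `∂w/∂v₂` is integrable then `∫ |w| ds` is bounded along the curves `t = s + d`. -/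
theorem exists_bound_of_pd_one {w : Annulus → ℝ} (hw : IsCn 1 w) (hi : Integrable (pd 1 w)) :
    ∃ C, ∀ d ∈ Ioo 0 Real.pi, ∫ s in (0 : ℝ)..Real.pi, |toCover w (s, s + d)| ≤ C := by
  have h0 : Integrable (pd 0 fun p => w (swapA p)) := by
    have : pd 0 (fun p => w (swapA p)) = fun p => pd 1 w (swapA p) :=
      funext fun p => pd_zero_swapA hw p
    rw [this]; exact integrable_swapA hi
  obtain ⟨C, hC⟩ := exists_bound_of_pd_zero hw.swapA h0
  refine ⟨C, fun d hd => ?_⟩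
  have hd' : Real.pi - d ∈ Ioo 0 Real.pi := ⟨by linarith [hd.2], by linarith [hd.1]⟩
  have := hC _ hd'
  simp only [swapA_strip, sub_sub_cancel] at this
  have hp : Function.Periodic (fun s => |toCover w (s, s + d)|) Real.pi := fun s => by
    have := strip_periodic w d s
    simp only at this ⊢
    rw [this]
  have h2 := intervalIntegral.integral_comp_add_right (a := 0) (b := Real.pi)
    (fun s => |toCover w (s, s + d)|) (Real.pi - d)
  have h3 := hp.intervalIntegral_add_eq (0 + (Real.pi - d)) 0
  rw [zero_add, add_comm Real.pi] at h2
  rw [zero_add, zero_add] at h3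
  rw [h2, h3] at this
  exact this

/-! ### Green's formula for functions vanishing at infinity -/

theorem tendsto_integral_strip {f : Annulus → ℝ} (hc : Continuous f) (hf : Integrable f) :
    Tendsto (fun n : ℕ => ∫ s in (0 : ℝ)..Real.pi, ∫ x in (Real.pi / (n + 3))..
      (Real.pi - Real.pi / (n + 3)), toCover f (s, s + x)) atTop (𝓝 (∫ p, f p)) := by
  have hpos : ∀ n : ℕ, (0 : ℝ) < n + 3 := fun n => by positivity
  have hle : ∀ n : ℕ, Real.pi / (n + 3) ≤ Real.pi - Real.pi / (n + 3) := fun n => by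
    have : Real.pi / (n + 3) ≤ Real.pi / 2 :=
      div_le_div_of_nonneg_left Real.pi_pos.le (by norm_num) (by
        have : (0 : ℝ) ≤ n := n.cast_nonneg
        linarith)
    linarith
  have hε : ∀ n : ℕ, 0 < Real.pi / (n + 3) := fun n => div_pos Real.pi_pos (hpos n)
  have hU : (⋃ n : ℕ, Ioc 0 Real.pi ×ˢ Ioc (Real.pi / (n + 3)) (Real.pi - Real.pi / (n + 3))) =
      Ioc 0 Real.pi ×ˢ Ioo 0 Real.pi := by
    rw [← prod_iUnion]
    congr 1
    ext x
    simp only [mem_iUnion, mem_Ioc, mem_Ioo]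
    constructor
    · rintro ⟨n, h1, h2⟩
      exact ⟨(hε n).trans h1, by linarith [hε n]⟩
    · rintro ⟨h1, h2⟩
      obtain ⟨n, hn⟩ := exists_nat_gt (Real.pi / min x (Real.pi - x))
      have hm : 0 < min x (Real.pi - x) := lt_min h1 (by linarith)
      rw [div_lt_iff₀ hm] at hn
      have h3 : Real.pi / (n + 3) < min x (Real.pi - x) := by
        rw [div_lt_iff₀ (hpos n)]
        nlinarith
      exact ⟨n, h3.trans_le (min_le_left _ _), by
        have := h3.le.trans (min_le_right _ _); linarith⟩
  have h1 := tendsto_setIntegral_of_monotone (μ := (volume : Measure (ℝ × ℝ)))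
    (f := fun x : ℝ × ℝ => toCover f (x.1, x.1 + x.2))
    (s := fun n : ℕ => Ioc 0 Real.pi ×ˢ Ioc (Real.pi / (n + 3)) (Real.pi - Real.pi / (n + 3)))
    (fun n => measurableSet_Ioc.prod measurableSet_Ioc) (by
      intro m n hmn
      have : Real.pi / (n + 3) ≤ Real.pi / (m + 3) :=
        div_le_div_of_nonneg_left Real.pi_pos.le (hpos m) (by
          have : (m : ℝ) ≤ n := Nat.cast_le.2 hmn
          linarith)
      exact prod_mono le_rfl (Ioc_subset_Ioc this (by linarith)))
    (by rw [hU]; exact (integrable_annulus_iff hc).1 hf)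
  rw [hU, ← integral_annulus hc] at h1
  refine h1.congr fun n => ?_
  exact setIntegral_rect Real.pi_pos.le (hle n) (F := fun s x => toCover f (s, s + x))
    (continuousOn_strip_rect hc (hε n) (by linarith [hε n]))

theorem abs_integral_mul_le {u w : Annulus → ℝ} (hu : Continuous u) (hw : Continuous w) {d δ C : ℝ}
    (hd : d ∈ Ioo 0 Real.pi) (hδ : ∀ s, |toCover u (s, s + d)| ≤ δ)
    (hC : ∫ s in (0 : ℝ)..Real.pi, |toCover w (s, s + d)| ≤ C) :
    |∫ s in (0 : ℝ)..Real.pi, toCover u (s, s + d) * toCover w (s, s + d)| ≤ δ * C := by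
  have hδ0 : 0 ≤ δ := (abs_nonneg _).trans (hδ 0)
  have cw := continuous_strip_fst hw hd.1 hd.2
  have cu := continuous_strip_fst hu hd.1 hd.2
  calc |∫ s in (0 : ℝ)..Real.pi, toCover u (s, s + d) * toCover w (s, s + d)|
      ≤ ∫ s in (0 : ℝ)..Real.pi, |toCover u (s, s + d) * toCover w (s, s + d)| :=
        intervalIntegral.abs_integral_le_integral_abs Real.pi_pos.le
    _ ≤ ∫ s in (0 : ℝ)..Real.pi, δ * |toCover w (s, s + d)| := by
        apply intervalIntegral.integral_mono_on Real.pi_pos.le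
        · exact (cu.mul cw).abs.intervalIntegrable _ _
        · exact (continuous_const.mul cw.abs).intervalIntegrable _ _
        · intro s _
          rw [abs_mul]
          exact mul_le_mul_of_nonneg_right (hδ s) (abs_nonneg _)
    _ = δ * ∫ s in (0 : ℝ)..Real.pi, |toCover w (s, s + d)| :=
        intervalIntegral.integral_const_mul _ _
    _ ≤ δ * C := mul_le_mul_of_nonneg_left hC hδ0

/-- Green's formula: the operator `∂²/∂v₁∂v₂` is symmetric on functions which tend to zero at
infinity. The boundary terms are products of a uniformly small factor and of a factor with bounded
integral. -/
theorem green {u v : Annulus → ℝ} (hu : IsCn 2 u) (hv : IsCn 2 v)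
    (u0 : Tendsto u (cocompact Annulus) (𝓝 0)) (v0 : Tendsto v (cocompact Annulus) (𝓝 0))
    (iu : Integrable (pd 0 (pd 1 u))) (iv : Integrable (pd 0 (pd 1 v))) :
    ∫ p, u p * pd 0 (pd 1 v) p = ∫ p, v p * pd 0 (pd 1 u) p := by
  have cu := hu.continuous
  have cv := hv.continuous
  have hv1 : IsCn 1 (pd 1 v) := hv.pd 1 (by norm_num)
  have hu0 : IsCn 1 (pd 0 u) := hu.pd 0 (by norm_num)
  have cu01 := continuous_pd_pd hu 0 1
  have cv01 := continuous_pd_pd hv 0 1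
  obtain ⟨Cu, hCu⟩ := bounded_of_tendsto_zero cu u0
  obtain ⟨Cv, hCv⟩ := bounded_of_tendsto_zero cv v0
  have i1 : Integrable (fun p => u p * pd 0 (pd 1 v) p) :=
    iv.bdd_mul cu.aestronglyMeasurable (Filter.Eventually.of_forall hCu)
  have i2 : Integrable (fun p => v p * pd 0 (pd 1 u) p) :=
    iu.bdd_mul cv.aestronglyMeasurable (Filter.Eventually.of_forall hCv)
  rw [← sub_eq_zero, ← integral_sub i1 i2]
  set f : Annulus → ℝ := fun p => u p * pd 0 (pd 1 v) p - v p * pd 0 (pd 1 u) p with hf_def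
  have cf : Continuous f := (cu.mul cv01).sub (cv.mul cu01)
  have hlim := tendsto_integral_strip cf (i1.sub i2)
  refine tendsto_nhds_unique hlim ?_
  have hw0 : IsCn 1 (fun p => u p * pd 1 v p) := (hu.of_le (by norm_num)).mul hv1
  have hw1 : IsCn 1 (fun p => v p * pd 0 u p) := (hv.of_le (by norm_num)).mul hu0
  have hfw : f = fun p => pd 0 (fun p => u p * pd 1 v p) p - pd 1 (fun p => v p * pd 0 u p) p := by
    funext p
    rw [pd_mul 0 (hu.diff two_ne_zero p) (hv1.diff one_ne_zero p),
      pd_mul 1 (hv.diff two_ne_zero p) (hu0.diff one_ne_zero p), pd_comm hu 1 0]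
    simp only [hf_def]; ring
  obtain ⟨C1, hC1⟩ := exists_bound_of_pd_zero hv1 iv
  obtain ⟨C2, hC2⟩ := exists_bound_of_pd_one hu0 (by
    have : pd 1 (pd 0 u) = pd 0 (pd 1 u) := funext fun p => pd_comm hu 1 0 p
    rw [this]; exact iu)
  rw [Metric.tendsto_atTop]
  intro η hη
  set C := |C1| + |C2| + 1 with hC_def
  have hC : 0 < C := by positivity
  have hδ : 0 < η / (4 * C) := by positivity
  obtain ⟨e1, he1, he1', hs1⟩ := exists_strip_small u0 hδ
  obtain ⟨e2, he2, he2', hs2⟩ := exists_strip_small v0 hδ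
  obtain ⟨N, hN⟩ := exists_nat_gt (Real.pi / min e1 e2)
  refine ⟨N, fun n hn => ?_⟩
  set ε := Real.pi / ((n : ℝ) + 3) with hε_def
  have hn3 : (0 : ℝ) < (n : ℝ) + 3 := by positivity
  have hε0 : 0 < ε := div_pos Real.pi_pos hn3
  have hm : 0 < min e1 e2 := lt_min he1 he2
  have hεm : ε < min e1 e2 := by
    rw [div_lt_iff₀ hm] at hN
    rw [hε_def, div_lt_iff₀ hn3]
    have : (N : ℝ) ≤ n := Nat.cast_le.2 hn
    nlinarith
  have hε1 := hεm.trans_le (min_le_left _ _)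
  have hε2 := hεm.trans_le (min_le_right _ _)
  have ha : ε ∈ Ioo 0 Real.pi := ⟨hε0, by linarith [Real.pi_pos]⟩
  have hb : Real.pi - ε ∈ Ioo 0 Real.pi := ⟨by linarith [Real.pi_pos], by linarith⟩
  have hab : ε ≤ Real.pi - ε := by linarith
  have hsplit : ∫ s in (0 : ℝ)..Real.pi, ∫ x in ε..(Real.pi - ε), toCover f (s, s + x) =
      (∫ s in (0 : ℝ)..Real.pi, ∫ x in ε..(Real.pi - ε),
        toCover (pd 0 fun p => u p * pd 1 v p) (s, s + x)) -
      ∫ s in (0 : ℝ)..Real.pi, ∫ x in ε..(Real.pi - ε),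
        toCover (pd 1 fun p => v p * pd 0 u p) (s, s + x) := by
    have r0 := continuousOn_strip_rect (hw0.pd (m := 0) 0 (by norm_num)).continuous
      (a := 0) (b := Real.pi) ha.1 hb.2
    have r1 := continuousOn_strip_rect (hw1.pd (m := 0) 1 (by norm_num)).continuous
      (a := 0) (b := Real.pi) ha.1 hb.2
    have rf := continuousOn_strip_rect cf (a := 0) (b := Real.pi) ha.1 hb.2
    rw [← setIntegral_rect Real.pi_pos.le hab r0, ← setIntegral_rect Real.pi_pos.le hab r1,
      ← setIntegral_rect Real.pi_pos.le hab rf, ← integral_sub]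
    · apply setIntegral_congr_fun (measurableSet_Ioc.prod measurableSet_Ioc)
      rintro ⟨s, x⟩ ⟨-, hx⟩
      have hmem := strip_mem (s := s) (ha.1.trans hx.1) (hx.2.trans_lt hb.2)
      simp only [Function.uncurry]
      rw [toCover_eq _ hmem, toCover_eq _ hmem, toCover_eq _ hmem, hfw]
    · exact integrableOn_rect r0
    · exact integrableOn_rect r1
  have bd : ∀ d ∈ Ioo 0 Real.pi, (d = ε ∨ d = Real.pi - ε) →
      |∫ s in (0 : ℝ)..Real.pi, toCover (fun p => u p * pd 1 v p) (s, s + d)| ≤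
          η / (4 * C) * |C1| ∧
      |∫ s in (0 : ℝ)..Real.pi, toCover (fun p => v p * pd 0 u p) (s, s + d)| ≤
          η / (4 * C) * |C2| := by
    intro d hd hd'
    have e : ∀ (x y : Annulus → ℝ) (s : ℝ), toCover (fun p => x p * y p) (s, s + d) =
        toCover x (s, s + d) * toCover y (s, s + d) := fun x y s => by
      simp only [toCover_eq _ (strip_mem (s := s) hd.1 hd.2)]
    simp only [e]
    constructor
    · refine abs_integral_mul_le cu hv1.continuous hd (fun s => ?_)
        ((hC1 d hd).trans (le_abs_self _))
      refine (hs1 s d hd.1 hd.2 ?_).le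
      rcases hd' with rfl | rfl
      · exact Or.inl hε1
      · exact Or.inr (by linarith)
    · refine abs_integral_mul_le cv hu0.continuous hd (fun s => ?_)
        ((hC2 d hd).trans (le_abs_self _))
      refine (hs2 s d hd.1 hd.2 ?_).le
      rcases hd' with rfl | rfl
      · exact Or.inl hε2
      · exact Or.inr (by linarith)
  rw [hsplit, stokes_zero hw0 ha hb, stokes_one hw1 ha hb hab,
    intervalIntegral.integral_sub, intervalIntegral.integral_sub, dist_zero_right, Real.norm_eq_abs]
  · obtain ⟨b1, b2⟩ := bd ε ha (Or.inl rfl)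
    obtain ⟨b3, b4⟩ := bd (Real.pi - ε) hb (Or.inr rfl)
    have e1 : η / (4 * C) * |C1| + η / (4 * C) * |C2| < η / 4 + η / 4 * 0 := by
      have : η / 4 = η / (4 * C) * C := by field_simp
      rw [this, hC_def]
      have : 0 < η / (4 * (|C1| + |C2| + 1)) := hδ
      nlinarith
    rw [abs_le] at b1 b2 b3 b4
    rw [abs_lt]
    constructor <;> linarith
  · exact (continuous_strip_fst hw1.continuous hb.1 hb.2).intervalIntegrable _ _
  · exact (continuous_strip_fst hw1.continuous ha.1 ha.2).intervalIntegrable _ _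
  · exact (continuous_strip_fst hw0.continuous hb.1 hb.2).intervalIntegrable _ _
  · exact (continuous_strip_fst hw0.continuous ha.1 ha.2).intervalIntegrable _ _

/-! ### The action of asymptotic metrics -/

/-- The properties of a pair of `C²` metrics in a common `𝓢`-class on which the Chasles relation
and the monotonicity formula rest. -/
structure Asymptotic (g h : Metric) : Prop where
  left : g.IsCn 2
  right : h.IsCn 2
  boundary : Tendsto (g.factor h) (cocompact Annulus) (𝓝 0)
  integrable : Integrable (pd 0 (pd 1 (g.factor h)))

theorem InSClass.asymptotic {b g : Metric} (h : InSClass b g) : Asymptotic b g :=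
  ⟨h.memMb.1, h.regular, h.boundary, h.integrable_pd_pd⟩

namespace Asymptotic

variable {g h k : Metric}

theorem regular (H : Asymptotic g h) : IsCn 2 (g.factor h) := g.isCn_factor h H.left H.right

theorem symm (H : Asymptotic g h) : Asymptotic h g := by
  have e : h.factor g = fun p => - g.factor h p := funext fun p => h.factor_comm g p
  refine ⟨H.right, H.left, ?_, ?_⟩
  · rw [e]; simpa using H.boundary.neg
  · have hu := H.regular
    have e1 : pd 1 (h.factor g) = fun p => - pd 1 (g.factor h) p := by
      funext p; rw [e, pd_neg 1 (hu.diff two_ne_zero p)]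
    have e2 : pd 0 (pd 1 (h.factor g)) = fun p => - pd 0 (pd 1 (g.factor h)) p := by
      funext p; rw [e1, pd_neg 0 ((hu.pd (m := 1) 1 (by norm_num)).diff one_ne_zero p)]
    rw [e2]; exact H.integrable.neg

theorem pd_pd_add (H : Asymptotic g h) (H' : Asymptotic h k) (p : Annulus) :
    pd 0 (pd 1 (g.factor k)) p = pd 0 (pd 1 (g.factor h)) p + pd 0 (pd 1 (h.factor k)) p := by
  have e : g.factor k = fun p => g.factor h p + h.factor k p :=
    funext fun p => g.factor_add k h p
  have e1 : pd 1 (g.factor k) = fun p => pd 1 (g.factor h) p + pd 1 (h.factor k) p := by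
    funext p; rw [e, pd_add 1 (H.regular.diff two_ne_zero p) (H'.regular.diff two_ne_zero p)]
  rw [e1, pd_add 0 ((H.regular.pd (m := 1) 1 (by norm_num)).diff one_ne_zero p)
    ((H'.regular.pd (m := 1) 1 (by norm_num)).diff one_ne_zero p)]

theorem trans (H : Asymptotic g h) (H' : Asymptotic h k) : Asymptotic g k := by
  have e : g.factor k = fun p => g.factor h p + h.factor k p :=
    funext fun p => g.factor_add k h p
  refine ⟨H.left, H'.right, ?_, ?_⟩
  · rw [e]; simpa using H.boundary.add H'.boundary
  · rw [funext (H.pd_pd_add H')]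
    exact H.integrable.add H'.integrable

theorem bounded (H : Asymptotic g h) : ∃ C, ∀ p, |g.factor h p| ≤ C :=
  bounded_of_tendsto_zero H.regular.continuous H.boundary

theorem integrable_mul (H : Asymptotic g h) {w : Annulus → ℝ} (hw : Integrable w) :
    Integrable (fun p => g.factor h p * w p) := by
  obtain ⟨C, hC⟩ := H.bounded
  exact hw.bdd_mul H.regular.continuous.aestronglyMeasurable (Filter.Eventually.of_forall hC)

theorem actionConverges (H : Asymptotic g h)
    (hi : Integrable (fun p => g.factor h p * g.curvForm p)) : ActionConverges g h := by
  refine ⟨hi, H.integrable_mul ?_⟩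
  simp only [funext fun p => ddI_eq H.regular p]
  exact H.integrable.const_mul 2

theorem action_eq (H : Asymptotic g h) : action g h =
    -(1 / 2) * (∫ p, g.factor h p * g.curvForm p) +
      (1 / 2) * ∫ p, g.factor h p * pd 0 (pd 1 (g.factor h)) p := by
  have e : ∀ p, g.factor h p * ddI (g.factor h) p =
      2 * (g.factor h p * pd 0 (pd 1 (g.factor h)) p) := fun p => by
    rw [ddI_eq H.regular]; ring
  unfold action
  simp only [e]
  rw [integral_const_mul]
  ring

/-- The monotonicity formula. -/
theorem monotonicity (H : Asymptotic g h)
    (hi : Integrable (fun p => g.factor h p * g.curvForm p)) :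
    Integrable (fun p => g.factor h p * (g.curvForm p + h.curvForm p)) ∧
      action g h = -(1 / 4) * ∫ p, g.factor h p * (g.curvForm p + h.curvForm p) := by
  have e : ∀ p, g.factor h p * (g.curvForm p + h.curvForm p) =
      2 * (g.factor h p * g.curvForm p) -
        2 * (g.factor h p * pd 0 (pd 1 (g.factor h)) p) := fun p => by
    rw [g.curvForm_factor h H.left H.right]; ring
  simp only [e]
  have i2 := H.integrable_mul H.integrable
  refine ⟨(hi.const_mul 2).sub (i2.const_mul 2), ?_⟩
  rw [H.action_eq, integral_sub (hi.const_mul 2) (i2.const_mul 2), integral_const_mul,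
    integral_const_mul]
  ring

/-- The Chasles relation. -/
theorem chasles (H : Asymptotic g k) (H' : Asymptotic k h)
    (hi : Integrable (fun p => g.factor k p * g.curvForm p))
    (hi' : Integrable (fun p => k.factor h p * k.curvForm p)) :
    ActionConverges g h ∧ action g h = action g k + action k h := by
  have HH := H.trans H'
  have j1 := H.integrable_mul H.integrable
  have j2 := H'.integrable_mul H'.integrable
  have j3 := H.integrable_mul H'.integrable
  have j4 := H'.integrable_mul H.integrable
  have eF : ∀ p, k.factor h p * g.curvForm p = k.factor h p * k.curvForm p +
      2 * (k.factor h p * pd 0 (pd 1 (g.factor k)) p) := fun p => by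
    rw [g.curvForm_factor k H.left H.right]; ring
  have hi3 : Integrable (fun p => k.factor h p * g.curvForm p) := by
    simp only [eF]; exact hi'.add (j4.const_mul 2)
  have e1 : ∀ p, g.factor h p * g.curvForm p =
      g.factor k p * g.curvForm p + k.factor h p * g.curvForm p := fun p => by
    rw [g.factor_add h k]; ring
  have e2 : ∀ p, g.factor h p * pd 0 (pd 1 (g.factor h)) p =
      g.factor k p * pd 0 (pd 1 (g.factor k)) p + k.factor h p * pd 0 (pd 1 (k.factor h)) p +
      (g.factor k p * pd 0 (pd 1 (k.factor h)) p +
        k.factor h p * pd 0 (pd 1 (g.factor k)) p) := fun p => by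
    rw [H.pd_pd_add H', g.factor_add h k]; ring
  have i1 : Integrable (fun p => g.factor h p * g.curvForm p) := by
    simp only [e1]; exact hi.add hi3
  refine ⟨HH.actionConverges i1, ?_⟩
  have hgreen := green H.regular H'.regular H.boundary H'.boundary H.integrable H'.integrable
  have t1 : ∫ p, g.factor h p * g.curvForm p = (∫ p, g.factor k p * g.curvForm p) +
      ((∫ p, k.factor h p * k.curvForm p) +
        2 * ∫ p, k.factor h p * pd 0 (pd 1 (g.factor k)) p) := by
    simp only [e1]
    rw [integral_add hi hi3]
    congr 1
    simp only [eF]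
    rw [integral_add hi' (j4.const_mul 2), integral_const_mul]
  have t2 : ∫ p, g.factor h p * pd 0 (pd 1 (g.factor h)) p =
      (∫ p, g.factor k p * pd 0 (pd 1 (g.factor k)) p) +
      (∫ p, k.factor h p * pd 0 (pd 1 (k.factor h)) p) +
      ((∫ p, g.factor k p * pd 0 (pd 1 (k.factor h)) p) +
        ∫ p, k.factor h p * pd 0 (pd 1 (g.factor k)) p) := by
    simp only [e2]
    have a := integral_add (j1.add j2) (j3.add j4)
    simp only [Pi.add_apply] at a
    rw [a, integral_add j1 j2, integral_add j3 j4]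
  rw [HH.action_eq, H.action_eq, H'.action_eq, t1, t2, hgreen]
  ring

theorem curvForm_of_curvature {g : Metric} {c : ℝ} (hg : ∀ p, g.curvature p = c) (p : Annulus) :
    g.curvForm p = c * g.dens p := by
  unfold Metric.curvForm
  rw [hg, g.volCoeff_eq]

/-- For asymptotic metrics of the same constant curvature, the difference of the area forms is
exact and integrable, and controls `u F_g`. -/
theorem integrable_of_curvature (H : Asymptotic g h) {c : ℝ} (hc : 0 < c)
    (hg : ∀ p, g.curvature p = c) (hh : ∀ p, h.curvature p = c) :
    Integrable (fun p => g.factor h p * g.curvForm p) := by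
  obtain ⟨M, hM⟩ := H.bounded
  have hcont : Continuous fun p => g.factor h p * g.curvForm p :=
    H.regular.continuous.mul (g.continuous_curvForm H.left)
  refine ((H.integrable.const_mul 2).norm.const_mul (Real.exp (2 * M) / 2)).mono'
    hcont.aestronglyMeasurable (Filter.Eventually.of_forall fun p => ?_)
  set x := g.factor h p with hx
  have key : |x| ≤ Real.exp (2 * M) / 2 * |Real.exp (2 * x) - 1| := by
    have hxM := abs_le.1 (hM p)
    rw [← hx] at hxM
    have hM0 : 0 ≤ M := (abs_nonneg _).trans (hM p)
    rcases le_total 0 x with h0 | h0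
    · have h1 := Real.add_one_le_exp (2 * x)
      have h2 : 1 ≤ Real.exp (2 * M) := Real.one_le_exp (by linarith)
      rw [abs_of_nonneg h0, abs_of_nonneg (by linarith)]
      nlinarith
    · have h1 := Real.add_one_le_exp (-(2 * x))
      have h2 : 1 ≤ Real.exp (2 * M) * Real.exp (2 * x) := by
        rw [← Real.exp_add]; exact Real.one_le_exp (by linarith [hxM.1])
      have h3 : Real.exp (2 * x) ≤ 1 := Real.exp_le_one_iff.2 (by linarith)
      have h4 : Real.exp (2 * x) * Real.exp (-(2 * x)) = 1 := by rw [← Real.exp_add]; simp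
      rw [abs_of_nonpos h0, abs_of_nonpos (by linarith)]
      have h5 : Real.exp (2 * x) * (-(2 * x)) ≤ 1 - Real.exp (2 * x) := by
        nlinarith [Real.exp_pos (2 * x)]
      have h6 : -(2 * x) ≤ Real.exp (2 * M) * (Real.exp (2 * x) * (-(2 * x))) := by
        nlinarith
      have h7 := mul_le_mul_of_nonneg_left h5 (Real.exp_pos (2 * M)).le
      nlinarith
  have e := g.curvForm_factor h H.left H.right p
  rw [curvForm_of_curvature hg, curvForm_of_curvature hh, g.dens_eq_exp_factor h, ← hx] at e
  have e2 : ‖2 * pd 0 (pd 1 (g.factor h)) p‖ = c * g.dens p * |Real.exp (2 * x) - 1| := by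
    have : 2 * pd 0 (pd 1 (g.factor h)) p = -(c * g.dens p * (Real.exp (2 * x) - 1)) := by linarith
    rw [this, norm_neg, Real.norm_eq_abs, abs_mul, abs_of_pos (mul_pos hc (g.dens_pos p))]
  rw [e2, curvForm_of_curvature hg, Real.norm_eq_abs, abs_mul,
    abs_of_pos (mul_pos hc (g.dens_pos p))]
  have := mul_le_mul_of_nonneg_right key (mul_pos hc (g.dens_pos p)).le
  linarith

end Asymptotic

/-! ### Integrals depending smoothly on a parameter -/

section Param

variable {H : Type} [NormedAddCommGroup H] [NormedSpace ℝ H] [ProperSpace H]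
  {E : Type} [NormedAddCommGroup E] [NormedSpace ℝ E]

theorem hasFDerivAt_integral_param {K : H × ℝ → E} (hK : ContDiff ℝ 1 K) {a b : ℝ} (z : H) :
    HasFDerivAt (fun z => ∫ x in a..b, K (z, x))
      (∫ x in a..b, (fderiv ℝ K (z, x)).comp (ContinuousLinearMap.inl ℝ H ℝ)) z := by
  have hc : Continuous fun w : H × ℝ => (fderiv ℝ K w).comp (ContinuousLinearMap.inl ℝ H ℝ) :=
    (hK.continuous_fderiv one_ne_zero).clm_comp continuous_const
  obtain ⟨C, hC⟩ := ((isCompact_closedBall z 1).prod (isCompact_uIcc (a := a) (b := b))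
    ).exists_bound_of_continuousOn hc.continuousOn
  refine (intervalIntegral.hasFDerivAt_integral_of_dominated_of_fderiv_le
    (F := fun z x => K (z, x))
    (F' := fun z x => (fderiv ℝ K (z, x)).comp (ContinuousLinearMap.inl ℝ H ℝ))
    (bound := fun _ => C) (Metric.closedBall_mem_nhds z one_pos) ?_ ?_ ?_ ?_ ?_ ?_)
  · exact Filter.Eventually.of_forall fun y =>
      (hK.continuous.comp (by fun_prop)).aestronglyMeasurable
  · exact (hK.continuous.comp (by fun_prop)).intervalIntegrable _ _
  · exact (hc.comp (by fun_prop : Continuous fun x : ℝ => (z, x))).aestronglyMeasurable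
  · exact Filter.Eventually.of_forall fun x hx y hy => hC (y, x) ⟨hy, uIoc_subset_uIcc hx⟩
  · exact intervalIntegrable_const
  · refine Filter.Eventually.of_forall fun x _ y _ => ?_
    have h1 := (hK.differentiable one_ne_zero (y, x)).hasFDerivAt
    exact h1.comp y (hasFDerivAt_prodMk_left y x)

theorem contDiff_integral_param {n : ℕ} {K : H × ℝ → E} (hK : ContDiff ℝ n K) {a b : ℝ} :
    ContDiff ℝ n (fun z => ∫ x in a..b, K (z, x)) := by
  induction n generalizing E with
  | zero =>
    simp only [Nat.cast_zero, contDiff_zero] at hK ⊢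
    exact intervalIntegral.continuous_parametric_intervalIntegral_of_continuous' (by exact hK) a b
  | succ n ih =>
    push_cast at hK ⊢
    rw [contDiff_succ_iff_hasFDerivAt]
    refine ⟨fun z => ∫ x in a..b, (fderiv ℝ K (z, x)).comp (ContinuousLinearMap.inl ℝ H ℝ), ?_,
      fun z => hasFDerivAt_integral_param (hK.of_le (by simp)) z⟩
    apply ih (K := fun w => (fderiv ℝ K w).comp (ContinuousLinearMap.inl ℝ H ℝ))
    exact (hK.fderiv_right (m := n) (by simp)).clm_comp contDiff_const

end Param

/-! ### Normal form of the metrics of constant curvature -/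

/-- `φ` is a lift of an orientation preserving `C³` diffeomorphism of the projective line, and
`h` is the pull-back of the de Sitter metric of curvature `c` by its diagonal action. -/
structure IsNormalForm (c : ℝ) (h : Metric) (φ : ℝ → ℝ) : Prop where
  smooth : ContDiff ℝ 3 φ
  deriv_pos : ∀ s, 0 < deriv φ s
  turn : ∀ s, φ (s + Real.pi) = φ s + Real.pi
  dens : ∀ q ∈ coverSet, toCover h.dens q =
    2 * deriv φ q.1 * deriv φ q.2 / (c * Real.sin (φ q.1 - φ q.2) ^ 2)

section Circle

variable {φ : ℝ → ℝ}

/-- The divided difference `sin (φ t - φ s) / (t - s)`, extended to the diagonal. -/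
def sinQuot (φ : ℝ → ℝ) (q : ℝ × ℝ) : ℝ :=
  ∫ x in (0 : ℝ)..1, deriv φ (q.1 + x * (q.2 - q.1)) *
    Real.cos (φ (q.1 + x * (q.2 - q.1)) - φ q.1)

theorem contDiff_deriv_of_three (hφ : ContDiff ℝ 3 φ) : ContDiff ℝ 2 (deriv φ) := by
  have h3 : (3 : WithTop ℕ∞) = 2 + 1 := by norm_num
  rw [h3, contDiff_succ_iff_deriv] at hφ
  exact hφ.2.2

theorem contDiff_sinQuot (hφ : ContDiff ℝ 3 φ) : ContDiff ℝ 2 (sinQuot φ) := by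
  have hφ' := contDiff_deriv_of_three hφ
  have hφ2 : ContDiff ℝ 2 φ := hφ.of_le (by norm_num)
  apply contDiff_integral_param (n := 2) (K := fun w : (ℝ × ℝ) × ℝ =>
    deriv φ (w.1.1 + w.2 * (w.1.2 - w.1.1)) *
      Real.cos (φ (w.1.1 + w.2 * (w.1.2 - w.1.1)) - φ w.1.1))
  have h1 : ContDiff ℝ 2 fun w : (ℝ × ℝ) × ℝ => w.1.1 + w.2 * (w.1.2 - w.1.1) := by fun_prop
  have h2 : ContDiff ℝ 2 fun w : (ℝ × ℝ) × ℝ => w.1.1 := by fun_prop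
  exact (hφ'.comp h1).mul (Real.contDiff_cos.comp ((hφ2.comp h1).sub (hφ2.comp h2)))

theorem sinQuot_diag (s : ℝ) : sinQuot φ (s, s) = deriv φ s := by
  simp [sinQuot]

theorem mul_sinQuot (hφ : ContDiff ℝ 3 φ) (s t : ℝ) :
    (t - s) * sinQuot φ (s, t) = Real.sin (φ t - φ s) := by
  have hd : ∀ x, HasDerivAt φ (deriv φ x) x := fun x =>
    (hφ.differentiable (by norm_num) x).hasDerivAt
  have hc : Continuous (deriv φ) := hφ.continuous_deriv (by norm_num)
  have hcφ := hφ.continuous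
  have h := intervalIntegral.integral_eq_sub_of_hasDerivAt (a := 0) (b := 1)
    (f := fun x => Real.sin (φ (s + x * (t - s)) - φ s))
    (f' := fun x => (t - s) * (deriv φ (s + x * (t - s)) *
      Real.cos (φ (s + x * (t - s)) - φ s))) (fun x _ => by
      have h1 : HasDerivAt (fun x : ℝ => s + x * (t - s)) (t - s) x := by
        simpa using ((hasDerivAt_id x).mul_const (t - s)).const_add s
      have h2 := ((hd (s + x * (t - s))).comp x h1).sub_const (φ s)
      have h3 := h2.sin
      refine h3.congr_deriv ?_
      simp only [Function.comp_apply]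
      ring) (by
      apply Continuous.intervalIntegrable
      fun_prop)
  rw [intervalIntegral.integral_const_mul] at h
  simpa [sinQuot] using h

theorem strictMono_of_deriv (hφ' : ∀ s, 0 < deriv φ s) : StrictMono φ := strictMono_of_deriv_pos hφ'

theorem sin_sub_pos_of_turn (hφ' : ∀ s, 0 < deriv φ s) (ht : ∀ s, φ (s + Real.pi) = φ s + Real.pi)
    {s t : ℝ} (h0 : s < t) (h1 : t < s + Real.pi) : 0 < Real.sin (φ t - φ s) := by
  have hm := strictMono_of_deriv hφ'
  have a := hm h0
  have b := hm h1
  rw [ht] at b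
  exact Real.sin_pos_of_pos_of_lt_pi (by linarith) (by linarith)

theorem sinQuot_pos (hφ : ContDiff ℝ 3 φ) (hφ' : ∀ s, 0 < deriv φ s)
    (ht : ∀ s, φ (s + Real.pi) = φ s + Real.pi) {s t : ℝ} (h : |t - s| < Real.pi) :
    0 < sinQuot φ (s, t) := by
  rw [abs_lt] at h
  rcases lt_trichotomy s t with hst | rfl | hst
  · have h1 := sin_sub_pos_of_turn hφ' ht hst (by linarith)
    rw [← mul_sinQuot hφ] at h1
    exact pos_of_mul_pos_right h1 (by linarith)
  · rw [sinQuot_diag]; exact hφ' s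
  · have h1 := sin_sub_pos_of_turn hφ' ht hst (by linarith)
    have h2 : Real.sin (φ t - φ s) < 0 := by
      rw [← neg_sub, Real.sin_neg]; linarith
    rw [← mul_sinQuot hφ] at h2
    have h3 : 0 < (s - t) * sinQuot φ (s, t) := by linarith
    exact pos_of_mul_pos_right h3 (by linarith)

theorem phi_add_int (ht : ∀ s, φ (s + Real.pi) = φ s + Real.pi) (s : ℝ) (n : ℤ) :
    φ (s + n * Real.pi) = φ s + n * Real.pi := by
  have hp : Function.Periodic (fun s => φ s - s) Real.pi := fun s => by
    simp only [ht]; ring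
  have : φ (s + n * Real.pi) - (s + n * Real.pi) = φ s - s := hp.int_mul n s
  linarith

theorem deriv_add_int (ht : ∀ s, φ (s + Real.pi) = φ s + Real.pi) (s : ℝ) (n : ℤ) :
    deriv φ (s + n * Real.pi) = deriv φ s := by
  have h : (fun x => φ (x + n * Real.pi)) = fun x => φ x + n * Real.pi :=
    funext fun x => phi_add_int ht x n
  have h2 := deriv_comp_add_const (f := φ) (n * Real.pi) s
  rw [h, deriv_add_const] at h2
  exact h2.symm

theorem sin_sq_add_int (x : ℝ) (n : ℤ) : Real.sin (x + n * Real.pi) ^ 2 = Real.sin x ^ 2 := by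
  rw [Real.sin_add_int_mul_pi, mul_pow]
  have : ((-1 : ℝ) ^ n) ^ 2 = 1 := by
    rw [← zpow_natCast, ← zpow_mul, mul_comm, zpow_mul]; simp
  rw [this, one_mul]

/-- The logarithmic factor between the de Sitter metric and its pull-back by `φ`, which extends to
the whole plane, by zero on the diagonals `t - s ∈ πℤ`. -/
def logFactor (φ : ℝ → ℝ) (q : ℝ × ℝ) : ℝ :=
  if Real.sin (q.2 - q.1) = 0 then 0 else
    (1 / 2) * Real.log (deriv φ q.1 * deriv φ q.2 * Real.sin (q.2 - q.1) ^ 2 /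
      Real.sin (φ q.2 - φ q.1) ^ 2)

theorem logFactor_add_int (ht : ∀ s, φ (s + Real.pi) = φ s + Real.pi) (s t : ℝ) (m n : ℤ) :
    logFactor φ (s + m * Real.pi, t + n * Real.pi) = logFactor φ (s, t) := by
  unfold logFactor
  simp only [phi_add_int ht, deriv_add_int ht]
  have e1 : t + n * Real.pi - (s + m * Real.pi) = t - s + ((n - m : ℤ) : ℝ) * Real.pi := by
    push_cast; ring
  have e2 : φ t + n * Real.pi - (φ s + m * Real.pi) =
      φ t - φ s + ((n - m : ℤ) : ℝ) * Real.pi := by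
    push_cast; ring
  have e3 : Real.sin (t - s + ((n - m : ℤ) : ℝ) * Real.pi) = 0 ↔ Real.sin (t - s) = 0 := by
    rw [← sq_eq_zero_iff, sin_sq_add_int, sq_eq_zero_iff]
  rw [e1, e2, sin_sq_add_int, sin_sq_add_int]
  simp only [e3]

theorem logFactor_symm (s t : ℝ) : logFactor φ (t, s) = logFactor φ (s, t) := by
  unfold logFactor
  have e : ∀ x y : ℝ, Real.sin (x - y) = - Real.sin (y - x) := fun x y => by
    rw [← Real.sin_neg]; congr 1; ring
  simp only [e s t, e (φ s) (φ t), neg_eq_zero, neg_sq, mul_comm (deriv φ t)]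

theorem logFactor_diag (s : ℝ) : logFactor φ (s, s) = 0 := by simp [logFactor]

theorem sin_phi_ne (hφ' : ∀ s, 0 < deriv φ s)
    (ht : ∀ s, φ (s + Real.pi) = φ s + Real.pi) {s t : ℝ} (h : Real.sin (t - s) ≠ 0) :
    Real.sin (φ t - φ s) ≠ 0 := by
  intro h0
  obtain ⟨n, hn⟩ := Real.sin_eq_zero_iff.1 h0
  have h1 : φ t = φ (s + n * Real.pi) := by rw [phi_add_int ht]; linarith
  have h2 := (strictMono_of_deriv hφ').injective h1
  apply h
  rw [Real.sin_eq_zero_iff]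
  exact ⟨n, by linarith⟩

theorem logFactor_band (hφ : ContDiff ℝ 3 φ) (hφ' : ∀ s, 0 < deriv φ s)
    (ht : ∀ s, φ (s + Real.pi) = φ s + Real.pi) {q : ℝ × ℝ} (h : |q.2 - q.1| < Real.pi) :
    logFactor φ q = (1 / 2) * Real.log (deriv φ q.1) + (1 / 2) * Real.log (deriv φ q.2) +
      Real.log (sinQuot id q) - Real.log (sinQuot φ q) := by
  obtain ⟨s, t⟩ := q
  simp only at h ⊢
  have p1 := sinQuot_pos hφ hφ' ht h
  have p2 : 0 < sinQuot id (s, t) := sinQuot_pos contDiff_id (fun s => by simp)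
    (fun s => rfl) h
  have d1 := hφ' s
  have d2 := hφ' t
  rcases eq_or_ne s t with rfl | hst
  · rw [logFactor_diag, sinQuot_diag, sinQuot_diag]; simp; ring
  · have hts : t - s ≠ 0 := sub_ne_zero.2 hst.symm
    have e1 := mul_sinQuot (φ := id) contDiff_id s t
    have e2 := mul_sinQuot hφ s t
    simp only [id] at e1
    have hne : Real.sin (t - s) ≠ 0 := by
      rw [← e1]; exact mul_ne_zero hts p2.ne'
    unfold logFactor
    rw [if_neg hne, ← e1, ← e2]
    have : deriv φ s * deriv φ t * ((t - s) * sinQuot id (s, t)) ^ 2 /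
        ((t - s) * sinQuot φ (s, t)) ^ 2 =
        deriv φ s * deriv φ t * (sinQuot id (s, t)) ^ 2 / (sinQuot φ (s, t)) ^ 2 := by
      field_simp
    rw [this, Real.log_div (by positivity) (by positivity), Real.log_mul (by positivity)
      (by positivity), Real.log_mul d1.ne' d2.ne', Real.log_pow, Real.log_pow]
    push_cast
    ring

theorem contDiff_logFactor (hφ : ContDiff ℝ 3 φ) (hφ' : ∀ s, 0 < deriv φ s)
    (ht : ∀ s, φ (s + Real.pi) = φ s + Real.pi) : ContDiff ℝ 2 (logFactor φ) := by
  rw [contDiff_iff_contDiffAt]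
  rintro ⟨s, t⟩
  have hdφ := contDiff_deriv_of_three hφ
  -- translate the point into the band `|t - s| < π`
  set n : ℤ := round ((t - s) / Real.pi) with hn
  set q₀ : ℝ × ℝ := (s, t - n * Real.pi) with hq₀
  have hband : |q₀.2 - q₀.1| < Real.pi := by
    have h1 := abs_sub_round ((t - s) / Real.pi)
    rw [← hn] at h1
    have h2 : q₀.2 - q₀.1 = ((t - s) / Real.pi - n) * Real.pi := by
      simp only [hq₀]; field_simp; ring
    rw [h2, abs_mul, abs_of_pos Real.pi_pos]
    nlinarith [Real.pi_pos]
  have hlocal : ContDiffAt ℝ 2 (logFactor φ) q₀ := by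
    have h1 : ContDiffAt ℝ 2 (fun q : ℝ × ℝ => (1 / 2) * Real.log (deriv φ q.1) +
        (1 / 2) * Real.log (deriv φ q.2) + Real.log (sinQuot id q) -
        Real.log (sinQuot φ q)) q₀ := by
      have a1 : ContDiffAt ℝ 2 (fun q : ℝ × ℝ => Real.log (deriv φ q.1)) q₀ :=
        ((hdφ.comp contDiff_fst).contDiffAt).log (hφ' _).ne'
      have a2 : ContDiffAt ℝ 2 (fun q : ℝ × ℝ => Real.log (deriv φ q.2)) q₀ :=
        ((hdφ.comp contDiff_snd).contDiffAt).log (hφ' _).ne'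
      have a3 : ContDiffAt ℝ 2 (fun q : ℝ × ℝ => Real.log (sinQuot id q)) q₀ :=
        ((contDiff_sinQuot contDiff_id).contDiffAt).log
          (sinQuot_pos contDiff_id (fun s => by simp) (fun s => rfl) hband).ne'
      have a4 : ContDiffAt ℝ 2 (fun q : ℝ × ℝ => Real.log (sinQuot φ q)) q₀ :=
        ((contDiff_sinQuot hφ).contDiffAt).log (sinQuot_pos hφ hφ' ht hband).ne'
      exact (((contDiffAt_const.mul a1).add (contDiffAt_const.mul a2)).add a3).sub a4
    refine h1.congr_of_eventuallyEq ?_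
    have hopen : IsOpen {q : ℝ × ℝ | |q.2 - q.1| < Real.pi} :=
      isOpen_lt (by fun_prop) continuous_const
    filter_upwards [hopen.mem_nhds hband] with q hq using logFactor_band hφ hφ' ht hq
  have e : logFactor φ = logFactor φ ∘ fun q : ℝ × ℝ => (q.1, q.2 - n * Real.pi) := by
    funext ⟨x, y⟩
    have := logFactor_add_int ht x y 0 (-n)
    simp only [Function.comp]
    rw [← this]
    push_cast
    congr 2 <;> ring
  rw [e]
  exact ContDiffAt.comp (s, t) (g := logFactor φ) hlocal
    (contDiff_fst.prodMk (contDiff_snd.sub contDiff_const)).contDiffAt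

end Circle

section Circle

variable {φ : ℝ → ℝ}

/-! ### First and second derivatives of the logarithmic factor -/

/-- `∂/∂s` of the logarithmic factor. -/
def factS (φ : ℝ → ℝ) (q : ℝ × ℝ) : ℝ := fderiv ℝ (logFactor φ) q (1, 0)

/-- `∂/∂t` of the logarithmic factor. -/
def factT (φ : ℝ → ℝ) (q : ℝ × ℝ) : ℝ := fderiv ℝ (logFactor φ) q (0, 1)

/-- The mixed second derivative of the logarithmic factor. -/
def factST (φ : ℝ → ℝ) (q : ℝ × ℝ) : ℝ := fderiv ℝ (factS φ) q (0, 1)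

/-- The function `½ log φ'`. -/
def halfLog (φ : ℝ → ℝ) (s : ℝ) : ℝ := (1 / 2) * Real.log (deriv φ s)

/-- A lift of an orientation preserving `C³` diffeomorphism of the projective line. -/
structure IsCircleLift (φ : ℝ → ℝ) : Prop where
  smooth : ContDiff ℝ 3 φ
  deriv_pos : ∀ s, 0 < deriv φ s
  turn : ∀ s, φ (s + Real.pi) = φ s + Real.pi

namespace IsCircleLift

variable (H : IsCircleLift φ)
include H

theorem contDiff_logFactor : ContDiff ℝ 2 (logFactor φ) :=
  SplitLiouville.contDiff_logFactor H.smooth H.deriv_pos H.turn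

theorem contDiff_factS : ContDiff ℝ 1 (factS φ) :=
  (H.contDiff_logFactor.fderiv_right (m := 1) (by norm_num)).clm_apply contDiff_const

theorem continuous_factT : Continuous (factT φ) :=
  ((H.contDiff_logFactor.fderiv_right (m := 1) (by norm_num)).clm_apply
    contDiff_const).continuous

theorem continuous_factST : Continuous (factST φ) :=
  ((H.contDiff_factS.fderiv_right (m := 0) (by norm_num)).clm_apply contDiff_const).continuous

theorem hasDerivAt_logFactor_fst (s t : ℝ) :
    HasDerivAt (fun s => logFactor φ (s, t)) (factS φ (s, t)) s := by
  have : HasDerivAt (fun s : ℝ => (s, t)) ((1 : ℝ), (0 : ℝ)) s :=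
    (hasDerivAt_id s).prodMk (hasDerivAt_const s t)
  exact (H.contDiff_logFactor.differentiable two_ne_zero (s, t)).hasFDerivAt.comp_hasDerivAt s this

theorem hasDerivAt_logFactor_snd (s t : ℝ) :
    HasDerivAt (fun t => logFactor φ (s, t)) (factT φ (s, t)) t := by
  have : HasDerivAt (fun t : ℝ => (s, t)) ((0 : ℝ), (1 : ℝ)) t :=
    (hasDerivAt_const t s).prodMk (hasDerivAt_id t)
  exact (H.contDiff_logFactor.differentiable two_ne_zero (s, t)).hasFDerivAt.comp_hasDerivAt t this

theorem hasDerivAt_factS_snd (s t : ℝ) :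
    HasDerivAt (fun t => factS φ (s, t)) (factST φ (s, t)) t := by
  have : HasDerivAt (fun t : ℝ => (s, t)) ((0 : ℝ), (1 : ℝ)) t :=
    (hasDerivAt_const t s).prodMk (hasDerivAt_id t)
  exact (H.contDiff_factS.differentiable one_ne_zero (s, t)).hasFDerivAt.comp_hasDerivAt t this

theorem hasDerivAt_phi (s : ℝ) : HasDerivAt φ (deriv φ s) s :=
  (H.smooth.differentiable (by norm_num) s).hasDerivAt

theorem contDiff_halfLog : ContDiff ℝ 2 (halfLog φ) :=
  contDiff_const.mul ((contDiff_deriv_of_three H.smooth).log fun s => (H.deriv_pos s).ne')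

theorem hasDerivAt_halfLog (s : ℝ) : HasDerivAt (halfLog φ) (deriv (halfLog φ) s) s :=
  (H.contDiff_halfLog.differentiable (by norm_num) s).hasDerivAt

theorem continuous_deriv_halfLog : Continuous (deriv (halfLog φ)) :=
  H.contDiff_halfLog.continuous_deriv (by norm_num)

theorem halfLog_add (s : ℝ) : halfLog φ (s + Real.pi) = halfLog φ s := by
  have := deriv_add_int H.turn s 1
  unfold halfLog
  rw [Int.cast_one, one_mul] at this
  rw [this]

theorem logFactor_add_fst (s t : ℝ) : logFactor φ (s + Real.pi, t) = logFactor φ (s, t) := by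
  simpa using logFactor_add_int H.turn s t 1 0

theorem logFactor_add_snd (s t : ℝ) : logFactor φ (s, t + Real.pi) = logFactor φ (s, t) := by
  simpa using logFactor_add_int H.turn s t 0 1

theorem factS_add_snd (s t : ℝ) : factS φ (s, t + Real.pi) = factS φ (s, t) := by
  have h := fderiv_comp_add_right (𝕜 := ℝ) (f := logFactor φ) (x := (s, t)) (0, Real.pi)
  have e : (fun x : ℝ × ℝ => logFactor φ (x + (0, Real.pi))) = logFactor φ := by
    funext ⟨x, y⟩; simpa using H.logFactor_add_snd x y
  rw [e] at h
  unfold factS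
  rw [h]; simp

theorem factT_add_snd (s t : ℝ) : factT φ (s, t + Real.pi) = factT φ (s, t) := by
  have h := fderiv_comp_add_right (𝕜 := ℝ) (f := logFactor φ) (x := (s, t)) (0, Real.pi)
  have e : (fun x : ℝ × ℝ => logFactor φ (x + (0, Real.pi))) = logFactor φ := by
    funext ⟨x, y⟩; simpa using H.logFactor_add_snd x y
  rw [e] at h
  unfold factT
  rw [h]; simp

theorem factST_add_snd (s t : ℝ) : factST φ (s, t + Real.pi) = factST φ (s, t) := by
  have h := fderiv_comp_add_right (𝕜 := ℝ) (f := factS φ) (x := (s, t)) (0, Real.pi)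
  have e : (fun x : ℝ × ℝ => factS φ (x + (0, Real.pi))) = factS φ := by
    funext ⟨x, y⟩; simpa using H.factS_add_snd x y
  rw [e] at h
  unfold factST
  rw [h]; simp

/-- The gradient of the logarithmic factor vanishes on the diagonal. -/
theorem factT_diag (s : ℝ) : factT φ (s, s) = 0 := by
  have h1 : HasDerivAt (fun s => logFactor φ (s, s)) (factS φ (s, s) + factT φ (s, s)) s := by
    have : HasDerivAt (fun s : ℝ => (s, s)) ((1 : ℝ), (1 : ℝ)) s :=
      (hasDerivAt_id s).prodMk (hasDerivAt_id s)
    have h := HasFDerivAt.comp_hasDerivAt (f := fun s : ℝ => (s, s)) s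
      (H.contDiff_logFactor.differentiable two_ne_zero (s, s)).hasFDerivAt this
    refine h.congr_deriv ?_
    unfold factS factT
    rw [← map_add]; simp
  have h2 : factS φ (s, s) + factT φ (s, s) = 0 := by
    have e : (fun s => logFactor φ (s, s)) = fun _ => 0 := funext fun s => logFactor_diag s
    rw [e] at h1
    exact h1.unique (hasDerivAt_const s 0)
  have h3 : factS φ (s, s) = factT φ (s, s) := by
    have a := H.hasDerivAt_logFactor_fst s s
    have e : (fun x => logFactor φ (x, s)) = fun x => logFactor φ (s, x) :=
      funext fun x => logFactor_symm s x
    rw [e] at a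
    exact a.unique (H.hasDerivAt_logFactor_snd s s)
  linarith

theorem logFactor_off {s t : ℝ} (h : Real.sin (t - s) ≠ 0) :
    logFactor φ (s, t) = halfLog φ s + halfLog φ t + Real.log (Real.sin (t - s)) -
      Real.log (Real.sin (φ t - φ s)) := by
  have h2 := sin_phi_ne H.deriv_pos H.turn h
  have d1 := H.deriv_pos s
  have d2 := H.deriv_pos t
  unfold logFactor halfLog
  rw [if_neg h, Real.log_div (by positivity) (by positivity), Real.log_mul (by positivity)
      (by positivity), Real.log_mul d1.ne' d2.ne', Real.log_pow, Real.log_pow]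
  push_cast
  ring

theorem factS_off {s t : ℝ} (h : Real.sin (t - s) ≠ 0) :
    factS φ (s, t) = deriv (halfLog φ) s - Real.cos (t - s) / Real.sin (t - s) +
      deriv φ s * (Real.cos (φ t - φ s) / Real.sin (φ t - φ s)) := by
  have h2 := sin_phi_ne H.deriv_pos H.turn h
  refine (H.hasDerivAt_logFactor_fst s t).unique ?_
  have e : (fun s => logFactor φ (s, t)) =ᶠ[𝓝 s] fun s => halfLog φ s + halfLog φ t +
      Real.log (Real.sin (t - s)) - Real.log (Real.sin (φ t - φ s)) := by
    have : ContinuousAt (fun s => Real.sin (t - s)) s := by fun_prop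
    filter_upwards [this.eventually_ne h] with x hx using H.logFactor_off hx
  refine HasDerivAt.congr_of_eventuallyEq ?_ e
  have a1 : HasDerivAt (fun s => Real.log (Real.sin (t - s)))
      (Real.cos (t - s) * (-1) / Real.sin (t - s)) s :=
    (((hasDerivAt_id s).const_sub t).sin).log h
  have a2 : HasDerivAt (fun s => Real.log (Real.sin (φ t - φ s)))
      (Real.cos (φ t - φ s) * (- deriv φ s) / Real.sin (φ t - φ s)) s :=
    (((H.hasDerivAt_phi s).const_sub (φ t)).sin).log h2
  refine ((((H.hasDerivAt_halfLog s).add_const _).add a1).sub a2).congr_deriv ?_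
  ring

theorem factT_off {s t : ℝ} (h : Real.sin (t - s) ≠ 0) :
    factT φ (s, t) = deriv (halfLog φ) t + Real.cos (t - s) / Real.sin (t - s) -
      deriv φ t * (Real.cos (φ t - φ s) / Real.sin (φ t - φ s)) := by
  have h2 := sin_phi_ne H.deriv_pos H.turn h
  refine (H.hasDerivAt_logFactor_snd s t).unique ?_
  have e : (fun t => logFactor φ (s, t)) =ᶠ[𝓝 t] fun t => halfLog φ s + halfLog φ t +
      Real.log (Real.sin (t - s)) - Real.log (Real.sin (φ t - φ s)) := by
    have : ContinuousAt (fun t => Real.sin (t - s)) t := by fun_prop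
    filter_upwards [this.eventually_ne h] with x hx using H.logFactor_off hx
  refine HasDerivAt.congr_of_eventuallyEq ?_ e
  have a1 : HasDerivAt (fun t => Real.log (Real.sin (t - s)))
      (Real.cos (t - s) * 1 / Real.sin (t - s)) t :=
    (((hasDerivAt_id t).sub_const s).sin).log h
  have a2 : HasDerivAt (fun t => Real.log (Real.sin (φ t - φ s)))
      (Real.cos (φ t - φ s) * (deriv φ t) / Real.sin (φ t - φ s)) t :=
    (((H.hasDerivAt_phi t).sub_const (φ s)).sin).log h2
  refine ((((H.hasDerivAt_halfLog t).const_add _).add a1).sub a2).congr_deriv ?_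
  ring

omit H in
theorem hasDerivAt_cot {x : ℝ} (h : Real.sin x ≠ 0) :
    HasDerivAt (fun x => Real.cos x / Real.sin x) (-(1 / Real.sin x ^ 2)) x := by
  refine ((Real.hasDerivAt_cos x).div (Real.hasDerivAt_sin x) h).congr_deriv ?_
  have := Real.sin_sq_add_cos_sq x
  field_simp
  linarith

theorem factST_off {s t : ℝ} (h : Real.sin (t - s) ≠ 0) :
    factST φ (s, t) = 1 / Real.sin (t - s) ^ 2 -
      deriv φ s * deriv φ t / Real.sin (φ t - φ s) ^ 2 := by
  have h2 := sin_phi_ne H.deriv_pos H.turn h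
  refine (H.hasDerivAt_factS_snd s t).unique ?_
  have e : (fun t => factS φ (s, t)) =ᶠ[𝓝 t] fun t => deriv (halfLog φ) s -
      Real.cos (t - s) / Real.sin (t - s) +
      deriv φ s * (Real.cos (φ t - φ s) / Real.sin (φ t - φ s)) := by
    have : ContinuousAt (fun t => Real.sin (t - s)) t := by fun_prop
    filter_upwards [this.eventually_ne h] with x hx using H.factS_off hx
  refine HasDerivAt.congr_of_eventuallyEq ?_ e
  have a1 : HasDerivAt (fun t => Real.cos (t - s) / Real.sin (t - s))
      (-(1 / Real.sin (t - s) ^ 2) * 1) t :=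
    HasDerivAt.comp (h₂ := fun x => Real.cos x / Real.sin x) (h := fun t => t - s) t
      (hasDerivAt_cot h) ((hasDerivAt_id t).sub_const s)
  have a2 : HasDerivAt (fun t => Real.cos (φ t - φ s) / Real.sin (φ t - φ s))
      (-(1 / Real.sin (φ t - φ s) ^ 2) * deriv φ t) t :=
    HasDerivAt.comp (h₂ := fun x => Real.cos x / Real.sin x) (h := fun t => φ t - φ s) t
      (hasDerivAt_cot h2) ((H.hasDerivAt_phi t).sub_const (φ s))
  refine ((a1.const_sub _).add (a2.const_mul (deriv φ s))).congr_deriv ?_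
  ring

/-- The identity `cot² = 1/sin² - 1`, for `φ t - φ s`, in terms of the logarithmic factor. -/
theorem factor_identity {s t : ℝ} (h : Real.sin (t - s) ≠ 0) :
    - (factS φ (s, t) * factT φ (s, t)) + factS φ (s, t) * deriv (halfLog φ) t +
      deriv (halfLog φ) s * factT φ (s, t) - deriv (halfLog φ) s * deriv (halfLog φ) t +
      factST φ (s, t) + deriv φ s * deriv φ t - 1 =
    - (Real.cos (t - s) / Real.sin (t - s)) *
      (factS φ (s, t) - factT φ (s, t) - deriv (halfLog φ) s + deriv (halfLog φ) t) := by
  have h2 := sin_phi_ne H.deriv_pos H.turn h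
  rw [H.factS_off h, H.factT_off h, H.factST_off h]
  have e1 : 1 / Real.sin (t - s) ^ 2 = 1 + (Real.cos (t - s) / Real.sin (t - s)) ^ 2 := by
    have := Real.sin_sq_add_cos_sq (t - s)
    field_simp; linarith
  have e2 : deriv φ s * deriv φ t / Real.sin (φ t - φ s) ^ 2 = deriv φ s * deriv φ t *
      (1 + (Real.cos (φ t - φ s) / Real.sin (φ t - φ s)) ^ 2) := by
    have := Real.sin_sq_add_cos_sq (φ t - φ s)
    field_simp
    rw [this, mul_one]
  rw [e1, e2]
  ring

end IsCircleLift

/-! ### Metrics in normal form -/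

namespace IsNormalForm

variable {c : ℝ} {h : Metric}

theorem lift (N : IsNormalForm c h φ) : IsCircleLift φ := ⟨N.smooth, N.deriv_pos, N.turn⟩

end IsNormalForm

theorem sin_sub_sq (x y : ℝ) : Real.sin (x - y) ^ 2 = Real.sin (y - x) ^ 2 := by
  rw [← neg_sub, Real.sin_neg, neg_sq]

theorem dens_deSitter (c : ℝ) (hc : 0 < c) {q : ℝ × ℝ} (hq : q ∈ coverSet) :
    toCover (deSitter c hc).dens q = 2 / (c * Real.sin (q.1 - q.2) ^ 2) := by
  rw [toCover_eq _ hq, ← sinSq_of_over (over_proj hq)]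
  simp [Metric.dens, deSitter, Metric.ofCoeff, frame, sinSq]

theorem isNormalForm_deSitter (c : ℝ) (hc : 0 < c) : IsNormalForm c (deSitter c hc) id :=
  ⟨contDiff_id, fun s => by simp, fun s => rfl, fun q hq => by
    rw [dens_deSitter c hc hq]; simp⟩

theorem mem_coverSet_iff' {s t : ℝ} : (s, t) ∈ coverSet ↔ Real.sin (t - s) ≠ 0 := by
  rw [mem_coverSet_iff, ← neg_sub, Real.sin_neg, neg_ne_zero]

theorem IsNormalForm.isCn {c : ℝ} (hc : 0 < c) {h : Metric} (N : IsNormalForm c h φ) :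
    h.IsCn 2 := by
  rw [Metric.isCn_iff]
  refine IsCn.of_eqOn ?_ N.dens
  have d := contDiff_deriv_of_three N.smooth
  have hφ2 : ContDiff ℝ 2 φ := N.smooth.of_le (by norm_num)
  refine ContDiffOn.div ?_ ?_ ?_
  · exact ((contDiff_const.mul (d.comp contDiff_fst)).mul (d.comp contDiff_snd)).contDiffOn
  · exact (contDiff_const.mul ((Real.contDiff_sin.comp
      ((hφ2.comp contDiff_fst).sub (hφ2.comp contDiff_snd))).pow 2)).contDiffOn
  · rintro ⟨s, t⟩ hq
    have := sin_phi_ne N.deriv_pos N.turn (mem_coverSet_iff'.1 hq)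
    have h2 : Real.sin (φ s - φ t) ^ 2 ≠ 0 := by
      rw [sin_sub_sq]; exact pow_ne_zero 2 this
    exact mul_ne_zero hc.ne' h2

theorem curvForm_deSitter (c : ℝ) (hc : 0 < c) {s t : ℝ} (hq : (s, t) ∈ coverSet) :
    toCover (deSitter c hc).curvForm (s, t) = 2 / Real.sin (t - s) ^ 2 := by
  set g := deSitter c hc
  have hg : g.IsCn 2 := (isNormalForm_deSitter c hc).isCn hc
  have lg : IsCn 2 fun x => Real.log (g.dens x) := (g.isCn_iff.1 hg).log g.dens_ne
  have lg1 : IsCn 1 (pd 1 fun x => Real.log (g.dens x)) := lg.pd 1 (by norm_num)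
  have e0 : ∀ q ∈ coverSet, toCover (fun x => Real.log (g.dens x)) q =
      Real.log (2 / c) - 2 * Real.log (Real.sin (q.2 - q.1)) := by
    rintro ⟨x, y⟩ hq
    have h1 := dens_deSitter c hc hq
    rw [toCover_eq _ hq] at h1 ⊢
    have h2 := mem_coverSet_iff'.1 hq
    rw [h1]
    simp only
    rw [sin_sub_sq]
    rw [← div_div, Real.log_div (by positivity) (by positivity), Real.log_pow]
    push_cast; ring
  have ev1 : ∀ {s t : ℝ}, (s, t) ∈ coverSet → ∀ᶠ x in 𝓝 s, (x, t) ∈ coverSet := fun {s t} hq =>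
    (by fun_prop : ContinuousAt (fun x : ℝ => (x, t)) s).eventually
      (isOpen_coverSet.mem_nhds hq)
  have ev2 : ∀ᶠ y in 𝓝 t, (s, y) ∈ coverSet :=
    (by fun_prop : ContinuousAt (fun y : ℝ => (s, y)) t).eventually
      (isOpen_coverSet.mem_nhds hq)
  have e1 : ∀ {s t : ℝ}, (s, t) ∈ coverSet →
      toCover (pd 1 fun x => Real.log (g.dens x)) (s, t) =
        2 * (Real.cos (t - s) / Real.sin (t - s)) := fun {s t} hq => by
    have h2 := mem_coverSet_iff'.1 hq
    refine (hasDerivAt_toCover_fst hq (lg.differentiableAt two_ne_zero hq)).unique ?_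
    have a1 : HasDerivAt (fun s => Real.log (Real.sin (t - s)))
        (Real.cos (t - s) * (-1) / Real.sin (t - s)) s :=
      (((hasDerivAt_id s).const_sub t).sin).log h2
    refine (((a1.const_mul 2).const_sub (Real.log (2 / c))).congr_deriv
      (by ring)).congr_of_eventuallyEq ?_
    filter_upwards [ev1 hq] with x hx using e0 _ hx
  have h2 := mem_coverSet_iff'.1 hq
  have e2 : toCover (pd 0 (pd 1 fun x => Real.log (g.dens x))) (s, t) =
      -(2 / Real.sin (t - s) ^ 2) := by
    refine (hasDerivAt_toCover_snd hq (lg1.differentiableAt one_ne_zero hq)).unique ?_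
    have a1 : HasDerivAt (fun t => Real.cos (t - s) / Real.sin (t - s))
        (-(1 / Real.sin (t - s) ^ 2) * 1) t :=
      HasDerivAt.comp (h₂ := fun x => Real.cos x / Real.sin x) (h := fun t => t - s) t
        (IsCircleLift.hasDerivAt_cot h2) ((hasDerivAt_id t).sub_const s)
    refine ((a1.const_mul 2).congr_deriv (by ring)).congr_of_eventuallyEq ?_
    filter_upwards [ev2] with x hx using e1 hx
  rw [toCover_eq _ hq, g.curvForm_eq hg,
    ← toCover_eq (pd 0 (pd 1 fun x => Real.log (g.dens x))) hq, e2, neg_neg]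

namespace IsNormalForm

variable {c : ℝ} {h : Metric} (hc : 0 < c) (N : IsNormalForm c h φ)
include hc N

theorem toCover_factor {q : ℝ × ℝ} (hq : q ∈ coverSet) :
    toCover ((deSitter c hc).factor h) q = logFactor φ q := by
  obtain ⟨s, t⟩ := q
  have h1 := mem_coverSet_iff'.1 hq
  have h2 := sin_phi_ne N.deriv_pos N.turn h1
  have e1 := dens_deSitter c hc hq
  have e2 := N.dens _ hq
  rw [toCover_eq _ hq] at e1 e2 ⊢
  rw [Metric.factor_eq, ← Real.log_div (h.dens_ne _) (Metric.dens_ne _ _), e1, e2]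
  unfold logFactor
  rw [if_neg h1]
  simp only
  rw [sin_sub_sq s, sin_sub_sq (φ s)]
  congr 2
  field_simp

theorem toCover_pd_one {q : ℝ × ℝ} (hq : q ∈ coverSet) :
    toCover (pd 1 ((deSitter c hc).factor h)) q = factS φ q := by
  rw [toCover_pd _ _ hq]
  unfold factS
  rw [Filter.EventuallyEq.fderiv_eq (f := logFactor φ)]
  · simp [frame]
  · filter_upwards [isOpen_coverSet.mem_nhds hq] with x hx using N.toCover_factor hc hx

theorem toCover_pd_pd {q : ℝ × ℝ} (hq : q ∈ coverSet) :
    toCover (pd 0 (pd 1 ((deSitter c hc).factor h))) q = factST φ q := by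
  rw [toCover_pd _ _ hq]
  unfold factST
  rw [Filter.EventuallyEq.fderiv_eq (f := factS φ)]
  · simp [frame]
  · filter_upwards [isOpen_coverSet.mem_nhds hq] with x hx using N.toCover_pd_one hc hx

theorem curvature_eq (p : Annulus) : h.curvature p = c := by
  have hg := (isNormalForm_deSitter c hc).isCn hc
  have hh := N.isCn hc
  have e := (deSitter c hc).curvForm_factor h hg hh p
  obtain ⟨s, d, -, hd, rfl⟩ := exists_strip p
  have hq := strip_mem (s := s) hd.1 hd.2
  rw [← toCover_eq h.curvForm hq, ← toCover_eq (deSitter c hc).curvForm hq,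
    ← toCover_eq (pd 0 (pd 1 ((deSitter c hc).factor h))) hq, curvForm_deSitter c hc hq,
    N.toCover_pd_pd hc hq, N.lift.factST_off (mem_coverSet_iff'.1 hq)] at e
  have e2 := N.dens _ hq
  have h2 := sin_phi_ne N.deriv_pos N.turn (mem_coverSet_iff'.1 hq)
  rw [toCover_eq _ hq] at e e2
  unfold Metric.curvForm at e
  rw [h.volCoeff_eq] at e
  have h3 := h.dens_ne (proj (s, s + d))
  refine mul_right_cancel₀ h3 ?_
  rw [e, e2]
  simp only
  rw [sin_sub_sq (φ s)]
  field_simp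
  ring

end IsNormalForm

theorem exists_bound_periodic {f : ℝ × ℝ → ℝ} (hf : Continuous f) :
    ∃ C, ∀ s ∈ Ico 0 Real.pi, ∀ d ∈ Ioo 0 Real.pi, |f (s, s + d)| ≤ C := by
  obtain ⟨C, hC⟩ := (isCompact_Icc.prod (isCompact_Icc (a := (0 : ℝ)) (b := Real.pi))
    ).exists_bound_of_continuousOn (s := Icc (0 : ℝ) Real.pi ×ˢ Icc (0 : ℝ) Real.pi)
    (f := fun x : ℝ × ℝ => f (x.1, x.1 + x.2)) (by fun_prop)
  exact ⟨C, fun s hs d hd => hC (s, d) ⟨⟨hs.1, hs.2.le⟩, hd.1.le, hd.2.le⟩⟩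

/-- A continuous bounded function on the annulus is integrable. -/
theorem integrable_of_bounded {f : Annulus → ℝ} (hf : Continuous f) {C : ℝ}
    (hC : ∀ p, |f p| ≤ C) : Integrable f := by
  rw [integrable_annulus_iff hf]
  refine IntegrableOn.of_bound ?_ ?_ C ?_
  · rw [Measure.volume_eq_prod, Measure.prod_prod]
    simp [ENNReal.mul_lt_top_iff]
  · refine ContinuousOn.aestronglyMeasurable ?_ (measurableSet_Ioc.prod measurableSet_Ioo)
    exact (continuousOn_strip hf).mono (prod_mono (subset_univ _) le_rfl)
  · refine (ae_restrict_iff' (measurableSet_Ioc.prod measurableSet_Ioo)).2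
      (Filter.Eventually.of_forall ?_)
    rintro ⟨s, d⟩ ⟨-, hd⟩
    rw [toCover_eq _ (strip_mem hd.1 hd.2)]
    exact hC _

/-- The vertices of a polygonal curve with four vertices. -/
theorem exists_isVertexSeq : IsVertexSeq 2 (fun i : ℤ => (i / 2 : ℤ) * (Real.pi / 2))
    (fun i : ℤ => ((i + 1) / 2 : ℤ) * (Real.pi / 2) + Real.pi / 4) := by
  have hπ := Real.pi_pos
  have hp2 : (0 : ℝ) ≤ Real.pi / 2 := by positivity
  refine ⟨two_pos, ?_, ?_, ?_, ?_, ?_, ?_, ?_⟩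
  · intro i j hij
    have : i / 2 ≤ j / 2 := Int.ediv_le_ediv two_pos hij
    exact mul_le_mul_of_nonneg_right (Int.cast_le.2 this) hp2
  · intro i j hij
    have : (i + 1) / 2 ≤ (j + 1) / 2 := Int.ediv_le_ediv two_pos (by omega)
    exact add_le_add (mul_le_mul_of_nonneg_right (Int.cast_le.2 this) hp2) le_rfl
  · intro i
    have : (i + 2 * (2 : ℕ)) / 2 = i / 2 + 2 := by omega
    simp only [this]; push_cast; ring
  · intro i
    have : (i + 2 * (2 : ℕ) + 1) / 2 = (i + 1) / 2 + 2 := by omega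
    simp only [this]; push_cast; ring
  · intro i
    have : (2 * i) / 2 = (2 * i + 1) / 2 := by omega
    simp only [this]
  · intro i
    have : (2 * i + 1 + 1) / 2 = (2 * i + 2 + 1) / 2 := by omega
    simp only [this]
  · intro i
    rcases Int.even_or_odd' i with ⟨j, rfl | rfl⟩
    · have h1 : (2 * j) / 2 = j := by omega
      have h2 : (2 * j + 1) / 2 = j := by omega
      simp only [h1, h2]
      constructor <;> linarith
    · have h1 : (2 * j + 1) / 2 = j := by omega
      have h2 : (2 * j + 1 + 1) / 2 = j + 1 := by omega
      simp only [h1, h2]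
      push_cast
      constructor <;> linarith

/-- A bound on the derivative of `u` bounds its variation along any polygonal curve, since the
horizontal segments of such a curve have total length at most `π`. -/
theorem VB_ne_top {u : Annulus → ℝ} (hu : IsCn 1 u) {C : ℝ} (hC : ∀ p, |pd 1 u p| ≤ C)
    (P : Set Annulus) : VB u P ≠ ⊤ := by
  have hC0 : 0 ≤ C := (abs_nonneg _).trans (hC basePoint)
  refine ne_top_of_le_ne_top (ENNReal.ofReal_ne_top (r := C * Real.pi)) ?_
  unfold VB
  refine iSup_le fun k => iSup_le fun s => iSup_le fun t => iSup_le fun ⟨hst, _⟩ => ?_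
  rw [← ENNReal.ofReal_sum_of_nonneg (fun _ _ => abs_nonneg _)]
  apply ENNReal.ofReal_le_ofReal
  have step : ∀ i : ℤ, |toCover u (s (2 * i + 1), t (2 * i + 1)) -
      toCover u (s (2 * i + 2), t (2 * i + 2))| ≤ C * (s (2 * i + 2) - s (2 * i)) := by
    intro i
    have ht := hst.horizontal i
    have hs := hst.vertical i
    have hmono : s (2 * i + 1) ≤ s (2 * i + 2) := hst.mono_fst (by omega)
    have h1 := hst.strip (2 * i + 1)
    have h2 := hst.strip (2 * i + 2)
    rw [← ht] at h2
    rw [← ht, hs]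
    have hmem : ∀ x ∈ Icc (s (2 * i + 1)) (s (2 * i + 2)), (x, t (2 * i + 1)) ∈ coverSet := by
      intro x hx
      have := strip_mem (s := x) (d := t (2 * i + 1) - x) (by linarith [hx.2, h2.1])
        (by linarith [hx.1, h1.2])
      simpa using this
    have hb := Convex.norm_image_sub_le_of_norm_hasDerivWithin_le (𝕜 := ℝ)
      (f := fun x => toCover u (x, t (2 * i + 1)))
      (f' := fun x => toCover (pd 1 u) (x, t (2 * i + 1)))
      (s := Icc (s (2 * i + 1)) (s (2 * i + 2))) (C := C)
      (x := s (2 * i + 2)) (y := s (2 * i + 1)) (fun x hx =>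
        (hasDerivAt_toCover_fst (hmem x hx)
          (hu.differentiableAt one_ne_zero (hmem x hx))).hasDerivWithinAt)
      (fun x hx => by rw [toCover_eq _ (hmem x hx)]; exact hC _) (convex_Icc _ _)
      (right_mem_Icc.2 hmono) (left_mem_Icc.2 hmono)
    rw [Real.norm_eq_abs, Real.norm_eq_abs, abs_sub_comm (s (2 * i + 1)),
      abs_of_nonneg (sub_nonneg.2 hmono)] at hb
    exact hb
  calc ∑ i ∈ Finset.range k, |toCover u (s (2 * (i : ℤ) + 1), t (2 * (i : ℤ) + 1)) -
        toCover u (s (2 * (i : ℤ) + 2), t (2 * (i : ℤ) + 2))|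
      ≤ ∑ i ∈ Finset.range k, C * (s (2 * ((i + 1 : ℕ) : ℤ)) - s (2 * ((i : ℕ) : ℤ))) := by
        refine Finset.sum_le_sum fun i _ => (step i).trans_eq ?_
        congr 3
    _ = C * (s (2 * (k : ℤ)) - s (2 * ((0 : ℕ) : ℤ))) := by
        rw [← Finset.mul_sum, Finset.sum_range_sub (fun i : ℕ => s (2 * (i : ℤ)))]
    _ = C * Real.pi := by
        have := hst.turn_fst 0
        rw [zero_add] at this
        rw [this]
        congr 1
        rw [Nat.cast_zero, mul_zero]; ring

theorem abs_le_of_strip {f : Annulus → ℝ} {C : ℝ}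
    (h : ∀ s ∈ Ico 0 Real.pi, ∀ d ∈ Ioo 0 Real.pi, |toCover f (s, s + d)| ≤ C) (p : Annulus) :
    |f p| ≤ C := by
  obtain ⟨s, d, hs, hd, rfl⟩ := exists_strip p
  rw [← toCover_eq f (strip_mem hd.1 hd.2)]
  exact h s hs d hd

namespace IsNormalForm

variable {c : ℝ} {h : Metric} (hc : 0 < c) (N : IsNormalForm c h φ)
include N

theorem isCn_factor : IsCn 2 ((deSitter c hc).factor h) :=
  Metric.isCn_factor _ _ ((isNormalForm_deSitter c hc).isCn hc) (N.isCn hc)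

theorem exists_bound :
    ∃ C0 C1 C2 : ℝ, (∀ p, |(deSitter c hc).factor h p| ≤ C0) ∧
      (∀ p, |pd 1 ((deSitter c hc).factor h) p| ≤ C1) ∧
      ∀ p, |pd 0 (pd 1 ((deSitter c hc).factor h)) p| ≤ C2 := by
  have H := N.lift
  obtain ⟨C0, hC0⟩ := exists_bound_periodic H.contDiff_logFactor.continuous
  obtain ⟨C1, hC1⟩ := exists_bound_periodic H.contDiff_factS.continuous
  obtain ⟨C2, hC2⟩ := exists_bound_periodic H.continuous_factST
  refine ⟨C0, C1, C2, abs_le_of_strip fun s hs d hd => ?_, abs_le_of_strip fun s hs d hd => ?_,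
    abs_le_of_strip fun s hs d hd => ?_⟩
  · rw [N.toCover_factor hc (strip_mem hd.1 hd.2)]; exact hC0 s hs d hd
  · rw [N.toCover_pd_one hc (strip_mem hd.1 hd.2)]; exact hC1 s hs d hd
  · rw [N.toCover_pd_pd hc (strip_mem hd.1 hd.2)]; exact hC2 s hs d hd

theorem tendsto_factor :
    Tendsto ((deSitter c hc).factor h) (cocompact Annulus) (𝓝 0) := by
  have H := N.lift
  have cL := H.contDiff_logFactor.continuous
  rw [Metric.tendsto_nhds]
  intro η hη
  -- by compactness of the circle, the factor is uniformly small near the two ends of the strip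
  have key : ∀ e : ℝ, (∀ s, logFactor φ (s, s + e) = 0) → ∃ δ > 0, ∀ s ∈ Icc 0 Real.pi, ∀ d,
      |d - e| < δ → |logFactor φ (s, s + d)| < η := by
    clear N
    generalize logFactor φ = L at cL ⊢
    intro e he
    have hopen : IsOpen {x : ℝ × ℝ | |L (x.1, x.1 + x.2)| < η} :=
      isOpen_lt (by fun_prop) continuous_const
    obtain ⟨U, V, -, hV, hU', hV', hUV⟩ := generalized_tube_lemma
      (isCompact_Icc (a := (0 : ℝ)) (b := Real.pi)) (isCompact_singleton (x := e)) hopen (by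
        rintro ⟨s, x⟩ ⟨-, hx⟩
        obtain rfl : x = e := hx
        change |L (s, s + x)| < η
        rw [he, abs_zero]; exact hη)
    obtain ⟨δ, hδ, hball⟩ := Metric.isOpen_iff.1 hV e (hV' (mem_singleton e))
    refine ⟨δ, hδ, fun s hs d hd => ?_⟩
    have hd' : d ∈ V := hball (by rw [Metric.mem_ball, Real.dist_eq]; exact hd)
    exact hUV (mk_mem_prod (hU' hs) hd')
  obtain ⟨δ1, hδ1, h1⟩ := key 0 (fun s => by rw [add_zero]; exact logFactor_diag s)
  obtain ⟨δ2, hδ2, h2⟩ := key Real.pi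
    (fun s => by rw [H.logFactor_add_snd]; exact logFactor_diag s)
  refine cocompact_le_of_strip (ε := min δ1 δ2) (lt_min hδ1 hδ2) fun s hs d hd0 hd1 hd => ?_
  rw [← toCover_eq ((deSitter c hc).factor h) (strip_mem hd0 hd1),
    N.toCover_factor hc (strip_mem hd0 hd1), Real.dist_eq, sub_zero]
  rcases hd with hd | hd
  · refine h1 s ⟨hs.1, hs.2.le⟩ d ?_
    rw [sub_zero, abs_of_pos hd0]; exact hd.trans_le (min_le_left _ _)
  · refine h2 s ⟨hs.1, hs.2.le⟩ d ?_
    rw [abs_of_neg (by linarith)]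
    have := min_le_right δ1 δ2
    linarith

omit N in
theorem two_le_dens (p : Annulus) : 2 ≤ c * (deSitter c hc).dens p := by
  have e := dens_deSitter c hc (rep_mem p)
  rw [toCover_rep] at e
  have h0 := sin_sq_pos p
  have h1 := Real.sin_sq_le_one ((rep p).1 - (rep p).2)
  rw [e]
  have : c * (2 / (c * Real.sin ((rep p).1 - (rep p).2) ^ 2)) =
      2 / Real.sin ((rep p).1 - (rep p).2) ^ 2 := by field_simp
  rw [this, le_div_iff₀ h0]
  linarith

/-- Metrics in normal form are in the `𝓢`-class of the de Sitter metric. -/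
theorem inSClass : InSClass (deSitter c hc) h := by
  have NG := isNormalForm_deSitter c hc
  have hg := NG.isCn hc
  have hu := N.isCn_factor hc
  obtain ⟨C0, C1, C2, b0, b1, b2⟩ := N.exists_bound hc
  have c2 := continuous_pd_pd hu 0 1
  have hdens : Continuous (deSitter c hc).dens := ((deSitter c hc).isCn_iff.1 hg).continuous
  have hbox : (deSitter c hc).dAlembert ((deSitter c hc).factor h) =
      fun p => 2 * pd 0 (pd 1 ((deSitter c hc).factor h)) p / (deSitter c hc).dens p :=
    funext fun p => (deSitter c hc).dAlembert_eq hu p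
  have cbox : Continuous ((deSitter c hc).dAlembert ((deSitter c hc).factor h)) := by
    rw [hbox]; exact (continuous_const.mul c2).div hdens fun p => Metric.dens_ne _ p
  refine ⟨⟨hg, ?_⟩, N.isCn hc, ?_, N.tendsto_factor hc, ?_, ?_, ?_⟩
  · have : (deSitter c hc).curvature = fun _ => c := funext fun p => NG.curvature_eq hc p
    rw [this]; exact memLp_top_const c
  · exact memLp_top_of_bound hu.continuous.aestronglyMeasurable C0
      (Filter.Eventually.of_forall b0)
  · refine memLp_top_of_bound cbox.aestronglyMeasurable (C2 * c)
      (Filter.Eventually.of_forall fun p => ?_)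
    rw [hbox]
    rw [Real.norm_eq_abs, abs_div, abs_of_pos (Metric.dens_pos _ p),
      div_le_iff₀ (Metric.dens_pos _ p), abs_mul, abs_two]
    have h3 := two_le_dens hc p
    have h4 := b2 p
    have h5 : 0 ≤ C2 := (abs_nonneg _).trans h4
    nlinarith
  · rw [Metric.area_eq, integrable_withDensity_iff_integrable_smul₀'
      (by exact (hdens.measurable.ennreal_ofReal).aemeasurable) (by simp)]
    refine ((integrable_of_bounded c2 b2).const_mul 2).congr
      (Filter.Eventually.of_forall fun p => ?_)
    have := Metric.dens_ne (deSitter c hc) p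
    simp only [smul_eq_mul, ENNReal.toReal_ofReal (Metric.dens_pos _ p).le, hbox]
    field_simp
  · exact ⟨_, ⟨2, _, _, exists_isVertexSeq, rfl⟩, VB_ne_top (hu.of_le (by norm_num)) b1 _⟩

end IsNormalForm

end Circle

/-! ### The action of metrics of constant curvature -/

theorem integral_swap_continuous {F : ℝ → ℝ → ℝ} (hF : Continuous (Function.uncurry F))
    (a b c d : ℝ) : ∫ x in a..b, ∫ y in c..d, F x y = ∫ y in c..d, ∫ x in a..b, F x y := by
  apply intervalIntegral_intervalIntegral_swap
  exact (hF.continuousOn.integrableOn_compact (isCompact_uIcc.prod isCompact_uIcc)).mono_set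
    (prod_mono uIoc_subset_uIcc uIoc_subset_uIcc)

theorem continuous_inner_integral {F : ℝ → ℝ → ℝ} (hF : Continuous (Function.uncurry F))
    (c d : ℝ) : Continuous fun x => ∫ y in c..d, F x y :=
  intervalIntegral.continuous_parametric_intervalIntegral_of_continuous' hF c d

/-- Integration over the torus in the coordinates `(s, t - s)` and in the coordinates `(s, t)`. -/
theorem integral_torus {K : ℝ × ℝ → ℝ} (hK : Continuous K)
    (hp : ∀ s t, K (s, t + Real.pi) = K (s, t)) :
    ∫ x in (0 : ℝ)..Real.pi, ∫ s in (0 : ℝ)..Real.pi, K (s, s + x) =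
      ∫ s in (0 : ℝ)..Real.pi, ∫ t in (0 : ℝ)..Real.pi, K (s, t) := by
  rw [integral_swap_continuous (F := fun x s => K (s, s + x)) (by unfold Function.uncurry; fun_prop)]
  congr 1
  funext s
  have h1 := intervalIntegral.integral_comp_add_left (a := 0) (b := Real.pi)
    (fun t => K (s, t)) s
  rw [h1, add_zero]
  have h2 := Function.Periodic.intervalIntegral_add_eq (f := fun t => K (s, t)) (T := Real.pi)
    (fun t => hp s t) s 0
  rw [h2, zero_add]

/-- `cot a · V(a) → 0` when `V` vanishes to second order at `0`. -/
theorem tendsto_cot_mul {V : ℝ → ℝ} (h0 : V 0 = 0) (h : HasDerivAt V 0 0) :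
    Tendsto (fun a => Real.cos a / Real.sin a * V a) (𝓝[≠] 0) (𝓝 0) := by
  have h1 := hasDerivAt_iff_tendsto_slope.1 h
  have h2 := hasDerivAt_iff_tendsto_slope.1 (Real.hasDerivAt_sin 0)
  rw [Real.cos_zero] at h2
  have h3 : Tendsto Real.cos (𝓝[≠] 0) (𝓝 1) := by
    have := Real.continuous_cos.tendsto 0
    rw [Real.cos_zero] at this
    exact this.mono_left nhdsWithin_le_nhds
  have h4 := (h3.div h2 one_ne_zero).mul h1
  rw [mul_zero] at h4
  refine h4.congr' ?_
  filter_upwards [self_mem_nhdsWithin] with a ha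
  have ha' : a ≠ 0 := ha
  simp only [slope_def_field, Real.sin_zero, h0, sub_zero, Pi.div_apply]
  by_cases hs : Real.sin a = 0
  · simp [hs]
  · field_simp

section Circle

variable {φ : ℝ → ℝ}

/-- The logarithmic factor averaged over the curve `t = s + d`. -/
def meanFactor (φ : ℝ → ℝ) (d : ℝ) : ℝ :=
  ∫ s in (0 : ℝ)..Real.pi, logFactor φ (s, s + d)

/-- The derivative of `meanFactor`. -/
def meanFactT (φ : ℝ → ℝ) (d : ℝ) : ℝ :=
  ∫ s in (0 : ℝ)..Real.pi, factT φ (s, s + d)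

/-- The left-hand side of the identity `factor_identity`. -/
def cotForm (φ : ℝ → ℝ) (q : ℝ × ℝ) : ℝ :=
  - (factS φ q * factT φ q) + factS φ q * deriv (halfLog φ) q.2 +
      deriv (halfLog φ) q.1 * factT φ q - deriv (halfLog φ) q.1 * deriv (halfLog φ) q.2 +
      factST φ q + deriv φ q.1 * deriv φ q.2 - 1

namespace IsCircleLift

variable (H : IsCircleLift φ)
include H

theorem continuous_meanFactT : Continuous (meanFactT φ) := by
  have := H.continuous_factT
  exact continuous_inner_integral (F := fun d s => factT φ (s, s + d))
    (by unfold Function.uncurry; fun_prop) _ _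

theorem meanFactor_eq (d : ℝ) : meanFactor φ d = ∫ x in (0 : ℝ)..d, meanFactT φ x := by
  have cT := H.continuous_factT
  unfold meanFactor meanFactT
  rw [integral_swap_continuous (F := fun x s => factT φ (s, s + x))
    (by unfold Function.uncurry; fun_prop)]
  congr 1
  funext s
  have h := intervalIntegral.integral_eq_sub_of_hasDerivAt (a := 0) (b := d)
    (f := fun x => logFactor φ (s, s + x)) (f' := fun x => factT φ (s, s + x)) (fun x _ => by
      have := (H.hasDerivAt_logFactor_snd s (s + x)).comp_const_add s x
      exact this)
    ((by fun_prop : Continuous fun x => factT φ (s, s + x)).intervalIntegrable _ _)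
  rw [h, add_zero, logFactor_diag, sub_zero]

theorem hasDerivAt_meanFactor (d : ℝ) : HasDerivAt (meanFactor φ) (meanFactT φ d) d := by
  have e : meanFactor φ = fun d => ∫ x in (0 : ℝ)..d, meanFactT φ x := funext H.meanFactor_eq
  rw [e]
  have c := H.continuous_meanFactT
  exact intervalIntegral.integral_hasDerivAt_right (c.intervalIntegrable _ _)
    (c.stronglyMeasurableAtFilter _ _) c.continuousAt

theorem meanFactT_zero : meanFactT φ 0 = 0 := by
  simp [meanFactT, H.factT_diag]

theorem meanFactT_pi : meanFactT φ Real.pi = 0 := by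
  simp [meanFactT, H.factT_add_snd, H.factT_diag]

omit H in
theorem meanFactor_zero : meanFactor φ 0 = 0 := by
  simp [meanFactor, logFactor_diag]

theorem meanFactor_pi : meanFactor φ Real.pi = 0 := by
  simp [meanFactor, H.logFactor_add_snd, logFactor_diag]

theorem integral_factS (d : ℝ) :
    ∫ s in (0 : ℝ)..Real.pi, factS φ (s, s + d) = - meanFactT φ d := by
  have cT := H.continuous_factT
  have cS := H.contDiff_factS.continuous
  have h := intervalIntegral.integral_eq_sub_of_hasDerivAt (a := 0) (b := Real.pi)
    (f := fun s => logFactor φ (s, s + d))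
    (f' := fun s => factS φ (s, s + d) + factT φ (s, s + d)) (fun s _ => by
      have : HasDerivAt (fun s : ℝ => (s, s + d)) ((1 : ℝ), (1 : ℝ)) s :=
        (hasDerivAt_id s).prodMk ((hasDerivAt_id s).add_const d)
      have h := HasFDerivAt.comp_hasDerivAt (f := fun s : ℝ => (s, s + d)) s
        (H.contDiff_logFactor.differentiable two_ne_zero (s, s + d)).hasFDerivAt this
      refine h.congr_deriv ?_
      unfold factS factT
      rw [← map_add]; simp)
    ((by fun_prop : Continuous fun s => factS φ (s, s + d) +
      factT φ (s, s + d)).intervalIntegrable _ _)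
  rw [intervalIntegral.integral_add
    ((by fun_prop : Continuous fun s => factS φ (s, s + d)).intervalIntegrable _ _)
    ((by fun_prop : Continuous fun s => factT φ (s, s + d)).intervalIntegrable _ _)] at h
  have e : logFactor φ (Real.pi, Real.pi + d) = logFactor φ (0, 0 + d) := by
    rw [zero_add, ← H.logFactor_add_snd 0 d, ← H.logFactor_add_fst 0 (d + Real.pi), zero_add,
      add_comm d]
  rw [e, sub_self] at h
  unfold meanFactT
  linarith

theorem integral_deriv_halfLog (d : ℝ) :
    ∫ s in (0 : ℝ)..Real.pi, deriv (halfLog φ) (s + d) = 0 := by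
  have h := intervalIntegral.integral_eq_sub_of_hasDerivAt (a := 0) (b := Real.pi)
    (f := fun s => halfLog φ (s + d)) (f' := fun s => deriv (halfLog φ) (s + d)) (fun s _ =>
      (H.hasDerivAt_halfLog (s + d)).comp_add_const s d)
    ((H.continuous_deriv_halfLog.comp (continuous_add_const d)).intervalIntegrable _ _)
  rw [h, add_comm, H.halfLog_add, zero_add, sub_self]

theorem integral_cotForm_strip {d : ℝ} (hd : Real.sin d ≠ 0) :
    ∫ s in (0 : ℝ)..Real.pi, cotForm φ (s, s + d) =
      2 * (Real.cos d / Real.sin d * meanFactT φ d) := by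
  have cT := H.continuous_factT
  have cS := H.contDiff_factS.continuous
  have cp := H.continuous_deriv_halfLog
  have e : ∀ s, cotForm φ (s, s + d) = - (Real.cos d / Real.sin d) *
      (factS φ (s, s + d) - factT φ (s, s + d) - deriv (halfLog φ) (s + 0) +
        deriv (halfLog φ) (s + d)) := fun s => by
    have h := H.factor_identity (s := s) (t := s + d) (by simpa using hd)
    rw [add_sub_cancel_left] at h
    rw [add_zero]
    exact h
  simp only [e]
  rw [intervalIntegral.integral_const_mul, intervalIntegral.integral_add,
    intervalIntegral.integral_sub, intervalIntegral.integral_sub, H.integral_factS,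
    H.integral_deriv_halfLog, H.integral_deriv_halfLog]
  · change _ * (_ - meanFactT φ d - 0 + 0) = _
    ring
  all_goals exact Continuous.intervalIntegrable (by fun_prop) _ _

theorem integral_factST (s : ℝ) : ∫ t in (0 : ℝ)..Real.pi, factST φ (s, t) = 0 := by
  have c := H.continuous_factST
  rw [intervalIntegral.integral_eq_sub_of_hasDerivAt (fun t _ => H.hasDerivAt_factS_snd s t)
    (Continuous.intervalIntegrable (by fun_prop) _ _)]
  have := H.factS_add_snd s 0
  rw [zero_add] at this
  rw [this, sub_self]

theorem integral_factT (s : ℝ) : ∫ t in (0 : ℝ)..Real.pi, factT φ (s, t) = 0 := by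
  have c := H.continuous_factT
  rw [intervalIntegral.integral_eq_sub_of_hasDerivAt (fun t _ => H.hasDerivAt_logFactor_snd s t)
    (Continuous.intervalIntegrable (by fun_prop) _ _)]
  have := H.logFactor_add_snd s 0
  rw [zero_add] at this
  rw [this, sub_self]

theorem integral_factS_fst (t : ℝ) : ∫ s in (0 : ℝ)..Real.pi, factS φ (s, t) = 0 := by
  have c := H.contDiff_factS.continuous
  rw [intervalIntegral.integral_eq_sub_of_hasDerivAt (fun s _ => H.hasDerivAt_logFactor_fst s t)
    (Continuous.intervalIntegrable (by fun_prop) _ _)]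
  have := H.logFactor_add_fst 0 t
  rw [zero_add] at this
  rw [this, sub_self]

theorem integral_factS_mul_factT (s : ℝ) :
    ∫ t in (0 : ℝ)..Real.pi, factS φ (s, t) * factT φ (s, t) =
      - ∫ t in (0 : ℝ)..Real.pi, logFactor φ (s, t) * factST φ (s, t) := by
  have c1 := H.continuous_factT
  have c2 := H.continuous_factST
  have c3 := H.contDiff_factS.continuous
  have c4 := H.contDiff_logFactor.continuous
  have h := intervalIntegral.integral_eq_sub_of_hasDerivAt (a := 0) (b := Real.pi)
    (fun t _ => (H.hasDerivAt_factS_snd s t).mul (H.hasDerivAt_logFactor_snd s t))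
    (Continuous.intervalIntegrable (by fun_prop) _ _)
  have e1 := H.factS_add_snd s 0
  have e2 := H.logFactor_add_snd s 0
  rw [zero_add] at e1 e2
  rw [intervalIntegral.integral_add (Continuous.intervalIntegrable (by fun_prop) _ _)
    (Continuous.intervalIntegrable (by fun_prop) _ _)] at h
  simp only [Pi.mul_apply, e1, e2, sub_self] at h
  rw [eq_neg_iff_add_eq_zero, add_comm, ← h]
  congr 2
  funext t; ring

theorem integral_deriv_phi : ∫ t in (0 : ℝ)..Real.pi, deriv φ t = Real.pi := by
  have c : Continuous (deriv φ) := (contDiff_deriv_of_three H.smooth).continuous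
  rw [intervalIntegral.integral_eq_sub_of_hasDerivAt (fun t _ => H.hasDerivAt_phi t)
    (c.intervalIntegrable _ _)]
  have := H.turn 0
  rw [zero_add] at this
  rw [this]; ring

theorem continuous_cotForm : Continuous (cotForm φ) := by
  have c1 := H.continuous_factT
  have c2 := H.continuous_factST
  have c3 := H.contDiff_factS.continuous
  have c4 := H.continuous_deriv_halfLog
  have c5 : Continuous (deriv φ) := (contDiff_deriv_of_three H.smooth).continuous
  unfold cotForm
  fun_prop

theorem deriv_halfLog_add (s : ℝ) : deriv (halfLog φ) (s + Real.pi) = deriv (halfLog φ) s := by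
  have : (fun x => halfLog φ (x + Real.pi)) = halfLog φ := funext H.halfLog_add
  rw [← deriv_comp_add_const, this]

theorem deriv_phi_add (s : ℝ) : deriv φ (s + Real.pi) = deriv φ s := by
  simpa using deriv_add_int H.turn s 1

theorem cotForm_add_snd (s t : ℝ) : cotForm φ (s, t + Real.pi) = cotForm φ (s, t) := by
  simp only [cotForm, H.factS_add_snd, H.factT_add_snd, H.factST_add_snd, H.deriv_halfLog_add,
    H.deriv_phi_add]

/-- All the terms of `cotForm` but the first one have integral `0` over the torus. -/
theorem integral_cotForm_torus :
    ∫ s in (0 : ℝ)..Real.pi, ∫ t in (0 : ℝ)..Real.pi, cotForm φ (s, t) =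
      ∫ s in (0 : ℝ)..Real.pi, ∫ t in (0 : ℝ)..Real.pi, logFactor φ (s, t) * factST φ (s, t) := by
  have c1 := H.continuous_factT
  have c2 := H.continuous_factST
  have c3 := H.contDiff_factS.continuous
  have c4 := H.continuous_deriv_halfLog
  have c5 : Continuous (deriv φ) := (contDiff_deriv_of_three H.smooth).continuous
  have c6 := H.contDiff_logFactor.continuous
  have p0 := H.integral_deriv_halfLog 0
  simp only [add_zero] at p0
  have e : ∀ s, ∫ t in (0 : ℝ)..Real.pi, cotForm φ (s, t) =
      (∫ t in (0 : ℝ)..Real.pi, logFactor φ (s, t) * factST φ (s, t)) +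
      (∫ t in (0 : ℝ)..Real.pi, factS φ (s, t) * deriv (halfLog φ) t) +
      (deriv φ s * Real.pi - Real.pi) := by
    intro s
    unfold cotForm
    rw [intervalIntegral.integral_sub, intervalIntegral.integral_add,
      intervalIntegral.integral_add, intervalIntegral.integral_sub,
      intervalIntegral.integral_add, intervalIntegral.integral_add,
      intervalIntegral.integral_neg, H.integral_factS_mul_factT]
    · simp only [intervalIntegral.integral_const_mul, H.integral_factT, H.integral_factST,
        H.integral_deriv_phi, p0, intervalIntegral.integral_const]
      simp only [smul_eq_mul]
      ring
    all_goals exact Continuous.intervalIntegrable (by fun_prop) _ _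
  simp only [e]
  have i1 : Continuous fun s => ∫ t in (0 : ℝ)..Real.pi, logFactor φ (s, t) * factST φ (s, t) :=
    continuous_inner_integral (F := fun s t => logFactor φ (s, t) * factST φ (s, t))
      (by unfold Function.uncurry; fun_prop) _ _
  have i2 : Continuous fun s => ∫ t in (0 : ℝ)..Real.pi, factS φ (s, t) * deriv (halfLog φ) t :=
    continuous_inner_integral (F := fun s t => factS φ (s, t) * deriv (halfLog φ) t)
      (by unfold Function.uncurry; fun_prop) _ _
  rw [intervalIntegral.integral_add, intervalIntegral.integral_add, intervalIntegral.integral_sub,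
    intervalIntegral.integral_mul_const, H.integral_deriv_phi,
    integral_swap_continuous (F := fun s t => factS φ (s, t) * deriv (halfLog φ) t)
      (by unfold Function.uncurry; fun_prop)]
  · simp only [intervalIntegral.integral_mul_const, H.integral_factS_fst,
      intervalIntegral.integral_const]
    simp
  all_goals exact Continuous.intervalIntegrable (by fun_prop) _ _

end IsCircleLift

/-- The action of a metric in normal form with respect to the de Sitter metric vanishes. -/
theorem IsNormalForm.action_deSitter {c : ℝ} (hc : 0 < c) {h : Metric} (N : IsNormalForm c h φ) :
    Integrable (fun p => (deSitter c hc).factor h p * (deSitter c hc).curvForm p) ∧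
      action (deSitter c hc) h = 0 := by
  have H := N.lift
  have A := (N.inSClass hc).asymptotic
  have i1 := A.integrable_of_curvature hc ((isNormalForm_deSitter c hc).curvature_eq hc)
    (N.curvature_eq hc)
  have i2 := A.integrable_mul A.integrable
  refine ⟨i1, ?_⟩
  rw [A.action_eq]
  suffices hz : ∫ p, ((deSitter c hc).factor h p * pd 0 (pd 1 ((deSitter c hc).factor h)) p -
      (deSitter c hc).factor h p * (deSitter c hc).curvForm p) = 0 by
    rw [integral_sub i2 i1] at hz
    linarith
  have cont : Continuous fun p => (deSitter c hc).factor h p *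
      pd 0 (pd 1 ((deSitter c hc).factor h)) p -
      (deSitter c hc).factor h p * (deSitter c hc).curvForm p :=
    (A.regular.continuous.mul (continuous_pd_pd A.regular 0 1)).sub
      (A.regular.continuous.mul (Metric.continuous_curvForm _ A.left))
  have T := tendsto_integral_strip cont (i2.sub i1)
  refine tendsto_nhds_unique T ?_
  have cL := H.contDiff_logFactor.continuous
  have cST := H.continuous_factST
  have cB := H.continuous_cotForm
  set D : ℝ → ℝ := fun x => ∫ s in (0 : ℝ)..Real.pi,
    (logFactor φ (s, s + x) * factST φ (s, s + x) - cotForm φ (s, s + x)) with hD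
  have cD : Continuous D := continuous_inner_integral
    (F := fun x s => logFactor φ (s, s + x) * factST φ (s, s + x) - cotForm φ (s, s + x))
    (by unfold Function.uncurry; fun_prop) _ _
  have D0 : ∫ x in (0 : ℝ)..Real.pi, D x = 0 := by
    rw [hD]
    have e := integral_torus (K := fun q => logFactor φ q * factST φ q - cotForm φ q)
      (by fun_prop) (fun s t => by
        simp only [H.logFactor_add_snd, H.factST_add_snd, H.cotForm_add_snd])
    rw [e]
    have e2 : ∀ s, ∫ t in (0 : ℝ)..Real.pi,
        (logFactor φ (s, t) * factST φ (s, t) - cotForm φ (s, t)) =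
        (∫ t in (0 : ℝ)..Real.pi, logFactor φ (s, t) * factST φ (s, t)) -
          ∫ t in (0 : ℝ)..Real.pi, cotForm φ (s, t) := fun s =>
      intervalIntegral.integral_sub (Continuous.intervalIntegrable (by fun_prop) _ _)
        (Continuous.intervalIntegrable (by fun_prop) _ _)
    simp only [e2]
    rw [intervalIntegral.integral_sub, H.integral_cotForm_torus, sub_self]
    · exact (continuous_inner_integral (F := fun s t => logFactor φ (s, t) * factST φ (s, t))
        (by unfold Function.uncurry; fun_prop) _ _).intervalIntegrable _ _
    · exact (continuous_inner_integral (F := fun s t => cotForm φ (s, t))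
        (by unfold Function.uncurry; fun_prop) _ _).intervalIntegrable _ _
  set Z : ℝ → ℝ := fun d => Real.cos d / Real.sin d * meanFactor φ d with hZ
  -- the truncated integrals
  have key : ∀ n : ℕ, (∫ s in (0 : ℝ)..Real.pi, ∫ x in (Real.pi / (n + 3))..
      (Real.pi - Real.pi / (n + 3)), toCover (fun p => (deSitter c hc).factor h p *
      pd 0 (pd 1 ((deSitter c hc).factor h)) p -
      (deSitter c hc).factor h p * (deSitter c hc).curvForm p) (s, s + x)) =
      (∫ x in (Real.pi / (n + 3))..(Real.pi - Real.pi / (n + 3)), D x) +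
        2 * (Z (Real.pi - Real.pi / (n + 3)) - Z (Real.pi / (n + 3))) := by
    intro n
    have hpi := Real.pi_pos
    have hn : (0 : ℝ) < n + 3 := by positivity
    have ha0 : 0 < Real.pi / (n + 3) := by positivity
    have hle : Real.pi / (n + 3) ≤ Real.pi / 2 :=
      div_le_div_of_nonneg_left hpi.le (by norm_num) (by
        have : (0 : ℝ) ≤ n := n.cast_nonneg
        linarith)
    generalize Real.pi / ((n : ℝ) + 3) = a at ha0 hle ⊢
    have hab : a ≤ Real.pi - a := by linarith
    rw [integral_swap_rect hpi.le hab (continuousOn_strip_rect cont ha0 (by linarith))]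
    have hsin : ∀ x ∈ uIcc a (Real.pi - a), 0 < Real.sin x := fun x hx => by
      rw [uIcc_of_le hab] at hx
      exact Real.sin_pos_of_pos_of_lt_pi (ha0.trans_le hx.1) (by linarith [hx.2])
    have dZ : ∀ x ∈ uIcc a (Real.pi - a), HasDerivAt Z (-(1 / Real.sin x ^ 2) * meanFactor φ x +
        Real.cos x / Real.sin x * meanFactT φ x) x := fun x hx =>
      (IsCircleLift.hasDerivAt_cot (hsin x hx).ne').mul (H.hasDerivAt_meanFactor x)
    have cM : Continuous (meanFactor φ) :=
      continuous_iff_continuousAt.2 fun x => (H.hasDerivAt_meanFactor x).continuousAt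
    have cM' := H.continuous_meanFactT
    have iZ : IntervalIntegrable (fun x => -(1 / Real.sin x ^ 2) * meanFactor φ x +
        Real.cos x / Real.sin x * meanFactT φ x) volume a (Real.pi - a) := by
      apply ContinuousOn.intervalIntegrable
      refine ((ContinuousOn.neg ?_).mul cM.continuousOn).add (ContinuousOn.mul ?_ cM'.continuousOn)
      · exact continuousOn_const.div (by fun_prop) fun x hx => pow_ne_zero 2 (hsin x hx).ne'
      · exact Real.continuousOn_cos.div Real.continuousOn_sin fun x hx => (hsin x hx).ne'
    rw [← intervalIntegral.integral_eq_sub_of_hasDerivAt dZ iZ,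
      ← intervalIntegral.integral_const_mul,
      ← intervalIntegral.integral_add (cD.intervalIntegrable _ _) (iZ.const_mul 2)]
    refine intervalIntegral.integral_congr fun x hx => ?_
    have hx' : x ∈ Ioo 0 Real.pi := by
      rw [uIcc_of_le hab] at hx
      exact ⟨ha0.trans_le hx.1, by linarith [hx.2]⟩
    have hxs := (hsin x hx).ne'
    have e1 : ∀ s, toCover (fun p => (deSitter c hc).factor h p *
        pd 0 (pd 1 ((deSitter c hc).factor h)) p -
        (deSitter c hc).factor h p * (deSitter c hc).curvForm p) (s, s + x) =
        (logFactor φ (s, s + x) * factST φ (s, s + x) - cotForm φ (s, s + x)) +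
          cotForm φ (s, s + x) - 2 / Real.sin x ^ 2 * logFactor φ (s, s + x) := fun s => by
      have hm := strip_mem (s := s) hx'.1 hx'.2
      have f1 := N.toCover_factor hc hm
      have f2 := N.toCover_pd_pd hc hm
      have f3 := curvForm_deSitter c hc hm
      rw [toCover_eq _ hm] at f1 f2 f3 ⊢
      rw [f1, f2, f3, add_sub_cancel_left]
      ring
    simp only [e1]
    rw [intervalIntegral.integral_sub, intervalIntegral.integral_add,
      intervalIntegral.integral_const_mul, H.integral_cotForm_strip hxs]
    · change D x + _ - _ * meanFactor φ x = _
      field_simp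
      ring
    all_goals exact Continuous.intervalIntegrable (by fun_prop) _ _
  simp only [key]
  have ta : Tendsto (fun n : ℕ => Real.pi / ((n : ℝ) + 3)) atTop (𝓝 0) :=
    tendsto_const_nhds.div_atTop
      (tendsto_atTop_add_const_right _ _ tendsto_natCast_atTop_atTop)
  have ta' : Tendsto (fun n : ℕ => Real.pi / ((n : ℝ) + 3)) atTop (𝓝[≠] 0) :=
    tendsto_nhdsWithin_iff.2 ⟨ta, Filter.Eventually.of_forall fun n =>
      (div_pos Real.pi_pos (by positivity)).ne'⟩
  have tb : Tendsto (fun n : ℕ => Real.pi - Real.pi / ((n : ℝ) + 3)) atTop (𝓝 Real.pi) := by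
    simpa using ta.const_sub Real.pi
  have l1 : Tendsto (fun n : ℕ => ∫ x in (Real.pi / ((n : ℝ) + 3))..
      (Real.pi - Real.pi / ((n : ℝ) + 3)), D x) atTop (𝓝 0) := by
    have e : ∀ a b : ℝ, ∫ x in a..b, D x = (∫ x in (0 : ℝ)..b, D x) - ∫ x in (0 : ℝ)..a, D x :=
      fun a b => (intervalIntegral.integral_interval_sub_left (cD.intervalIntegrable _ _)
        (cD.intervalIntegrable _ _)).symm
    have cP : Continuous fun b => ∫ x in (0 : ℝ)..b, D x :=
      intervalIntegral.continuous_primitive (fun a b => cD.intervalIntegrable a b) 0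
    have := ((cP.tendsto Real.pi).comp tb).sub ((cP.tendsto 0).comp ta)
    rw [D0, intervalIntegral.integral_same, sub_zero] at this
    refine this.congr fun n => ?_
    rw [e]; rfl
  have l2 : Tendsto (fun n : ℕ => Z (Real.pi / ((n : ℝ) + 3))) atTop (𝓝 0) := by
    have h0 := H.hasDerivAt_meanFactor 0
    rw [H.meanFactT_zero] at h0
    exact (tendsto_cot_mul IsCircleLift.meanFactor_zero h0).comp ta'
  have l3 : Tendsto (fun n : ℕ => Z (Real.pi - Real.pi / ((n : ℝ) + 3))) atTop (𝓝 0) := by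
    have h0 : HasDerivAt (fun a => meanFactor φ (Real.pi - a)) 0 0 := by
      have := H.hasDerivAt_meanFactor (Real.pi - 0)
      have h2 := this.comp_const_sub Real.pi 0
      rwa [sub_zero, H.meanFactT_pi, neg_zero] at h2
    have := ((tendsto_cot_mul (V := fun a => meanFactor φ (Real.pi - a))
      (by rw [sub_zero]; exact H.meanFactor_pi) h0).comp ta').neg
    rw [neg_zero] at this
    refine this.congr fun n => ?_
    simp only [Function.comp, hZ, Real.cos_pi_sub, Real.sin_pi_sub]
    ring
  simpa using l1.add ((l3.sub l2).const_mul 2)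

end Circle

/-! ### Metrics of constant curvature: the Liouville equation -/

/-- Differentiation under the integral sign, with continuity on an open set only. -/
theorem hasDerivAt_integral_of_continuousOn {F F' : ℝ × ℝ → ℝ} {Ω : Set (ℝ × ℝ)} (hΩ : IsOpen Ω)
    (hF : ContinuousOn F Ω) (hF' : ContinuousOn F' Ω)
    (hd : ∀ s t, (s, t) ∈ Ω → HasDerivAt (fun s => F (s, t)) (F' (s, t)) s)
    {s₀ a b : ℝ} (hsub : ∀ t ∈ uIcc a b, (s₀, t) ∈ Ω) :
    HasDerivAt (fun s => ∫ t in a..b, F (s, t)) (∫ t in a..b, F' (s₀, t)) s₀ := by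
  obtain ⟨U, V, hU, hV, hU', hV', hUV⟩ := generalized_tube_lemma
    (isCompact_singleton (x := s₀)) (isCompact_uIcc (a := a) (b := b)) hΩ (by
      rintro ⟨s, x⟩ ⟨hs, hx⟩
      obtain rfl : s = s₀ := hs
      exact hsub x hx)
  obtain ⟨δ, hδ, hball⟩ := Metric.isOpen_iff.1 hU s₀ (hU' (mem_singleton s₀))
  have hmem : ∀ s ∈ Metric.closedBall s₀ (δ / 2), ∀ t ∈ uIcc a b, (s, t) ∈ Ω := fun s hs t ht =>
    hUV (mk_mem_prod (hball (Metric.closedBall_subset_ball (by linarith) hs)) (hV' ht))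
  obtain ⟨C, hC⟩ := ((isCompact_closedBall s₀ (δ / 2)).prod
    (isCompact_uIcc (a := a) (b := b))).exists_bound_of_continuousOn
      (hF'.mono fun z hz => hmem z.1 hz.1 z.2 hz.2)
  have slice : ∀ {G : ℝ × ℝ → ℝ}, ContinuousOn G Ω → ∀ s ∈ Metric.closedBall s₀ (δ / 2),
      ContinuousOn (fun t => G (s, t)) (uIcc a b) := fun hG s hs =>
    hG.comp (by fun_prop) fun t ht => hmem s hs t ht
  have h0 : s₀ ∈ Metric.closedBall s₀ (δ / 2) := Metric.mem_closedBall_self (by positivity)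
  refine (intervalIntegral.hasDerivAt_integral_of_dominated_loc_of_deriv_le
    (F := fun s t => F (s, t)) (F' := fun s t => F' (s, t)) (bound := fun _ => C)
    (Metric.closedBall_mem_nhds s₀ (half_pos hδ)) ?_ ?_ ?_ ?_ ?_ ?_).2
  · filter_upwards [Metric.closedBall_mem_nhds s₀ (half_pos hδ)] with s hs
    exact ((slice hF s hs).mono uIoc_subset_uIcc).aestronglyMeasurable measurableSet_uIoc
  · exact (slice hF s₀ h0).intervalIntegrable
  · exact ((slice hF' s₀ h0).mono uIoc_subset_uIcc).aestronglyMeasurable measurableSet_uIoc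
  · exact Filter.Eventually.of_forall fun t ht s hs => hC (s, t) ⟨hs, uIoc_subset_uIcc ht⟩
  · exact intervalIntegrable_const
  · exact Filter.Eventually.of_forall fun t ht s hs => hd s t (hmem s hs t (uIoc_subset_uIcc ht))

/-- `log f` for a metric `f dθ₁ dθ₂`. -/
def Metric.logDens (h : Metric) (p : Annulus) : ℝ := Real.log (h.dens p)

namespace Metric

variable {h : Metric} {c : ℝ}

theorem isCn_logDens (hh : h.IsCn 2) : SplitLiouville.IsCn 2 h.logDens :=
  (h.isCn_iff.1 hh).log h.dens_ne

/-- The Liouville equation. -/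
theorem pd_pd_logDens (hh : h.IsCn 2) (hK : ∀ p, h.curvature p = c) (p : Annulus) :
    pd 0 (pd 1 h.logDens) p = -(c * h.dens p) := by
  have h1 := h.curvForm_eq hh p
  rw [Asymptotic.curvForm_of_curvature hK] at h1
  change _ = - pd 0 (pd 1 h.logDens) p at h1
  linarith

theorem pd_one_dens (hh : h.IsCn 2) (p : Annulus) :
    pd 1 h.dens p = h.dens p * pd 1 h.logDens p := by
  have := pd_log 1 ((h.isCn_iff.1 hh).diff two_ne_zero p) (h.dens_ne p)
  change pd 1 h.logDens p = _ at this
  rw [this]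
  field_simp [h.dens_ne p]

/-- By the Liouville equation, `∂²B/∂s² - ½ (∂B/∂s)²` with `B = log f` depends only on `s`. -/
theorem schwarzian_const (hh : h.IsCn 2) (hK : ∀ p, h.curvature p = c) {s t₁ t₂ : ℝ}
    (h1 : t₁ ∈ Ioo s (s + Real.pi)) (h2 : t₂ ∈ Ioo s (s + Real.pi)) :
    toCover (pd 1 (pd 1 h.logDens)) (s, t₁) - (1 / 2) * toCover (pd 1 h.logDens) (s, t₁) ^ 2 =
      toCover (pd 1 (pd 1 h.logDens)) (s, t₂) - (1 / 2) * toCover (pd 1 h.logDens) (s, t₂) ^ 2 := by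
  have hB := isCn_logDens hh
  have hG : SplitLiouville.IsCn 1 (pd 1 h.logDens) := hB.pd 1 (by norm_num)
  have hf := (h.isCn_iff.1 hh)
  have hΩ : IsOpen {q : ℝ × ℝ | q.2 ∈ Ioo q.1 (q.1 + Real.pi)} :=
    (isOpen_lt continuous_fst continuous_snd).inter
      (isOpen_lt continuous_snd (continuous_fst.add continuous_const))
  have sub : ∀ {s t : ℝ}, t ∈ Ioo s (s + Real.pi) → (s, t) ∈ coverSet := fun {s t} ht => by
    have := strip_mem (s := s) (d := t - s) (by linarith [ht.1]) (by linarith [ht.2])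
    simpa using this
  have conv : ∀ {s : ℝ}, t₁ ∈ Ioo s (s + Real.pi) → t₂ ∈ Ioo s (s + Real.pi) →
      uIcc t₁ t₂ ⊆ Ioo s (s + Real.pi) := fun h1 h2 => ordConnected_Ioo.uIcc_subset h1 h2
  have cd : ContinuousOn (toCover h.dens) {q : ℝ × ℝ | q.2 ∈ Ioo q.1 (q.1 + Real.pi)} :=
    (continuousOn_toCover hf.continuous).mono fun q hq => sub hq
  have cd1 : ContinuousOn (toCover (pd 1 h.dens)) {q : ℝ × ℝ | q.2 ∈ Ioo q.1 (q.1 + Real.pi)} :=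
    (continuousOn_toCover (hf.pd (m := 1) 1 (by norm_num)).continuous).mono fun q hq => sub hq
  -- the increment of `∂B/∂s` between `t₁` and `t₂`
  have e1 : ∀ᶠ x in 𝓝 s, toCover (pd 1 h.logDens) (x, t₂) - toCover (pd 1 h.logDens) (x, t₁) =
      -(c * ∫ t in t₁..t₂, toCover h.dens (x, t)) := by
    have ev : ∀ {t}, t ∈ Ioo s (s + Real.pi) → ∀ᶠ x in 𝓝 s, t ∈ Ioo x (x + Real.pi) := fun ht =>
      (by fun_prop : ContinuousAt (fun x : ℝ => (x, _)) s).eventually (hΩ.mem_nhds ht)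
    filter_upwards [ev h1, ev h2] with x hx1 hx2
    have hsub := conv hx1 hx2
    rw [← intervalIntegral.integral_const_mul, ← intervalIntegral.integral_neg]
    symm
    refine intervalIntegral.integral_eq_sub_of_hasDerivAt
      (f := fun t => toCover (pd 1 h.logDens) (x, t)) (fun t ht => ?_) ?_
    · have hm := sub (hsub ht)
      refine (hasDerivAt_toCover_snd hm (hG.differentiableAt one_ne_zero hm)).congr_deriv ?_
      rw [toCover_eq _ hm, toCover_eq _ hm, pd_pd_logDens hh hK]
    · exact ((cd.comp (f := fun t => (x, t)) (by fun_prop) fun t ht =>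
        hsub ht).const_smul c).neg.intervalIntegrable
  have d1 : ∀ {t}, t ∈ Ioo s (s + Real.pi) → HasDerivAt
      (fun x => toCover (pd 1 h.logDens) (x, t)) (toCover (pd 1 (pd 1 h.logDens)) (s, t)) s :=
    fun ht => hasDerivAt_toCover_fst (sub ht) (hG.differentiableAt one_ne_zero (sub ht))
  have d2 := ((hasDerivAt_integral_of_continuousOn hΩ cd cd1 (fun x t hx =>
    hasDerivAt_toCover_fst (sub hx) (hf.differentiableAt two_ne_zero (sub hx)))
    (conv h1 h2)).const_mul c).neg
  have e2 := ((d1 h2).sub (d1 h1)).unique (d2.congr_of_eventuallyEq e1)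
  have e3 : -(c * ∫ t in t₁..t₂, toCover (pd 1 h.dens) (s, t)) =
      (1 / 2) * toCover (pd 1 h.logDens) (s, t₂) ^ 2 -
        (1 / 2) * toCover (pd 1 h.logDens) (s, t₁) ^ 2 := by
    rw [← intervalIntegral.integral_const_mul, ← intervalIntegral.integral_neg]
    refine intervalIntegral.integral_eq_sub_of_hasDerivAt
      (f := fun t => (1 / 2) * toCover (pd 1 h.logDens) (s, t) ^ 2) (fun t ht => ?_) ?_
    · have hm := sub (conv h1 h2 ht)
      refine (((hasDerivAt_toCover_snd hm (hG.differentiableAt one_ne_zero hm)).pow 2).const_mul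
        (1 / 2)).congr_deriv ?_
      rw [toCover_eq _ hm, toCover_eq _ hm, toCover_eq _ hm, pd_pd_logDens hh hK,
        pd_one_dens hh]
      push_cast; ring
    · exact ((cd1.comp (f := fun t => (s, t)) (by fun_prop) fun t ht =>
        conv h1 h2 ht).const_smul c).neg.intervalIntegrable
  linarith

/-- A primitive of `s ↦ f (s, t₀)`, given by the Liouville equation. -/
def primitive (h : Metric) (c t₀ s : ℝ) : ℝ := -(toCover (pd 0 h.logDens) (s, t₀) / c)

theorem hasDerivAt_primitive (hc : 0 < c) (hh : h.IsCn 2) (hK : ∀ p, h.curvature p = c)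
    {s t₀ : ℝ} (hm : (s, t₀) ∈ coverSet) :
    HasDerivAt (h.primitive c t₀) (toCover h.dens (s, t₀)) s := by
  have hB := isCn_logDens hh
  have hG : SplitLiouville.IsCn 1 (pd 0 h.logDens) := hB.pd 0 (by norm_num)
  refine (((hasDerivAt_toCover_fst hm (hG.differentiableAt one_ne_zero hm)).div_const
    c).neg).congr_deriv ?_
  rw [toCover_eq _ hm, toCover_eq _ hm, pd_comm hB, pd_pd_logDens hh hK]
  field_simp

theorem toCover_dens_pos {q : ℝ × ℝ} (hq : q ∈ coverSet) : 0 < toCover h.dens q := by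
  rw [toCover_eq _ hq]; exact h.dens_pos _

/-- The two leaves `t = t₀` and `t = t₁` carry solutions of the same Hill equation, hence have
constant Wronskian. -/
theorem wronskian_const (hh : h.IsCn 2) (hK : ∀ p, h.curvature p = c) {t₀ t₁ : ℝ} {J : Set ℝ}
    (hJ : IsOpen J) (hJ' : IsPreconnected J)
    (hmem : ∀ s ∈ J, ∃ m n : ℤ, t₀ + m * Real.pi ∈ Ioo s (s + Real.pi) ∧
      t₁ + n * Real.pi ∈ Ioo s (s + Real.pi)) :
    ∃ w, ∀ s ∈ J, HasDerivAt
      (fun s => Real.exp ((1 / 2) * (toCover h.logDens (s, t₀) - toCover h.logDens (s, t₁))))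
      (w * toCover h.dens (s, t₀)) s := by
  have hB := isCn_logDens hh
  have hG : SplitLiouville.IsCn 1 (pd 1 h.logDens) := hB.pd 1 (by norm_num)
  have per : ∀ (f : Annulus → ℝ) (s t : ℝ) (n : ℤ),
      toCover f (s, t + n * Real.pi) = toCover f (s, t) := fun f s t n => by
    have := toCover_add_int f s t 0 n
    simpa using this
  have mem : ∀ s t : ℝ, ∀ n : ℤ, t + n * Real.pi ∈ Ioo s (s + Real.pi) → (s, t) ∈ coverSet := by
    intro s t n ht
    have := strip_mem (s := s) (d := t + n * Real.pi - s) (by linarith [ht.1]) (by linarith [ht.2])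
    rw [add_sub_cancel] at this
    intro e
    exact this (by rw [coe_add_int_mul_pi]; exact e)
  set W : ℝ → ℝ := fun s => (1 / 2) * Real.exp (-(1 / 2) *
    (toCover h.logDens (s, t₀) + toCover h.logDens (s, t₁))) *
    (toCover (pd 1 h.logDens) (s, t₀) - toCover (pd 1 h.logDens) (s, t₁)) with hW
  have dB : ∀ s t, (s, t) ∈ coverSet → HasDerivAt (fun s => toCover h.logDens (s, t))
      (toCover (pd 1 h.logDens) (s, t)) s := fun s t hm =>
    hasDerivAt_toCover_fst hm (hB.differentiableAt two_ne_zero hm)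
  have dG : ∀ s t, (s, t) ∈ coverSet → HasDerivAt (fun s => toCover (pd 1 h.logDens) (s, t))
      (toCover (pd 1 (pd 1 h.logDens)) (s, t)) s := fun s t hm =>
    hasDerivAt_toCover_fst hm (hG.differentiableAt one_ne_zero hm)
  have dW : ∀ s ∈ J, HasDerivAt W 0 s := by
    intro s hs
    obtain ⟨m, n, h0, h1⟩ := hmem s hs
    have m0 := mem s t₀ m h0
    have m1 := mem s t₁ n h1
    have q := schwarzian_const hh hK h0 h1
    rw [per, per, per, per] at q
    refine (((((dB s t₀ m0).add (dB s t₁ m1)).const_mul (-(1 / 2))).exp.const_mul (1 / 2)).mul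
      ((dG s t₀ m0).sub (dG s t₁ m1))).congr_deriv ?_
    simp only [Pi.add_apply, Pi.sub_apply]
    have e : toCover (pd 1 (pd 1 h.logDens)) (s, t₀) - toCover (pd 1 (pd 1 h.logDens)) (s, t₁) =
      (1 / 2) * (toCover (pd 1 h.logDens) (s, t₀) ^ 2 -
        toCover (pd 1 h.logDens) (s, t₁) ^ 2) := by linarith
    rw [e]
    ring
  rcases J.eq_empty_or_nonempty with rfl | ⟨s₁, hs₁⟩
  · exact ⟨0, by simp⟩
  refine ⟨W s₁, fun s hs => ?_⟩
  have hw : W s = W s₁ := hJ.is_const_of_deriv_eq_zero hJ'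
    (fun s hs => (dW s hs).differentiableAt.differentiableWithinAt)
    (fun s hs => (dW s hs).deriv) hs hs₁
  obtain ⟨m, n, h0, h1⟩ := hmem s hs
  have m0 := mem s t₀ m h0
  have m1 := mem s t₁ n h1
  refine (((dB s t₀ m0).sub (dB s t₁ m1)).const_mul (1 / 2)).exp.congr_deriv ?_
  have e : toCover h.dens (s, t₀) = Real.exp (toCover h.logDens (s, t₀)) := by
    rw [toCover_eq _ m0, toCover_eq _ m0]
    exact (Real.exp_log (h.dens_pos _)).symm
  rw [← hw, e, hW]
  simp only [Pi.sub_apply]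
  have e2 : Real.exp ((1 / 2) * (toCover h.logDens (s, t₀) - toCover h.logDens (s, t₁))) =
      Real.exp (-(1 / 2) * (toCover h.logDens (s, t₀) + toCover h.logDens (s, t₁))) *
        Real.exp (toCover h.logDens (s, t₀)) := by
    rw [← Real.exp_add]; congr 1; ring
  rw [e2]; ring

end Metric

theorem tendsto_proj_diag (t : ℝ) :
    Tendsto (fun s => proj (s, t)) (𝓝[≠] t) (cocompact Annulus) := by
  rw [(hasBasis_cocompact).tendsto_right_iff]
  intro K hK
  obtain ⟨m, hm0, hm⟩ : ∃ m > 0, ∀ p ∈ K, m ≤ sinSq p := by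
    rcases K.eq_empty_or_nonempty with rfl | hne
    · exact ⟨1, one_pos, by simp⟩
    · obtain ⟨p, -, hp⟩ := hK.exists_isMinOn hne continuous_sinSq.continuousOn
      exact ⟨sinSq p, sinSq_pos p, fun q hq => hp hq⟩
  have c : Tendsto (fun s => Real.sin (s - t) ^ 2) (𝓝 t) (𝓝 0) := by
    have : Continuous fun s => Real.sin (s - t) ^ 2 := by fun_prop
    simpa using this.tendsto t
  have hpi : ∀ᶠ s in 𝓝 t, |s - t| < Real.pi := by
    have : Continuous fun s => |s - t| := by fun_prop
    exact this.continuousAt.eventually_lt continuousAt_const (by simpa using Real.pi_pos)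
  filter_upwards [self_mem_nhdsWithin, nhdsWithin_le_nhds (c.eventually_lt_const hm0),
    nhdsWithin_le_nhds hpi] with s hs h1 h2 hK'
  have hs' : s - t ≠ 0 := sub_ne_zero.2 hs
  have h3 := abs_lt.1 h2
  have hq : (s, t) ∈ coverSet := by
    rw [mem_coverSet_iff]
    exact fun h0 => hs' ((Real.sin_eq_zero_iff_of_lt_of_lt (by exact h3.1) (by exact h3.2)).1 h0)
  have := hm _ hK'
  rw [sinSq_of_over (over_proj hq)] at this
  linarith

namespace Metric

variable {h : Metric} {c : ℝ}

theorem tendsto_dens_mul_sin_sq (hc : 0 < c)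
    (hu : Tendsto ((deSitter c hc).factor h) (cocompact Annulus) (𝓝 0)) (t : ℝ) :
    Tendsto (fun s => toCover h.dens (s, t) * Real.sin (s - t) ^ 2) (𝓝[≠] t) (𝓝 (2 / c)) := by
  have h1 := (Real.continuous_exp.tendsto _).comp ((hu.comp (tendsto_proj_diag t)).const_mul 2)
  have h2 := h1.const_mul (2 / c)
  rw [mul_zero, Real.exp_zero, mul_one] at h2
  refine h2.congr' ?_
  have hpi : ∀ᶠ s in 𝓝 t, |s - t| < Real.pi := by
    have : Continuous fun s => |s - t| := by fun_prop
    exact this.continuousAt.eventually_lt continuousAt_const (by simpa using Real.pi_pos)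
  filter_upwards [self_mem_nhdsWithin, nhdsWithin_le_nhds hpi] with s hs h2
  have hs' : s - t ≠ 0 := sub_ne_zero.2 hs
  have h3 := abs_lt.1 h2
  have h0 : Real.sin (s - t) ≠ 0 := fun h0 =>
    hs' ((Real.sin_eq_zero_iff_of_lt_of_lt h3.1 h3.2).1 h0)
  have hq : (s, t) ∈ coverSet := mem_coverSet_iff.2 h0
  have e := dens_deSitter c hc hq
  rw [toCover_eq _ hq] at e ⊢
  simp only [Function.comp]
  rw [dens_eq_exp_factor (deSitter c hc) h, e]
  field_simp

/-- A metric of curvature `c`, asymptotic to the de Sitter metric, in terms of a primitive of the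
function `f (·, t₀)`. -/
theorem dens_mul_sub_sq (hc : 0 < c) (hh : h.IsCn 2) (hK : ∀ p, h.curvature p = c)
    (hu : Tendsto ((deSitter c hc).factor h) (cocompact Annulus) (𝓝 0)) {t₀ s t : ℝ}
    (hs : s ∈ Ioo t₀ (t₀ + Real.pi)) (ht : t ∈ Ioo t₀ (t₀ + Real.pi)) (hst : s ≠ t) :
    toCover h.dens (s, t) * (c * (h.primitive c t₀ s - h.primitive c t₀ t) ^ 2) =
      2 * toCover h.dens (s, t₀) * toCover h.dens (t, t₀) := by
  have mem0 : ∀ x ∈ Ioo t₀ (t₀ + Real.pi), (x, t₀) ∈ coverSet := fun x hx => by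
    have := strip_mem (s := t₀) (d := x - t₀) (by linarith [hx.1]) (by linarith [hx.2])
    rw [add_sub_cancel] at this
    exact swap_mem this
  -- an interval with one end at `t` and containing `s`
  obtain ⟨J, hJo, hJc, hsJ, hJI, hJt, hJn, hJm⟩ : ∃ J : Set ℝ, IsOpen J ∧ IsPreconnected J ∧ s ∈ J ∧
      J ⊆ Ioo t₀ (t₀ + Real.pi) ∧ t ∉ J ∧ (𝓝[J] t).NeBot ∧
      ∀ x ∈ J, ∃ m n : ℤ, t₀ + m * Real.pi ∈ Ioo x (x + Real.pi) ∧
        t + n * Real.pi ∈ Ioo x (x + Real.pi) := by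
    rcases lt_or_gt_of_ne hst with h | h
    · refine ⟨Ioo t₀ t, isOpen_Ioo, isPreconnected_Ioo, ⟨hs.1, h⟩,
        Ioo_subset_Ioo_right ht.2.le, by simp, right_nhdsWithin_Ioo_neBot ht.1, fun x hx => ⟨1, 0, ?_, ?_⟩⟩
      · push_cast; constructor <;> linarith [hx.1, hx.2, ht.2]
      · push_cast; constructor <;> linarith [hx.1, hx.2, ht.2]
    · refine ⟨Ioo t (t₀ + Real.pi), isOpen_Ioo, isPreconnected_Ioo, ⟨h, hs.2⟩,
        Ioo_subset_Ioo_left ht.1.le, by simp, left_nhdsWithin_Ioo_neBot ht.2, fun x hx => ⟨1, 1, ?_, ?_⟩⟩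
      · push_cast; constructor <;> linarith [hx.1, hx.2, ht.1]
      · push_cast; constructor <;> linarith [hx.1, hx.2, ht.1]
  have memt : ∀ x ∈ J, (x, t) ∈ coverSet := fun x hx => by
    have hxI := hJI hx
    rw [mem_coverSet_iff]
    intro h0
    refine hJt ?_
    have := (Real.sin_eq_zero_iff_of_lt_of_lt (x := x - t) (by linarith [hxI.1, ht.2])
      (by linarith [hxI.2, ht.1])).1 h0
    rwa [← sub_eq_zero.1 this]
  obtain ⟨w, hw⟩ := wronskian_const hh hK hJo hJc hJm
  set r : ℝ → ℝ := fun s =>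
    Real.exp ((1 / 2) * (toCover h.logDens (s, t₀) - toCover h.logDens (s, t))) with hr
  set X := h.primitive c t₀ with hX
  have dX : ∀ x ∈ Ioo t₀ (t₀ + Real.pi), HasDerivAt X (toCover h.dens (x, t₀)) x := fun x hx =>
    hasDerivAt_primitive hc hh hK (mem0 x hx)
  have r2 : ∀ x ∈ J, r x ^ 2 * toCover h.dens (x, t) = toCover h.dens (x, t₀) := fun x hx => by
    have m0 := mem0 x (hJI hx)
    have m1 := memt x hx
    simp only [hr]
    rw [toCover_eq _ m0, toCover_eq _ m0, toCover_eq _ m1, toCover_eq _ m1]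
    simp only [logDens]
    rw [← Real.exp_nat_mul]
    push_cast
    rw [← mul_assoc, mul_one_div_cancel two_ne_zero, one_mul, Real.exp_sub,
      Real.exp_log (h.dens_pos _), Real.exp_log (h.dens_pos _)]
    field_simp [h.dens_ne]
  have hk : ∀ x ∈ J, r x - w * X x = r s - w * X s := fun x hx =>
    hJo.is_const_of_deriv_eq_zero hJc (f := fun x => r x - w * X x)
      (fun x hx => ((hw x hx).sub ((dX x (hJI hx)).const_mul w)
        ).differentiableAt.differentiableWithinAt)
      (fun x hx => by
        have := ((hw x hx).sub ((dX x (hJI hx)).const_mul w)).deriv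
        rw [sub_self] at this
        exact this) hx hsJ
  have hle : 𝓝[J] t ≤ 𝓝[≠] t := nhdsWithin_mono _ fun x hx e => hJt (by rwa [← show x = t from e])
  have T := (tendsto_dens_mul_sin_sq hc hu t).mono_left hle
  have cX : ContinuousAt X t := (dX t ht).continuousAt
  have TX : Tendsto X (𝓝[J] t) (𝓝 (X t)) := cX.tendsto.mono_left nhdsWithin_le_nhds
  have Tf : Tendsto (fun x => toCover h.dens (x, t₀)) (𝓝[J] t) (𝓝 (toCover h.dens (t, t₀))) := by
    have := (h.isCn_iff.1 hh).differentiableAt two_ne_zero (mem0 t ht)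
    have c1 : ContinuousAt (fun x => toCover h.dens (x, t₀)) t :=
      ContinuousAt.comp (g := toCover h.dens) (f := fun x : ℝ => (x, t₀)) this.continuousAt (by fun_prop)
    exact c1.tendsto.mono_left nhdsWithin_le_nhds
  have Ts : Tendsto (fun x => Real.sin (x - t) ^ 2) (𝓝[J] t) (𝓝 0) := by
    have : Continuous fun s => Real.sin (s - t) ^ 2 := by fun_prop
    have := this.tendsto t
    simp only [sub_self, Real.sin_zero, ne_eq, OfNat.ofNat_ne_zero, not_false_eq_true,
      zero_pow] at this
    exact this.mono_left nhdsWithin_le_nhds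
  -- the constant is determined by letting `x` tend to `t`
  have Tr : Tendsto (fun x => r x ^ 2) (𝓝[J] t) (𝓝 0) := by
    have := (Tf.mul Ts).div T (by positivity)
    rw [mul_zero, zero_div] at this
    refine this.congr' ?_
    filter_upwards [self_mem_nhdsWithin] with x hx
    simp only [Pi.div_apply]
    have h1 := toCover_dens_pos (h := h) (memt x hx)
    have h2 : Real.sin (x - t) ≠ 0 := (mem_coverSet_iff (q := (x, t))).1 (memt x hx)
    rw [← r2 x hx]
    field_simp
  have hrX : ∀ x ∈ J, r x = w * (X x - X t) := by
    have l1 : Tendsto (fun x => r x ^ 2) (𝓝[J] t) (𝓝 ((r s - w * X s + w * X t) ^ 2)) := by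
      refine (((TX.const_mul w).const_add (r s - w * X s)).pow 2).congr' ?_
      filter_upwards [self_mem_nhdsWithin] with x hx
      rw [← hk x hx]; ring
    have l2 : (r s - w * X s + w * X t) ^ 2 = 0 := tendsto_nhds_unique l1 Tr
    have := pow_eq_zero_iff (two_ne_zero) |>.1 l2
    intro x hx
    have := hk x hx
    linarith
  have hfr : ∀ x ∈ J, toCover h.dens (x, t) * (w * (X x - X t)) ^ 2 = toCover h.dens (x, t₀) :=
    fun x hx => by rw [← r2 x hx, hrX x hx]; ring
  have hw2 : w ^ 2 * (2 * toCover h.dens (t, t₀)) = c := by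
    have s1 : Tendsto (slope X t) (𝓝[J] t) (𝓝 (toCover h.dens (t, t₀))) :=
      (hasDerivAt_iff_tendsto_slope.1 (dX t ht)).mono_left hle
    have s2 : Tendsto (slope (fun x => Real.sin (x - t)) t) (𝓝[J] t) (𝓝 1) := by
      have := (((hasDerivAt_id t).sub_const t).sin)
      simp only [id, sub_self, Real.cos_zero, mul_one] at this
      exact (hasDerivAt_iff_tendsto_slope.1 this).mono_left hle
    have l1 := T.mul (((s1.const_mul w).pow 2))
    have l2 := Tf.mul (s2.pow 2)
    have := tendsto_nhds_unique (l1.congr' (f₂ := fun x => toCover h.dens (x, t₀) *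
      slope (fun x => Real.sin (x - t)) t x ^ 2) (by
        filter_upwards [self_mem_nhdsWithin] with x hx
        have hne : x - t ≠ 0 := sub_ne_zero.2 fun e => hJt (by rwa [← e])
        rw [← hfr x hx]
        simp only [slope_def_field, sub_self, Real.sin_zero, sub_zero]
        field_simp)) l2
    have hp := toCover_dens_pos (h := h) (mem0 t ht)
    field_simp at this
    linarith
  have e := hfr s hsJ
  rw [← hw2, ← e]
  ring

end Metric

/-! ### Metrics of constant curvature: the normal form -/

namespace Metric

variable {h : Metric} {c : ℝ}

/-- The function `1 / f (·, t₀)`, extended by `0` at the pole of `f (·, t₀)`: this value is given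
by the conventions `toCover f = 0` off `coverSet` and `0⁻¹ = 0`. -/
def invDens (h : Metric) (t₀ s : ℝ) : ℝ := (toCover h.dens (s, t₀))⁻¹

theorem invDens_pos {s t₀ : ℝ} (hm : (s, t₀) ∈ coverSet) : 0 < h.invDens t₀ s :=
  inv_pos.2 (toCover_dens_pos hm)

theorem invDens_of_notMem {s t₀ : ℝ} (hm : (s, t₀) ∉ coverSet) : h.invDens t₀ s = 0 := by
  have e : toCover h.dens (s, t₀) = 0 := dif_neg hm
  rw [invDens, e, inv_zero]

theorem invDens_nonneg (s t₀ : ℝ) : 0 ≤ h.invDens t₀ s := by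
  by_cases hm : (s, t₀) ∈ coverSet
  · exact (invDens_pos hm).le
  · rw [invDens_of_notMem hm]

theorem invDens_add (s t₀ : ℝ) (n : ℤ) : h.invDens t₀ (s + n * Real.pi) = h.invDens t₀ s := by
  unfold invDens
  have := toCover_add_int h.dens s t₀ n 0
  simp only [Int.cast_zero, zero_mul, add_zero] at this
  rw [this]

theorem strip_mem_fst {t₀ s : ℝ} (hs : s ∈ Ioo t₀ (t₀ + Real.pi)) : (s, t₀) ∈ coverSet := by
  have := strip_mem (s := t₀) (d := s - t₀) (by linarith [hs.1]) (by linarith [hs.2])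
  rw [add_sub_cancel] at this
  exact swap_mem this

theorem contDiffAt_dens (hh : h.IsCn 2) {s t₀ : ℝ} (hm : (s, t₀) ∈ coverSet) :
    ContDiffAt ℝ 2 (fun x => toCover h.dens (x, t₀)) s :=
  ContDiffAt.comp (g := toCover h.dens) (f := fun x : ℝ => (x, t₀)) s
    ((h.isCn_iff.1 hh).contDiffAt hm) (contDiff_id.prodMk contDiff_const).contDiffAt

theorem contDiffAt_primitive (hc : 0 < c) (hh : h.IsCn 2) (hK : ∀ p, h.curvature p = c) {s t₀ : ℝ}
    (hm : (s, t₀) ∈ coverSet) : ContDiffAt ℝ 2 (h.primitive c t₀) s := by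
  have hopen : IsOpen {x : ℝ | (x, t₀) ∈ coverSet} :=
    isOpen_coverSet.preimage (by fun_prop : Continuous fun x : ℝ => (x, t₀))
  have h2 : ContDiffOn ℝ (1 + 1) (h.primitive c t₀) {x : ℝ | (x, t₀) ∈ coverSet} := by
    rw [contDiffOn_succ_iff_deriv_of_isOpen hopen]
    refine ⟨fun x hx => (hasDerivAt_primitive hc hh hK hx
      ).differentiableAt.differentiableWithinAt, by simp, ?_⟩
    refine ContDiffOn.congr (f := fun x => toCover h.dens (x, t₀)) (fun x hx =>
      ((contDiffAt_dens hh hx).of_le (by norm_num)).contDiffWithinAt) fun x hx => ?_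
    exact (hasDerivAt_primitive hc hh hK hx).deriv
  have := h2.contDiffAt (hopen.mem_nhds hm)
  rwa [one_add_one_eq_two] at this

theorem contDiff_invDens (hc : 0 < c) (hh : h.IsCn 2) (hK : ∀ p, h.curvature p = c)
    (hu : Tendsto ((deSitter c hc).factor h) (cocompact Annulus) (𝓝 0)) (t₀ : ℝ) :
    ContDiff ℝ 2 (h.invDens t₀) := by
  rw [contDiff_iff_contDiffAt]
  intro s
  by_cases hm : (s, t₀) ∈ coverSet
  · exact (contDiffAt_dens hh hm).inv (toCover_dens_pos hm).ne'
  · -- near its zero, the function is read in the primitive of a leaf far from `t₀`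
    have hπ := Real.pi_pos
    set b := s - Real.pi / 2 with hb
    have hsb : s ∈ Ioo b (b + Real.pi) := by constructor <;> linarith
    have e : h.invDens t₀ =ᶠ[𝓝 s] fun x => c * (h.primitive c b x - h.primitive c b s) ^ 2 /
        (2 * toCover h.dens (x, b) * toCover h.dens (s, b)) := by
      filter_upwards [Ioo_mem_nhds hsb.1 hsb.2] with x hx
      have h1 : h.invDens t₀ x = h.invDens s x := by
        unfold invDens toCover
        have : (s : RP1) = (t₀ : RP1) := not_not.1 hm
        simp only [this]
      rw [h1]
      rcases eq_or_ne x s with rfl | hne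
      · rw [invDens_of_notMem (fun h => h rfl)]; simp
      · have key := dens_mul_sub_sq hc hh hK hu hx hsb hne
        have mx : (x, s) ∈ coverSet := by
          rw [mem_coverSet_iff]
          intro h0
          have := (Real.sin_eq_zero_iff_of_lt_of_lt (x := x - s) (by linarith [hx.1, hsb.2])
            (by linarith [hx.2, hsb.1])).1 h0
          exact hne (sub_eq_zero.1 this)
        have p1 := toCover_dens_pos (h := h) mx
        have p2 := toCover_dens_pos (h := h) (strip_mem_fst hx)
        have p3 := toCover_dens_pos (h := h) (strip_mem_fst hsb)
        unfold invDens
        rw [eq_div_iff (by positivity), ← key]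
        field_simp
    refine ContDiffAt.congr_of_eventuallyEq ?_ e
    have p := (toCover_dens_pos (h := h) (strip_mem_fst hsb)).ne'
    refine ContDiffAt.div ?_ ?_ (mul_ne_zero (mul_ne_zero two_ne_zero p) p)
    · exact contDiffAt_const.mul (((contDiffAt_primitive hc hh hK (strip_mem_fst hsb)).sub
        contDiffAt_const).pow 2)
    · exact (contDiffAt_const.mul (contDiffAt_dens hh (strip_mem_fst hsb))).mul contDiffAt_const

theorem pi_half_mem : ((Real.pi / 2, 0) : ℝ × ℝ) ∈ coverSet :=
  strip_mem_fst ⟨by positivity, by linarith [Real.pi_pos]⟩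

/-- The derivative of the normalizing diffeomorphism. The two functions in the denominator are
squares of solutions of a Hill equation, vanishing at `0` and at `π / 2`. -/
def speed (h : Metric) (c s : ℝ) : ℝ :=
  (√(2 * toCover h.dens (Real.pi / 2, 0) / c))⁻¹ / (h.invDens 0 s + h.invDens (Real.pi / 2) s)

theorem invDens_add_pos (s : ℝ) : 0 < h.invDens 0 s + h.invDens (Real.pi / 2) s := by
  by_cases h0 : (s, (0 : ℝ)) ∈ coverSet
  · exact add_pos_of_pos_of_nonneg (invDens_pos h0) (invDens_nonneg _ _)
  · refine add_pos_of_nonneg_of_pos (invDens_nonneg _ _) (invDens_pos ?_)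
    intro e
    refine h0 fun e2 => pi_half_mem ?_
    exact e.symm.trans (not_not.1 h0)

theorem speed_pos (hc : 0 < c) (s : ℝ) : 0 < h.speed c s := by
  have := toCover_dens_pos (h := h) pi_half_mem
  exact div_pos (inv_pos.2 (Real.sqrt_pos.2 (by positivity))) (invDens_add_pos s)

theorem speed_add (s : ℝ) : h.speed c (s + Real.pi) = h.speed c s := by
  have e : ∀ t, h.invDens t (s + Real.pi) = h.invDens t s := fun t => by
    simpa using invDens_add (h := h) s t 1
  unfold speed
  rw [e, e]

theorem contDiff_speed (hc : 0 < c) (hh : h.IsCn 2) (hK : ∀ p, h.curvature p = c)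
    (hu : Tendsto ((deSitter c hc).factor h) (cocompact Annulus) (𝓝 0)) :
    ContDiff ℝ 2 (h.speed c) :=
  contDiff_const.div ((contDiff_invDens hc hh hK hu 0).add
    (contDiff_invDens hc hh hK hu (Real.pi / 2))) fun s => (invDens_add_pos s).ne'

/-- The normalizing diffeomorphism. -/
def normalizer (h : Metric) (c s : ℝ) : ℝ := ∫ x in (0 : ℝ)..s, h.speed c x

section

variable (hc : 0 < c) (hh : h.IsCn 2) (hK : ∀ p, h.curvature p = c)
  (hu : Tendsto ((deSitter c hc).factor h) (cocompact Annulus) (𝓝 0))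
include hc hh hK hu

theorem hasDerivAt_normalizer (s : ℝ) : HasDerivAt (h.normalizer c) (h.speed c s) s := by
  have c := (contDiff_speed hc hh hK hu).continuous
  exact intervalIntegral.integral_hasDerivAt_right (c.intervalIntegrable _ _)
    (c.stronglyMeasurableAtFilter _ _) c.continuousAt

theorem contDiff_normalizer : ContDiff ℝ 3 (h.normalizer c) := by
  have h3 : (3 : WithTop ℕ∞) = 2 + 1 := by norm_num
  rw [h3, contDiff_succ_iff_deriv]
  refine ⟨fun s => (hasDerivAt_normalizer hc hh hK hu s).differentiableAt, by simp, ?_⟩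
  have : deriv (h.normalizer c) = h.speed c :=
    funext fun s => (hasDerivAt_normalizer hc hh hK hu s).deriv
  rw [this]
  exact contDiff_speed hc hh hK hu

/-- On `(0, π)`, the normalizing diffeomorphism is the arctangent of a multiple of a primitive of
`f (·, 0)`. -/
theorem exists_normalizer_eq_arctan :
    ∃ (a : ℝ → ℝ) (C : ℝ), (∀ s ∈ Ioo 0 Real.pi, h.normalizer c s = Real.arctan (a s) + C) ∧
      (∀ s ∈ Ioo 0 Real.pi, HasDerivAt a ((1 + a s ^ 2) * h.speed c s) s) ∧
      ∀ s ∈ Ioo 0 Real.pi, ∀ t ∈ Ioo 0 Real.pi, s ≠ t →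
        toCover h.dens (s, t) * (c * (a s - a t) ^ 2) =
          2 * ((1 + a s ^ 2) * h.speed c s) * ((1 + a t ^ 2) * h.speed c t) := by
  have hπ := Real.pi_pos
  have I0 : ∀ {s}, s ∈ Ioo 0 Real.pi → s ∈ Ioo 0 (0 + Real.pi) := fun hs => by rwa [zero_add]
  have pm : Real.pi / 2 ∈ Ioo 0 Real.pi := pi_div_two_mem
  have p0 := toCover_dens_pos (h := h) pi_half_mem
  have L0 : 0 < 2 * toCover h.dens (Real.pi / 2, 0) / c := by positivity
  set R := √(2 * toCover h.dens (Real.pi / 2, 0) / c) with hR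
  have R0 : 0 < R := Real.sqrt_pos.2 L0
  have R2 : R ^ 2 = 2 * toCover h.dens (Real.pi / 2, 0) / c := Real.sq_sqrt L0.le
  set X := h.primitive c 0 with hX
  have dX : ∀ s ∈ Ioo 0 Real.pi, HasDerivAt X (toCover h.dens (s, 0)) s := fun s hs =>
    hasDerivAt_primitive hc hh hK (strip_mem_fst (I0 hs))
  have key : ∀ s ∈ Ioo 0 Real.pi, (1 + ((X s - X (Real.pi / 2)) / R) ^ 2) * h.speed c s =
      toCover h.dens (s, 0) / R := by
    intro s hs
    have ps := toCover_dens_pos (h := h) (strip_mem_fst (I0 hs))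
    have e2 : h.invDens (Real.pi / 2) s =
        ((X s - X (Real.pi / 2)) / R) ^ 2 / toCover h.dens (s, 0) := by
      rw [div_pow, R2]
      rcases eq_or_ne s (Real.pi / 2) with rfl | hne
      · rw [invDens_of_notMem (fun h => h rfl)]; simp
      · have k := dens_mul_sub_sq hc hh hK hu (I0 hs) (I0 pm) hne
        rw [← hX] at k
        have p1 : 0 < toCover h.dens (s, Real.pi / 2) := by
          refine lt_of_le_of_ne ?_ ?_
          · unfold toCover; split_ifs
            · exact (h.dens_pos _).le
            · exact le_rfl
          · intro e
            rw [← e, zero_mul] at k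
            exact (mul_pos (mul_pos two_pos ps) p0).ne k
        unfold invDens
        field_simp
        linarith
    have e1 : h.invDens 0 s = 1 / toCover h.dens (s, 0) := by
      unfold invDens; rw [one_div]
    unfold speed
    rw [e1, e2, ← hR]
    have : 0 < 1 + ((X s - X (Real.pi / 2)) / R) ^ 2 := by positivity
    rw [← add_div]
    generalize 1 + ((X s - X (Real.pi / 2)) / R) ^ 2 = z at this ⊢
    field_simp
  have da : ∀ s ∈ Ioo 0 Real.pi, HasDerivAt (fun s => (X s - X (Real.pi / 2)) / R)
      ((1 + ((X s - X (Real.pi / 2)) / R) ^ 2) * h.speed c s) s := fun s hs => by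
    rw [key s hs]
    exact ((dX s hs).sub_const _).div_const R
  refine ⟨fun s => (X s - X (Real.pi / 2)) / R, h.normalizer c (Real.pi / 2) -
    Real.arctan ((X (Real.pi / 2) - X (Real.pi / 2)) / R), fun s hs => ?_, da, fun s hs t ht hst => ?_⟩
  · have d : ∀ s ∈ Ioo 0 Real.pi, HasDerivAt (fun s => h.normalizer c s -
        Real.arctan ((X s - X (Real.pi / 2)) / R)) 0 s := fun s hs => by
      refine ((hasDerivAt_normalizer hc hh hK hu s).sub (da s hs).arctan).congr_deriv ?_
      have : 0 < 1 + ((X s - X (Real.pi / 2)) / R) ^ 2 := by positivity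
      generalize 1 + ((X s - X (Real.pi / 2)) / R) ^ 2 = z at this ⊢
      field_simp
      ring
    have := isOpen_Ioo.is_const_of_deriv_eq_zero isPreconnected_Ioo
      (fun s hs => (d s hs).differentiableAt.differentiableWithinAt)
      (fun s hs => (d s hs).deriv) hs pm
    linarith
  · rw [key s hs, key t ht]
    have k := dens_mul_sub_sq hc hh hK hu (I0 hs) (I0 ht) hst
    rw [← hX] at k
    have : (X s - X (Real.pi / 2)) / R - (X t - X (Real.pi / 2)) / R = (X s - X t) / R := by ring
    rw [this]
    field_simp
    linarith

theorem normalizer_identity {s t : ℝ} (hs : s ∈ Ioo 0 Real.pi) (ht : t ∈ Ioo 0 Real.pi)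
    (hst : s ≠ t) : toCover h.dens (s, t) *
      (c * Real.sin (h.normalizer c s - h.normalizer c t) ^ 2) =
        2 * h.speed c s * h.speed c t := by
  obtain ⟨a, C, h1, -, h3⟩ := exists_normalizer_eq_arctan hc hh hK hu
  have k := h3 s hs t ht hst
  rw [h1 s hs, h1 t ht, add_sub_add_right_eq_sub, Real.sin_sub, Real.sin_arctan, Real.sin_arctan,
    Real.cos_arctan, Real.cos_arctan]
  have q1 : √(1 + a s ^ 2) ^ 2 = 1 + a s ^ 2 := Real.sq_sqrt (by positivity)
  have q2 : √(1 + a t ^ 2) ^ 2 = 1 + a t ^ 2 := Real.sq_sqrt (by positivity)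
  have e : (a s / √(1 + a s ^ 2) * (1 / √(1 + a t ^ 2)) -
      1 / √(1 + a s ^ 2) * (a t / √(1 + a t ^ 2))) ^ 2 =
      (a s - a t) ^ 2 / ((1 + a s ^ 2) * (1 + a t ^ 2)) := by
    rw [← q1, ← q2, Real.sqrt_sq (by positivity), Real.sqrt_sq (by positivity)]
    have : √(1 + a s ^ 2) ≠ 0 := by positivity
    have : √(1 + a t ^ 2) ≠ 0 := by positivity
    field_simp
  rw [e]
  have z1 : 0 < 1 + a s ^ 2 := by positivity
  have z2 : 0 < 1 + a t ^ 2 := by positivity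
  generalize 1 + a s ^ 2 = y at *
  generalize 1 + a t ^ 2 = z at *
  rw [mul_div_assoc', mul_div_assoc', k]
  field_simp

theorem normalizer_strictMono : StrictMono (h.normalizer c) :=
  strictMono_of_deriv_pos fun s => by
    rw [(hasDerivAt_normalizer hc hh hK hu s).deriv]; exact speed_pos hc s

theorem normalizer_pi : h.normalizer c Real.pi = Real.pi := by
  have hπ := Real.pi_pos
  have cN : Continuous (h.normalizer c) := (contDiff_normalizer hc hh hK hu).continuous
  have cS : Continuous (h.speed c) := (contDiff_speed hc hh hK hu).continuous
  have n0 : h.normalizer c 0 = 0 := by simp [normalizer]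
  have hpos : 0 < h.normalizer c Real.pi := by
    rw [← n0]; exact normalizer_strictMono hc hh hK hu hπ
  -- the increment is at most `π`, the length of the range of the arctangent
  have hle : h.normalizer c Real.pi ≤ Real.pi := by
    obtain ⟨a, C, h1, -, -⟩ := exists_normalizer_eq_arctan hc hh hK hu
    have b0 : C - Real.pi / 2 ≤ h.normalizer c 0 := by
      refine ge_of_tendsto ((cN.tendsto 0).mono_left (nhdsWithin_le_nhds (s := Ioi 0))) ?_
      filter_upwards [Ioo_mem_nhdsGT hπ] with s hs
      rw [h1 s hs]; linarith [Real.neg_pi_div_two_lt_arctan (a s)]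
    have b1 : h.normalizer c Real.pi ≤ C + Real.pi / 2 := by
      refine le_of_tendsto ((cN.tendsto Real.pi).mono_left
        (nhdsWithin_le_nhds (s := Iio Real.pi))) ?_
      filter_upwards [Ioo_mem_nhdsLT hπ] with s hs
      rw [h1 s hs]; linarith [Real.arctan_lt_pi_div_two (a s)]
    linarith
  -- letting `t → π`
  have e1 : ∀ s ∈ Ioo 0 Real.pi, toCover h.dens (s, Real.pi) *
      (c * Real.sin (h.normalizer c s - h.normalizer c Real.pi) ^ 2) =
        2 * h.speed c s * h.speed c Real.pi := by
    intro s hs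
    have hm : (s, Real.pi) ∈ coverSet := by
      have := strip_mem (s := s) (d := Real.pi - s) (by linarith [hs.2]) (by linarith [hs.1])
      simpa using this
    have cf : ContinuousAt (fun t => toCover h.dens (s, t)) Real.pi :=
      ContinuousAt.comp (g := toCover h.dens) (f := fun t : ℝ => (s, t))
        ((h.isCn_iff.1 hh).differentiableAt two_ne_zero hm).continuousAt (by fun_prop)
    have l1 : ContinuousAt (fun t => toCover h.dens (s, t) *
        (c * Real.sin (h.normalizer c s - h.normalizer c t) ^ 2)) Real.pi :=
      cf.mul (by fun_prop)
    have l2 : ContinuousAt (fun t => 2 * h.speed c s * h.speed c t) Real.pi := by fun_prop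
    refine tendsto_nhds_unique_of_eventuallyEq (l1.tendsto.mono_left nhdsWithin_le_nhds)
      (l2.tendsto.mono_left (nhdsWithin_le_nhds (s := Iio Real.pi))) ?_
    filter_upwards [Ioo_mem_nhdsLT hs.2] with t ht
    exact normalizer_identity hc hh hK hu hs ⟨hs.1.trans ht.1, ht.2⟩ ht.1.ne
  -- letting `s → 0`
  have cI := (contDiff_invDens hc hh hK hu 0).continuous
  have e2 : Real.sin (h.normalizer c 0 - h.normalizer c Real.pi) ^ 2 =
      2 * h.speed c 0 * h.speed c Real.pi * h.invDens 0 0 / c := by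
    have l1 : Continuous fun s => Real.sin (h.normalizer c s - h.normalizer c Real.pi) ^ 2 := by
      fun_prop
    have l2 : Continuous fun s => 2 * h.speed c s * h.speed c Real.pi * h.invDens 0 s / c := by
      fun_prop
    refine tendsto_nhds_unique_of_eventuallyEq ((l1.tendsto 0).mono_left nhdsWithin_le_nhds)
      ((l2.tendsto 0).mono_left (nhdsWithin_le_nhds (s := Ioi 0))) ?_
    filter_upwards [Ioo_mem_nhdsGT hπ] with s hs
    have k := e1 s hs
    have per := toCover_add_int h.dens s 0 0 1
    simp only [Int.cast_zero, zero_mul, add_zero, Int.cast_one, one_mul, zero_add] at per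
    have hp := toCover_dens_pos (h := h) (strip_mem_fst (t₀ := 0) (s := s) (by rwa [zero_add]))
    rw [per] at k
    rw [← k]
    unfold invDens
    field_simp
  rw [invDens_of_notMem (fun h => h rfl), mul_zero, zero_div, n0, zero_sub,
    pow_eq_zero_iff two_ne_zero, Real.sin_neg, neg_eq_zero] at e2
  by_contra hne
  exact (Real.sin_pos_of_pos_of_lt_pi hpos (lt_of_le_of_ne hle hne)).ne' e2

/-- A metric of constant curvature, asymptotic to the de Sitter metric, is in normal form. -/
theorem isNormalForm_of_curvature : IsNormalForm c h (h.normalizer c) := by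
  have hπ := Real.pi_pos
  have cN : Continuous (h.normalizer c) := (contDiff_normalizer hc hh hK hu).continuous
  have cS : Continuous (h.speed c) := (contDiff_speed hc hh hK hu).continuous
  have hder : ∀ s, deriv (h.normalizer c) s = h.speed c s := fun s =>
    (hasDerivAt_normalizer hc hh hK hu s).deriv
  have turn : ∀ s, h.normalizer c (s + Real.pi) = h.normalizer c s + Real.pi := fun s => by
    have h1 := intervalIntegral.integral_add_adjacent_intervals
      (cS.intervalIntegrable (μ := volume) 0 s) (cS.intervalIntegrable s (s + Real.pi))
    have h2 := Function.Periodic.intervalIntegral_add_eq (f := h.speed c) (T := Real.pi)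
      (fun t => speed_add t) s 0
    rw [zero_add] at h2
    have h3 := normalizer_pi hc hh hK hu
    unfold normalizer at h3 ⊢
    linarith
  refine ⟨contDiff_normalizer hc hh hK hu, fun s => by rw [hder]; exact speed_pos hc s, turn, ?_⟩
  -- the identity holds when neither angle is a multiple of `π`
  have gen : ∀ s t : ℝ, (s, t) ∈ coverSet → (s, (0 : ℝ)) ∈ coverSet → (t, (0 : ℝ)) ∈ coverSet →
      toCover h.dens (s, t) * (c * Real.sin (h.normalizer c s - h.normalizer c t) ^ 2) =
        2 * h.speed c s * h.speed c t := by
    intro s t hst hs ht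
    have red : ∀ x : ℝ, (x, (0 : ℝ)) ∈ coverSet → ∃ n : ℤ, ∃ y ∈ Ioo 0 Real.pi,
        x = y + n * Real.pi := by
      intro x hx
      refine ⟨toIcoDiv hπ 0 x, toIcoMod hπ 0 x, ?_, ?_⟩
      · have hm := toIcoMod_mem_Ico hπ 0 x
        rw [zero_add] at hm
        refine ⟨lt_of_le_of_ne hm.1 fun e => ?_, hm.2⟩
        have := toIcoMod_add_toIcoDiv_zsmul hπ 0 x
        rw [← e, zero_add] at this
        rw [mem_coverSet_iff] at hx
        apply hx
        simp only [sub_zero]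
        rw [← this, zsmul_eq_mul]
        exact Real.sin_int_mul_pi _
      · rw [← zsmul_eq_mul, toIcoMod_add_toIcoDiv_zsmul]
    obtain ⟨m, s, hs', rfl⟩ := red s hs
    obtain ⟨n, t, ht', rfl⟩ := red t ht
    have sper : ∀ x (n : ℤ), h.speed c (x + n * Real.pi) = h.speed c x := fun x n => by
      rw [← hder, ← hder, deriv_add_int turn]
    rw [toCover_add_int, phi_add_int turn, phi_add_int turn, sper, sper]
    have : h.normalizer c s + m * Real.pi - (h.normalizer c t + n * Real.pi) =
        h.normalizer c s - h.normalizer c t + ((m - n : ℤ) : ℝ) * Real.pi := by push_cast; ring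
    rw [this, sin_sq_add_int]
    refine normalizer_identity hc hh hK hu hs' ht' ?_
    rintro rfl
    apply hst
    simp only [coe_add_int_mul_pi]
  -- and everywhere by continuity
  have all : ∀ s t : ℝ, (s, t) ∈ coverSet →
      toCover h.dens (s, t) * (c * Real.sin (h.normalizer c s - h.normalizer c t) ^ 2) =
        2 * h.speed c s * h.speed c t := by
    intro s t hst
    have cf : ContinuousAt (fun x => toCover h.dens (s + x, t + x)) 0 :=
      ContinuousAt.comp (g := toCover h.dens) (f := fun x : ℝ => (s + x, t + x)) (by
        simpa using ((h.isCn_iff.1 hh).differentiableAt two_ne_zero hst).continuousAt) (by fun_prop)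
    have l1 : ContinuousAt (fun x => toCover h.dens (s + x, t + x) *
        (c * Real.sin (h.normalizer c (s + x) - h.normalizer c (t + x)) ^ 2)) 0 :=
      cf.mul (by fun_prop)
    have l2 : ContinuousAt (fun x => 2 * h.speed c (s + x) * h.speed c (t + x)) 0 := by fun_prop
    have ev : ∀ y : ℝ, ∀ᶠ x in 𝓝[≠] (0 : ℝ), (y + x, (0 : ℝ)) ∈ coverSet := by
      intro y
      simp only [mem_coverSet_iff, sub_zero]
      by_cases hy : Real.sin y = 0
      · filter_upwards [nhdsWithin_le_nhds (Ioo_mem_nhds (neg_lt_zero.2 hπ) hπ),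
          self_mem_nhdsWithin] with x hx hx0 h0
        obtain ⟨k, hk⟩ := Real.sin_eq_zero_iff.1 hy
        rw [← hk, add_comm, Real.sin_add_int_mul_pi] at h0
        rcases mul_eq_zero.1 h0 with h0 | h0
        · exact zpow_ne_zero k (by norm_num : (-1 : ℝ) ≠ 0) h0
        · exact hx0 ((Real.sin_eq_zero_iff_of_lt_of_lt hx.1 hx.2).1 h0)
      · have : ContinuousAt (fun x => Real.sin (y + x)) 0 := by fun_prop
        exact nhdsWithin_le_nhds (this.eventually_ne (by simpa using hy))
    have hopen : ∀ᶠ x in 𝓝 (0 : ℝ), (s + x, t + x) ∈ coverSet :=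
      (by fun_prop : ContinuousAt (fun x : ℝ => (s + x, t + x)) 0).eventually
        (by simpa using isOpen_coverSet.mem_nhds hst)
    have := tendsto_nhds_unique_of_eventuallyEq (l1.tendsto.mono_left nhdsWithin_le_nhds)
      (l2.tendsto.mono_left (nhdsWithin_le_nhds (s := {0}ᶜ))) (by
        filter_upwards [ev s, ev t, nhdsWithin_le_nhds hopen] with x h1 h2 h3
        exact gen _ _ h3 h1 h2)
    simpa using this
  rintro ⟨s, t⟩ hq
  have k := all s t hq
  simp only [hder]
  have hne : c * Real.sin (h.normalizer c s - h.normalizer c t) ^ 2 ≠ 0 := by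
    intro e
    rw [e, mul_zero] at k
    exact (mul_pos (mul_pos two_pos (speed_pos (h := h) hc s)) (speed_pos (h := h) hc t)).ne k
  rw [eq_div_iff hne, k]

end

end Metric

/-- The action vanishes on pairs of metrics of the same constant curvature. -/
theorem action_of_curvature {c : ℝ} (hc : 0 < c) {g h : Metric}
    (Hg : InSClass (deSitter c hc) g) (Hh : InSClass (deSitter c hc) h)
    (hg : ∀ p, g.curvature p = c) (hh : ∀ p, h.curvature p = c) :
    ActionConverges g h ∧ action g h = 0 := by
  have Ng := Metric.isNormalForm_of_curvature hc Hg.regular hg Hg.boundary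
  have Nh := Metric.isNormalForm_of_curvature hc Hh.regular hh Hh.boundary
  obtain ⟨ig, ag⟩ := Ng.action_deSitter hc
  obtain ⟨-, ah⟩ := Nh.action_deSitter hc
  have A := Hg.asymptotic
  have B := A.symm.trans Hh.asymptotic
  have i2 := B.integrable_of_curvature hc hg hh
  obtain ⟨-, e⟩ := A.chasles B ig i2
  refine ⟨B.actionConverges i2, ?_⟩
  rw [ag, ah] at e
  linarith

/-! ### Uniformizing metrics -/

/-- The coordinate `e^{2iθ}` on the projective line. -/
def circ (x : RP1) : ℂ := (AddCircle.toCircle x : ℂ)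

theorem circ_coe (x : ℝ) : circ (x : RP1) = Complex.exp (2 * Complex.I * x) := by
  unfold circ
  rw [AddCircle.toCircle_apply_mk, Circle.coe_exp]
  congr 1
  have : (Real.pi : ℂ) ≠ 0 := by exact_mod_cast Real.pi_ne_zero
  push_cast
  field_simp

theorem circ_injective : Function.Injective circ := fun _ _ h =>
  AddCircle.injective_toCircle Real.pi_ne_zero (Subtype.ext h)

theorem circ_norm (x : RP1) : ‖circ x‖ = 1 := Circle.norm_coe _

/-- A unit complex valued function with velocity `2 i r e`, `r` real, has an angle. -/
theorem exists_angle {e : ℝ → ℂ} (he : ContDiff ℝ 3 e) (h1 : ∀ s, ‖e s‖ = 1)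
    (hr : ∀ s, ∃ r : ℝ, r ≠ 0 ∧ deriv e s = 2 * Complex.I * r * e s) :
    ∃ φ : ℝ → ℝ, ContDiff ℝ 3 φ ∧ (∀ s, e s = circ (φ s : RP1)) ∧
      ∀ s, deriv φ s ≠ 0 ∧ deriv e s = 2 * Complex.I * (deriv φ s : ℝ) * e s := by
  choose r hr0 hr using hr
  have hne : ∀ s, e s ≠ 0 := fun s h => by have := h1 s; rw [h] at this; simp at this
  have h3 : (3 : WithTop ℕ∞) = 2 + 1 := by norm_num
  have hd : ContDiff ℝ 2 (deriv e) := by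
    rw [h3, contDiff_succ_iff_deriv] at he
    exact he.2.2
  have rc : ContDiff ℝ 2 r := by
    have e1 : r = fun s => Complex.reCLM (deriv e s * (2 * Complex.I * e s)⁻¹) := by
      funext s
      rw [hr s]
      have := hne s
      have : 2 * Complex.I * (r s) * e s * (2 * Complex.I * e s)⁻¹ = r s := by
        field_simp [Complex.I_ne_zero]
      rw [this]; simp
    rw [e1]
    refine Complex.reCLM.contDiff.comp (hd.mul ((contDiff_const.mul
      (he.of_le (by norm_num))).inv fun s => ?_))
    exact mul_ne_zero (mul_ne_zero two_ne_zero Complex.I_ne_zero) (hne s)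
  set φ : ℝ → ℝ := fun s => (e 0).arg / 2 + ∫ x in (0 : ℝ)..s, r x with hφ
  have dφ : ∀ s, HasDerivAt φ (r s) s := fun s =>
    (intervalIntegral.integral_hasDerivAt_right (rc.continuous.intervalIntegrable _ _)
      (rc.continuous.stronglyMeasurableAtFilter _ _) rc.continuous.continuousAt).const_add _
  have dd : deriv φ = r := funext fun s => (dφ s).deriv
  refine ⟨φ, ?_, fun s => ?_, fun s => ?_⟩
  · rw [h3, contDiff_succ_iff_deriv, dd]
    exact ⟨fun s => (dφ s).differentiableAt, by simp, rc⟩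
  · rw [circ_coe]
    have de : ∀ s, HasDerivAt (fun s => e s * Complex.exp (-(2 * Complex.I * φ s))) 0 s := by
      intro s
      have a1 : HasDerivAt e (deriv e s) s := (he.differentiable (by norm_num) s).hasDerivAt
      have a2 : HasDerivAt (fun s => (φ s : ℂ)) (r s : ℂ) s := (dφ s).ofReal_comp
      refine (a1.mul ((a2.const_mul (2 * Complex.I)).neg.cexp)).congr_deriv ?_
      rw [hr s]; ring
    have hc := is_const_of_deriv_eq_zero (fun s => (de s).differentiableAt)
      (fun s => (de s).deriv) s 0
    have e0 : Complex.exp (2 * Complex.I * φ 0) = e 0 := by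
      have : φ 0 = (e 0).arg / 2 := by simp [hφ]
      rw [this]
      have h := Complex.norm_mul_exp_arg_mul_I (e 0)
      rw [h1, Complex.ofReal_one, one_mul] at h
      rw [← h]
      congr 1
      rw [h]
      push_cast; ring
    rw [← e0, ← Complex.exp_add, add_neg_cancel, Complex.exp_zero, Complex.exp_neg] at hc
    have := Complex.exp_ne_zero (2 * Complex.I * φ s)
    field_simp at hc
    exact hc
  · rw [dd]; exact ⟨hr0 s, hr s⟩

theorem sin_eq_zero_of_circ_eq {x y : ℝ} (h : circ (x : RP1) = circ (y : RP1)) :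
    Real.sin (x - y) = 0 :=
  coe_eq_coe_iff_sin.1 (circ_injective h)

/-- A continuous function varying by at least `π` meets `π ℤ`. -/
theorem exists_sin_eq_zero {g : ℝ → ℝ} (hg : Continuous g) {a b : ℝ} (hab : a ≤ b)
    (h : Real.pi ≤ |g b - g a|) : ∃ x ∈ Icc a b, Real.sin (g x) = 0 := by
  have hπ := Real.pi_pos
  have : ∃ k : ℤ, k * Real.pi ∈ uIcc (g a) (g b) := by
    refine ⟨⌈min (g a) (g b) / Real.pi⌉, ?_⟩
    have h1 := Int.le_ceil (min (g a) (g b) / Real.pi)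
    have h2 := Int.ceil_lt_add_one (min (g a) (g b) / Real.pi)
    rw [div_le_iff₀ hπ] at h1
    refine ⟨h1, ?_⟩
    rw [← sub_lt_iff_lt_add, lt_div_iff₀ hπ] at h2
    have h3 : max (g a) (g b) - min (g a) (g b) = |g b - g a| := max_sub_min_eq_abs _ _
    change _ ≤ max (g a) (g b)
    linarith
  obtain ⟨k, hk⟩ := this
  obtain ⟨x, hx, hxe⟩ := intermediate_value_uIcc (a := a) (b := b) hg.continuousOn hk
  rw [uIcc_of_le hab] at hx
  exact ⟨x, hx, by rw [hxe]; exact Real.sin_int_mul_pi k⟩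

/-- The lift of a circle map which is injective on each turn has degree one. -/
theorem turn_of_sin {φ : ℝ → ℝ} (hφ : Continuous φ) (hm : StrictMono φ)
    (h0 : ∀ s, Real.sin (φ (s + Real.pi) - φ s) = 0)
    (h1 : ∀ s, ∀ t ∈ Ioo s (s + Real.pi), Real.sin (φ t - φ s) ≠ 0) (s : ℝ) :
    φ (s + Real.pi) = φ s + Real.pi := by
  have hπ := Real.pi_pos
  obtain ⟨n, hn⟩ := Real.sin_eq_zero_iff.1 (h0 s)
  have hlt := hm (show s < s + Real.pi by linarith)
  have n0 : 0 < n := by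
    by_contra hle
    have : (n : ℝ) ≤ 0 := by exact_mod_cast not_lt.1 hle
    nlinarith
  rcases (show n = 1 ∨ 2 ≤ n by omega) with rfl | h2
  · rw [Int.cast_one, one_mul] at hn; linarith
  · exfalso
    have h2' : (2 : ℝ) ≤ n := by exact_mod_cast h2
    have hmem : φ s + Real.pi ∈ Ioo (φ s) (φ (s + Real.pi)) := ⟨by linarith, by nlinarith⟩
    obtain ⟨t, ht, hte⟩ := intermediate_value_Ioo (show s ≤ s + Real.pi by linarith)
      hφ.continuousOn hmem
    exact h1 s t ht (by rw [hte]; simp)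

section Pullback

variable {c : ℝ} {hc : 0 < c} {h : Metric} {Φ : Annulus ≃ₜ Annulus}

theorem isCn_of_rep {E : Type*} [NormedAddCommGroup E] [NormedSpace ℝ E] {n : WithTop ℕ∞}
    {f : Annulus → E} (hf : ∀ p, ContDiffAt ℝ n (toCover f) (rep p)) : IsCn n f := by
  intro q hq
  refine ContDiffAt.contDiffWithinAt ?_
  have hr := rep_over (proj q)
  have hq' := over_proj hq
  set v : ℝ × ℝ := rep (proj q) - q with hv
  have c1 : ((v.1 : ℝ) : RP1) = 0 := by
    rw [hv, Prod.fst_sub, AddCircle.coe_sub, hr.1, hq'.1, sub_self]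
  have c2 : ((v.2 : ℝ) : RP1) = 0 := by
    rw [hv, Prod.snd_sub, AddCircle.coe_sub, hr.2, hq'.2, sub_self]
  have hper : (fun x => toCover f (x + v)) = toCover f := by
    funext x
    simp only [toCover, Prod.fst_add, Prod.snd_add, AddCircle.coe_add, c1, c2, add_zero]
  rw [← hper]
  refine ContDiffAt.comp (g := toCover f) (f := fun x => x + v) q ?_ (by fun_prop)
  rw [hv, add_sub_cancel]
  exact hf _

/-- The angular coordinates of a split diffeomorphism. -/
theorem pullback_coordinates (H : IsSplitPullback 3 Φ (deSitter c hc) h) :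
    IsCn 3 (fun p => circ (Φ p).1.1) ∧ IsCn 3 (fun p => circ (Φ p).1.2) ∧
    ∀ p, ∃ r₀ r₁ : ℝ, r₀ ≠ 0 ∧ r₁ ≠ 0 ∧
      pd 0 (fun p => circ (Φ p).1.1) p = 0 ∧
      pd 1 (fun p => circ (Φ p).1.1) p = 2 * Complex.I * r₁ * circ (Φ p).1.1 ∧
      pd 0 (fun p => circ (Φ p).1.2) p = 2 * Complex.I * r₀ * circ (Φ p).1.2 ∧
      pd 1 (fun p => circ (Φ p).1.2) p = 0 ∧
      h.dens p = r₀ * r₁ * (deSitter c hc).dens (Φ p) := by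
  have ev : ∀ p, ∃ F : ℝ × ℝ → ℝ × ℝ, ContDiffAt ℝ 3 F (rep p) ∧ Over (F (rep p)) (Φ p) ∧
      (toCover (fun p => circ (Φ p).1.1) =ᶠ[𝓝 (rep p)]
        fun q => Complex.exp (2 * Complex.I * (F q).1)) ∧
      (toCover (fun p => circ (Φ p).1.2) =ᶠ[𝓝 (rep p)]
        fun q => Complex.exp (2 * Complex.I * (F q).2)) ∧
      (∀ i, ∃ r : ℝ, r ≠ 0 ∧ fderiv ℝ F (rep p) (frame i) = r • frame i) ∧
      ∀ v w, h.form p v w = (deSitter c hc).form (Φ p) (fderiv ℝ F (rep p) v)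
        (fderiv ℝ F (rep p) w) := by
    intro p
    obtain ⟨F, h1, h2, h3, h4⟩ := H p
    refine ⟨F, h2, h1.self_of_nhds _ (rep_over p), ?_, ?_, h3, h4⟩
    · filter_upwards [h1, isOpen_coverSet.mem_nhds (rep_mem p)] with q hq hm
      rw [toCover_eq _ hm, ← circ_coe, (hq _ (over_proj hm)).1]
    · filter_upwards [h1, isOpen_coverSet.mem_nhds (rep_mem p)] with q hq hm
      rw [toCover_eq _ hm, ← circ_coe, (hq _ (over_proj hm)).2]
  have smooth : ∀ {f : ℝ × ℝ → ℝ} {q}, ContDiffAt ℝ 3 f q →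
      ContDiffAt ℝ 3 (fun q => Complex.exp (2 * Complex.I * (f q : ℝ))) q := fun hf =>
    (contDiffAt_const.mul (Complex.ofRealCLM.contDiff.contDiffAt.comp _ hf)).cexp
  have deriv_exp : ∀ {f : ℝ × ℝ → ℝ} {q v}, DifferentiableAt ℝ f q →
      fderiv ℝ (fun q => Complex.exp (2 * Complex.I * (f q : ℝ))) q v =
        2 * Complex.I * (fderiv ℝ f q v : ℝ) * Complex.exp (2 * Complex.I * (f q : ℝ)) := by
    intro f q v hf
    have h1 := ((Complex.ofRealCLM.hasFDerivAt.comp q hf.hasFDerivAt).const_mul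
      (2 * Complex.I)).cexp
    have h2 : HasFDerivAt (fun q => Complex.exp (2 * Complex.I * (f q : ℝ))) _ q := h1
    rw [h2.fderiv]
    simp
    ring
  refine ⟨isCn_of_rep fun p => ?_, isCn_of_rep fun p => ?_, fun p => ?_⟩
  · obtain ⟨F, h2, -, e1, -⟩ := ev p
    exact (smooth (contDiffAt_fst.comp (rep p) h2)).congr_of_eventuallyEq e1
  · obtain ⟨F, h2, -, -, e2, -⟩ := ev p
    exact (smooth (contDiffAt_snd.comp (rep p) h2)).congr_of_eventuallyEq e2
  · obtain ⟨F, h2, hov, e1, e2, h3, h4⟩ := ev p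
    obtain ⟨r₀, n0, h30⟩ := h3 0
    obtain ⟨r₁, n1, h31⟩ := h3 1
    have dF := h2.differentiableAt (by norm_num)
    have dF1 : ∀ v, fderiv ℝ (fun q => (F q).1) (rep p) v = (fderiv ℝ F (rep p) v).1 := fun v => by
      rw [(dF.hasFDerivAt.fst).fderiv]; rfl
    have dF2 : ∀ v, fderiv ℝ (fun q => (F q).2) (rep p) v = (fderiv ℝ F (rep p) v).2 := fun v => by
      rw [(dF.hasFDerivAt.snd).fderiv]; rfl
    have c1 : Complex.exp (2 * Complex.I * ((F (rep p)).1 : ℝ)) = circ (Φ p).1.1 := by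
      rw [← circ_coe, hov.1]
    have c2 : Complex.exp (2 * Complex.I * ((F (rep p)).2 : ℝ)) = circ (Φ p).1.2 := by
      rw [← circ_coe, hov.2]
    refine ⟨r₀, r₁, n0, n1, ?_, ?_, ?_, ?_, ?_⟩
    · rw [pd, der, e1.fderiv_eq, deriv_exp dF.fst, dF1, h30]; simp [frame]
    · rw [pd, der, e1.fderiv_eq, deriv_exp dF.fst, dF1, h31, c1]; simp [frame]
    · rw [pd, der, e2.fderiv_eq, deriv_exp dF.snd, dF2, h30, c2]; simp [frame]
    · rw [pd, der, e2.fderiv_eq, deriv_exp dF.snd, dF2, h31]; simp [frame]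
    · unfold Metric.dens
      rw [h4, h30, h31]
      simp only [map_smul, LinearMap.smul_apply, smul_eq_mul]
      ring

/-- A uniformizing metric is in normal form. -/
theorem exists_isNormalForm (H : IsSplitPullback 3 Φ (deSitter c hc) h) :
    ∃ φ, IsNormalForm c h φ := by
  have hπ := Real.pi_pos
  obtain ⟨s1, s2, loc⟩ := pullback_coordinates H
  set E₁ : Annulus → ℂ := fun p => circ (Φ p).1.1 with hE₁
  set E₂ : Annulus → ℂ := fun p => circ (Φ p).1.2 with hE₂
  set e₁ : ℝ → ℂ := fun s => toCover E₁ (s, s + Real.pi / 2) with he₁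
  set e₂ : ℝ → ℂ := fun t => toCover E₂ (t + Real.pi / 2, t) with he₂
  have m1 : ∀ s : ℝ, (s, s + Real.pi / 2) ∈ coverSet := fun s =>
    strip_mem (by linarith) (by linarith)
  have m2 : ∀ t : ℝ, (t + Real.pi / 2, t) ∈ coverSet := fun t => swap_mem (m1 t)
  -- each coordinate is constant along the leaves of the corresponding foliation
  have k1 : ∀ s, ∀ t ∈ Ioo s (s + Real.pi), toCover E₁ (s, t) = e₁ s := by
    intro s t ht
    have hm : ∀ t ∈ Ioo s (s + Real.pi), (s, t) ∈ coverSet := fun t ht => swap_mem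
      (Metric.strip_mem_fst ht)
    have d : ∀ t ∈ Ioo s (s + Real.pi), HasDerivAt (fun t => toCover E₁ (s, t)) 0 t := by
      intro t ht
      obtain ⟨r₀, r₁, -, -, z, -⟩ := loc (proj (s, t))
      have := hasDerivAt_toCover_snd (hm t ht) (s1.differentiableAt (by norm_num) (hm t ht))
      rwa [toCover_eq _ (hm t ht), z] at this
    exact isOpen_Ioo.is_const_of_deriv_eq_zero isPreconnected_Ioo
      (fun t ht => (d t ht).differentiableAt.differentiableWithinAt)
      (fun t ht => (d t ht).deriv) ht ⟨by linarith, by linarith⟩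
  have k2 : ∀ t, ∀ s ∈ Ioo t (t + Real.pi), toCover E₂ (s, t) = e₂ t := by
    intro t s hs
    have d : ∀ s ∈ Ioo t (t + Real.pi), HasDerivAt (fun s => toCover E₂ (s, t)) 0 s := by
      intro s hs
      have hm := Metric.strip_mem_fst hs
      obtain ⟨r₀, r₁, -, -, -, -, -, z, -⟩ := loc (proj (s, t))
      have := hasDerivAt_toCover_fst hm (s2.differentiableAt (by norm_num) hm)
      rwa [toCover_eq _ hm, z] at this
    exact isOpen_Ioo.is_const_of_deriv_eq_zero isPreconnected_Ioo
      (fun t ht => (d t ht).differentiableAt.differentiableWithinAt)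
      (fun t ht => (d t ht).deriv) hs ⟨by linarith, by linarith⟩
  have red : ∀ s t : ℝ, (s, t) ∈ coverSet → ∃ n : ℤ, t + n * Real.pi ∈ Ioo s (s + Real.pi) := by
    intro s t hst
    refine ⟨- toIcoDiv hπ s t, ?_⟩
    have e : t + ((- toIcoDiv hπ s t : ℤ) : ℝ) * Real.pi = toIcoMod hπ s t := by
      rw [← self_sub_toIcoDiv_zsmul, zsmul_eq_mul]; push_cast; ring
    rw [e]
    have hm := toIcoMod_mem_Ico hπ s t
    refine ⟨lt_of_le_of_ne hm.1 fun e2 => hst ?_, hm.2⟩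
    have := coe_add_int_mul_pi t (- toIcoDiv hπ s t)
    rw [e, ← e2] at this
    exact this
  have l1 : ∀ s t : ℝ, (s, t) ∈ coverSet → toCover E₁ (s, t) = e₁ s := fun s t hst => by
    obtain ⟨n, hn⟩ := red s t hst
    rw [← k1 s _ hn]
    have := toCover_add_int E₁ s t 0 n
    simp only [Int.cast_zero, zero_mul, add_zero] at this
    exact this.symm
  have l2 : ∀ s t : ℝ, (s, t) ∈ coverSet → toCover E₂ (s, t) = e₂ t := fun s t hst => by
    obtain ⟨n, hn⟩ := red t s (swap_mem hst)
    rw [← k2 t _ hn]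
    have := toCover_add_int E₂ s t n 0
    simp only [Int.cast_zero, zero_mul, add_zero] at this
    exact this.symm
  have ev1 : ∀ s t : ℝ, (s, t) ∈ coverSet → (fun x => toCover E₁ (x, t)) =ᶠ[𝓝 s] e₁ := fun s t hst => by
    filter_upwards [(by fun_prop : ContinuousAt (fun x : ℝ => (x, t)) s).eventually
      (isOpen_coverSet.mem_nhds hst)] with x hx using l1 x t hx
  have ev2 : ∀ s t : ℝ, (s, t) ∈ coverSet → (fun x => toCover E₂ (s, x)) =ᶠ[𝓝 t] e₂ := fun s t hst => by
    filter_upwards [(by fun_prop : ContinuousAt (fun x : ℝ => (s, x)) t).eventually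
      (isOpen_coverSet.mem_nhds hst)] with x hx using l2 s x hx
  have C1 : ContDiff ℝ 3 e₁ := contDiff_iff_contDiffAt.2 fun s =>
    (ContDiffAt.comp (g := toCover E₁) (f := fun x : ℝ => (x, s + Real.pi / 2)) s
      (s1.contDiffAt (m1 s)) (by fun_prop)).congr_of_eventuallyEq (ev1 _ _ (m1 s)).symm
  have C2 : ContDiff ℝ 3 e₂ := contDiff_iff_contDiffAt.2 fun t =>
    (ContDiffAt.comp (g := toCover E₂) (f := fun x : ℝ => (t + Real.pi / 2, x)) t
      (s2.contDiffAt (m2 t)) (by fun_prop)).congr_of_eventuallyEq (ev2 _ _ (m2 t)).symm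
  have d1 : ∀ s t : ℝ, (s, t) ∈ coverSet → deriv e₁ s = toCover (pd 1 E₁) (s, t) := fun s t hst =>
    ((hasDerivAt_toCover_fst hst (s1.differentiableAt (by norm_num) hst)).congr_of_eventuallyEq
      (ev1 _ _ hst).symm).deriv
  have d2 : ∀ s t : ℝ, (s, t) ∈ coverSet → deriv e₂ t = toCover (pd 0 E₂) (s, t) := fun s t hst =>
    ((hasDerivAt_toCover_snd hst (s2.differentiableAt (by norm_num) hst)).congr_of_eventuallyEq
      (ev2 _ _ hst).symm).deriv
  have n1 : ∀ s, ‖e₁ s‖ = 1 := fun s => by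
    rw [he₁]; simp only; rw [toCover_eq _ (m1 s)]; exact circ_norm _
  have n2 : ∀ s, ‖e₂ s‖ = 1 := fun s => by
    rw [he₂]; simp only; rw [toCover_eq _ (m2 s)]; exact circ_norm _
  obtain ⟨φ₁, -, a1, b1⟩ := exists_angle C1 n1 fun s => by
    obtain ⟨r₀, r₁, -, hr, -, z, -⟩ := loc (proj (s, s + Real.pi / 2))
    refine ⟨r₁, hr, ?_⟩
    rw [d1 _ _ (m1 s), toCover_eq _ (m1 s), z, he₁]
    simp only
    rw [toCover_eq _ (m1 s)]
  obtain ⟨φ₂, c2, a2, b2⟩ := exists_angle C2 n2 fun t => by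
    obtain ⟨r₀, r₁, hr, -, -, -, z, -⟩ := loc (proj (t + Real.pi / 2, t))
    refine ⟨r₀, hr, ?_⟩
    rw [d2 _ _ (m2 t), toCover_eq _ (m2 t), z, he₂]
    simp only
    rw [toCover_eq _ (m2 t)]
  have hover : ∀ s t : ℝ, (s, t) ∈ coverSet → Over (φ₁ s, φ₂ t) (Φ (proj (s, t))) := by
    intro s t hst
    have q1 := l1 s t hst
    have q2 := l2 s t hst
    rw [toCover_eq _ hst, a1] at q1
    rw [toCover_eq _ hst, a2] at q2
    exact ⟨(circ_injective q1).symm, (circ_injective q2).symm⟩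
  have off : ∀ s t : ℝ, (s, t) ∈ coverSet → Real.sin (φ₂ t - φ₁ s) ≠ 0 := fun s t hst =>
    mem_coverSet_iff'.1 (over_mem (hover s t hst))
  have t0 : ∀ s, Real.sin (φ₂ (s + Real.pi) - φ₂ s) = 0 := fun s => by
    refine sin_eq_zero_of_circ_eq ?_
    rw [← a2, ← a2, he₂]
    have := toCover_add_pi E₂ (s + Real.pi / 2) s
    rw [add_right_comm] at this
    exact this
  -- the derivative of `φ₂` has constant sign
  have sgn : (∀ s, 0 < deriv φ₂ s) ∨ ∀ s, deriv φ₂ s < 0 := by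
    have := hasDerivWithinAt_forall_lt_or_forall_gt_of_forall_ne (f := φ₂) (f' := deriv φ₂)
      (s := univ) (m := 0) convex_univ (fun s _ =>
        ((c2.differentiable (by norm_num) s).hasDerivAt).hasDerivWithinAt) (fun s _ => (b2 s).1)
    rcases this with h | h
    · exact Or.inr fun s => h s trivial
    · exact Or.inl fun s => h s trivial
  have inj : ∀ s, φ₂ (s + Real.pi) ≠ φ₂ s := fun s e => by
    rcases sgn with h | h
    · exact ((strictMono_of_deriv_pos h) (show s < s + Real.pi by linarith)).ne' e
    · exact ((strictAnti_of_deriv_neg h) (show s < s + Real.pi by linarith)).ne e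
  have eq12 : ∀ s, Real.sin (φ₂ s - φ₁ s) = 0 := by
    intro s
    by_contra hs
    obtain ⟨n, hn⟩ := Real.sin_eq_zero_iff.1 (t0 s)
    have n0 : n ≠ 0 := by
      rintro rfl
      rw [Int.cast_zero, zero_mul] at hn
      exact inj s (by linarith)
    have hvar : Real.pi ≤ |(φ₂ (s + Real.pi) - φ₁ s) - (φ₂ s - φ₁ s)| := by
      rw [sub_sub_sub_cancel_right, ← hn, abs_mul, abs_of_pos hπ]
      have : (1 : ℝ) ≤ |(n : ℝ)| := by exact_mod_cast Int.one_le_abs n0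
      nlinarith
    obtain ⟨x, hx, hx0⟩ := exists_sin_eq_zero (g := fun t => φ₂ t - φ₁ s)
      (c2.continuous.sub continuous_const) (show s ≤ s + Real.pi by linarith) hvar
    rcases eq_or_lt_of_le hx.1 with e | h1
    · rw [← e] at hx0; exact hs hx0
    rcases eq_or_lt_of_le hx.2 with e | h2
    · rw [e] at hx0
      have e3 : φ₂ (s + Real.pi) - φ₁ s = φ₂ s - φ₁ s + n * Real.pi := by linarith
      simp only [e3, Real.sin_add_int_mul_pi] at hx0
      rcases mul_eq_zero.1 hx0 with h0 | h0
      · exact zpow_ne_zero n (by norm_num : (-1 : ℝ) ≠ 0) h0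
      · exact hs h0
    · exact off s x (swap_mem (Metric.strip_mem_fst ⟨h1, h2⟩)) hx0
  have coe12 : ∀ s, (φ₁ s : RP1) = (φ₂ s : RP1) := fun s => (coe_eq_coe_iff_sin.2 (eq12 s)).symm
  have e12 : e₁ = e₂ := funext fun s => by rw [a1, a2, coe12]
  have off2 : ∀ s, ∀ t ∈ Ioo s (s + Real.pi), Real.sin (φ₂ t - φ₂ s) ≠ 0 := fun s t ht => by
    have hm : (s, t) ∈ coverSet := swap_mem (Metric.strip_mem_fst ht)
    intro h0
    refine over_mem (hover s t hm) ?_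
    exact (coe12 s).trans (coe_eq_coe_iff_sin.2 h0).symm
  have dens : ∀ q ∈ coverSet, toCover h.dens q =
      2 * deriv φ₂ q.1 * deriv φ₂ q.2 / (c * Real.sin (φ₂ q.1 - φ₂ q.2) ^ 2) := by
    rintro ⟨s, t⟩ hq
    obtain ⟨r₀, r₁, -, -, -, z1, z0, -, hd⟩ := loc (proj (s, t))
    have hov := hover s t hq
    have I2 : (2 * Complex.I : ℂ) ≠ 0 := mul_ne_zero two_ne_zero Complex.I_ne_zero
    have hne : ∀ s, e₂ s ≠ 0 := fun s h => by have := n2 s; rw [h] at this; simp at this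
    have q1 : r₁ = deriv φ₂ s := by
      have e := d1 s t hq
      have l := l1 s t hq
      rw [toCover_eq _ hq] at e l
      change pd 1 E₁ (proj (s, t)) = _ * E₁ (proj (s, t)) at z1
      rw [z1, l, e12, (b2 s).2] at e
      exact_mod_cast (mul_left_cancel₀ I2 (mul_right_cancel₀ (hne s) e)).symm
    have q0 : r₀ = deriv φ₂ t := by
      have e := d2 s t hq
      have l := l2 s t hq
      rw [toCover_eq _ hq] at e l
      change pd 0 E₂ (proj (s, t)) = _ * E₂ (proj (s, t)) at z0
      rw [z0, l, (b2 t).2] at e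
      exact_mod_cast (mul_left_cancel₀ I2 (mul_right_cancel₀ (hne t) e)).symm
    have e3 : (deSitter c hc).dens (Φ (proj (s, t))) =
        2 / (c * Real.sin (φ₂ s - φ₂ t) ^ 2) := by
      have hov2 : Over (φ₂ s, φ₂ t) (Φ (proj (s, t))) := ⟨(coe12 s).symm.trans hov.1, hov.2⟩
      have := dens_deSitter c hc (over_mem hov2)
      rwa [toCover_of_over _ hov2] at this
    rw [toCover_eq _ hq, hd, q1, q0, e3]
    ring
  rcases sgn with hpos | hneg
  · exact ⟨φ₂, c2, hpos, turn_of_sin c2.continuous (strictMono_of_deriv_pos hpos) t0 off2, dens⟩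
  · -- a diffeomorphism reversing the orientation of the circle
    have dn : ∀ s, deriv (fun s => - φ₂ s) s = - deriv φ₂ s := fun s => deriv.fun_neg
    refine ⟨fun s => - φ₂ s, c2.neg, fun s => ?_, turn_of_sin c2.continuous.neg ?_ ?_ ?_, ?_⟩
    · rw [dn]; linarith [hneg s]
    · exact (strictAnti_of_deriv_neg hneg).neg
    · intro s
      rw [Pi.neg_apply, Pi.neg_apply, neg_sub_neg, ← neg_sub, Real.sin_neg, t0, neg_zero]
    · intro s t ht
      rw [Pi.neg_apply, Pi.neg_apply, neg_sub_neg, ← neg_sub, Real.sin_neg]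
      exact neg_ne_zero.2 (off2 s t ht)
    · intro q hq
      rw [dens q hq, dn, dn, neg_sub_neg, sin_sub_sq (φ₂ q.2)]
      ring

end Pullback

/-- Uniformizing metrics are in the `𝓢`-class of the de Sitter metric and have constant
curvature. -/
theorem IsUniformizing.inSClass {c : ℝ} {hc : 0 < c} {h : Metric} (H : IsUniformizing c hc h) :
    InSClass (deSitter c hc) h ∧ ∀ p, h.curvature p = c := by
  obtain ⟨Φ, hΦ⟩ := H
  obtain ⟨φ, N⟩ := exists_isNormalForm hΦ
  exact ⟨N.inSClass hc, N.curvature_eq hc⟩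

/-! ### Stokes' theorem for `C¹` functions on the torus -/

theorem continuous_double_integral {X : Type*} [TopologicalSpace X] [FirstCountableTopology X]
    {F : X → ℝ → ℝ → ℝ} (hF : Continuous fun z : X × ℝ × ℝ => F z.1 z.2.1 z.2.2) (a b c d : ℝ) :
    Continuous fun x => ∫ s in a..b, ∫ t in c..d, F x s t := by
  apply intervalIntegral.continuous_parametric_intervalIntegral_of_continuous' (f := fun x s =>
    ∫ t in c..d, F x s t)
  apply intervalIntegral.continuous_parametric_intervalIntegral_of_continuous'
    (f := fun (y : X × ℝ) t => F y.1 y.2 t)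
  exact hF.comp (by fun_prop : Continuous fun y : (X × ℝ) × ℝ => (y.1.1, y.1.2, y.2))

/-- The divided difference of `f` along `v`: the mean of `∂f/∂v` over a segment. -/
def divDiff {E : Type*} [NormedAddCommGroup E] [NormedSpace ℝ E] (f : E → ℝ) (v x : E) (h : ℝ) :
    ℝ := ∫ y in (0 : ℝ)..1, fderiv ℝ f (x + (y * h) • v) v

section

variable {E : Type*} [NormedAddCommGroup E] [NormedSpace ℝ E] {f : E → ℝ}

theorem divDiff_zero (v x : E) : divDiff f v x 0 = fderiv ℝ f x v := by
  simp [divDiff]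

theorem mul_divDiff (hf : ContDiff ℝ 1 f) (v x : E) (h : ℝ) :
    h * divDiff f v x h = f (x + h • v) - f x := by
  have hc := hf.continuous_fderiv one_ne_zero
  unfold divDiff
  rw [← intervalIntegral.integral_const_mul]
  rw [intervalIntegral.integral_eq_sub_of_hasDerivAt (f := fun y : ℝ => f (x + (y * h) • v))
    (fun y _ => ?_) (Continuous.intervalIntegrable (by fun_prop) _ _)]
  · simp
  · have h1 : HasDerivAt (fun y : ℝ => x + (y * h) • v) (h • v) y := by
      have := ((((hasDerivAt_id y).mul_const h).smul_const v).const_add x)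
      simpa using this
    have h2 := HasFDerivAt.comp_hasDerivAt (f := fun y : ℝ => x + (y * h) • v) y
      (hf.differentiable one_ne_zero _).hasFDerivAt h1
    refine h2.congr_deriv ?_
    rw [map_smul, smul_eq_mul]

theorem continuous_divDiff (hf : ContDiff ℝ 1 f) (v : E) :
    Continuous fun z : E × ℝ => divDiff f v z.1 z.2 := by
  have hc := hf.continuous_fderiv one_ne_zero
  apply intervalIntegral.continuous_parametric_intervalIntegral_of_continuous'
    (f := fun (z : E × ℝ) y => fderiv ℝ f (z.1 + (y * z.2) • v) v)
  unfold Function.uncurry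
  fun_prop

end

/-- A function on `ℝ²` that is `π`-periodic in each variable. -/
def IsDoublyPeriodic (f : ℝ × ℝ → ℝ) : Prop :=
  ∀ s t, f (s + Real.pi, t) = f (s, t) ∧ f (s, t + Real.pi) = f (s, t)

theorem IsDoublyPeriodic.fderiv {f : ℝ × ℝ → ℝ} (h : IsDoublyPeriodic f) (v : ℝ × ℝ) :
    IsDoublyPeriodic fun q => fderiv ℝ f q v := by
  have key : ∀ w : ℝ × ℝ, (∀ q, f (q + w) = f q) → ∀ q, _root_.fderiv ℝ f (q + w) = _root_.fderiv ℝ f q := by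
    intro w hw q
    have h := fderiv_comp_add_right (𝕜 := ℝ) (f := f) (x := q) w
    rw [funext hw] at h
    exact h.symm
  intro s t
  constructor
  · have := key (Real.pi, 0) (fun q => by
      obtain ⟨x, y⟩ := q
      simpa using (h x y).1) (s, t)
    simp only [Prod.mk_add_mk, add_zero] at this
    simp only [this]
  · have := key (0, Real.pi) (fun q => by
      obtain ⟨x, y⟩ := q
      simpa using (h x y).2) (s, t)
    simp only [Prod.mk_add_mk, add_zero] at this
    simp only [this]

/-- The bracket `f_t g_s - f_s g_t`, that is, the coefficient of `df ∧ dg` in the frame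
`(∂/∂t, ∂/∂s)`. -/
def flatBracket (f g : ℝ × ℝ → ℝ) (q : ℝ × ℝ) : ℝ :=
  fderiv ℝ f q (0, 1) * fderiv ℝ g q (1, 0) - fderiv ℝ f q (1, 0) * fderiv ℝ g q (0, 1)

section Flat

variable {f g e : ℝ × ℝ → ℝ}

theorem hasDerivAt_fst_of_contDiff (hf : ContDiff ℝ 1 f) (s t : ℝ) :
    HasDerivAt (fun s => f (s, t)) (fderiv ℝ f (s, t) (1, 0)) s := by
  have : HasDerivAt (fun s : ℝ => (s, t)) ((1 : ℝ), (0 : ℝ)) s :=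
    (hasDerivAt_id s).prodMk (hasDerivAt_const s t)
  exact (hf.differentiable one_ne_zero (s, t)).hasFDerivAt.comp_hasDerivAt s this

/-- Integration by parts in the first variable. -/
theorem integral_parts_fst (hf : ContDiff ℝ 1 f) (hg : ContDiff ℝ 1 g) (pf : IsDoublyPeriodic f)
    (pg : IsDoublyPeriodic g) (t h : ℝ) :
    ∫ s in (0 : ℝ)..Real.pi, fderiv ℝ f (s, t) (1, 0) * g (s, t + h) =
      -∫ s in (0 : ℝ)..Real.pi, f (s, t) * fderiv ℝ g (s, t + h) (1, 0) := by
  have cf := hf.continuous_fderiv one_ne_zero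
  have cg := hg.continuous_fderiv one_ne_zero
  have cf0 := hf.continuous
  have cg0 := hg.continuous
  have e := intervalIntegral.integral_eq_sub_of_hasDerivAt (a := 0) (b := Real.pi) (fun s _ =>
    (hasDerivAt_fst_of_contDiff hf s t).mul (hasDerivAt_fst_of_contDiff hg s (t + h)))
    (Continuous.intervalIntegrable (by fun_prop) _ _)
  rw [intervalIntegral.integral_add (Continuous.intervalIntegrable (by fun_prop) _ _)
    (Continuous.intervalIntegrable (by fun_prop) _ _)] at e
  have e1 := (pf 0 t).1
  have e2 := (pg 0 (t + h)).1
  rw [zero_add] at e1 e2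
  simp only [Pi.mul_apply, e1, e2, sub_self] at e
  linarith

theorem integral_shift_snd {K : ℝ → ℝ} (hK : ∀ t, K (t + Real.pi) = K t) (h : ℝ) :
    ∫ t in (0 : ℝ)..Real.pi, K (t + h) = ∫ t in (0 : ℝ)..Real.pi, K t := by
  rw [intervalIntegral.integral_comp_add_right (fun t => K t) h]
  have := Function.Periodic.intervalIntegral_add_eq (f := K) (T := Real.pi) hK h 0
  rw [zero_add] at this ⊢
  rw [← this, add_comm]

/-- The integral of an exact form `d(f dg)`, for functions which are merely `C¹`. -/
theorem integral_flatBracket (hf : ContDiff ℝ 1 f) (hg : ContDiff ℝ 1 g) (pf : IsDoublyPeriodic f)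
    (pg : IsDoublyPeriodic g) :
    ∫ s in (0 : ℝ)..Real.pi, ∫ t in (0 : ℝ)..Real.pi, flatBracket f g (s, t) = 0 := by
  have cf := hf.continuous_fderiv one_ne_zero
  have cg := hg.continuous_fderiv one_ne_zero
  have cf0 := hf.continuous
  have cg0 := hg.continuous
  -- translations in the second variable
  have I : ∀ h : ℝ, ∫ s in (0 : ℝ)..Real.pi, ∫ t in (0 : ℝ)..Real.pi,
      fderiv ℝ f (s, t) (1, 0) * g (s, t + h) =
      -∫ s in (0 : ℝ)..Real.pi, ∫ t in (0 : ℝ)..Real.pi,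
        f (s, t + -h) * fderiv ℝ g (s, t) (1, 0) := by
    intro h
    rw [integral_swap_continuous (by unfold Function.uncurry; fun_prop)]
    simp only [integral_parts_fst hf hg pf pg]
    rw [intervalIntegral.integral_neg, integral_swap_continuous (by unfold Function.uncurry; fun_prop)]
    congr 2
    funext s
    rw [← integral_shift_snd (K := fun t => f (s, t + -h) * fderiv ℝ g (s, t) (1, 0)) (fun t => ?_) h]
    · simp only [add_neg_cancel_right]
    · have e1 := (pf s (t + -h)).2
      have e2 := ((pg.fderiv (1, 0)) s t).2
      simp only at e2
      rw [add_right_comm, e1, e2]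
  have cdf := continuous_divDiff hf (0, 1)
  have cdg := continuous_divDiff hg (0, 1)
  have Q : ∀ h : ℝ, h ≠ 0 → ∫ s in (0 : ℝ)..Real.pi, ∫ t in (0 : ℝ)..Real.pi,
      (fderiv ℝ f (s, t) (1, 0) * divDiff g (0, 1) (s, t) h -
        divDiff f (0, 1) (s, t) (-h) * fderiv ℝ g (s, t) (1, 0)) = 0 := by
    intro h hh
    refine (mul_eq_zero.1 ?_).resolve_left hh
    have e0 := I 0
    have eh := I h
    rw [← intervalIntegral.integral_const_mul]
    simp only [← intervalIntegral.integral_const_mul]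
    have e1 : ∀ s t : ℝ, h * (fderiv ℝ f (s, t) (1, 0) * divDiff g (0, 1) (s, t) h -
        divDiff f (0, 1) (s, t) (-h) * fderiv ℝ g (s, t) (1, 0)) =
        (fderiv ℝ f (s, t) (1, 0) * g (s, t + h) + f (s, t + -h) * fderiv ℝ g (s, t) (1, 0)) -
        (fderiv ℝ f (s, t) (1, 0) * g (s, t + 0) + f (s, t + -0) * fderiv ℝ g (s, t) (1, 0)) := by
      intro s t
      have h1 := mul_divDiff hg (0, 1) (s, t) h
      have h2 := mul_divDiff hf (0, 1) (s, t) (-h)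
      simp only [Prod.smul_mk, smul_eq_mul, mul_zero, mul_one, Prod.mk_add_mk, add_zero,
        neg_zero] at h1 h2 ⊢
      linear_combination fderiv ℝ f (s, t) (1, 0) * h1 + fderiv ℝ g (s, t) (1, 0) * h2
    simp only [e1]
    have split : ∀ x : ℝ, ∫ s in (0 : ℝ)..Real.pi, ∫ t in (0 : ℝ)..Real.pi,
        (fderiv ℝ f (s, t) (1, 0) * g (s, t + x) + f (s, t + -x) * fderiv ℝ g (s, t) (1, 0)) = 0 := by
      intro x
      have e2 : ∀ s : ℝ, ∫ t in (0 : ℝ)..Real.pi,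
          (fderiv ℝ f (s, t) (1, 0) * g (s, t + x) + f (s, t + -x) * fderiv ℝ g (s, t) (1, 0)) =
          (∫ t in (0 : ℝ)..Real.pi, fderiv ℝ f (s, t) (1, 0) * g (s, t + x)) +
          ∫ t in (0 : ℝ)..Real.pi, f (s, t + -x) * fderiv ℝ g (s, t) (1, 0) := fun s =>
        intervalIntegral.integral_add (Continuous.intervalIntegrable (by fun_prop) _ _)
          (Continuous.intervalIntegrable (by fun_prop) _ _)
      simp only [e2]
      rw [intervalIntegral.integral_add, I x, neg_add_cancel]
      · exact (continuous_inner_integral (F := fun s t => fderiv ℝ f (s, t) (1, 0) * g (s, t + x))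
          (by unfold Function.uncurry; fun_prop) _ _).intervalIntegrable _ _
      · exact (continuous_inner_integral (F := fun s t => f (s, t + -x) * fderiv ℝ g (s, t) (1, 0))
          (by unfold Function.uncurry; fun_prop) _ _).intervalIntegrable _ _
    have e3 : ∀ s : ℝ, ∫ t in (0 : ℝ)..Real.pi,
        ((fderiv ℝ f (s, t) (1, 0) * g (s, t + h) + f (s, t + -h) * fderiv ℝ g (s, t) (1, 0)) -
        (fderiv ℝ f (s, t) (1, 0) * g (s, t + 0) + f (s, t + -0) * fderiv ℝ g (s, t) (1, 0))) =
        (∫ t in (0 : ℝ)..Real.pi,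
          (fderiv ℝ f (s, t) (1, 0) * g (s, t + h) + f (s, t + -h) * fderiv ℝ g (s, t) (1, 0))) -
        ∫ t in (0 : ℝ)..Real.pi,
          (fderiv ℝ f (s, t) (1, 0) * g (s, t + 0) + f (s, t + -0) * fderiv ℝ g (s, t) (1, 0)) :=
      fun s => intervalIntegral.integral_sub (Continuous.intervalIntegrable (by fun_prop) _ _)
          (Continuous.intervalIntegrable (by fun_prop) _ _)
    simp only [e3]
    rw [intervalIntegral.integral_sub, split h, split 0, sub_self]
    · exact (continuous_inner_integral (F := fun s t => fderiv ℝ f (s, t) (1, 0) * g (s, t + h) +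
        f (s, t + -h) * fderiv ℝ g (s, t) (1, 0))
        (by unfold Function.uncurry; fun_prop) _ _).intervalIntegrable _ _
    · exact (continuous_inner_integral (F := fun s t => fderiv ℝ f (s, t) (1, 0) * g (s, t + 0) +
        f (s, t + -0) * fderiv ℝ g (s, t) (1, 0))
        (by unfold Function.uncurry; fun_prop) _ _).intervalIntegrable _ _
  have cont : Continuous fun h : ℝ => ∫ s in (0 : ℝ)..Real.pi, ∫ t in (0 : ℝ)..Real.pi,
      (fderiv ℝ f (s, t) (1, 0) * divDiff g (0, 1) (s, t) h -
        divDiff f (0, 1) (s, t) (-h) * fderiv ℝ g (s, t) (1, 0)) := by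
    apply continuous_double_integral (F := fun h s t => fderiv ℝ f (s, t) (1, 0) *
      divDiff g (0, 1) (s, t) h - divDiff f (0, 1) (s, t) (-h) * fderiv ℝ g (s, t) (1, 0))
    have a1 := cdf.comp (by fun_prop : Continuous fun z : ℝ × ℝ × ℝ => (((z.2.1, z.2.2) : ℝ × ℝ), -z.1))
    have a2 := cdg.comp (by fun_prop : Continuous fun z : ℝ × ℝ × ℝ => (((z.2.1, z.2.2) : ℝ × ℝ), z.1))
    simp only [Function.comp_def] at a1 a2
    fun_prop
  have lim : ∫ s in (0 : ℝ)..Real.pi, ∫ t in (0 : ℝ)..Real.pi,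
      (fderiv ℝ f (s, t) (1, 0) * divDiff g (0, 1) (s, t) 0 -
        divDiff f (0, 1) (s, t) (-0) * fderiv ℝ g (s, t) (1, 0)) = 0 :=
    tendsto_nhds_unique_of_eventuallyEq
      ((cont.tendsto 0).mono_left (nhdsWithin_le_nhds (s := {0}ᶜ))) tendsto_const_nhds
      (by filter_upwards [self_mem_nhdsWithin] with h hh using Q h hh)
  simp only [neg_zero, divDiff_zero] at lim
  rw [← neg_eq_zero, ← intervalIntegral.integral_neg, ← lim]
  simp only [← intervalIntegral.integral_neg]
  congr 1; funext s; congr 1; funext t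
  unfold flatBracket; ring

theorem IsDoublyPeriodic.mul (pf : IsDoublyPeriodic f) (pg : IsDoublyPeriodic g) :
    IsDoublyPeriodic fun q => f q * g q := fun s t => by
  simp only [(pf s t).1, (pf s t).2, (pg s t).1, (pg s t).2, and_self]

theorem IsDoublyPeriodic.sub (pf : IsDoublyPeriodic f) (pg : IsDoublyPeriodic g) :
    IsDoublyPeriodic fun q => f q - g q := fun s t => by
  simp only [(pf s t).1, (pf s t).2, (pg s t).1, (pg s t).2, and_self]

theorem continuous_flatBracket (hf : ContDiff ℝ 1 f) (hg : ContDiff ℝ 1 g) :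
    Continuous (flatBracket f g) := by
  have cf := hf.continuous_fderiv one_ne_zero
  have cg := hg.continuous_fderiv one_ne_zero
  unfold flatBracket
  fun_prop

/-- The trilinear form `∫ f dg ∧ de` is invariant under cyclic permutations. -/
theorem integral_mul_flatBracket (hf : ContDiff ℝ 1 f) (hg : ContDiff ℝ 1 g) (he : ContDiff ℝ 1 e)
    (pf : IsDoublyPeriodic f) (pg : IsDoublyPeriodic g) (pe : IsDoublyPeriodic e) :
    ∫ s in (0 : ℝ)..Real.pi, ∫ t in (0 : ℝ)..Real.pi, f (s, t) * flatBracket g e (s, t) =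
      ∫ s in (0 : ℝ)..Real.pi, ∫ t in (0 : ℝ)..Real.pi, g (s, t) * flatBracket e f (s, t) := by
  have h := integral_flatBracket (hf.mul hg) he (pf.mul pg) pe
  have e1 : ∀ q, flatBracket (fun q => f q * g q) e q =
      f q * flatBracket g e q - g q * flatBracket e f q := by
    intro q
    have h1 := hf.differentiable one_ne_zero q
    have h2 := hg.differentiable one_ne_zero q
    unfold flatBracket
    rw [fderiv_fun_mul h1 h2]
    simp only [add_apply, smul_apply, smul_eq_mul]
    ring
  change ∫ s in (0 : ℝ)..Real.pi, ∫ t in (0 : ℝ)..Real.pi,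
    flatBracket (fun q => f q * g q) e (s, t) = 0 at h
  have c1 := continuous_flatBracket hg he
  have c2 := continuous_flatBracket he hf
  have cf := hf.continuous
  have cg := hg.continuous
  have e2 : ∀ s, ∫ t in (0 : ℝ)..Real.pi, (f (s, t) * flatBracket g e (s, t) -
      g (s, t) * flatBracket e f (s, t)) =
      (∫ t in (0 : ℝ)..Real.pi, f (s, t) * flatBracket g e (s, t)) -
      ∫ t in (0 : ℝ)..Real.pi, g (s, t) * flatBracket e f (s, t) := fun s =>
    intervalIntegral.integral_sub (Continuous.intervalIntegrable (by fun_prop) _ _)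
      (Continuous.intervalIntegrable (by fun_prop) _ _)
  simp only [e1, e2] at h
  rw [intervalIntegral.integral_sub] at h
  · linarith
  · exact (continuous_inner_integral (F := fun s t => f (s, t) * flatBracket g e (s, t))
      (by unfold Function.uncurry; fun_prop) _ _).intervalIntegrable _ _
  · exact (continuous_inner_integral (F := fun s t => g (s, t) * flatBracket e f (s, t))
      (by unfold Function.uncurry; fun_prop) _ _).intervalIntegrable _ _

end Flat

/-! ### Stokes' theorem for paths of functions on the annulus -/

/-- The restriction of a function on `ℝ² × ℝ` to a slice. -/
def slice (a : (ℝ × ℝ) × ℝ → ℝ) (τ : ℝ) (q : ℝ × ℝ) : ℝ := a (q, τ)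

/-- The coefficient of `da ∧ db ∧ dc` in the frame `(∂/∂t, ∂/∂s, ∂/∂τ)`. -/
def flatJac (a b c : (ℝ × ℝ) × ℝ → ℝ) (z : (ℝ × ℝ) × ℝ) : ℝ :=
  fderiv ℝ a z (0, 1) * flatBracket (slice b z.2) (slice c z.2) z.1 +
    fderiv ℝ b z (0, 1) * flatBracket (slice c z.2) (slice a z.2) z.1 +
    fderiv ℝ c z (0, 1) * flatBracket (slice a z.2) (slice b z.2) z.1

section Flat

variable {a b c : (ℝ × ℝ) × ℝ → ℝ}

theorem contDiff_slice (ha : ContDiff ℝ 1 a) (τ : ℝ) : ContDiff ℝ 1 (slice a τ) :=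
  ha.comp (contDiff_id.prodMk contDiff_const)

theorem fderiv_slice (ha : ContDiff ℝ 1 a) (τ : ℝ) (q v : ℝ × ℝ) :
    fderiv ℝ (slice a τ) q v = fderiv ℝ a (q, τ) (v, 0) := by
  have h1 : HasFDerivAt (fun q : ℝ × ℝ => (q, τ))
      ((ContinuousLinearMap.id ℝ (ℝ × ℝ)).prod (0 : ℝ × ℝ →L[ℝ] ℝ)) q :=
    (hasFDerivAt_id q).prodMk (hasFDerivAt_const τ q)
  have h2 := (ha.differentiable one_ne_zero (q, τ)).hasFDerivAt.comp q h1
  have h3 : HasFDerivAt (slice a τ) _ q := h2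
  rw [h3.fderiv]
  simp

theorem continuous_flatBracket_slice (ha : ContDiff ℝ 1 a) (hb : ContDiff ℝ 1 b) :
    Continuous fun z : (ℝ × ℝ) × ℝ => flatBracket (slice a z.2) (slice b z.2) z.1 := by
  have ca := ha.continuous_fderiv one_ne_zero
  have cb := hb.continuous_fderiv one_ne_zero
  simp only [flatBracket, fderiv_slice ha, fderiv_slice hb]
  fun_prop

theorem continuous_flatJac (ha : ContDiff ℝ 1 a) (hb : ContDiff ℝ 1 b) (hc : ContDiff ℝ 1 c) :
    Continuous (flatJac a b c) := by
  have ca := ha.continuous_fderiv one_ne_zero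
  have cb := hb.continuous_fderiv one_ne_zero
  have cc := hc.continuous_fderiv one_ne_zero
  have h1 := continuous_flatBracket_slice hb hc
  have h2 := continuous_flatBracket_slice hc ha
  have h3 := continuous_flatBracket_slice ha hb
  unfold flatJac
  fun_prop

theorem flatBracket_sub_left {f f' g : ℝ × ℝ → ℝ} (hf : ContDiff ℝ 1 f) (hf' : ContDiff ℝ 1 f')
    (q : ℝ × ℝ) : flatBracket (fun q => f' q - f q) g q = flatBracket f' g q - flatBracket f g q := by
  unfold flatBracket
  rw [fderiv_fun_sub (hf'.differentiable one_ne_zero q) (hf.differentiable one_ne_zero q)]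
  simp only [sub_apply]
  ring

theorem flatBracket_sub_right {f g g' : ℝ × ℝ → ℝ} (hg : ContDiff ℝ 1 g) (hg' : ContDiff ℝ 1 g')
    (q : ℝ × ℝ) : flatBracket f (fun q => g' q - g q) q = flatBracket f g' q - flatBracket f g q := by
  unfold flatBracket
  rw [fderiv_fun_sub (hg'.differentiable one_ne_zero q) (hg.differentiable one_ne_zero q)]
  simp only [sub_apply]
  ring

/-- The increment of `∫ f dg ∧ de`, in terms of the increments of the three functions. -/
theorem integral_mul_flatBracket_sub {f g e f' g' e' : ℝ × ℝ → ℝ}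
    (hf : ContDiff ℝ 1 f) (hg : ContDiff ℝ 1 g) (he : ContDiff ℝ 1 e)
    (hf' : ContDiff ℝ 1 f') (hg' : ContDiff ℝ 1 g') (he' : ContDiff ℝ 1 e')
    (pf : IsDoublyPeriodic f) (pg : IsDoublyPeriodic g) (pe : IsDoublyPeriodic e)
    (pg' : IsDoublyPeriodic g') (pe' : IsDoublyPeriodic e') :
    (∫ s in (0 : ℝ)..Real.pi, ∫ t in (0 : ℝ)..Real.pi, f' (s, t) * flatBracket g' e' (s, t)) -
      ∫ s in (0 : ℝ)..Real.pi, ∫ t in (0 : ℝ)..Real.pi, f (s, t) * flatBracket g e (s, t) =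
    ∫ s in (0 : ℝ)..Real.pi, ∫ t in (0 : ℝ)..Real.pi,
      ((f' (s, t) - f (s, t)) * flatBracket g' e' (s, t) +
        (g' (s, t) - g (s, t)) * flatBracket e' f (s, t) +
        (e' (s, t) - e (s, t)) * flatBracket f g (s, t)) := by
  have cf := hf.continuous
  have cg := hg.continuous
  have ce := he.continuous
  have cf' := hf'.continuous
  have cg' := hg'.continuous
  have ce' := he'.continuous
  have b1 := continuous_flatBracket hg' he'
  have b2 := continuous_flatBracket he' hf
  have b3 := continuous_flatBracket hf hg
  have b4 := continuous_flatBracket hg he'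
  have b5 := continuous_flatBracket hg he
  have add2 : ∀ {u v : ℝ × ℝ → ℝ}, Continuous u → Continuous v →
      ∫ s in (0 : ℝ)..Real.pi, ∫ t in (0 : ℝ)..Real.pi, (u (s, t) + v (s, t)) =
      (∫ s in (0 : ℝ)..Real.pi, ∫ t in (0 : ℝ)..Real.pi, u (s, t)) +
      ∫ s in (0 : ℝ)..Real.pi, ∫ t in (0 : ℝ)..Real.pi, v (s, t) := by
    intro u v cu cv
    rw [← intervalIntegral.integral_add]
    · congr 1; funext s
      exact intervalIntegral.integral_add (Continuous.intervalIntegrable (by fun_prop) _ _)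
        (Continuous.intervalIntegrable (by fun_prop) _ _)
    · exact (continuous_inner_integral (F := fun s t => u (s, t))
        (by unfold Function.uncurry; fun_prop) _ _).intervalIntegrable _ _
    · exact (continuous_inner_integral (F := fun s t => v (s, t))
        (by unfold Function.uncurry; fun_prop) _ _).intervalIntegrable _ _
  have e1 := integral_mul_flatBracket hf (hg'.sub hg) he' pf (pg'.sub pg) pe'
  have e2 := integral_mul_flatBracket hf hg (he'.sub he) pf pg (pe'.sub pe)
  have e3 := integral_mul_flatBracket hg (he'.sub he) hf pg (pe'.sub pe) pf
  rw [e3] at e2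
  change ∫ s in (0 : ℝ)..Real.pi, ∫ t in (0 : ℝ)..Real.pi, f (s, t) *
    flatBracket (fun q => g' q - g q) e' (s, t) = ∫ s in (0 : ℝ)..Real.pi, ∫ t in (0 : ℝ)..Real.pi,
      (g' (s, t) - g (s, t)) * flatBracket e' f (s, t) at e1
  change ∫ s in (0 : ℝ)..Real.pi, ∫ t in (0 : ℝ)..Real.pi, f (s, t) *
    flatBracket g (fun q => e' q - e q) (s, t) = ∫ s in (0 : ℝ)..Real.pi, ∫ t in (0 : ℝ)..Real.pi,
      (e' (s, t) - e (s, t)) * flatBracket f g (s, t) at e2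
  simp only [flatBracket_sub_left hg hg'] at e1
  simp only [flatBracket_sub_right he he'] at e2
  rw [add2 (u := fun q => (f' q - f q) * flatBracket g' e' q + (g' q - g q) * flatBracket e' f q)
    (v := fun q => (e' q - e q) * flatBracket f g q) (by fun_prop) (by fun_prop),
    add2 (u := fun q => (f' q - f q) * flatBracket g' e' q)
    (v := fun q => (g' q - g q) * flatBracket e' f q) (by fun_prop) (by fun_prop), ← e1, ← e2,
    ← add2 (u := fun q => (f' q - f q) * flatBracket g' e' q)
    (v := fun q => f q * (flatBracket g' e' q - flatBracket g e' q)) (by fun_prop) (by fun_prop),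
    ← add2 (u := fun q => (f' q - f q) * flatBracket g' e' q +
      f q * (flatBracket g' e' q - flatBracket g e' q))
    (v := fun q => f q * (flatBracket g e' q - flatBracket g e q)) (by fun_prop) (by fun_prop),
    sub_eq_iff_eq_add,
    ← add2 (u := fun q => ((f' q - f q) * flatBracket g' e' q +
      f q * (flatBracket g' e' q - flatBracket g e' q)) +
      f q * (flatBracket g e' q - flatBracket g e q))
    (v := fun q => f q * flatBracket g e q) (by fun_prop) (by fun_prop)]
  congr 1; funext s; congr 1; funext t
  ring

/-- Stokes' theorem `∫ da ∧ db ∧ dc = ∫ a db ∧ dc` on the product of the torus and an interval,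
for `C¹` functions. -/
theorem flat_stokes (ha : ContDiff ℝ 1 a) (hb : ContDiff ℝ 1 b) (hc : ContDiff ℝ 1 c)
    (pa : ∀ τ, IsDoublyPeriodic (slice a τ)) (pb : ∀ τ, IsDoublyPeriodic (slice b τ))
    (pc : ∀ τ, IsDoublyPeriodic (slice c τ)) (T : ℝ) :
    ∫ s in (0 : ℝ)..Real.pi, ∫ t in (0 : ℝ)..Real.pi, ∫ τ in (0 : ℝ)..T, flatJac a b c ((s, t), τ) =
      ∫ s in (0 : ℝ)..Real.pi, ∫ t in (0 : ℝ)..Real.pi,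
        (a ((s, t), T) * flatBracket (slice b T) (slice c T) (s, t) -
          a ((s, t), 0) * flatBracket (slice b 0) (slice c 0) (s, t)) := by
  have cJ := continuous_flatJac ha hb hc
  set Ψ : ℝ → ℝ := fun τ => ∫ s in (0 : ℝ)..Real.pi, ∫ t in (0 : ℝ)..Real.pi,
    slice a τ (s, t) * flatBracket (slice b τ) (slice c τ) (s, t) with hΨ
  set D : ℝ → ℝ := fun τ => ∫ s in (0 : ℝ)..Real.pi, ∫ t in (0 : ℝ)..Real.pi,
    flatJac a b c ((s, t), τ) with hD
  have cD : Continuous D := continuous_double_integral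
    (F := fun τ s t => flatJac a b c ((s, t), τ)) (by fun_prop) _ _ _ _
  have dΨ : ∀ τ, HasDerivAt Ψ (D τ) τ := by
    intro τ
    set Λ : ℝ → ℝ := fun x => ∫ s in (0 : ℝ)..Real.pi, ∫ t in (0 : ℝ)..Real.pi,
      (divDiff a (0, 1) ((s, t), τ) (x - τ) * flatBracket (slice b x) (slice c x) (s, t) +
        divDiff b (0, 1) ((s, t), τ) (x - τ) * flatBracket (slice c x) (slice a τ) (s, t) +
        divDiff c (0, 1) ((s, t), τ) (x - τ) * flatBracket (slice a τ) (slice b τ) (s, t)) with hΛ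
    have cΛ : Continuous Λ := by
      apply continuous_double_integral (F := fun x s t =>
        (divDiff a (0, 1) ((s, t), τ) (x - τ) * flatBracket (slice b x) (slice c x) (s, t) +
        divDiff b (0, 1) ((s, t), τ) (x - τ) * flatBracket (slice c x) (slice a τ) (s, t) +
        divDiff c (0, 1) ((s, t), τ) (x - τ) * flatBracket (slice a τ) (slice b τ) (s, t)))
      have w : Continuous fun z : ℝ × ℝ × ℝ => ((((z.2.1, z.2.2) : ℝ × ℝ), τ), z.1 - τ) := by
        fun_prop
      have d1 := (continuous_divDiff ha (0, 1)).comp w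
      have d2 := (continuous_divDiff hb (0, 1)).comp w
      have d3 := (continuous_divDiff hc (0, 1)).comp w
      have w2 : Continuous fun z : ℝ × ℝ × ℝ => (((z.2.1, z.2.2) : ℝ × ℝ), z.1) := by fun_prop
      have b1 := (continuous_flatBracket_slice hb hc).comp w2
      have b3 := (continuous_flatBracket (contDiff_slice ha τ) (contDiff_slice hb τ)).comp
        (by fun_prop : Continuous fun z : ℝ × ℝ × ℝ => ((z.2.1, z.2.2) : ℝ × ℝ))
      have b2 : Continuous fun z : ℝ × ℝ × ℝ =>
          flatBracket (slice c z.1) (slice a τ) (z.2.1, z.2.2) := by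
        have cc := hc.continuous_fderiv one_ne_zero
        have ca := ha.continuous_fderiv one_ne_zero
        simp only [flatBracket, fderiv_slice hc, fderiv_slice ha]
        fun_prop
      simp only [Function.comp_def] at d1 d2 d3 b1 b3
      exact ((d1.mul b1).add (d2.mul b2)).add (d3.mul b3)
    have Λτ : Λ τ = D τ := by
      simp only [hΛ, hD, flatJac, sub_self, divDiff_zero]
    have key : ∀ x, Ψ x - Ψ τ = (x - τ) * Λ x := by
      intro x
      have h := integral_mul_flatBracket_sub (contDiff_slice ha τ) (contDiff_slice hb τ)
        (contDiff_slice hc τ) (contDiff_slice ha x) (contDiff_slice hb x) (contDiff_slice hc x)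
        (pa τ) (pb τ) (pc τ) (pb x) (pc x)
      rw [hΨ]
      simp only
      rw [h, hΛ]
      simp only [← intervalIntegral.integral_const_mul]
      congr 1; funext s; congr 1; funext t
      have e : ∀ {f : (ℝ × ℝ) × ℝ → ℝ}, ContDiff ℝ 1 f →
          slice f x (s, t) - slice f τ (s, t) = (x - τ) * divDiff f (0, 1) ((s, t), τ) (x - τ) := by
        intro f hf
        rw [mul_divDiff hf]
        simp [slice]
      rw [e ha, e hb, e hc]
      ring
    rw [hasDerivAt_iff_tendsto_slope, ← Λτ]
    refine ((cΛ.tendsto τ).mono_left (nhdsWithin_le_nhds (s := {τ}ᶜ))).congr' ?_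
    filter_upwards [self_mem_nhdsWithin] with x hx
    have hx' : x - τ ≠ 0 := sub_ne_zero.2 hx
    rw [slope_def_field, key x]
    field_simp
  have h := intervalIntegral.integral_eq_sub_of_hasDerivAt (a := 0) (b := T) (fun τ _ => dΨ τ)
    (cD.intervalIntegrable _ _)
  have e1 : ∫ s in (0 : ℝ)..Real.pi, ∫ t in (0 : ℝ)..Real.pi,
      (a ((s, t), T) * flatBracket (slice b T) (slice c T) (s, t) -
        a ((s, t), 0) * flatBracket (slice b 0) (slice c 0) (s, t)) = Ψ T - Ψ 0 := by
    have k : ∀ τ, Continuous fun q => slice a τ q * flatBracket (slice b τ) (slice c τ) q :=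
      fun τ => (contDiff_slice ha τ).continuous.mul
        (continuous_flatBracket (contDiff_slice hb τ) (contDiff_slice hc τ))
    rw [hΨ]
    simp only
    rw [← intervalIntegral.integral_sub]
    · congr 1; funext s
      exact intervalIntegral.integral_sub
        (((k T).comp (by fun_prop : Continuous fun t : ℝ => (s, t))).intervalIntegrable _ _)
        (((k 0).comp (by fun_prop : Continuous fun t : ℝ => (s, t))).intervalIntegrable _ _)
    · exact (continuous_inner_integral (F := fun s t => slice a T (s, t) *
        flatBracket (slice b T) (slice c T) (s, t)) (k T) _ _).intervalIntegrable _ _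
    · exact (continuous_inner_integral (F := fun s t => slice a 0 (s, t) *
        flatBracket (slice b 0) (slice c 0) (s, t)) (k 0) _ _).intervalIntegrable _ _
  rw [e1, ← h, hD]
  have c2 : Continuous fun z : ℝ × ℝ => ∫ t in (0 : ℝ)..Real.pi, flatJac a b c ((z.2, t), z.1) :=
    intervalIntegral.continuous_parametric_intervalIntegral_of_continuous'
      (f := fun (z : ℝ × ℝ) t => flatJac a b c ((z.2, t), z.1))
      (by unfold Function.uncurry; fun_prop) _ _
  rw [integral_swap_continuous (F := fun τ s => ∫ t in (0 : ℝ)..Real.pi, flatJac a b c ((s, t), τ))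
    c2]
  congr 1; funext s
  rw [integral_swap_continuous (F := fun t τ => flatJac a b c ((s, t), τ))
    (by unfold Function.uncurry; fun_prop)]

end Flat

/-- A path of `C¹` functions on the annulus, constant outside the set `K`. -/
structure IsPath {E : Type*} [NormedAddCommGroup E] [NormedSpace ℝ E] (K : Set Annulus)
    (a : Annulus → ℝ → E) : Prop where
  regular : ContDiffOn ℝ 1 (fun z : (ℝ × ℝ) × ℝ => toCover (fun p => a p z.2) z.1)
    (coverSet ×ˢ univ)
  const : ∀ p ∉ K, ∀ τ, a p τ = a p 0

/-- The bracket `f_0 g_1 - f_1 g_0`, that is, the coefficient of `df ∧ dg`. -/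
def bracket (f g : Annulus → ℝ) (p : Annulus) : ℝ := pd 0 f p * pd 1 g p - pd 1 f p * pd 0 g p

/-- The coefficient of `da ∧ db ∧ dc` in the frame `(v₁, v₂, ∂/∂τ)`. -/
def jac (a b c : Annulus → ℝ → ℝ) (p : Annulus) (τ : ℝ) : ℝ :=
  deriv (a p) τ * bracket (fun x => b x τ) (fun x => c x τ) p +
    deriv (b p) τ * bracket (fun x => c x τ) (fun x => a x τ) p +
    deriv (c p) τ * bracket (fun x => a x τ) (fun x => b x τ) p

/-- The Stokes formula `∫ ω = ∫ β` for a family `ω` of `2`-forms on the annulus with parameter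
in `[0, T]`, and a `2`-form `β`. -/
structure HasStokes (T : ℝ) (ω : Annulus → ℝ → ℝ) (β : Annulus → ℝ) : Prop where
  inner : ∀ p, IntervalIntegrable (ω p) volume 0 T
  left : Integrable (fun p => ∫ τ in (0 : ℝ)..T, ω p τ)
  right : Integrable β
  eq : ∫ p, ∫ τ in (0 : ℝ)..T, ω p τ = ∫ p, β p

namespace HasStokes

variable {T : ℝ} {ω ω' : Annulus → ℝ → ℝ} {β β' : Annulus → ℝ}

theorem const_mul (H : HasStokes T ω β) (r : ℝ) :
    HasStokes T (fun p τ => r * ω p τ) (fun p => r * β p) := by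
  refine ⟨fun p => (H.inner p).const_mul r, ?_, H.right.const_mul r, ?_⟩
  · simp only [intervalIntegral.integral_const_mul]; exact H.left.const_mul r
  · simp only [intervalIntegral.integral_const_mul]
    rw [integral_const_mul, integral_const_mul, H.eq]

theorem congr (H : HasStokes T ω β) (hω : ∀ p τ, ω p τ = ω' p τ) (hβ : ∀ p, β p = β' p) :
    HasStokes T ω' β' := by
  obtain rfl : ω = ω' := funext fun p => funext (hω p)
  obtain rfl : β = β' := funext hβ
  exact H

theorem sub (H : HasStokes T ω β) (H' : HasStokes T ω' β') :
    HasStokes T (fun p τ => ω p τ - ω' p τ) (fun p => β p - β' p) := by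
  have e : ∀ p, ∫ τ in (0 : ℝ)..T, (ω p τ - ω' p τ) =
      (∫ τ in (0 : ℝ)..T, ω p τ) - ∫ τ in (0 : ℝ)..T, ω' p τ := fun p =>
    intervalIntegral.integral_sub (H.inner p) (H'.inner p)
  refine ⟨fun p => (H.inner p).sub (H'.inner p), ?_, H.right.sub H'.right, ?_⟩
  · simp only [e]; exact H.left.sub H'.left
  · simp only [e]
    rw [integral_sub H.left H'.left, integral_sub H.right H'.right, H.eq, H'.eq]

theorem sum {ι : Type*} (s : Finset ι) {ω : ι → Annulus → ℝ → ℝ} {β : ι → Annulus → ℝ}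
    (H : ∀ i ∈ s, HasStokes T (ω i) (β i)) :
    HasStokes T (fun p τ => ∑ i ∈ s, ω i p τ) (fun p => ∑ i ∈ s, β i p) := by
  have e : ∀ p, ∫ τ in (0 : ℝ)..T, ∑ i ∈ s, ω i p τ = ∑ i ∈ s, ∫ τ in (0 : ℝ)..T, ω i p τ :=
    fun p => intervalIntegral.integral_finsetSum fun i hi => (H i hi).inner p
  refine ⟨fun p => ?_, ?_, integrable_finsetSum _ fun i hi => (H i hi).right, ?_⟩
  · have := IntervalIntegrable.sum s fun i hi => (H i hi).inner p
    exact this.congr fun τ _ => by simp [Finset.sum_apply]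
  · simp only [e]; exact integrable_finsetSum _ fun i hi => (H i hi).left
  · simp only [e]
    rw [integral_finsetSum _ fun i hi => (H i hi).left,
      integral_finsetSum _ fun i hi => (H i hi).right]
    exact Finset.sum_congr rfl fun i hi => (H i hi).eq

end HasStokes

/-- A smooth cutoff in a neighbourhood of the diagonal of the torus. -/
def cutoff (m : ℝ) (q : ℝ × ℝ) : ℝ :=
  Real.smoothTransition ((Real.sin (q.1 - q.2) ^ 2 - m / 4) / (m / 4))

/-- A path of functions cut off near the ends of the annulus, read on the torus. -/
def flatten (m : ℝ) (a : Annulus → ℝ → ℝ) (z : (ℝ × ℝ) × ℝ) : ℝ :=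
  cutoff m z.1 * toCover (fun p => a p z.2) z.1

section Path

variable {K : Set Annulus} {a b c : Annulus → ℝ → ℝ} {m : ℝ}

theorem contDiff_flatten (hm : 0 < m) (ha : IsPath K a) : ContDiff ℝ 1 (flatten m a) := by
  rw [contDiff_iff_contDiffAt]
  rintro ⟨q, τ⟩
  by_cases hq : q ∈ coverSet
  · have h1 : ContDiffAt ℝ 1 (fun z : (ℝ × ℝ) × ℝ => toCover (fun p => a p z.2) z.1) (q, τ) :=
      ha.regular.contDiffAt ((isOpen_coverSet.prod isOpen_univ).mem_nhds ⟨hq, trivial⟩)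
    have h2 : ContDiff ℝ 1 fun z : (ℝ × ℝ) × ℝ => cutoff m z.1 := by
      unfold cutoff
      have := (Real.smoothTransition.contDiff (n := 1))
      refine this.comp ?_
      have hs : ContDiff ℝ 1 fun z : (ℝ × ℝ) × ℝ => Real.sin (z.1.1 - z.1.2) :=
        Real.contDiff_sin.comp (by fun_prop)
      exact ((hs.pow 2).sub contDiff_const).div_const _
    exact h2.contDiffAt.mul h1
  · have h0 : Real.sin (q.1 - q.2) = 0 := by
      by_contra h; exact hq (mem_coverSet_iff.2 h)
    have ev : flatten m a =ᶠ[𝓝 (q, τ)] fun _ => 0 := by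
      have cs : Continuous fun z : (ℝ × ℝ) × ℝ => Real.sin (z.1.1 - z.1.2) ^ 2 := by fun_prop
      have := cs.tendsto (q, τ)
      simp only [h0, ne_eq, OfNat.ofNat_ne_zero, not_false_eq_true, zero_pow] at this
      filter_upwards [this.eventually_lt_const (show 0 < m / 4 by positivity)] with z hz
      unfold flatten cutoff
      rw [Real.smoothTransition.zero_of_nonpos, zero_mul]
      exact div_nonpos_of_nonpos_of_nonneg (by linarith) (by positivity)
    exact contDiffAt_const.congr_of_eventuallyEq ev

theorem isDoublyPeriodic_flatten (a : Annulus → ℝ → ℝ) (τ : ℝ) :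
    IsDoublyPeriodic (slice (flatten m a) τ) := by
  intro s t
  have e1 := toCover_add_int (fun p => a p τ) s t 1 0
  have e2 := toCover_add_int (fun p => a p τ) s t 0 1
  simp only [Int.cast_one, one_mul, Int.cast_zero, zero_mul, add_zero] at e1 e2
  have c1 : cutoff m (s + Real.pi, t) = cutoff m (s, t) := by
    unfold cutoff
    have : s + Real.pi - t = s - t + Real.pi := by ring
    simp only [this, Real.sin_add_pi, neg_sq]
  have c2 : cutoff m (s, t + Real.pi) = cutoff m (s, t) := by
    unfold cutoff
    have : s - (t + Real.pi) = s - t - Real.pi := by ring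
    simp only [this, Real.sin_sub_pi, neg_sq]
  simp only [slice, flatten, e1, e2, c1, c2, and_self]

theorem cutoff_eq_one (hm : 0 < m) {q : ℝ × ℝ} (hq : m / 2 ≤ Real.sin (q.1 - q.2) ^ 2) :
    cutoff m q = 1 := by
  unfold cutoff
  refine Real.smoothTransition.one_of_one_le ?_
  rw [le_div_iff₀ (by positivity)]
  linarith

theorem IsPath.isCn {E : Type*} [NormedAddCommGroup E] [NormedSpace ℝ E] {a : Annulus → ℝ → E}
    (ha : IsPath K a) (τ : ℝ) : IsCn 1 (fun p => a p τ) :=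
  ha.regular.comp (f := fun q : ℝ × ℝ => (q, τ)) (contDiff_id.prodMk contDiff_const).contDiffOn
    fun _ hq => ⟨hq, trivial⟩

/-- In the region where the cutoff is `1`. -/
theorem slice_flatten_eventuallyEq (hm : 0 < m) (a : Annulus → ℝ → ℝ) {q : ℝ × ℝ}
    (hq : m / 2 < Real.sin (q.1 - q.2) ^ 2) (τ : ℝ) :
    slice (flatten m a) τ =ᶠ[𝓝 q] toCover (fun p => a p τ) := by
  have cs : Continuous fun q : ℝ × ℝ => Real.sin (q.1 - q.2) ^ 2 := by fun_prop
  filter_upwards [cs.continuousAt.eventually_const_lt hq] with x hx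
  unfold slice flatten
  rw [cutoff_eq_one hm hx.le, one_mul]

theorem flatBracket_flatten (hm : 0 < m) (a b : Annulus → ℝ → ℝ) {q : ℝ × ℝ} (hq : q ∈ coverSet)
    (hq' : m / 2 < Real.sin (q.1 - q.2) ^ 2) (τ : ℝ) :
    flatBracket (slice (flatten m a) τ) (slice (flatten m b) τ) q =
      bracket (fun x => a x τ) (fun x => b x τ) (proj q) := by
  unfold flatBracket bracket
  rw [(slice_flatten_eventuallyEq hm a hq' τ).fderiv_eq,
    (slice_flatten_eventuallyEq hm b hq' τ).fderiv_eq]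
  have e : ∀ (f : Annulus → ℝ) (i : Fin 2), pd i f (proj q) = fderiv ℝ (toCover f) q (frame i) :=
    fun f i => by rw [← toCover_pd i f hq, toCover_eq _ hq]
  rw [e, e, e, e]
  simp [frame]

theorem fderiv_flatten_time (hm : 0 < m) (ha : IsPath K a) (q : ℝ × ℝ) (τ : ℝ) :
    fderiv ℝ (flatten m a) (q, τ) (0, 1) = deriv (fun τ => flatten m a (q, τ)) τ := by
  have h1 : HasDerivAt (fun τ : ℝ => (q, τ)) ((0 : ℝ × ℝ), (1 : ℝ)) τ :=
    (hasDerivAt_const τ q).prodMk (hasDerivAt_id τ)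
  have := ((contDiff_flatten hm ha).differentiable one_ne_zero (q, τ)).hasFDerivAt.comp_hasDerivAt
    τ h1
  exact this.deriv.symm

theorem flatJac_flatten (hm : 0 < m) (hK : ∀ p ∈ K, m ≤ sinSq p) (ha : IsPath K a)
    (hb : IsPath K b) (hc : IsPath K c) {q : ℝ × ℝ} (hq : q ∈ coverSet) (τ : ℝ) :
    flatJac (flatten m a) (flatten m b) (flatten m c) (q, τ) = jac a b c (proj q) τ := by
  unfold flatJac jac
  rw [fderiv_flatten_time hm ha, fderiv_flatten_time hm hb, fderiv_flatten_time hm hc]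
  rcases lt_or_ge (m / 2) (Real.sin (q.1 - q.2) ^ 2) with h | h
  · have e : ∀ a : Annulus → ℝ → ℝ, (fun τ => flatten m a (q, τ)) = a (proj q) := fun a => by
      funext τ
      unfold flatten
      simp only
      rw [cutoff_eq_one hm h.le, one_mul, toCover_eq _ hq]
    simp only [e, flatBracket_flatten hm _ _ hq h]
  · have hn : proj q ∉ K := fun hp => by
      have := hK _ hp
      rw [sinSq_of_over (over_proj hq)] at this
      linarith
    have e1 : ∀ {a : Annulus → ℝ → ℝ}, IsPath K a → deriv (a (proj q)) τ = 0 := fun {a} ha => by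
      rw [show a (proj q) = fun _ => a (proj q) 0 from funext (ha.const _ hn)]
      exact deriv_const _ _
    have e2 : ∀ {a : Annulus → ℝ → ℝ}, IsPath K a → deriv (fun τ => flatten m a (q, τ)) τ = 0 :=
      fun {a} ha => by
        have : (fun τ => flatten m a (q, τ)) = fun _ => flatten m a (q, 0) := by
          funext x
          unfold flatten
          simp only
          rw [toCover_eq _ hq, toCover_eq _ hq, ha.const _ hn x]
        rw [this]
        exact deriv_const _ _
    simp only [e1 ha, e1 hb, e1 hc, e2 ha, e2 hb, e2 hc, zero_mul]

/-- The integral of a function on the annulus that extends continuously to the torus. -/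
theorem integral_of_torus {f : Annulus → ℝ} {G : ℝ × ℝ → ℝ} (hG : Continuous G)
    (pG : IsDoublyPeriodic G) (h : ∀ q ∈ coverSet, toCover f q = G q) :
    Integrable f ∧ ∫ p, f p = ∫ s in (0 : ℝ)..Real.pi, ∫ t in (0 : ℝ)..Real.pi, G (s, t) := by
  have hf : Continuous f := continuous_of_continuousOn_toCover (hG.continuousOn.congr h)
  have hπ := Real.pi_pos
  constructor
  · obtain ⟨C, hC⟩ := exists_bound_periodic hG
    exact integrable_of_bounded hf (abs_le_of_strip fun s hs d hd => by
      rw [h _ (strip_mem hd.1 hd.2)]; exact hC s hs d hd)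
  · rw [integral_annulus hf, ← integral_torus hG fun s t => (pG s t).2,
      integral_swap_continuous (F := fun x s => G (s, s + x)) (by unfold Function.uncurry; fun_prop),
      ← setIntegral_rect hπ.le hπ.le (F := fun s x => G (s, s + x))
        (by unfold Function.uncurry; fun_prop)]
    have e : ∫ x in Ioc 0 Real.pi ×ˢ Ioo 0 Real.pi, toCover f (x.1, x.1 + x.2) =
        ∫ x in Ioc 0 Real.pi ×ˢ Ioo 0 Real.pi, G (x.1, x.1 + x.2) :=
      setIntegral_congr_fun (measurableSet_Ioc.prod measurableSet_Ioo)
        fun x hx => h _ (strip_mem hx.2.1 hx.2.2)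
    rw [e]
    refine setIntegral_congr_set ?_
    rw [Measure.volume_eq_prod]
    exact Measure.set_prod_ae_eq (ae_eq_refl _) Ioo_ae_eq_Ioc

theorem der_congr {f f' : Annulus → ℝ} {p : Annulus} (h : f =ᶠ[𝓝 p] f') : der f p = der f' p := by
  unfold der
  refine Filter.EventuallyEq.fderiv_eq ?_
  have ht : Tendsto proj (𝓝 (rep p)) (𝓝 p) := by
    have := (continuousOn_proj.continuousAt (isOpen_coverSet.mem_nhds (rep_mem p))).tendsto
    rwa [proj_rep] at this
  filter_upwards [ht.eventually h, isOpen_coverSet.mem_nhds (rep_mem p)] with q hq hm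
  rw [toCover_eq _ hm, toCover_eq _ hm, hq]

theorem bracket_congr {f f' g g' : Annulus → ℝ} {p : Annulus}
    (hf : f =ᶠ[𝓝 p] f') (hg : g =ᶠ[𝓝 p] g') : bracket f g p = bracket f' g' p := by
  unfold bracket pd
  rw [der_congr hf, der_congr hg]

/-- Stokes' theorem for paths of `C¹` functions on the annulus. -/
theorem hasStokes_jac (hKc : IsCompact K) (ha : IsPath K a) (hb : IsPath K b) (hc : IsPath K c)
    (T : ℝ) : HasStokes T (jac a b c) fun p =>
      a p T * bracket (fun x => b x T) (fun x => c x T) p -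
        a p 0 * bracket (fun x => b x 0) (fun x => c x 0) p := by
  obtain ⟨m, hm, hK⟩ : ∃ m > 0, ∀ p ∈ K, m ≤ sinSq p := by
    rcases K.eq_empty_or_nonempty with rfl | hne
    · exact ⟨1, one_pos, by simp⟩
    · obtain ⟨p, -, hp⟩ := hKc.exists_isMinOn hne continuous_sinSq.continuousOn
      exact ⟨sinSq p, sinSq_pos p, fun q hq => hp hq⟩
  have fa := contDiff_flatten hm ha
  have fb := contDiff_flatten hm hb
  have fc := contDiff_flatten hm hc
  have cJ := continuous_flatJac fa fb fc
  have hJ : ∀ p τ, jac a b c p τ = flatJac (flatten m a) (flatten m b) (flatten m c) (rep p, τ) :=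
    fun p τ => by rw [flatJac_flatten hm hK ha hb hc (rep_mem p), proj_rep]
  have pa := isDoublyPeriodic_flatten (m := m) a
  have pb := isDoublyPeriodic_flatten (m := m) b
  have pc := isDoublyPeriodic_flatten (m := m) c
  have cB : ∀ τ, Continuous fun q => slice (flatten m a) τ q *
      flatBracket (slice (flatten m b) τ) (slice (flatten m c) τ) q := fun τ =>
    (contDiff_slice fa τ).continuous.mul
      (continuous_flatBracket (contDiff_slice fb τ) (contDiff_slice fc τ))
  have pB : ∀ τ, IsDoublyPeriodic fun q => slice (flatten m a) τ q *
      flatBracket (slice (flatten m b) τ) (slice (flatten m c) τ) q := fun τ =>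
    (pa τ).mul ((((pb τ).fderiv (0, 1)).mul ((pc τ).fderiv (1, 0))).sub
      (((pb τ).fderiv (1, 0)).mul ((pc τ).fderiv (0, 1))))
  have slide : ∀ {a : (ℝ × ℝ) × ℝ → ℝ}, ContDiff ℝ 1 a → (∀ τ, IsDoublyPeriodic (slice a τ)) →
      ∀ τ, IsDoublyPeriodic fun q => fderiv ℝ a (q, τ) (0, 1) := by
    intro a ha pa τ s t
    have h1 : ∀ q, fderiv ℝ a (q, τ) (0, 1) = deriv (fun x => slice a x q) τ := fun q => by
      have h1 : HasDerivAt (fun τ : ℝ => (q, τ)) ((0 : ℝ × ℝ), (1 : ℝ)) τ :=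
        (hasDerivAt_const τ q).prodMk (hasDerivAt_id τ)
      exact ((ha.differentiable one_ne_zero (q, τ)).hasFDerivAt.comp_hasDerivAt τ h1).deriv.symm
    simp only [h1, (pa _ s t).1, (pa _ s t).2, and_self]
  have pJ : ∀ τ, IsDoublyPeriodic fun q =>
      flatJac (flatten m a) (flatten m b) (flatten m c) (q, τ) := by
    intro τ
    have br : ∀ {f g : ℝ × ℝ → ℝ}, IsDoublyPeriodic f → IsDoublyPeriodic g →
        IsDoublyPeriodic (flatBracket f g) := fun hf hg =>
      ((hf.fderiv (0, 1)).mul (hg.fderiv (1, 0))).sub ((hf.fderiv (1, 0)).mul (hg.fderiv (0, 1)))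
    intro s t
    unfold flatJac
    simp only [(slide fa pa τ s t).1, (slide fb pb τ s t).1, (slide fc pc τ s t).1,
      (slide fa pa τ s t).2, (slide fb pb τ s t).2, (slide fc pc τ s t).2,
      (br (pb τ) (pc τ) s t).1, (br (pc τ) (pa τ) s t).1, (br (pa τ) (pb τ) s t).1,
      (br (pb τ) (pc τ) s t).2, (br (pc τ) (pa τ) s t).2, (br (pa τ) (pb τ) s t).2, and_self]
  have L := integral_of_torus (f := fun p => ∫ τ in (0 : ℝ)..T, jac a b c p τ)
    (G := fun q => ∫ τ in (0 : ℝ)..T, flatJac (flatten m a) (flatten m b) (flatten m c) (q, τ))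
    (intervalIntegral.continuous_parametric_intervalIntegral_of_continuous'
      (f := fun q τ => flatJac (flatten m a) (flatten m b) (flatten m c) (q, τ)) cJ 0 T)
    (fun s t => by simp only [(pJ _ s t).1, (pJ _ s t).2, and_self])
    (fun q hq => by
      rw [toCover_eq _ hq]
      simp only [flatJac_flatten hm hK ha hb hc hq])
  have R := integral_of_torus (f := fun p => a p T * bracket (fun x => b x T) (fun x => c x T) p -
        a p 0 * bracket (fun x => b x 0) (fun x => c x 0) p)
    ((cB T).sub (cB 0)) ((pB T).sub (pB 0)) (fun q hq => by
      rw [toCover_eq _ hq]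
      rcases lt_or_ge (m / 2) (Real.sin (q.1 - q.2) ^ 2) with h | h
      · rw [Pi.sub_apply, flatBracket_flatten hm _ _ hq h, flatBracket_flatten hm _ _ hq h]
        unfold slice flatten
        rw [cutoff_eq_one hm h.le, one_mul, one_mul, toCover_eq _ hq, toCover_eq _ hq]
      · -- both sides vanish outside `K`
        have hn : ∀ x : Annulus, sinSq x < m → x ∉ K := fun x hx hp => by
          have := hK _ hp
          linarith
        have hlt : Real.sin (q.1 - q.2) ^ 2 < m := by linarith
        have near : ∀ᶠ x in 𝓝 (proj q), sinSq x < m :=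
          continuous_sinSq.continuousAt.eventually_lt_const
            (by rw [sinSq_of_over (over_proj hq)]; exact hlt)
        have hev : ∀ {a : Annulus → ℝ → ℝ}, IsPath K a →
            (fun x => a x T) =ᶠ[𝓝 (proj q)] fun x => a x 0 := fun ha => by
          filter_upwards [near] with x hx using ha.const x (hn x hx) T
        have cs : Continuous fun q : ℝ × ℝ => Real.sin (q.1 - q.2) ^ 2 := by fun_prop
        have fev : ∀ {a : Annulus → ℝ → ℝ}, IsPath K a →
            slice (flatten m a) T =ᶠ[𝓝 q] slice (flatten m a) 0 := fun {a} ha => by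
          filter_upwards [cs.continuousAt.eventually_lt_const hlt,
            isOpen_coverSet.mem_nhds hq] with x hx hm'
          unfold slice flatten
          simp only
          rw [toCover_eq _ hm', toCover_eq _ hm', ha.const _ (hn _ ?_) T]
          rw [sinSq_of_over (over_proj hm')]; exact hx
        have e : a (proj q) T = a (proj q) 0 := (hev ha).self_of_nhds
        have e' : slice (flatten m a) T q = slice (flatten m a) 0 q := (fev ha).self_of_nhds
        rw [bracket_congr (hev hb) (hev hc), e, Pi.sub_apply]
        unfold flatBracket
        rw [(fev hb).fderiv_eq, (fev hc).fderiv_eq, e']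
        ring)
  refine ⟨fun p => ?_, L.1, R.1, ?_⟩
  · rw [show jac a b c p = fun τ => flatJac (flatten m a) (flatten m b) (flatten m c) (rep p, τ)
      from funext (hJ p)]
    exact (cJ.comp (by fun_prop : Continuous fun τ : ℝ => (rep p, τ))).intervalIntegrable _ _
  · rw [L.2, R.2]
    exact flat_stokes fa fb fc pa pb pc T

end Path

/-! ### The volume form of the quadric `{q = -1}` -/

theorem det4_expand (a b c d : W) : det4 a b c d =
    a 0 * (b 1 * (c 2 * d 3 - c 3 * d 2) - b 2 * (c 1 * d 3 - c 3 * d 1)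
      + b 3 * (c 1 * d 2 - c 2 * d 1))
    - a 1 * (b 0 * (c 2 * d 3 - c 3 * d 2) - b 2 * (c 0 * d 3 - c 3 * d 0)
      + b 3 * (c 0 * d 2 - c 2 * d 0))
    + a 2 * (b 0 * (c 1 * d 3 - c 3 * d 1) - b 1 * (c 0 * d 3 - c 3 * d 0)
      + b 3 * (c 0 * d 1 - c 1 * d 0))
    - a 3 * (b 0 * (c 1 * d 2 - c 2 * d 1) - b 1 * (c 0 * d 2 - c 2 * d 0)
      + b 2 * (c 0 * d 1 - c 1 * d 0)) := by
  simp [det4, Matrix.det_succ_row_zero, Fin.sum_univ_succ, Fin.succAbove]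
  ring

theorem det4_eq_sum (a b c d : W) : det4 a b c d =
    ∑ σ : Equiv.Perm (Fin 4), ((Equiv.Perm.sign σ : ℤ) : ℝ) *
      (a (σ 0) * b (σ 1) * c (σ 2) * d (σ 3)) := by
  rw [det4, ← Matrix.det_transpose, Matrix.det_apply']
  refine Finset.sum_congr rfl fun σ _ => ?_
  rw [Fin.prod_univ_four]
  rfl

namespace IsPath

variable {E F G : Type*} [NormedAddCommGroup E] [NormedSpace ℝ E] [NormedAddCommGroup F]
  [NormedSpace ℝ F] [NormedAddCommGroup G] [NormedSpace ℝ G] {K : Set Annulus}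
  {a : Annulus → ℝ → E} {b : Annulus → ℝ → F}

theorem comp_of_forall {f : E → G} (hf : ∀ p τ, ContDiffAt ℝ 1 f (a p τ)) (ha : IsPath K a) :
    IsPath K fun p τ => f (a p τ) := by
  refine ⟨fun z hz => ?_, fun p hp τ => by rw [ha.const p hp τ]⟩
  have h1 := hf (proj z.1) z.2
  rw [← toCover_eq (fun p => a p z.2) hz.1] at h1
  have := ContDiffAt.comp_contDiffWithinAt (g := f) z h1 (ha.regular z hz)
  refine this.congr (fun y hy => ?_) ?_
  · rw [toCover_eq _ hy.1, Function.comp_apply, toCover_eq _ hy.1]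
  · rw [toCover_eq _ hz.1, Function.comp_apply, toCover_eq _ hz.1]

theorem comp {f : E → G} (hf : ContDiff ℝ 1 f) (ha : IsPath K a) :
    IsPath K fun p τ => f (a p τ) :=
  comp_of_forall (fun _ _ => hf.contDiffAt) ha

theorem prodMk (ha : IsPath K a) (hb : IsPath K b) : IsPath K fun p τ => (a p τ, b p τ) := by
  refine ⟨(ha.regular.prodMk hb.regular).congr fun z hz => ?_,
    fun p hp τ => by rw [ha.const p hp τ, hb.const p hp τ]⟩
  rw [toCover_eq _ hz.1, toCover_eq _ hz.1, toCover_eq _ hz.1]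

theorem add {b : Annulus → ℝ → E} (ha : IsPath K a) (hb : IsPath K b) :
    IsPath K fun p τ => a p τ + b p τ :=
  (ha.prodMk hb).comp (f := fun z : E × E => z.1 + z.2) (by fun_prop)

theorem sub {b : Annulus → ℝ → E} (ha : IsPath K a) (hb : IsPath K b) :
    IsPath K fun p τ => a p τ - b p τ :=
  (ha.prodMk hb).comp (f := fun z : E × E => z.1 - z.2) (by fun_prop)

theorem smul {a : Annulus → ℝ → ℝ} {b : Annulus → ℝ → E} (ha : IsPath K a) (hb : IsPath K b) :
    IsPath K fun p τ => a p τ • b p τ :=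
  (ha.prodMk hb).comp (f := fun z : ℝ × E => z.1 • z.2) (by fun_prop)

variable {a b : Annulus → ℝ → ℝ}

theorem mul (ha : IsPath K a) (hb : IsPath K b) : IsPath K fun p τ => a p τ * b p τ :=
  (ha.prodMk hb).comp (f := fun z : ℝ × ℝ => z.1 * z.2) (by fun_prop)

theorem div (ha : IsPath K a) (hb : IsPath K b) (h : ∀ p τ, b p τ ≠ 0) :
    IsPath K fun p τ => a p τ / b p τ :=
  (ha.prodMk hb).comp_of_forall (f := fun z : ℝ × ℝ => z.1 / z.2)
    fun p τ => contDiffAt_fst.div contDiffAt_snd (h p τ)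

theorem differentiableAt {a : Annulus → ℝ → E} (ha : IsPath K a) (p : Annulus) (τ : ℝ) :
    DifferentiableAt ℝ (a p) τ := by
  have h : ContDiffAt ℝ 1 (fun z : (ℝ × ℝ) × ℝ => toCover (fun p => a p z.2) z.1) (rep p, τ) :=
    ha.regular.contDiffAt ((isOpen_coverSet.prod isOpen_univ).mem_nhds ⟨rep_mem p, trivial⟩)
  have h2 := (h.differentiableAt one_ne_zero).comp τ
    (f := fun τ : ℝ => (rep p, τ)) (by fun_prop)
  refine h2.congr_of_eventuallyEq (Eventually.of_forall fun x => ?_)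
  rw [Function.comp_apply, toCover_rep]

end IsPath

/-- The value on `(v₁, v₂, ∂/∂τ)` of the pull-back by a path `X` of the volume form of the
quadric `{q = -1}`. -/
def pathVol (X : Annulus → ℝ → W) (p : Annulus) (τ : ℝ) : ℝ :=
  det4 (X p τ) (pd 0 (fun x => X x τ) p) (pd 1 (fun x => X x τ) p) (deriv (X p) τ)

/-- A `2`-form whose differential is the volume form of the quadric `{q = -1}`, pulled back by
`Y`. With `P = x₀ + x₃`, `Q = x₁ - x₂`, `R = x₀ - x₃`, `S = x₁ + x₂`, the quadric is
`P² + Q² = R² + S² + 2`, on which the volume form is `½ (P dQ - Q dP) dR dS / (P² + Q²)`. -/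
def volPrimitive (Y : Annulus → W) (p : Annulus) : ℝ :=
  (1 / 2) * ((Y p 0 - Y p 3) * (Y p 0 + Y p 3) / ((Y p 0 + Y p 3) ^ 2 + (Y p 1 - Y p 2) ^ 2) *
      bracket (fun x => Y x 1 + Y x 2) (fun x => Y x 1 - Y x 2) p
    - (Y p 0 - Y p 3) * (Y p 1 - Y p 2) / ((Y p 0 + Y p 3) ^ 2 + (Y p 1 - Y p 2) ^ 2) *
      bracket (fun x => Y x 1 + Y x 2) (fun x => Y x 0 + Y x 3) p)

/-- On the tangent spaces of the quadric `P² + Q² = R² + S² + 2`, the form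
`P dQ dR dS - Q dP dR dS + dP dQ (R dS - S dR)` is `2 (P dQ - Q dP) dR dS / (P² + Q²)`. -/
theorem quadric_vol_identity {P Q R S P0 P1 P2 Q0 Q1 Q2 R0 R1 R2 S0 S1 S2 θ0 θ1 θ2 : ℝ}
    (h : P ^ 2 + Q ^ 2 = R ^ 2 + S ^ 2 + 2) (h0 : P * P0 + Q * Q0 = R * R0 + S * S0)
    (h1 : P * P1 + Q * Q1 = R * R1 + S * S1) (h2 : P * P2 + Q * Q2 = R * R2 + S * S2)
    (e0 : θ0 = P * Q0 - Q * P0) (e1 : θ1 = P * Q1 - Q * P1) (e2 : θ2 = P * Q2 - Q * P2) :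
    (P ^ 2 + Q ^ 2) * (θ0 * (R1 * S2 - R2 * S1) + θ1 * (R2 * S0 - R0 * S2)
        + θ2 * (R0 * S1 - R1 * S0)
      + (P0 * Q1 - P1 * Q0) * (R * S2 - S * R2) + (P1 * Q2 - P2 * Q1) * (R * S0 - S * R0)
      + (P2 * Q0 - P0 * Q2) * (R * S1 - S * R1)) =
    2 * (θ0 * (R1 * S2 - R2 * S1) + θ1 * (R2 * S0 - R0 * S2) + θ2 * (R0 * S1 - R1 * S0)) := by
  subst e0 e1 e2
  linear_combination h * ((P * Q0 - Q * P0) * (R1 * S2 - R2 * S1)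
      + (P * Q1 - Q * P1) * (R2 * S0 - R0 * S2) + (P * Q2 - Q * P2) * (R0 * S1 - R1 * S0))
    + h0 * ((P * Q1 - Q * P1) * (R * S2 - S * R2) - (P * Q2 - Q * P2) * (R * S1 - S * R1))
    + h1 * ((P * Q2 - Q * P2) * (R * S0 - S * R0) - (P * Q0 - Q * P0) * (R * S2 - S * R2))
    + h2 * ((P * Q0 - Q * P0) * (R * S1 - S * R1) - (P * Q1 - Q * P1) * (R * S0 - S * R0))

/-- The form `d(R P / ρ) dS dQ - d(R Q / ρ) dS dP`, where `ρ = P² + Q²`, is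
`(P dQ - Q dP) dR dS / ρ`. -/
theorem quadric_primitive_identity {P Q R P0 P1 P2 Q0 Q1 Q2 R0 R1 R2 S0 S1 S2 : ℝ}
    {d0 d1 d2 e0 e1 e2 κ : ℝ} (hκ : (P ^ 2 + Q ^ 2) * κ = 1)
    (hd0 : d0 = (R0 * P + R * P0) * κ - R * P * (2 * (P * P0 + Q * Q0)) * κ ^ 2)
    (hd1 : d1 = (R1 * P + R * P1) * κ - R * P * (2 * (P * P1 + Q * Q1)) * κ ^ 2)
    (hd2 : d2 = (R2 * P + R * P2) * κ - R * P * (2 * (P * P2 + Q * Q2)) * κ ^ 2)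
    (he0 : e0 = (R0 * Q + R * Q0) * κ - R * Q * (2 * (P * P0 + Q * Q0)) * κ ^ 2)
    (he1 : e1 = (R1 * Q + R * Q1) * κ - R * Q * (2 * (P * P1 + Q * Q1)) * κ ^ 2)
    (he2 : e2 = (R2 * Q + R * Q2) * κ - R * Q * (2 * (P * P2 + Q * Q2)) * κ ^ 2) :
    (d2 * (S0 * Q1 - S1 * Q0) + S2 * (Q0 * d1 - Q1 * d0) + Q2 * (d0 * S1 - d1 * S0)) -
      (e2 * (S0 * P1 - S1 * P0) + S2 * (P0 * e1 - P1 * e0) + P2 * (e0 * S1 - e1 * S0)) =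
    κ * ((P * Q0 - Q * P0) * (R1 * S2 - R2 * S1) + (P * Q1 - Q * P1) * (R2 * S0 - R0 * S2)
      + (P * Q2 - Q * P2) * (R0 * S1 - R1 * S0)) := by
  subst hd0 hd1 hd2 he0 he1 he2
  linear_combination (2 * R * κ * ((P0 * Q1 - P1 * Q0) * S2 + (P1 * Q2 - P2 * Q1) * S0
    + (P2 * Q0 - P0 * Q2) * S1)) * hκ

section Derivatives

variable {P Q R S : Annulus → ℝ}

theorem pd_quadric_ratio (i : Fin 2) {T : Annulus → ℝ} (hP : IsCn 1 P) (hQ : IsCn 1 Q)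
    (hR : IsCn 1 R) (hT : IsCn 1 T) (p : Annulus) (h : P p ^ 2 + Q p ^ 2 ≠ 0) :
    pd i (fun x => R x * T x / (P x ^ 2 + Q x ^ 2)) p =
      (pd i R p * T p + R p * pd i T p) * (P p ^ 2 + Q p ^ 2)⁻¹ -
      R p * T p * (2 * (P p * pd i P p + Q p * pd i Q p)) * (P p ^ 2 + Q p ^ 2)⁻¹ ^ 2 := by
  have d : ∀ {f : Annulus → ℝ}, IsCn 1 f → DifferentiableAt ℝ (toCover f) (rep p) :=
    fun hf => hf.diff one_ne_zero p
  have hρ := (hP.mul hP).add (hQ.mul hQ)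
  simp only [div_eq_mul_inv, pow_two] at h ⊢
  have hi : DifferentiableAt ℝ (toCover fun x => (P x * P x + Q x * Q x)⁻¹) (rep p) :=
    diff_comp (Φ := fun y : ℝ => y⁻¹) (d hρ) (hasDerivAt_inv h).differentiableAt
  rw [pd_mul i (d (hR.mul hT)) hi, pd_mul i (d hR) (d hT), pd_inv i (d hρ) h,
    pd_add i (d (hP.mul hP)) (d (hQ.mul hQ)), pd_mul i (d hP) (d hP), pd_mul i (d hQ) (d hQ)]
  rw [div_eq_mul_inv, ← inv_pow]
  generalize (P p * P p + Q p * Q p)⁻¹ = κ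
  ring

theorem pd_quadric (i : Fin 2) (hP : IsCn 1 P) (hQ : IsCn 1 Q) (hR : IsCn 1 R) (hS : IsCn 1 S)
    (h : ∀ p, P p ^ 2 + Q p ^ 2 = R p ^ 2 + S p ^ 2 + 2) (p : Annulus) :
    P p * pd i P p + Q p * pd i Q p = R p * pd i R p + S p * pd i S p := by
  have d : ∀ {f : Annulus → ℝ}, IsCn 1 f → DifferentiableAt ℝ (toCover f) (rep p) :=
    fun hf => hf.diff one_ne_zero p
  have e : (fun x => (P x * P x + Q x * Q x) - (R x * R x + S x * S x)) = fun _ => (2 : ℝ) := by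
    funext x; linarith [h x]
  have := pd_const i (p := p) (2 : ℝ)
  rw [← e, pd_sub i (d ((hP.mul hP).add (hQ.mul hQ))) (d ((hR.mul hR).add (hS.mul hS))),
    pd_add i (d (hP.mul hP)) (d (hQ.mul hQ)), pd_add i (d (hR.mul hR)) (d (hS.mul hS)),
    pd_mul i (d hP) (d hP), pd_mul i (d hQ) (d hQ), pd_mul i (d hR) (d hR),
    pd_mul i (d hS) (d hS)] at this
  linarith

end Derivatives

section Time

variable {P Q R S T : ℝ → ℝ} {τ : ℝ}

theorem deriv_quadric_ratio (hP : DifferentiableAt ℝ P τ) (hQ : DifferentiableAt ℝ Q τ)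
    (hR : DifferentiableAt ℝ R τ) (hT : DifferentiableAt ℝ T τ) (h : P τ ^ 2 + Q τ ^ 2 ≠ 0) :
    deriv (fun x => R x * T x / (P x ^ 2 + Q x ^ 2)) τ =
      (deriv R τ * T τ + R τ * deriv T τ) * (P τ ^ 2 + Q τ ^ 2)⁻¹ -
      R τ * T τ * (2 * (P τ * deriv P τ + Q τ * deriv Q τ)) * (P τ ^ 2 + Q τ ^ 2)⁻¹ ^ 2 := by
  have := ((hR.hasDerivAt.mul hT.hasDerivAt).div
    ((hP.hasDerivAt.pow 2).add (hQ.hasDerivAt.pow 2)) h).deriv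
  refine this.trans ?_
  simp only [Pi.mul_apply, Pi.add_apply, Pi.pow_apply]
  field_simp
  ring

theorem deriv_quadric (hP : Differentiable ℝ P) (hQ : Differentiable ℝ Q) (hR : Differentiable ℝ R)
    (hS : Differentiable ℝ S) (h : ∀ x, P x ^ 2 + Q x ^ 2 = R x ^ 2 + S x ^ 2 + 2) :
    P τ * deriv P τ + Q τ * deriv Q τ = R τ * deriv R τ + S τ * deriv S τ := by
  have h1 := ((hP τ).hasDerivAt.pow 2).add ((hQ τ).hasDerivAt.pow 2)
  have h2 := (((hR τ).hasDerivAt.pow 2).add ((hS τ).hasDerivAt.pow 2)).add_const 2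
  have e : P ^ 2 + Q ^ 2 = fun x => (R ^ 2 + S ^ 2) x + 2 := funext h
  rw [e] at h1
  have := h1.unique h2
  simp at this
  linarith

end Time

section Volume

variable {K : Set Annulus} {X : Annulus → ℝ → W} {T : ℝ}

theorem IsPath.clm {E F : Type*} [NormedAddCommGroup E] [NormedSpace ℝ E] [NormedAddCommGroup F]
    [NormedSpace ℝ F] {a : Annulus → ℝ → E} (ha : IsPath K a) (L : E →L[ℝ] F) :
    IsPath K fun p τ => L (a p τ) :=
  ha.comp L.contDiff

theorem IsPath.pd_clm {E F : Type*} [NormedAddCommGroup E] [NormedSpace ℝ E]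
    [NormedAddCommGroup F] [NormedSpace ℝ F] {a : Annulus → ℝ → E} (ha : IsPath K a)
    (L : E →L[ℝ] F) (i : Fin 2) (p : Annulus) (τ : ℝ) :
    pd i (fun x => L (a x τ)) p = L (pd i (fun x => a x τ) p) :=
  pd_comp_clm i ((ha.isCn τ).diff one_ne_zero p) L

theorem IsPath.deriv_clm {E F : Type*} [NormedAddCommGroup E] [NormedSpace ℝ E]
    [NormedAddCommGroup F] [NormedSpace ℝ F] {a : Annulus → ℝ → E} (ha : IsPath K a)
    (L : E →L[ℝ] F) (p : Annulus) (τ : ℝ) :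
    deriv (fun τ => L (a p τ)) τ = L (deriv (a p) τ) :=
  (L.hasFDerivAt.comp_hasDerivAt τ (ha.differentiableAt p τ).hasDerivAt).deriv

/-- Stokes' theorem for the volume form of the quadric `{q = -1}` and its primitive. -/
theorem hasStokes_pathVol (hK : IsCompact K) (hX : IsPath K X)
    (hq : ∀ p τ, pairing (X p τ) (X p τ) = -1) :
    HasStokes T (pathVol X) fun p =>
      volPrimitive (fun x => X x T) p - volPrimitive (fun x => X x 0) p := by
  let e : Fin 4 → W →L[ℝ] ℝ := fun i => ContinuousLinearMap.proj i
  have hP := hX.clm (e 0 + e 3)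
  have hQ := hX.clm (e 1 - e 2)
  have hR := hX.clm (e 0 - e 3)
  have hS := hX.clm (e 1 + e 2)
  have quad : ∀ p τ, (e 0 + e 3) (X p τ) ^ 2 + (e 1 - e 2) (X p τ) ^ 2 =
      (e 0 - e 3) (X p τ) ^ 2 + (e 1 + e 2) (X p τ) ^ 2 + 2 := fun p τ => by
    have := hq p τ
    simp only [pairing] at this
    simp only [e, add_apply, sub_apply, ContinuousLinearMap.proj_apply]
    linarith
  have ne : ∀ p τ, (e 0 + e 3) (X p τ) ^ 2 + (e 1 - e 2) (X p τ) ^ 2 ≠ 0 := fun p τ => by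
    rw [quad]; positivity
  have hρ := (hP.comp (f := fun y : ℝ => y ^ 2) (by fun_prop)).add
    (hQ.comp (f := fun y : ℝ => y ^ 2) (by fun_prop))
  have hA := (hR.mul hP).div hρ ne
  have hB := (hR.mul hQ).div hρ ne
  have key := ((hasStokes_jac hK hA hS hQ T).sub (hasStokes_jac hK hB hS hP T)).const_mul (1 / 2)
  refine HasStokes.congr key (fun p τ => ?_) (fun p => ?_)
  · have I := quadric_primitive_identity (mul_inv_cancel₀ (ne p τ))
      (pd_quadric_ratio 0 (hP.isCn τ) (hQ.isCn τ) (hR.isCn τ) (hP.isCn τ) p (ne p τ))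
      (pd_quadric_ratio 1 (hP.isCn τ) (hQ.isCn τ) (hR.isCn τ) (hP.isCn τ) p (ne p τ))
      (deriv_quadric_ratio (hP.differentiableAt p τ) (hQ.differentiableAt p τ)
        (hR.differentiableAt p τ) (hP.differentiableAt p τ) (ne p τ))
      (pd_quadric_ratio 0 (hP.isCn τ) (hQ.isCn τ) (hR.isCn τ) (hQ.isCn τ) p (ne p τ))
      (pd_quadric_ratio 1 (hP.isCn τ) (hQ.isCn τ) (hR.isCn τ) (hQ.isCn τ) p (ne p τ))
      (deriv_quadric_ratio (hP.differentiableAt p τ) (hQ.differentiableAt p τ)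
        (hR.differentiableAt p τ) (hQ.differentiableAt p τ) (ne p τ))
      (S0 := pd 0 (fun x => (e 1 + e 2) (X x τ)) p) (S1 := pd 1 (fun x => (e 1 + e 2) (X x τ)) p)
      (S2 := deriv (fun τ => (e 1 + e 2) (X p τ)) τ)
    have V := quadric_vol_identity (quad p τ)
      (pd_quadric 0 (hP.isCn τ) (hQ.isCn τ) (hR.isCn τ) (hS.isCn τ) (fun p => quad p τ) p)
      (pd_quadric 1 (hP.isCn τ) (hQ.isCn τ) (hR.isCn τ) (hS.isCn τ) (fun p => quad p τ) p)
      (deriv_quadric (τ := τ) (hP.differentiableAt p) (hQ.differentiableAt p)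
        (hR.differentiableAt p) (hS.differentiableAt p) (quad p)) rfl rfl rfl
    have J : ∀ V X ρ : ℝ, ρ ≠ 0 → ρ * V = 2 * X → ρ⁻¹ * X = V / 2 := by
      intro V X ρ hρ h
      field_simp
      linarith
    unfold jac bracket
    rw [I, J _ _ _ (ne p τ) V]
    simp only [hX.pd_clm, hX.deriv_clm]
    simp only [pathVol, det4_expand, e, add_apply, sub_apply,
      ContinuousLinearMap.proj_apply]
    ring
  · simp only [volPrimitive, e, add_apply, sub_apply, ContinuousLinearMap.proj_apply]
    ring

end Volume

/-! ### The `𝓦`-volume of a lens cobordism -/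

section Alpha

variable {K : Set Annulus} {N : Annulus → ℝ → W × W} {T : ℝ}

/-- The value on `(v₁, v₂, ∂/∂τ)` of the pull-back of `dα` by a path. -/
def pathDAlpha (N : Annulus → ℝ → W × W) (p : Annulus) (τ : ℝ) : ℝ :=
  (1 / 4) * (
    det4 (deriv (N p) τ).1 (N p τ).2 (pd 0 (fun x => N x τ) p).2 (pd 1 (fun x => N x τ) p).1
    - det4 (deriv (N p) τ).1 (N p τ).2 (pd 1 (fun x => N x τ) p).2 (pd 0 (fun x => N x τ) p).1
    + det4 (N p τ).1 (deriv (N p) τ).2 (pd 0 (fun x => N x τ) p).2 (pd 1 (fun x => N x τ) p).1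
    - det4 (N p τ).1 (deriv (N p) τ).2 (pd 1 (fun x => N x τ) p).2 (pd 0 (fun x => N x τ) p).1
    + det4 (pd 1 (fun x => N x τ) p).1 (N p τ).2 (deriv (N p) τ).2 (pd 0 (fun x => N x τ) p).1
    - det4 (pd 0 (fun x => N x τ) p).1 (N p τ).2 (deriv (N p) τ).2 (pd 1 (fun x => N x τ) p).1
    + det4 (N p τ).1 (pd 1 (fun x => N x τ) p).2 (deriv (N p) τ).2 (pd 0 (fun x => N x τ) p).1
    - det4 (N p τ).1 (pd 0 (fun x => N x τ) p).2 (deriv (N p) τ).2 (pd 1 (fun x => N x τ) p).1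
    + det4 (pd 0 (fun x => N x τ) p).1 (N p τ).2 (pd 1 (fun x => N x τ) p).2 (deriv (N p) τ).1
    - det4 (pd 1 (fun x => N x τ) p).1 (N p τ).2 (pd 0 (fun x => N x τ) p).2 (deriv (N p) τ).1
    + det4 (N p τ).1 (pd 0 (fun x => N x τ) p).2 (pd 1 (fun x => N x τ) p).2 (deriv (N p) τ).1
    - det4 (N p τ).1 (pd 1 (fun x => N x τ) p).2 (pd 0 (fun x => N x τ) p).2 (deriv (N p) τ).1)

/-- Stokes' theorem for the form `α`: it is a linear combination of the forms
`x_i n_j dn_k ∧ dx_l`. -/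
theorem hasStokes_alpha (hK : IsCompact K) (hN : IsPath K N) :
    HasStokes T (pathDAlpha N) fun p =>
      alphaCoeff (fun x => N x T) p - alphaCoeff (fun x => N x 0) p := by
  let ex : Fin 4 → W × W →L[ℝ] ℝ := fun i =>
    (ContinuousLinearMap.proj i).comp (ContinuousLinearMap.fst ℝ W W)
  let en : Fin 4 → W × W →L[ℝ] ℝ := fun i =>
    (ContinuousLinearMap.proj i).comp (ContinuousLinearMap.snd ℝ W W)
  have hx : ∀ i, IsPath K fun p τ => ex i (N p τ) := fun i => hN.clm (ex i)
  have hn : ∀ i, IsPath K fun p τ => en i (N p τ) := fun i => hN.clm (en i)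
  have H := (HasStokes.sum Finset.univ fun (σ : Equiv.Perm (Fin 4)) _ =>
    (hasStokes_jac hK ((hx (σ 0)).mul (hn (σ 1))) (hn (σ 2)) (hx (σ 3)) T).const_mul
      ((Equiv.Perm.sign σ : ℤ) : ℝ)).const_mul (1 / 4)
  have dx : ∀ i p τ, DifferentiableAt ℝ (toCover fun x => ex i (N x τ)) (rep p) :=
    fun i p τ => ((hx i).isCn τ).diff one_ne_zero p
  have dn : ∀ i p τ, DifferentiableAt ℝ (toCover fun x => en i (N x τ)) (rep p) :=
    fun i p τ => ((hn i).isCn τ).diff one_ne_zero p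
  have dt : ∀ i j p τ, deriv (fun τ => ex i (N p τ) * en j (N p τ)) τ =
      ex i (deriv (N p) τ) * en j (N p τ) + ex i (N p τ) * en j (deriv (N p) τ) := by
    intro i j p τ
    rw [← hN.deriv_clm (ex i), ← hN.deriv_clm (en j)]
    exact deriv_fun_mul ((hx i).differentiableAt p τ) ((hn j).differentiableAt p τ)
  refine H.congr (fun p τ => ?_) (fun p => ?_)
  · unfold jac bracket
    simp only [dt, pd_mul _ (dx _ p τ) (dn _ p τ), hN.pd_clm, hN.deriv_clm]
    rw [pathDAlpha]
    simp only [det4_eq_sum, ← Finset.sum_add_distrib, ← Finset.sum_sub_distrib]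
    congr 1
    refine Finset.sum_congr rfl fun σ _ => ?_
    simp only [ex, en, ContinuousLinearMap.comp_apply, ContinuousLinearMap.proj_apply,
      ContinuousLinearMap.coe_fst', ContinuousLinearMap.coe_snd']
    ring
  · have sw : ∀ a b c d : W, det4 a b c d = -det4 a b d c := fun a b c d => by
      simp only [det4_expand]; ring
    unfold bracket alphaCoeff
    simp only [hN.pd_clm]
    rw [sw _ _ (pd 0 (fun x => N x T) p).1, sw _ _ (pd 0 (fun x => N x 0) p).1, ← mul_sub]
    simp only [det4_eq_sum, ← Finset.sum_add_distrib, ← Finset.sum_sub_distrib,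
      ← Finset.sum_neg_distrib]
    congr 1
    refine Finset.sum_congr rfl fun σ _ => ?_
    simp only [ex, en, ContinuousLinearMap.comp_apply, ContinuousLinearMap.proj_apply,
      ContinuousLinearMap.coe_fst', ContinuousLinearMap.coe_snd']
    ring

end Alpha

section Ends

variable {S S' : Annulus → W × W} {M : Annulus → ℝ → W × W}

theorem sin_sq_mem (τ : ℝ) : Real.sin τ ^ 2 ∈ Icc (0 : ℝ) 1 := ⟨sq_nonneg _, Real.sin_sq_le_one τ⟩

theorem hasDerivAt_sin_sq (τ : ℝ) :
    HasDerivAt (fun τ : ℝ => Real.sin τ ^ 2) (2 * Real.sin τ * Real.cos τ) τ := by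
  simpa using (Real.hasDerivAt_sin τ).fun_pow 2

theorem image_sin_sq : (fun τ : ℝ => Real.sin τ ^ 2) '' Ioo 0 (Real.pi / 2) = Ioo 0 1 := by
  ext r
  constructor
  · rintro ⟨τ, ⟨h0, h1⟩, rfl⟩
    have hs := Real.sin_pos_of_pos_of_lt_pi h0 (by linarith)
    have hc := Real.cos_pos_of_mem_Ioo ⟨by linarith, h1⟩
    have := Real.sin_sq_add_cos_sq τ
    exact ⟨by positivity, by nlinarith⟩
  · rintro ⟨h0, h1⟩
    have hr : 0 < √r := Real.sqrt_pos.2 h0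
    have hr1 : √r < 1 := (Real.sqrt_lt' one_pos).2 (by simpa using h1)
    refine ⟨Real.arcsin √r, ⟨Real.arcsin_pos.2 hr, Real.arcsin_lt_pi_div_two.2 hr1⟩, ?_⟩
    simp only
    rw [Real.sin_arcsin (by linarith) hr1.le, Real.sq_sqrt h0.le]

theorem injOn_sin_sq : InjOn (fun τ : ℝ => Real.sin τ ^ 2) (Ioo 0 (Real.pi / 2)) := by
  intro a ha b hb h
  have h1 := Real.sin_pos_of_pos_of_lt_pi ha.1 (by linarith [ha.2, Real.pi_pos])
  have h2 := Real.sin_pos_of_pos_of_lt_pi hb.1 (by linarith [hb.2, Real.pi_pos])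
  have h3 : Real.sin a = Real.sin b := (pow_left_inj₀ h1.le h2.le two_ne_zero).1 h
  exact Real.injOn_sin ⟨by linarith [ha.1, Real.pi_pos], ha.2.le⟩
    ⟨by linarith [hb.1, Real.pi_pos], hb.2.le⟩ h3

/-- Reparametrized by `sin²`, a lens cobordism extends to a path defined for all times. -/
theorem IsLensCobordism.isPath (H : IsLensCobordism S S' M) :
    ∃ K, IsCompact K ∧ IsPath K fun p τ => M p (Real.sin τ ^ 2) := by
  obtain ⟨K, hK, hc⟩ := H.constant
  refine ⟨K, hK, ?_, fun p hp τ => ?_⟩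
  · have hs : ContDiff ℝ 1 fun z : (ℝ × ℝ) × ℝ => (z.1, Real.sin z.2 ^ 2) :=
      contDiff_fst.prodMk ((Real.contDiff_sin.comp contDiff_snd).pow 2)
    exact H.regular.comp (f := fun z : (ℝ × ℝ) × ℝ => (z.1, Real.sin z.2 ^ 2)) hs.contDiffOn
      fun z hz => ⟨hz.1, sin_sq_mem _⟩
  · simp only [Real.sin_zero, ne_eq, OfNat.ofNat_ne_zero, not_false_eq_true, zero_pow]
    exact hc p hp _ (sin_sq_mem τ)

theorem IsLensCobordism.differentiableAt (H : IsLensCobordism S S' M) (p : Annulus) {r : ℝ}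
    (hr : r ∈ Ioo (0 : ℝ) 1) : DifferentiableAt ℝ (M p) r := by
  have h : ContDiffAt ℝ 1 (fun z : (ℝ × ℝ) × ℝ => toCover (fun p => M p z.2) z.1) (rep p, r) :=
    H.regular.contDiffAt (prod_mem_nhds (isOpen_coverSet.mem_nhds (rep_mem p))
      (Icc_mem_nhds hr.1 hr.2))
  have h2 := (h.differentiableAt one_ne_zero).comp r (f := fun τ : ℝ => (rep p, τ)) (by fun_prop)
  refine h2.congr_of_eventuallyEq (Eventually.of_forall fun x => ?_)
  rw [Function.comp_apply, toCover_rep]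

theorem det4_smul_right (a b c d : W) (r : ℝ) : det4 a b c (r • d) = r * det4 a b c d := by
  simp only [det4_expand, Pi.smul_apply, smul_eq_mul]; ring

theorem IsLensCobordism.integral_omegaCoeff (H : IsLensCobordism S S' M) (p : Annulus)
    (hp : ∀ i τ, (pd i (fun x => M x (Real.sin τ ^ 2)) p).1 =
      pd i (fun x => (M x (Real.sin τ ^ 2)).1) p) :
    ∫ r in (0 : ℝ)..1, omegaCoeff M p r =
      ∫ τ in (0 : ℝ)..Real.pi / 2, pathVol (fun p τ => (M p (Real.sin τ ^ 2)).1) p τ := by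
  have hπ := Real.pi_pos
  rw [intervalIntegral.integral_of_le zero_le_one, intervalIntegral.integral_of_le (by linarith),
    integral_Ioc_eq_integral_Ioo, integral_Ioc_eq_integral_Ioo, ← image_sin_sq,
    integral_image_eq_integral_abs_deriv_smul measurableSet_Ioo
      (f' := fun τ => 2 * Real.sin τ * Real.cos τ) (fun τ _ => ?_) injOn_sin_sq]
  · refine setIntegral_congr_fun measurableSet_Ioo fun τ hτ => ?_
    have hs := Real.sin_pos_of_pos_of_lt_pi hτ.1 (by linarith [hτ.2])
    have hc := Real.cos_pos_of_mem_Ioo ⟨by linarith [hτ.1], hτ.2⟩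
    have hr : Real.sin τ ^ 2 ∈ Ioo (0 : ℝ) 1 := by
      rw [← image_sin_sq]; exact mem_image_of_mem _ hτ
    have e : deriv (fun τ => (M p (Real.sin τ ^ 2)).1) τ =
        (2 * Real.sin τ * Real.cos τ) • (deriv (M p) (Real.sin τ ^ 2)).1 := by
      have h2 := HasDerivAt.scomp τ (g₁ := M p) (h := fun τ => Real.sin τ ^ 2)
        (H.differentiableAt p hr).hasDerivAt (hasDerivAt_sin_sq τ)
      exact ((hasFDerivAt_fst (𝕜 := ℝ) (E := W) (F := W)).comp_hasDerivAt τ h2).deriv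
    rw [omegaCoeff, derivWithin_of_mem_nhds (Icc_mem_nhds hr.1 hr.2), pathVol, e, det4_smul_right,
      abs_of_pos (by positivity), smul_eq_mul, hp, hp]
  · exact (hasDerivAt_sin_sq τ).hasDerivWithinAt

/-- The `𝓦`-volume of a lens cobordism depends only on its ends. -/
theorem IsLensCobordism.wVolume_eq (H : IsLensCobordism S S' M) :
    wVolume M = -(∫ p, (volPrimitive (fun x => (S' x).1) p - volPrimitive (fun x => (S x).1) p))
      - ∫ p, (alphaCoeff S p - alphaCoeff S' p) := by
  obtain ⟨K, hK, hN⟩ := H.isPath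
  have hX : IsPath K fun p τ => (M p (Real.sin τ ^ 2)).1 :=
    hN.clm (ContinuousLinearMap.fst ℝ W W)
  have hV := hasStokes_pathVol (T := Real.pi / 2) hK hX fun p τ => (H.mem p _ (sin_sq_mem τ)).1
  have e0 : (fun x => M x 0) = S := funext H.start
  have e1 : (fun x => M x 1) = S' := funext H.finish
  have e0' : (fun x => (M x 0).1) = fun x => (S x).1 := funext fun x => by rw [H.start]
  have e1' : (fun x => (M x 1).1) = fun x => (S' x).1 := funext fun x => by rw [H.finish]
  have hi : ∀ p, ∫ r in (0 : ℝ)..1, omegaCoeff M p r =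
      ∫ τ in (0 : ℝ)..Real.pi / 2, pathVol (fun p τ => (M p (Real.sin τ ^ 2)).1) p τ :=
    fun p => H.integral_omegaCoeff p fun i τ =>
      (hN.pd_clm (ContinuousLinearMap.fst ℝ W W) i p τ).symm
  have hE := hV.eq
  simp only [Real.sin_pi_div_two, one_pow, Real.sin_zero, ne_eq, OfNat.ofNat_ne_zero,
    not_false_eq_true, zero_pow, e0', e1'] at hE
  unfold wVolume
  simp only [hi]
  rw [hE, e0, e1]

end Ends

/-- A path of maps into `U` that is constant outside a compact set is a lens cobordism, and its
`𝓦`-volume is the integral of the pull-back of `dα - ω`. -/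
theorem IsPath.lensCobordism {K : Set Annulus} {N : Annulus → ℝ → W × W} (hK : IsCompact K)
    (hN : IsPath K N) (hU : ∀ p τ, N p τ ∈ unitTangent) :
    IsLensCobordism (fun p => N p 0) (fun p => N p 1) N ∧
      wVolume N = ∫ p, ∫ τ in (0 : ℝ)..1, (pathDAlpha N p τ - pathVol (fun p τ => (N p τ).1) p τ) := by
  have hX : IsPath K fun p τ => (N p τ).1 := hN.clm (ContinuousLinearMap.fst ℝ W W)
  have hV := hasStokes_pathVol (T := 1) hK hX fun p τ => (hU p τ).1
  have hA := hasStokes_alpha (T := 1) hK hN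
  refine ⟨⟨hN.regular.mono fun z hz => ⟨hz.1, trivial⟩, fun p τ _ => hU p τ, fun _ => rfl,
    fun _ => rfl, K, hK, fun p hp τ _ => hN.const p hp τ⟩, ?_⟩
  have ho : ∀ p, ∫ τ in (0 : ℝ)..1, omegaCoeff N p τ =
      ∫ τ in (0 : ℝ)..1, pathVol (fun p τ => (N p τ).1) p τ := by
    intro p
    rw [intervalIntegral.integral_of_le zero_le_one, intervalIntegral.integral_of_le zero_le_one,
      integral_Ioc_eq_integral_Ioo, integral_Ioc_eq_integral_Ioo]
    refine setIntegral_congr_fun measurableSet_Ioo fun τ hτ => ?_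
    have e : ∀ i, (pd i (fun x => N x τ) p).1 = pd i (fun x => (N x τ).1) p := fun i =>
      (hN.pd_clm (ContinuousLinearMap.fst ℝ W W) i p τ).symm
    have e' : (deriv (N p) τ).1 = deriv (fun τ => (N p τ).1) τ :=
      (hN.deriv_clm (ContinuousLinearMap.fst ℝ W W) p τ).symm
    simp only [omegaCoeff, derivWithin_of_mem_nhds (Icc_mem_nhds hτ.1 hτ.2), pathVol, e, e']
  have hs : ∀ p, ∫ τ in (0 : ℝ)..1, (pathDAlpha N p τ - pathVol (fun p τ => (N p τ).1) p τ) =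
      (∫ τ in (0 : ℝ)..1, pathDAlpha N p τ) - ∫ τ in (0 : ℝ)..1, pathVol (fun p τ => (N p τ).1) p τ :=
    fun p => intervalIntegral.integral_sub (hA.inner p) (hV.inner p)
  unfold wVolume
  simp only [ho, hs]
  rw [integral_sub hA.left hV.left, hA.eq]
  have hm : ∫ p, (alphaCoeff (fun x => N x 0) p - alphaCoeff (fun x => N x 1) p) =
      -∫ p, (alphaCoeff (fun x => N x 1) p - alphaCoeff (fun x => N x 0) p) := by
    rw [← integral_neg]
    congr 1; funext p; ring
  rw [hm]
  ring

/-! ### Light-like frames -/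

section Pairing

theorem pairing_comm (x y : W) : pairing x y = pairing y x := by unfold pairing; ring

theorem pairing_add_left (x y z : W) : pairing (x + y) z = pairing x z + pairing y z := by
  simp only [pairing, Pi.add_apply]; ring

theorem pairing_sub_left (x y z : W) : pairing (x - y) z = pairing x z - pairing y z := by
  simp only [pairing, Pi.sub_apply]; ring

theorem pairing_neg_left (x z : W) : pairing (-x) z = -pairing x z := by
  simp only [pairing, Pi.neg_apply]; ring

theorem pairing_smul_left (r : ℝ) (x z : W) : pairing (r • x) z = r * pairing x z := by
  simp only [pairing, Pi.smul_apply, smul_eq_mul]; ring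

theorem pairing_add_right (x y z : W) : pairing x (y + z) = pairing x y + pairing x z := by
  simp only [pairing, Pi.add_apply]; ring

theorem pairing_sub_right (x y z : W) : pairing x (y - z) = pairing x y - pairing x z := by
  simp only [pairing, Pi.sub_apply]; ring

theorem pairing_neg_right (x z : W) : pairing x (-z) = -pairing x z := by
  simp only [pairing, Pi.neg_apply]; ring

theorem pairing_smul_right (r : ℝ) (x z : W) : pairing x (r • z) = r * pairing x z := by
  simp only [pairing, Pi.smul_apply, smul_eq_mul]; ring

theorem IsCn.pairing {n : WithTop ℕ∞} {f g : Annulus → W} (hf : IsCn n f) (hg : IsCn n g) :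
    IsCn n fun p => pairing (f p) (g p) :=
  (hf.prodMk hg).comp (Φ := fun z : W × W => SplitLiouville.pairing z.1 z.2)
    fun _ => by unfold SplitLiouville.pairing; fun_prop

theorem pd_pairing (i : Fin 2) {f g : Annulus → W} (hf : IsCn 1 f) (hg : IsCn 1 g) (p : Annulus) :
    pd i (fun x => pairing (f x) (g x)) p = pairing (pd i f p) (g p) + pairing (f p) (pd i g p) := by
  have d : ∀ {f : Annulus → ℝ}, IsCn 1 f → DifferentiableAt ℝ (toCover f) (rep p) :=
    fun hf => hf.diff one_ne_zero p
  have c : ∀ {f : Annulus → W}, IsCn 1 f → ∀ j, IsCn 1 fun x => f x j := fun hf j =>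
    hf.comp (Φ := fun z : W => z j) fun _ => by fun_prop
  have e : ∀ {f : Annulus → W}, IsCn 1 f → ∀ j, pd i (fun x => f x j) p = pd i f p j :=
    fun hf j => pd_comp_clm i (hf.diff one_ne_zero p) (ContinuousLinearMap.proj (R := ℝ) j)
  have m : ∀ j k, IsCn 1 fun x => f x j * g x k := fun j k => (c hf j).mul (c hg k)
  have pm : ∀ j k, pd i (fun x => f x j * g x k) p = pd i f p j * g p k + f p j * pd i g p k :=
    fun j k => by rw [pd_mul i (d (c hf j)) (d (c hg k)), e hf, e hg]; ring
  unfold pairing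
  rw [pd_add i (d (((m 0 3).neg.sub (m 3 0)).add (m 1 2))) (d (m 2 1)),
    pd_add i (d ((m 0 3).neg.sub (m 3 0))) (d (m 1 2)), pd_sub i (d (m 0 3).neg) (d (m 3 0)),
    pd_neg i (d (m 0 3)), pm, pm, pm, pm]
  ring

/-- If the pairing of two functions is constant, its derivative vanishes. -/
theorem pairing_pd_eq (i : Fin 2) {f g : Annulus → W} (hf : IsCn 1 f) (hg : IsCn 1 g) {c : ℝ}
    (h : ∀ p, pairing (f p) (g p) = c) (p : Annulus) :
    pairing (pd i f p) (g p) = -pairing (f p) (pd i g p) := by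
  have := pd_pairing i hf hg p
  rw [show (fun x => pairing (f x) (g x)) = fun _ => c from funext h, pd_const] at this
  linarith

end Pairing

/-- A frame of `W` made of light-like vectors, all orthogonal except `⟨σ, η⟩ = 1` and
`⟨s₀, s₁⟩ = f`, with the orientation of the frames `(σ, η, σ₀, σ₁)` along isotropic surfaces. -/
structure IsLightFrame (σ η s₀ s₁ : W) (f : ℝ) : Prop where
  ne : f ≠ 0
  det : det4 σ η s₀ s₁ = -f
  σσ : pairing σ σ = 0
  ση : pairing σ η = 1
  ηη : pairing η η = 0
  σs₀ : pairing σ s₀ = 0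
  σs₁ : pairing σ s₁ = 0
  ηs₀ : pairing η s₀ = 0
  ηs₁ : pairing η s₁ = 0
  s₀s₀ : pairing s₀ s₀ = 0
  s₁s₁ : pairing s₁ s₁ = 0
  s₀s₁ : pairing s₀ s₁ = f

namespace IsLightFrame

variable {σ η s₀ s₁ : W} {f : ℝ}

/-- The pairing is nondegenerate. -/
theorem eq_zero (H : IsLightFrame σ η s₀ s₁ f) {y : W} (h1 : pairing y σ = 0)
    (h2 : pairing y η = 0) (h3 : pairing y s₀ = 0) (h4 : pairing y s₁ = 0) : y = 0 := by
  have h := Matrix.eq_zero_of_mulVec_eq_zero (M := Matrix.of ![σ, η, s₀, s₁])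
    (v := ![-y 3, y 2, y 1, -y 0])
    (by have := H.det; unfold det4 at this; rw [this]; exact neg_ne_zero.2 H.ne) (by
      unfold pairing at h1 h2 h3 h4
      funext i
      fin_cases i <;> simp [Matrix.mulVec, dotProduct, Fin.sum_univ_four] <;> linarith)
  funext i
  have e0 := congrFun h 3
  have e1 := congrFun h 2
  have e2 := congrFun h 1
  have e3 := congrFun h 0
  simp at e0 e1 e2 e3
  fin_cases i <;> simp [e0, e1, e2, e3]

/-- The coordinates in a light-like frame. -/
theorem expand (H : IsLightFrame σ η s₀ s₁ f) (x : W) :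
    x = pairing x η • σ + pairing x σ • η + (pairing x s₁ / f) • s₀ + (pairing x s₀ / f) • s₁ := by
  have hf := H.ne
  have c1 := pairing_comm η σ
  have c2 := pairing_comm s₀ σ
  have c3 := pairing_comm s₁ σ
  have c4 := pairing_comm s₀ η
  have c5 := pairing_comm s₁ η
  have c6 := pairing_comm s₁ s₀
  rw [← sub_eq_zero]
  apply H.eq_zero <;>
    simp only [pairing_sub_left, pairing_add_left, pairing_smul_left, c1, c2, c3, c4, c5, c6, H.σσ,
      H.ση, H.ηη, H.σs₀, H.σs₁, H.ηs₀, H.ηs₁, H.s₀s₀, H.s₁s₁, H.s₀s₁] <;> field_simp <;> ring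

/-- The determinant of four combinations of four vectors. -/
theorem det4_comb (σ η s₀ s₁ a b c d : W) :
    det4 (a 0 • σ + a 1 • η + a 2 • s₀ + a 3 • s₁) (b 0 • σ + b 1 • η + b 2 • s₀ + b 3 • s₁)
      (c 0 • σ + c 1 • η + c 2 • s₀ + c 3 • s₁) (d 0 • σ + d 1 • η + d 2 • s₀ + d 3 • s₁) =
    det4 a b c d * det4 σ η s₀ s₁ := by
  unfold det4
  rw [← Matrix.det_mul]
  congr 1
  ext i j
  fin_cases i <;> simp [Matrix.mul_apply, Fin.sum_univ_four]

/-- The frame of a rescaled isotropic surface `E σ`, where `a₀`, `a₁` are the derivatives of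
`log E`. -/
theorem rescale (H : IsLightFrame σ η s₀ s₁ f) {E : ℝ} (hE : E ≠ 0) (a₀ a₁ : ℝ) :
    IsLightFrame (E • σ) (E⁻¹ • (η - (a₁ / f) • s₀ - (a₀ / f) • s₁ - (a₀ * a₁ / f) • σ))
      (E • (a₀ • σ + s₀)) (E • (a₁ • σ + s₁)) (E ^ 2 * f) := by
  have hf := H.ne
  have c1 := pairing_comm η σ
  have c2 := pairing_comm s₀ σ
  have c3 := pairing_comm s₁ σ
  have c4 := pairing_comm s₀ η
  have c5 := pairing_comm s₁ η
  have c6 := pairing_comm s₁ s₀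
  refine ⟨by positivity, ?_, ?_, ?_, ?_, ?_, ?_, ?_, ?_, ?_, ?_, ?_⟩
  · have h := det4_comb σ η s₀ s₁ ![E, 0, 0, 0]
      ![-E⁻¹ * (a₀ * a₁ / f), E⁻¹, -E⁻¹ * (a₁ / f), -E⁻¹ * (a₀ / f)] ![E * a₀, 0, E, 0]
      ![E * a₁, 0, 0, E]
    rw [H.det] at h
    refine Eq.trans ?_ (h.trans ?_)
    · congr 1 <;> simp <;> module
    · simp [det4_expand]
      exact Or.inl (by field_simp)
  all_goals
    simp only [pairing_sub_left, pairing_add_left, pairing_smul_left, pairing_sub_right,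
      pairing_add_right, pairing_smul_right, c1, c2, c3, c4, c5, c6, H.σσ,
      H.ση, H.ηη, H.σs₀, H.σs₁, H.ηs₀, H.ηs₁, H.s₀s₀, H.s₁s₁, H.s₀s₁]
    field_simp
    try ring

/-- The form `dα - ω` along a variation of an Epstein surface, computed in its frame. The vectors
are `x = r (σ - η)`, `n = r (σ + η)` and their derivatives along the annulus and in the parameter,
with `⟨η, σ₀₀⟩ = A`, `⟨η, σ₁₁⟩ = B`, `⟨η, σ₀₁⟩ = C`. -/
theorem dAlpha_sub_vol (H : IsLightFrame σ η s₀ s₁ f) {r u w₀ w₁ A B C : ℝ} (hr : r ^ 2 = 1 / 2)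
    {x n x₀ n₀ x₁ n₁ xt nt : W} (hx : x = r • (σ - η)) (hn : n = r • (σ + η))
    (hx₀ : x₀ = r • (s₀ - (-(C / f) • s₀ - (A / f) • s₁)))
    (hn₀ : n₀ = r • (s₀ + (-(C / f) • s₀ - (A / f) • s₁)))
    (hx₁ : x₁ = r • (s₁ - (-(B / f) • s₀ - (C / f) • s₁)))
    (hn₁ : n₁ = r • (s₁ + (-(B / f) • s₀ - (C / f) • s₁)))
    (hxt : xt = r • (u • σ - (-u • η - w₀ • s₀ - w₁ • s₁)))
    (hnt : nt = r • (u • σ + (-u • η - w₀ • s₀ - w₁ • s₁))) :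
    (1 / 4) * (det4 xt n n₀ x₁ - det4 xt n n₁ x₀ + det4 x nt n₀ x₁ - det4 x nt n₁ x₀
      + det4 x₁ n nt x₀ - det4 x₀ n nt x₁ + det4 x n₁ nt x₀ - det4 x n₀ nt x₁
      + det4 x₀ n n₁ xt - det4 x₁ n n₀ xt + det4 x n₀ n₁ xt - det4 x n₁ n₀ xt)
      - det4 x x₀ x₁ xt = u * C := by
  have hf := H.ne
  have comb : ∀ (y : W) (a b c d : ℝ), y = a • σ + b • η + c • s₀ + d • s₁ →
      y = (![a, b, c, d] : W) 0 • σ + (![a, b, c, d] : W) 1 • η +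
        (![a, b, c, d] : W) 2 • s₀ + (![a, b, c, d] : W) 3 • s₁ := by
    intro y a b c d h; simpa using h
  rw [comb x r (-r) 0 0 (by rw [hx]; module), comb n r r 0 0 (by rw [hn]; module),
    comb x₀ 0 0 (r * (1 + C / f)) (r * (A / f)) (by rw [hx₀]; module),
    comb n₀ 0 0 (r * (1 - C / f)) (-r * (A / f)) (by rw [hn₀]; module),
    comb x₁ 0 0 (r * (B / f)) (r * (1 + C / f)) (by rw [hx₁]; module),
    comb n₁ 0 0 (-r * (B / f)) (r * (1 - C / f)) (by rw [hn₁]; module),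
    comb xt (r * u) (r * u) (r * w₀) (r * w₁) (by rw [hxt]; module),
    comb nt (r * u) (-r * u) (-r * w₀) (-r * w₁) (by rw [hnt]; module)]
  simp only [det4_comb, H.det]
  -- every determinant is a multiple of `r⁴ = 1/4`
  have h4 : r ^ 4 = 1 / 4 := by rw [show r ^ 4 = (r ^ 2) ^ 2 by ring, hr]; norm_num
  have : u * C = r ^ 4 * (4 * u * C) := by rw [h4]; ring
  rw [this]
  simp [det4_expand]
  field_simp
  ring

end IsLightFrame

/-! ### Isotropic surfaces over a split immersion -/

/-- The structure equations of an isotropic surface `σ` and its dual `η`. -/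
theorem pd_dual {σ η : Annulus → W} {f : Annulus → ℝ} (hσ : IsCn 2 σ) (hη : IsCn 1 η)
    (H : ∀ p, IsLightFrame (σ p) (η p) (pd 0 σ p) (pd 1 σ p) (f p)) (p : Annulus) :
    pd 0 η p = -(pairing (η p) (pd 0 (pd 1 σ) p) / f p) • pd 0 σ p
        - (pairing (η p) (pd 0 (pd 0 σ) p) / f p) • pd 1 σ p ∧
      pd 1 η p = -(pairing (η p) (pd 1 (pd 1 σ) p) / f p) • pd 0 σ p
        - (pairing (η p) (pd 0 (pd 1 σ) p) / f p) • pd 1 σ p := by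
  have hσ1 : IsCn 1 σ := hσ.of_le one_le_two
  have hd : ∀ i, IsCn 1 (pd i σ) := fun i => hσ.pd i (by norm_num)
  have a : ∀ i, pairing (pd i η p) (η p) = 0 := fun i => by
    have h1 := pairing_pd_eq i hη hη (fun p => (H p).ηη) p
    rw [pairing_comm (η p)] at h1
    linarith
  have b0 : ∀ i, pairing (pd i η p) (pd 0 σ p) = -pairing (η p) (pd i (pd 0 σ) p) := fun i =>
    pairing_pd_eq i hη (hd 0) (fun p => (H p).ηs₀) p
  have b1 : ∀ i, pairing (pd i η p) (pd 1 σ p) = -pairing (η p) (pd i (pd 1 σ) p) := fun i =>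
    pairing_pd_eq i hη (hd 1) (fun p => (H p).ηs₁) p
  have c : ∀ i, pairing (pd i η p) (σ p) = -pairing (η p) (pd i σ p) := fun i =>
    pairing_pd_eq i hη hσ1 (c := 1) (fun p => by rw [pairing_comm]; exact (H p).ση) p
  have c0 := c 0
  have c1 := c 1
  rw [(H p).ηs₀, neg_zero] at c0
  rw [(H p).ηs₁, neg_zero] at c1
  constructor
  · conv_lhs => rw [(H p).expand (pd 0 η p)]
    rw [a, c0, b0, b1]
    module
  · conv_lhs => rw [(H p).expand (pd 1 η p)]
    rw [a, c1, b0, b1, pd_comm hσ 1 0 p]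
    module

/-- A smooth section of the tautological line bundle over a split immersion, whose first
fundamental form is positive on the oriented split frame. -/
structure IsLightSection (F : Annulus → W) : Prop where
  smooth : IsCn 4 F
  split : ∀ p, ∃ a b a' b' : Fin 2 → ℝ,
    F p = tensor a b ∧ pd 0 F p = tensor a b' ∧ pd 1 F p = tensor a' b
  pos : ∀ p, 0 < pairing (pd 0 F p) (pd 1 F p)

/-- The coefficient of the first fundamental form. -/
def conf (F : Annulus → W) (p : Annulus) : ℝ := pairing (pd 0 F p) (pd 1 F p)

/-- The coefficient `⟨η, F₀₁⟩`, where `η` is the dual of `F`. -/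
def modulus (F : Annulus → W) (p : Annulus) : ℝ :=
  -(pairing (pd 0 (pd 1 F) p) (pd 0 (pd 1 F) p) / (2 * conf F p))

/-- The dual isotropic surface of `F`, found in the span of `F₀₁` and `F`. -/
def dualSection (F : Annulus → W) (p : Annulus) : W :=
  -((conf F p)⁻¹ • (pd 0 (pd 1 F) p - modulus F p • F p))

/-- The orientation of the frame of an isotropic surface is given by the pairing. -/
theorem det4_tensor (a b a' b' : Fin 2 → ℝ) (y : W) :
    det4 (tensor a b) y (tensor a b') (tensor a' b) =
      -(pairing (tensor a b') (tensor a' b) * pairing (tensor a b) y) := by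
  rw [det4_expand]
  simp [pairing, tensor]
  ring

namespace IsLightSection

variable {F : Annulus → W} (H : IsLightSection F)

include H

theorem conf_ne (p : Annulus) : conf F p ≠ 0 := (H.pos p).ne'

theorem isCn_pd (i : Fin 2) : IsCn 3 (pd i F) := H.smooth.pd i (by norm_num)

theorem isCn_mixed : IsCn 2 (pd 0 (pd 1 F)) := (H.isCn_pd 1).pd 0 (by norm_num)

theorem isCn_conf : IsCn 3 (conf F) := (H.isCn_pd 0).pairing (H.isCn_pd 1)

theorem isCn_modulus : IsCn 2 (modulus F) :=
  ((H.isCn_mixed.pairing H.isCn_mixed).div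
    ((H.isCn_conf.of_le (by norm_num)).comp (Φ := fun x : ℝ => 2 * x) fun _ => by fun_prop)
    fun p => mul_ne_zero two_ne_zero (H.conf_ne p)).neg

theorem isCn_dualSection : IsCn 2 (dualSection F) :=
  (((H.isCn_conf.inv H.conf_ne).of_le (by norm_num)).smul
    (H.isCn_mixed.sub (H.isCn_modulus.smul (H.smooth.of_le (by norm_num))))).neg

theorem pairing_self (p : Annulus) : pairing (F p) (F p) = 0 := by
  obtain ⟨a, b, a', b', h1, -, -⟩ := H.split p
  rw [h1, pairing_tensor]; ring

theorem pairing_pd (i : Fin 2) (p : Annulus) : pairing (F p) (pd i F p) = 0 := by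
  obtain ⟨a, b, a', b', h1, h2, h3⟩ := H.split p
  fin_cases i
  · simp only [Fin.zero_eta, h1, h2, pairing_tensor]; ring
  · simp only [Fin.mk_one, h1, h3, pairing_tensor]; ring

theorem pairing_pd_self (i : Fin 2) (p : Annulus) : pairing (pd i F p) (pd i F p) = 0 := by
  obtain ⟨a, b, a', b', h1, h2, h3⟩ := H.split p
  fin_cases i
  · simp only [Fin.zero_eta, h2, pairing_tensor]; ring
  · simp only [Fin.mk_one, h3, pairing_tensor]; ring

theorem pairing_mixed (p : Annulus) : pairing (F p) (pd 0 (pd 1 F) p) = -conf F p := by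
  have := pairing_pd_eq 0 (H.smooth.of_le (by norm_num)) ((H.isCn_pd 1).of_le (by norm_num))
    (H.pairing_pd 1) p
  rw [conf, this, neg_neg]

theorem pairing_pd_mixed (i : Fin 2) (p : Annulus) :
    pairing (pd i F p) (pd 0 (pd 1 F) p) = 0 := by
  have h : ∀ i j, pairing (pd i F p) (pd j (pd i F) p) = 0 := fun i j => by
    have hc : IsCn 1 (pd i F) := (H.isCn_pd i).of_le (by norm_num)
    have := pairing_pd_eq j hc hc (H.pairing_pd_self i) p
    rw [pairing_comm] at this
    linarith
  fin_cases i
  · have := h 0 1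
    rwa [pd_comm (H.smooth.of_le (by norm_num)) 1 0] at this
  · exact h 1 0

theorem modulus_eq (p : Annulus) :
    pairing (pd 0 (pd 1 F) p) (pd 0 (pd 1 F) p) = -(2 * conf F p * modulus F p) := by
  have := H.conf_ne p
  unfold modulus
  field_simp

theorem frame (p : Annulus) :
    IsLightFrame (F p) (dualSection F p) (pd 0 F p) (pd 1 F p) (conf F p) := by
  have hk := H.conf_ne p
  have c1 := pairing_comm (pd 0 (pd 1 F) p) (F p)
  have c2 := pairing_comm (pd 0 (pd 1 F) p) (pd 0 F p)
  have c3 := pairing_comm (pd 0 (pd 1 F) p) (pd 1 F p)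
  have hη : pairing (F p) (dualSection F p) = 1 := by
    unfold dualSection
    rw [pairing_neg_right, pairing_smul_right, pairing_sub_right, pairing_smul_right,
      H.pairing_mixed, H.pairing_self]
    field_simp
    ring
  refine ⟨hk, ?_, H.pairing_self p, hη, ?_, H.pairing_pd 0 p, H.pairing_pd 1 p, ?_, ?_,
    H.pairing_pd_self 0 p, H.pairing_pd_self 1 p, rfl⟩
  · obtain ⟨a, b, a', b', h1, h2, h3⟩ := H.split p
    rw [h1] at hη
    rw [conf, h1, h2, h3, det4_tensor, hη, mul_one]
  all_goals
    unfold dualSection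
    simp only [pairing_neg_right, pairing_smul_right, pairing_sub_right, pairing_neg_left,
      pairing_smul_left, pairing_sub_left, c1, c2, c3, H.pairing_mixed, H.pairing_self,
      H.pairing_pd, H.pairing_pd_mixed, H.modulus_eq]
    field_simp
    try ring

theorem pairing_dual_mixed (p : Annulus) :
    pairing (dualSection F p) (pd 0 (pd 1 F) p) = modulus F p := by
  have hk := H.conf_ne p
  unfold dualSection
  simp only [pairing_neg_left, pairing_smul_left, pairing_sub_left, H.pairing_mixed, H.modulus_eq]
  field_simp
  ring

/-- The Gauss equation of the isotropic surface `F`. -/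
theorem modulus_eq_log (p : Annulus) :
    modulus F p = (1 / 2) * pd 0 (pd 1 fun x => Real.log (conf F x)) p := by
  have hk := H.conf_ne p
  have f4 : IsCn 2 F := H.smooth.of_le (by norm_num)
  have f3 : ∀ i, IsCn 1 (pd i F) := fun i => (H.isCn_pd i).of_le (by norm_num)
  have f2 : ∀ i j, IsCn 1 (pd j (pd i F)) := fun i j => (H.isCn_pd i).pd j (by norm_num)
  have mix : pd 1 (pd 0 F) = pd 0 (pd 1 F) := funext fun x => pd_comm f4 1 0 x
  have e0 : ∀ x, pd 0 (conf F) x = pairing (pd 0 (pd 0 F) x) (pd 1 F x) := fun x => by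
    have := pd_pairing 0 (f3 0) (f3 1) x
    rw [H.pairing_pd_mixed 0, add_zero] at this
    exact this
  have e1 : ∀ x, pd 1 (conf F) x = pairing (pd 0 F x) (pd 1 (pd 1 F) x) := fun x => by
    have := pd_pairing 1 (f3 0) (f3 1) x
    rw [mix, pairing_comm (pd 0 (pd 1 F) x), H.pairing_pd_mixed 1, zero_add] at this
    exact this
  have sq : ∀ i x, pairing (pd i (pd i F) x) (pd i F x) = 0 := fun i x => by
    have := pairing_pd_eq i (f3 i) (f3 i) (H.pairing_pd_self i) x
    rw [pairing_comm (pd i F x)] at this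
    linarith
  have on : ∀ i x, pairing (pd i (pd i F) x) (F x) = 0 := fun i x => by
    have := pairing_pd_eq i (f4.of_le one_le_two) (f3 i) (H.pairing_pd i) x
    rw [H.pairing_pd_self] at this
    rw [pairing_comm]
    linarith
  -- `F₀₀` and `F₁₁` are combinations of `F, F₀` and of `F, F₁`
  have x0 : pd 0 (pd 0 F) p = pairing (pd 0 (pd 0 F) p) (dualSection F p) • F p
      + (pd 0 (conf F) p / conf F p) • pd 0 F p := by
    conv_lhs => rw [(H.frame p).expand (pd 0 (pd 0 F) p)]
    rw [on, sq, e0]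
    module
  have x1 : pd 1 (pd 1 F) p = pairing (pd 1 (pd 1 F) p) (dualSection F p) • F p
      + (pd 1 (conf F) p / conf F p) • pd 1 F p := by
    conv_lhs => rw [(H.frame p).expand (pd 1 (pd 1 F) p)]
    rw [on, sq, e1, pairing_comm (pd 0 F p)]
    module
  have y : pairing (pd 0 (pd 0 F) p) (pd 1 (pd 1 F) p) =
      pd 0 (conf F) p * pd 1 (conf F) p / conf F p := by
    rw [x0, x1]
    simp only [pairing_add_left, pairing_add_right, pairing_smul_left, pairing_smul_right,
      H.pairing_self, H.pairing_pd, pairing_comm (pd 0 F p) (F p)]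
    rw [show pairing (pd 0 F p) (pd 1 F p) = conf F p from rfl]
    field_simp
    ring
  have z : pd 0 (pd 1 (conf F)) p = pd 0 (conf F) p * pd 1 (conf F) p / conf F p
      + 2 * conf F p * modulus F p := by
    have h1 := pd_pairing 0 (f3 0) (f2 1 1) p
    rw [← show pd 1 (conf F) = _ from funext e1, y] at h1
    have h2 := pairing_pd_eq 1 (f3 0) (f2 1 0) (H.pairing_pd_mixed 0) p
    rw [mix, H.modulus_eq, pd_comm ((H.isCn_pd 1).of_le (by norm_num)) 1 0] at h2
    linarith
  have l0 : (pd 1 fun x => Real.log (conf F x)) = fun x => pd 1 (conf F) x * (conf F x)⁻¹ :=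
    funext fun x => by
      rw [pd_log 1 (H.isCn_conf.diff (by norm_num) x) (H.conf_ne x), div_eq_mul_inv]
  have d1 : IsCn 1 (pd 1 (conf F)) := H.isCn_conf.pd 1 (by norm_num)
  rw [l0, pd_mul 0 (d1.diff one_ne_zero p)
    ((H.isCn_conf.inv H.conf_ne).diff (by norm_num) p),
    pd_inv 0 (H.isCn_conf.diff (by norm_num) p) hk, z]
  field_simp
  ring

end IsLightSection

/-- The isotropic surface `e^v F`. -/
def scaled (F : Annulus → W) (v : Annulus → ℝ) (p : Annulus) : W := Real.exp (v p) • F p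

/-- The dual of the isotropic surface `e^v F`. -/
def scaledDual (F : Annulus → W) (v : Annulus → ℝ) (p : Annulus) : W :=
  (Real.exp (v p))⁻¹ • (dualSection F p - (pd 1 v p / conf F p) • pd 0 F p
    - (pd 0 v p / conf F p) • pd 1 F p - (pd 0 v p * pd 1 v p / conf F p) • F p)

/-- The Epstein surfaces of `e^v F` are given by `r = √2 / 2` and `r = -√2 / 2`. -/
def epstein (F : Annulus → W) (r : ℝ) (v : Annulus → ℝ) (p : Annulus) : W × W :=
  (r • (scaled F v p - scaledDual F v p), r • (scaled F v p + scaledDual F v p))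

namespace IsLightSection

variable {F : Annulus → W} (H : IsLightSection F) {v : Annulus → ℝ} (hv : IsCn 2 v)

include H hv

theorem isCn_scaled : IsCn 2 (scaled F v) := hv.exp.smul (H.smooth.of_le (by norm_num))

theorem pd_scaled (i : Fin 2) (p : Annulus) :
    pd i (scaled F v) p = Real.exp (v p) • (pd i v p • F p + pd i F p) := by
  have h := pd_smul i (hv.exp.diff two_ne_zero p) (H.smooth.diff (by norm_num) p)
  rw [pd_exp i (hv.diff two_ne_zero p)] at h
  refine h.trans ?_
  module

theorem scaled_frame (p : Annulus) :
    IsLightFrame (scaled F v p) (scaledDual F v p) (pd 0 (scaled F v) p) (pd 1 (scaled F v) p)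
      (Real.exp (v p) ^ 2 * conf F p) := by
  rw [H.pd_scaled hv, H.pd_scaled hv]
  exact (H.frame p).rescale (Real.exp_ne_zero _) _ _

theorem isCn_scaledDual : IsCn 1 (scaledDual F v) := by
  have d : ∀ i, IsCn 1 (pd i v) := fun i => hv.pd i (by norm_num)
  have k : IsCn 1 (conf F) := H.isCn_conf.of_le (by norm_num)
  have f : ∀ i, IsCn 1 (pd i F) := fun i => (H.isCn_pd i).of_le (by norm_num)
  refine (((hv.exp.of_le one_le_two).inv fun p => Real.exp_ne_zero _)).smul ?_
  exact (((H.isCn_dualSection.of_le one_le_two).sub (((d 1).div k H.conf_ne).smul (f 0))).sub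
    (((d 0).div k H.conf_ne).smul (f 1))).sub
    ((((d 0).mul (d 1)).div k H.conf_ne).smul (H.smooth.of_le (by norm_num)))

theorem pairing_scaledDual_mixed (p : Annulus) :
    pairing (scaledDual F v p) (pd 0 (pd 1 (scaled F v)) p) = modulus F p + pd 0 (pd 1 v) p := by
  have hk := H.conf_ne p
  have hE := Real.exp_ne_zero (v p)
  have d : ∀ i, IsCn 1 (pd i v) := fun i => hv.pd i (by norm_num)
  have f1 : IsCn 1 (pd 1 F) := (H.isCn_pd 1).of_le (by norm_num)
  have f0 : IsCn 1 F := H.smooth.of_le (by norm_num)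
  have e : pd 1 (scaled F v) = fun x => Real.exp (v x) • (pd 1 v x • F x + pd 1 F x) :=
    funext fun x => H.pd_scaled hv 1 x
  rw [e, pd_smul 0 (hv.exp.diff two_ne_zero p) ((((d 1).smul f0).add f1).diff one_ne_zero p),
    pd_add 0 (((d 1).smul f0).diff one_ne_zero p) (f1.diff one_ne_zero p),
    pd_smul 0 ((d 1).diff one_ne_zero p) (f0.diff one_ne_zero p), pd_exp 0 (hv.diff two_ne_zero p)]
  have Hf := H.frame p
  simp only [scaledDual, pairing_sub_left, pairing_smul_left, pairing_add_right,
    pairing_smul_right, H.pairing_dual_mixed, H.pairing_pd_mixed, H.pairing_mixed, Hf.ηs₀, Hf.ηs₁,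
    Hf.s₀s₀, Hf.s₁s₁, Hf.s₀s₁, Hf.σσ, Hf.σs₀, Hf.σs₁, pairing_comm (dualSection F p) (F p), Hf.ση,
    pairing_comm (pd 0 F p) (F p), pairing_comm (pd 1 F p) (F p),
    pairing_comm (pd 1 F p) (pd 0 F p)]
  field_simp
  ring

theorem epstein_mem {r : ℝ} (hr : r ^ 2 = 1 / 2) (p : Annulus) :
    epstein F r v p ∈ unitTangent := by
  have Hf := H.scaled_frame hv p
  have c := pairing_comm (scaledDual F v p) (scaled F v p)
  refine ⟨?_, ?_, ?_⟩ <;>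
    simp only [epstein, pairing_smul_left, pairing_smul_right, pairing_sub_left, pairing_sub_right,
      pairing_add_left, pairing_add_right, c, Hf.σσ, Hf.ση, Hf.ηη] <;>
    linarith

theorem pd_epstein (i : Fin 2) (r : ℝ) (p : Annulus) :
    pd i (epstein F r v) p =
      (r • (pd i (scaled F v) p - pd i (scaledDual F v) p),
        r • (pd i (scaled F v) p + pd i (scaledDual F v) p)) := by
  have ds := (H.isCn_scaled hv).diff two_ne_zero p
  have dη := (H.isCn_scaledDual hv).diff one_ne_zero p
  have hs := ((H.isCn_scaled hv).of_le one_le_two).sub (H.isCn_scaledDual hv)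
  have ha := ((H.isCn_scaled hv).of_le one_le_two).add (H.isCn_scaledDual hv)
  have c : ∀ {f : Annulus → W}, IsCn 1 f → IsCn 1 (fun x => r • f x) ∧
      pd i (fun x => r • f x) p = r • pd i f p := fun {f} hf =>
    ⟨hf.comp (Φ := fun y : W => r • y) fun _ => by fun_prop,
      pd_comp_clm i (hf.diff one_ne_zero p) (r • ContinuousLinearMap.id ℝ W)⟩
  have e : pd i (epstein F r v) p = (pd i (fun x => r • (scaled F v x - scaledDual F v x)) p,
      pd i (fun x => r • (scaled F v x + scaledDual F v x)) p) := by
    unfold pd epstein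
    rw [der_prodMk ((c hs).1.diff one_ne_zero p) ((c ha).1.diff one_ne_zero p)]
    rfl
  rw [e, (c hs).2, (c ha).2, pd_sub i ds dη, pd_add i ds dη]

end IsLightSection

/-! ### The variation of an Epstein surface -/

section Variation

variable {F : Annulus → W} {v u : Annulus → ℝ} {K : Set Annulus}

theorem IsPath.ofConst {E : Type*} [NormedAddCommGroup E] [NormedSpace ℝ E] {f : Annulus → E}
    (hf : IsCn 1 f) : IsPath K fun p _ => f p :=
  ⟨ContDiffOn.comp hf contDiffOn_fst fun _ hz => hz.1, fun _ _ _ => rfl⟩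

theorem IsPath.line (hv : IsCn 1 v) (hu : IsCn 1 u) (h : ∀ p ∉ K, u p = 0) :
    IsPath K fun p τ => v p + τ * u p := by
  refine ⟨?_, fun p hp τ => by simp [h p hp]⟩
  have h1 : ContDiffOn ℝ 1 (fun z : (ℝ × ℝ) × ℝ => toCover v z.1) (coverSet ×ˢ univ) :=
    ContDiffOn.comp hv contDiffOn_fst fun _ hz => hz.1
  have h2 : ContDiffOn ℝ 1 (fun z : (ℝ × ℝ) × ℝ => toCover u z.1) (coverSet ×ˢ univ) :=
    ContDiffOn.comp hu contDiffOn_fst fun _ hz => hz.1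
  refine (h1.add (contDiffOn_snd.mul h2)).congr fun z hz => ?_
  rw [toCover_eq _ hz.1, toCover_eq _ hz.1, toCover_eq _ hz.1]

theorem pd_eq_zero_of_eventuallyEq {f : Annulus → ℝ} {p : Annulus} (i : Fin 2)
    (h : f =ᶠ[𝓝 p] fun _ => 0) : pd i f p = 0 := by
  have := pd_const i (p := p) (0 : ℝ)
  unfold pd at this ⊢
  rw [der_congr h, this]

variable (H : IsLightSection F) (hv : IsCn 2 v) (hu : IsCn 2 u)

include hv hu in
theorem isCn_line (τ : ℝ) : IsCn 2 fun p => v p + τ * u p :=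
  hv.add (hu.comp (Φ := fun x : ℝ => τ * x) fun _ => by fun_prop)

include hv hu in
theorem pd_line (i : Fin 2) (τ : ℝ) (p : Annulus) :
    pd i (fun p => v p + τ * u p) p = pd i v p + τ * pd i u p := by
  rw [pd_add i (hv.diff two_ne_zero p)
    ((hu.comp (Φ := fun x : ℝ => τ * x) fun _ => by fun_prop).diff two_ne_zero p),
    pd_const_mul i τ (hu.diff two_ne_zero p)]

include H hv hu in
/-- The Epstein surfaces of `e^{v + τ u} F` form a path. -/
theorem isPath_epstein (hK : IsClosed K) (h : ∀ p ∉ K, u p = 0) :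
    IsPath K (fun p τ => scaled F (fun x => v x + τ * u x) p) ∧
      IsPath K (fun p τ => scaledDual F (fun x => v x + τ * u x) p) := by
  have d : ∀ i, IsPath K fun p τ => pd i (fun x => v x + τ * u x) p := by
    intro i
    simp only [pd_line hv hu]
    refine IsPath.line (hv.pd i (by norm_num)) (hu.pd i (by norm_num)) fun p hp => ?_
    refine pd_eq_zero_of_eventuallyEq i ?_
    filter_upwards [hK.isOpen_compl.mem_nhds hp] with x hx using h x hx
  have e : IsPath K fun p τ => Real.exp (v p + τ * u p) :=
    (IsPath.line (hv.of_le one_le_two) (hu.of_le one_le_two) h).comp Real.contDiff_exp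
  have k : IsPath K fun p (_ : ℝ) => conf F p := .ofConst (H.isCn_conf.of_le (by norm_num))
  have f : ∀ i, IsPath K fun p (_ : ℝ) => pd i F p :=
    fun i => .ofConst ((H.isCn_pd i).of_le (by norm_num))
  have f0 : IsPath K fun p (_ : ℝ) => F p := .ofConst (H.smooth.of_le (by norm_num))
  have n : IsPath K fun p (_ : ℝ) => dualSection F p :=
    .ofConst (H.isCn_dualSection.of_le one_le_two)
  have ne : ∀ p (_ : ℝ), conf F p ≠ 0 := fun p _ => H.conf_ne p
  refine ⟨e.smul f0, IsPath.smul ?_ (((n.sub (((d 1).div k ne).smul (f 0))).sub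
    (((d 0).div k ne).smul (f 1))).sub ((((d 0).mul (d 1)).div k ne).smul f0))⟩
  exact e.comp_of_forall (f := fun x : ℝ => x⁻¹) fun p τ => contDiffAt_inv ℝ (Real.exp_ne_zero _)

theorem hasDerivAt_scaled (p : Annulus) (τ : ℝ) :
    HasDerivAt (fun τ => scaled F (fun x => v x + τ * u x) p)
      (u p • scaled F (fun x => v x + τ * u x) p) τ := by
  have h1 : HasDerivAt (fun τ => v p + τ * u p) (u p) τ := by
    simpa using ((hasDerivAt_id τ).mul_const (u p)).const_add (v p)
  refine (h1.exp.smul_const (F p)).congr_deriv ?_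
  unfold scaled
  module

include H hv hu in
theorem hasDerivAt_scaledDual (p : Annulus) (τ : ℝ) {V : Annulus → ℝ} {f : ℝ}
    (hV : V = fun x => v x + τ * u x) (hf : f = Real.exp (V p) ^ 2 * conf F p) :
    HasDerivAt (fun τ => scaledDual F (fun x => v x + τ * u x) p)
      (-u p • scaledDual F V p - (pd 1 u p / f) • pd 0 (scaled F V) p
        - (pd 0 u p / f) • pd 1 (scaled F V) p) τ := by
  have hk := H.conf_ne p
  have h1 : ∀ a b : ℝ, HasDerivAt (fun τ => a + τ * b) b τ := fun a b => by
    simpa using ((hasDerivAt_id τ).mul_const b).const_add a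
  have hE := (h1 (v p) (u p)).exp.fun_inv (Real.exp_ne_zero _)
  have d := fun i => h1 (pd i v p) (pd i u p)
  have hB := (((hasDerivAt_const τ (dualSection F p)).fun_sub
    (((d 1).div_const (conf F p)).smul_const (pd 0 F p))).fun_sub
    (((d 0).div_const (conf F p)).smul_const (pd 1 F p))).fun_sub
    ((((d 0).fun_mul (d 1)).div_const (conf F p)).smul_const (F p))
  have hV2 : IsCn 2 V := hV ▸ isCn_line hv hu τ
  have := hE.fun_smul hB
  simp only [scaledDual, pd_line hv hu]
  refine this.congr_deriv ?_
  rw [H.pd_scaled hV2, H.pd_scaled hV2, hf]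
  subst hV
  simp only [pd_line hv hu]
  have hx := Real.exp_ne_zero (v p + τ * u p)
  generalize Real.exp (v p + τ * u p) = E at hx ⊢
  funext j
  simp only [Pi.add_apply, Pi.sub_apply, Pi.smul_apply, smul_eq_mul, Pi.zero_apply]
  field_simp
  ring

include H hv hu in
/-- Rescaling an Epstein surface by `e^{τ u}`, `0 ≤ τ ≤ 1`, gives a lens cobordism. -/
theorem wVolume_variation {r : ℝ} (hr : r ^ 2 = 1 / 2) (hK : IsCompact K) (h : ∀ p ∉ K, u p = 0) :
    IsLensCobordism (epstein F r v) (epstein F r fun x => v x + u x)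
        (fun p τ => epstein F r (fun x => v x + τ * u x) p) ∧
      wVolume (fun p τ => epstein F r (fun x => v x + τ * u x) p) =
        ∫ p, (u p * (modulus F p + pd 0 (pd 1 v) p) + (1 / 2) * (u p * pd 0 (pd 1 u) p)) := by
  obtain ⟨P, Q⟩ := isPath_epstein H hv hu hK.isClosed h
  have hN : IsPath K fun p τ => epstein F r (fun x => v x + τ * u x) p :=
    ((P.sub Q).comp (f := fun y : W => r • y) (by fun_prop)).prodMk
      ((P.add Q).comp (f := fun y : W => r • y) (by fun_prop))
  obtain ⟨L, V⟩ := hN.lensCobordism hK fun p τ => H.epstein_mem (isCn_line hv hu τ) hr p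
  simp only [zero_mul, add_zero, one_mul] at L
  refine ⟨L, V.trans ?_⟩
  congr 1
  funext p
  have key : ∀ τ, pathDAlpha (fun p τ => epstein F r (fun x => v x + τ * u x) p) p τ -
      pathVol (fun p τ => (epstein F r (fun x => v x + τ * u x) p).1) p τ =
        u p * (modulus F p + pd 0 (pd 1 v) p) + τ * (u p * pd 0 (pd 1 u) p) := by
    intro τ
    obtain ⟨V, hV⟩ : ∃ V : Annulus → ℝ, V = fun x => v x + τ * u x := ⟨_, rfl⟩
    have hV2 : IsCn 2 V := hV ▸ isCn_line hv hu τ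
    have Hf := H.scaled_frame hV2
    obtain ⟨s0, s1⟩ := pd_dual (H.isCn_scaled hV2) (H.isCn_scaledDual hV2) Hf p
    have dσ := hasDerivAt_scaled (F := F) (v := v) (u := u) p τ
    rw [← hV] at dσ
    have dη := hasDerivAt_scaledDual H hv hu p τ hV rfl
    have dN : deriv (fun τ => epstein F r (fun x => v x + τ * u x) p) τ = _ :=
      (((dσ.fun_sub dη).const_smul r).prodMk ((dσ.fun_add dη).const_smul r)).deriv
    have dx : deriv (fun τ => (epstein F r (fun x => v x + τ * u x) p).1) τ = _ :=
      ((dσ.fun_sub dη).const_smul r).deriv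
    have px : ∀ i, pd i (fun x => (epstein F r V x).1) p = (pd i (epstein F r V) p).1 := fun i => by
      have := hN.pd_clm (ContinuousLinearMap.fst ℝ W W) i p τ
      rw [← hV] at this
      exact this
    have m01 : pd 0 (pd 1 V) p = pd 0 (pd 1 v) p + τ * pd 0 (pd 1 u) p := by
      have e : pd 1 V = fun x => pd 1 v x + τ * pd 1 u x := by
        funext x; rw [hV]; exact pd_line hv hu 1 τ x
      rw [e, pd_add 0 ((hv.pd (m := 1) 1 (by norm_num)).diff one_ne_zero p)
        (((hu.pd (m := 1) 1 (by norm_num)).comp (Φ := fun x : ℝ => τ * x)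
          fun _ => by fun_prop).diff one_ne_zero p),
        pd_const_mul 0 τ ((hu.pd (m := 1) 1 (by norm_num)).diff one_ne_zero p)]
    have main := (Hf p).dAlpha_sub_vol (u := u p) (w₀ := pd 1 u p / (Real.exp (V p) ^ 2 * conf F p))
      (w₁ := pd 0 u p / (Real.exp (V p) ^ 2 * conf F p)) hr rfl rfl rfl rfl rfl rfl rfl rfl
      (A := pairing (scaledDual F V p) (pd 0 (pd 0 (scaled F V)) p))
      (B := pairing (scaledDual F V p) (pd 1 (pd 1 (scaled F V)) p))
      (C := pairing (scaledDual F V p) (pd 0 (pd 1 (scaled F V)) p))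
    rw [← s0, ← s1, H.pairing_scaledDual_mixed hV2, m01] at main
    have fin : u p * (modulus F p + pd 0 (pd 1 v) p) + τ * (u p * pd 0 (pd 1 u) p) =
      u p * (modulus F p + (pd 0 (pd 1 v) p + τ * pd 0 (pd 1 u) p)) := by ring
    rw [fin, ← main]
    unfold pathDAlpha pathVol
    rw [dN, dx]
    beta_reduce
    rw [← hV, px, px, H.pd_epstein hV2, H.pd_epstein hV2]
    rfl
  simp only [key]
  rw [intervalIntegral.integral_add (Continuous.intervalIntegrable (by fun_prop) _ _)
    (Continuous.intervalIntegrable (by fun_prop) _ _),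
    intervalIntegral.integral_const, intervalIntegral.integral_mul_const, integral_id]
  simp

end Variation

/-! ### The Epstein surfaces of a metric -/

section EpsteinSurface

variable {F σ η : Annulus → W} {φ : Annulus → Projectivization ℝ W} {g h : Metric}

/-- The conformal factor of the isotropic surface with first fundamental form `g` over the
section `F`. -/
def scale (F : Annulus → W) (g : Metric) (p : Annulus) : ℝ :=
  (1 / 2) * (Real.log (g.dens p) - Real.log (conf F p))

theorem exp_scale_sq (H : IsLightSection F) (p : Annulus) :
    Real.exp (scale F g p) ^ 2 * conf F p = g.dens p := by
  have hg := g.dens_pos p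
  have hk : 0 < conf F p := H.pos p
  have e : Real.exp (scale F g p) ^ 2 = g.dens p / conf F p := by
    rw [← Real.exp_nat_mul, ← Real.exp_log (div_pos hg hk), Real.log_div hg.ne' hk.ne']
    congr 1
    unfold scale
    push_cast
    ring
  rw [e]
  field_simp

theorem isCn_scale (H : IsLightSection F) (hg : g.IsCn 2) : IsCn 2 (scale F g) :=
  (((g.isCn_iff.1 hg).log g.dens_ne).sub
    ((H.isCn_conf.of_le (by norm_num)).log H.conf_ne)).comp (Φ := fun x : ℝ => (1 / 2) * x)
    fun _ => by fun_prop

/-- An isotropic surface over `φ` is a `C²` multiple of a given section. -/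
theorem IsIsotropicSurface.exists_ratio (hσ : IsIsotropicSurface φ g σ) (hF : IsCn 2 F)
    (hφ : ∀ p, ∃ hp : F p ≠ 0, φ p = Projectivization.mk ℝ (F p) hp) :
    ∃ r : Annulus → ℝ, IsCn 2 r ∧ ∀ p, σ p = r p • F p := by
  have hr : ∀ p, ∃ a : ℝ, a • F p = σ p := fun p => by
    obtain ⟨⟨h0, h1⟩, -⟩ := hσ.2 p
    obtain ⟨h2, h3⟩ := hφ p
    exact (Projectivization.mk_eq_mk_iff' ℝ _ _ h0 h2).1 (h1.symm.trans h3)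
  choose a ha using hr
  have comp : ∀ {f : Annulus → W}, IsCn 2 f → ∀ i, IsCn 2 fun p => f p i := fun hf i =>
    hf.comp (Φ := fun x : W => x i) fun _ => by fun_prop
  have dot : ∀ {f k : Annulus → W}, IsCn 2 f → IsCn 2 k →
      IsCn 2 fun p => f p 0 * k p 0 + f p 1 * k p 1 + f p 2 * k p 2 + f p 3 * k p 3 :=
    fun hf hk => ((((comp hf 0).mul (comp hk 0)).add ((comp hf 1).mul (comp hk 1))).add
      ((comp hf 2).mul (comp hk 2))).add ((comp hf 3).mul (comp hk 3))
  have ne : ∀ p, F p 0 * F p 0 + F p 1 * F p 1 + F p 2 * F p 2 + F p 3 * F p 3 ≠ 0 := by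
    intro p h0
    obtain ⟨h2, -⟩ := hφ p
    apply h2
    have := mul_self_nonneg (F p 0)
    have := mul_self_nonneg (F p 1)
    have := mul_self_nonneg (F p 2)
    have := mul_self_nonneg (F p 3)
    funext i
    have c : F p i * F p i = 0 := by
      fin_cases i <;> dsimp only [Fin.zero_eta, Fin.mk_one, Fin.reduceFinMk] <;> linarith
    exact mul_self_eq_zero.1 c
  refine ⟨a, ?_, fun p => (ha p).symm⟩
  have e : a = fun p => (σ p 0 * F p 0 + σ p 1 * F p 1 + σ p 2 * F p 2 + σ p 3 * F p 3) /
      (F p 0 * F p 0 + F p 1 * F p 1 + F p 2 * F p 2 + F p 3 * F p 3) := by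
    funext p
    rw [eq_div_iff (ne p), ← ha p]
    simp only [Pi.smul_apply, smul_eq_mul]
    ring
  rw [e]
  exact (dot hσ.1 hF).div (dot hF hF) ne

/-- The ratio of an isotropic surface and a section determines the first fundamental form. -/
theorem IsIsotropicSurface.dens_eq (hσ : IsIsotropicSurface φ g σ) (hF : IsCn 2 F)
    (hs : ∀ p, ∃ a b a' b' : Fin 2 → ℝ,
      F p = tensor a b ∧ pd 0 F p = tensor a b' ∧ pd 1 F p = tensor a' b)
    {r : Annulus → ℝ} (hr : IsCn 2 r) (h : ∀ p, σ p = r p • F p) (p : Annulus) :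
    g.dens p = r p ^ 2 * conf F p := by
  have e : ∀ i, pd i σ p = r p • pd i F p + pd i r p • F p := fun i => by
    rw [show σ = fun p => r p • F p from funext h]
    exact pd_smul i (hr.diff two_ne_zero p) (hF.diff two_ne_zero p)
  have hg : g.dens p = pairing (pd 0 σ p) (pd 1 σ p) := (hσ.2 p).2.2 (frame 0) (frame 1)
  obtain ⟨a, b, a', b', h1, h2, h3⟩ := hs p
  rw [hg, e, e, conf, h1, h2, h3]
  simp only [pairing_add_left, pairing_add_right, pairing_smul_left, pairing_smul_right,
    pairing_tensor]
  ring

/-- The Epstein surfaces of a metric `g` are `S` and `-S`, where `S` is determined by any section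
of the tautological bundle. -/
theorem IsEpsteinSurface.eq_epstein {S : Annulus → W × W} (hS : IsEpsteinSurface φ g S)
    (H : IsLightSection F) (hφ : ∀ p, ∃ hp : F p ≠ 0, φ p = Projectivization.mk ℝ (F p) hp)
    (hg : g.IsCn 2) : S = epstein F (√2 / 2) (scale F g) ∨ S = epstein F (-(√2 / 2)) (scale F g) := by
  obtain ⟨σ, η, hσ, hη, hS⟩ := hS
  have f2 : IsCn 2 F := H.smooth.of_le (by norm_num)
  obtain ⟨r, hr, hrF⟩ := hσ.exists_ratio f2 hφ
  have hsq : ∀ p, r p ^ 2 = Real.exp (scale F g p) ^ 2 := fun p =>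
    mul_right_cancel₀ (H.conf_ne p)
      ((hσ.dens_eq f2 H.split hr hrF p).symm.trans (exp_scale_sq H p).symm)
  have hne : ∀ p, r p ≠ 0 := fun p h0 => by
    have := hsq p
    rw [h0, zero_pow two_ne_zero] at this
    exact (pow_pos (Real.exp_pos _) 2).ne this
  -- the sign of the ratio is constant since the annulus is connected
  obtain ⟨ε, hε, he⟩ : ∃ ε : ℝ, (ε = 1 ∨ ε = -1) ∧ ∀ p, r p = ε * Real.exp (scale F g p) := by
    have hor : ∀ p, r p = Real.exp (scale F g p) ∨ r p = -Real.exp (scale F g p) :=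
      fun p => sq_eq_sq_iff_eq_or_eq_neg.1 (hsq p)
    by_cases hp : ∃ p, 0 < r p
    · obtain ⟨p, hp⟩ := hp
      refine ⟨1, Or.inl rfl, fun q => ?_⟩
      rcases hor q with h | h
      · rw [h, one_mul]
      · have hq : r q < 0 := by rw [h]; exact neg_neg_of_pos (Real.exp_pos _)
        obtain ⟨x, hx⟩ := mem_range_of_exists_le_of_exists_ge hr.continuous ⟨q, hq.le⟩ ⟨p, hp.le⟩
        exact absurd hx (hne x)
    · push Not at hp
      refine ⟨-1, Or.inr rfl, fun q => ?_⟩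
      rcases hor q with h | h
      · have := hp q
        rw [h] at this
        exact absurd (Real.exp_pos _) (not_lt.2 this)
      · rw [h, neg_one_mul]
  have hε2 : ε * ε = 1 := by rcases hε with rfl | rfl <;> norm_num
  have hv := isCn_scale H hg
  have eσ : σ = fun p => ε • scaled F (scale F g) p := funext fun p => by
    rw [hrF, he, scaled, smul_smul]
  have eη : ∀ p, η p = ε • scaledDual F (scale F g) p := fun p => by
    have Hf := H.scaled_frame hv p
    obtain ⟨h1, h2, h3⟩ := hη p
    have d : ∀ i, pairing (η p) (pd i (scaled F (scale F g)) p) = 0 := fun i => by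
      have h4 : pairing (η p) (pd i σ p) = 0 := h3 (SplitLiouville.frame i)
      have h5 : pd i σ p = ε • pd i (scaled F (scale F g)) p := by
        rw [eσ]
        exact pd_comp_clm i ((H.isCn_scaled hv).diff two_ne_zero p) (ε • ContinuousLinearMap.id ℝ W)
      rw [h5, pairing_smul_right] at h4
      rcases mul_eq_zero.1 h4 with h6 | h6
      · rw [h6] at hε2; norm_num at hε2
      · exact h6
    have hs : pairing (η p) (scaled F (scale F g) p) = ε := by
      rw [eσ, pairing_smul_right] at h1
      linear_combination ε * h1 - pairing (η p) (scaled F (scale F g) p) * hε2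
    have hx := Hf.expand (η p)
    rw [d, d, hs, zero_div, zero_smul, zero_smul, add_zero, add_zero] at hx
    have h0 : pairing (η p) (scaledDual F (scale F g) p) = 0 := by
      rw [hx] at h2
      simp only [pairing_add_left, pairing_add_right, pairing_smul_left, pairing_smul_right,
        Hf.σσ, Hf.ηη, Hf.ση, pairing_comm (scaledDual F (scale F g) p)] at h2
      have h4 : ε * pairing (η p) (scaledDual F (scale F g) p) = 0 := by linarith
      rcases mul_eq_zero.1 h4 with h6 | h6
      · rw [h6] at hε2; norm_num at hε2
      · exact h6
    rw [h0, zero_smul, zero_add] at hx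
    exact hx
  have e : ∀ p, S p = epstein F (ε * (√2 / 2)) (scale F g) p := fun p => by
    rw [hS p, eη, eσ]
    refine Prod.ext ?_ ?_ <;> dsimp only [epstein] <;> module
  rcases hε with rfl | rfl
  · left; funext p; rw [e, one_mul]
  · right; funext p; rw [e, neg_one_mul]

/-- A split immersion that carries an isotropic surface has a section as above. -/
theorem IsSplitImmersion.exists_section (hφ : IsSplitImmersion φ)
    (hσ : IsIsotropicSurface φ g σ) : ∃ F, IsLightSection F ∧
      ∀ p, ∃ hp : F p ≠ 0, φ p = Projectivization.mk ℝ (F p) hp := by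
  obtain ⟨F, hF, h⟩ := hφ
  have f2 : IsCn 2 F := hF.of_le (WithTop.coe_le_coe.2 (le_top : (2 : ℕ∞) ≤ ⊤))
  obtain ⟨r, hr, hrF⟩ := hσ.exists_ratio f2 fun p => (h p).1
  refine ⟨F, ⟨hF.of_le (WithTop.coe_le_coe.2 (le_top : (4 : ℕ∞) ≤ ⊤)), fun p => (h p).2.2, fun p => ?_⟩,
    fun p => (h p).1⟩
  have h1 := hσ.dens_eq f2 (fun p => (h p).2.2) hr hrF p
  have h2 := g.dens_pos p
  rw [h1] at h2
  exact (pos_iff_pos_of_mul_pos h2).1 (by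
    refine lt_of_le_of_ne (sq_nonneg _) fun h0 => ?_
    rw [← h0, zero_mul] at h2
    exact lt_irrefl _ h2)

/-- The coefficient `⟨η, σ₀₁⟩` of an Epstein surface is half the curvature form, up to sign. -/
theorem modulus_add_scale (H : IsLightSection F) (hg : g.IsCn 2) (p : Annulus) :
    modulus F p + pd 0 (pd 1 (scale F g)) p = -(1 / 2) * g.curvForm p := by
  have lg := (g.isCn_iff.1 hg).log g.dens_ne
  have lk : IsCn 2 fun x => Real.log (conf F x) := (H.isCn_conf.of_le (by norm_num)).log H.conf_ne
  have d : ∀ {f : Annulus → ℝ}, IsCn 2 f → IsCn 1 (pd 1 f) := fun hf => hf.pd 1 (by norm_num)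
  have e : pd 1 (scale F g) = fun x => (1 / 2) * (pd 1 (fun x => Real.log (g.dens x)) x -
      pd 1 (fun x => Real.log (conf F x)) x) := funext fun x => by
    unfold scale
    rw [pd_const_mul 1 _ ((lg.sub lk).diff two_ne_zero x),
      pd_sub 1 (lg.diff two_ne_zero x) (lk.diff two_ne_zero x)]
  rw [e, pd_const_mul 0 _ (((d lg).sub (d lk)).diff one_ne_zero p),
    pd_sub 0 ((d lg).diff one_ne_zero p) ((d lk).diff one_ne_zero p), H.modulus_eq_log,
    g.curvForm_eq hg]
  ring

end EpsteinSurface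

/-! ### The `𝓦`-volume and the Liouville action -/

/-- The Liouville action of metrics that agree outside a compact set. -/
theorem action_of_compact {g h : Metric} (hg : g.IsCn 2) (hh : h.IsCn 2) {K : Set Annulus}
    (hK : IsCompact K) (hgh : ∀ p ∉ K, g.factor h p = 0) :
    ActionConverges g h ∧ action g h = ∫ p, (g.factor h p * (-(1 / 2) * g.curvForm p)
      + (1 / 2) * (g.factor h p * pd 0 (pd 1 (g.factor h)) p)) := by
  have hu : IsCn 2 (g.factor h) := g.isCn_factor h hg hh
  have key : ∀ {f : Annulus → ℝ}, Continuous f → Integrable fun p => g.factor h p * f p := by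
    intro f hf
    have hc : Continuous fun p => g.factor h p * f p := hu.continuous.mul hf
    obtain ⟨C, hC⟩ := hK.exists_bound_of_continuousOn hc.continuousOn
    refine integrable_of_bounded hc (C := max C 0) fun p => ?_
    by_cases hp : p ∈ K
    · exact (hC p hp).trans (le_max_left _ _)
    · rw [hgh p hp, zero_mul, abs_zero]; exact le_max_right _ _
  have h1 := key (g.continuous_curvForm hg)
  have h2 := key (continuous_pd_pd hu 0 1)
  have e : ∀ p, ddI (g.factor h) p = 2 * pd 0 (pd 1 (g.factor h)) p := ddI_eq hu
  refine ⟨⟨h1, ?_⟩, ?_⟩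
  · simp only [e]
    exact (h2.const_mul 2).congr (Eventually.of_forall fun p => by ring)
  · unfold action
    simp only [e]
    have a : ∀ p, g.factor h p * (-(1 / 2) * g.curvForm p)
        + (1 / 2) * (g.factor h p * pd 0 (pd 1 (g.factor h)) p) =
        -(1 / 2) * (g.factor h p * g.curvForm p)
        + (1 / 2) * (g.factor h p * pd 0 (pd 1 (g.factor h)) p) := fun p => by ring
    have b : ∀ p, g.factor h p * (2 * pd 0 (pd 1 (g.factor h)) p) =
        2 * (g.factor h p * pd 0 (pd 1 (g.factor h)) p) := fun p => by ring
    simp only [a, b]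
    rw [integral_add (h1.const_mul _) (h2.const_mul _), integral_const_mul, integral_const_mul,
      integral_const_mul]
    ring

theorem exists_notMem_of_isCompact {K : Set Annulus} (hK : IsCompact K) : ∃ p, p ∉ K := by
  obtain ⟨ε, h0, h1, h2⟩ := exists_strip_notMem hK
  have := Real.pi_pos
  exact ⟨_, h2 0 (ε / 2) (by positivity) (by linarith) (Or.inl (by linarith))⟩

theorem eq_zero_of_neg_mem {z : W × W} (h : z ∈ unitTangent) (h0 : z = -z) : False := by
  have h1 : z = 0 := self_eq_neg.1 h0
  have := h.1
  rw [h1] at this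
  simp [pairing] at this

/-- The `𝓦`-volume of the lens cobordisms between Epstein surfaces of metrics that agree outside a
compact set is the Liouville action. -/
theorem wVolume_eq_action {g h : Metric} {φ : Annulus → Projectivization ℝ W}
    {S S' : Annulus → W × W} (hg : g.IsCn 2) (hh : h.IsCn 2)
    (hgh : ∃ K : Set Annulus, IsCompact K ∧ ∀ p ∉ K, g.form p = h.form p)
    (hφ : IsSplitImmersion φ) (hS : IsEpsteinSurface φ g S) (hS' : IsEpsteinSurface φ h S') :
    ActionConverges g h ∧ (∃ M, IsLensCobordism S S' M ∨ IsLensCobordism S (-S') M) ∧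
      ∀ M, IsLensCobordism S S' M ∨ IsLensCobordism S (-S') M → wVolume M = action g h := by
  obtain ⟨K, hK, hgh⟩ := hgh
  have hu0 : ∀ p ∉ K, g.factor h p = 0 := fun p hp => by
    unfold Metric.factor
    rw [hgh p hp, div_self (h.pos p).ne', Real.log_one, mul_zero]
  obtain ⟨hc, ha⟩ := action_of_compact hg hh hK hu0
  obtain ⟨F, H, hF⟩ : ∃ F, IsLightSection F ∧
      ∀ p, ∃ hp : F p ≠ 0, φ p = Projectivization.mk ℝ (F p) hp := by
    obtain ⟨σ, η, hσ, -⟩ := hS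
    exact hφ.exists_section hσ
  obtain ⟨r, hr, hSr, hSr'⟩ : ∃ r : ℝ, r ^ 2 = 1 / 2 ∧ S = epstein F r (scale F g) ∧
      (epstein F r (scale F h) = S' ∨ epstein F r (scale F h) = -S') := by
    have h2 : (√2 / 2) ^ 2 = (1 / 2 : ℝ) := by
      rw [div_pow, Real.sq_sqrt two_pos.le]; norm_num
    have hn : ∀ r v, epstein F (-r) v = -epstein F r v := fun r v => by
      funext p
      simp only [epstein, Pi.neg_apply, neg_smul, Prod.neg_mk]
    rcases hS.eq_epstein H hF hg with e | e <;> rcases hS'.eq_epstein H hF hh with e' | e'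
    · exact ⟨_, h2, e, Or.inl e'.symm⟩
    · exact ⟨_, h2, e, Or.inr (by rw [e', hn, neg_neg])⟩
    · exact ⟨_, by rw [neg_sq]; exact h2, e, Or.inr (by rw [e', hn])⟩
    · exact ⟨_, by rw [neg_sq]; exact h2, e, Or.inl e'.symm⟩
  have hv : (fun x => scale F g x + g.factor h x) = scale F h := by
    funext x
    rw [Metric.factor_eq, scale, scale]
    ring
  obtain ⟨L, V⟩ := wVolume_variation H (isCn_scale H hg) (g.isCn_factor h hg hh) hr hK hu0
  simp only [modulus_add_scale H hg] at V
  rw [← ha] at V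
  rw [hv, ← hSr] at L
  refine ⟨hc, ⟨_, hSr'.imp (fun e => e ▸ L) fun e => e ▸ L⟩, fun M hM => ?_⟩
  obtain ⟨T, hT, hTr⟩ : ∃ T, IsLensCobordism S T M ∧
      (epstein F r (scale F h) = T ∨ epstein F r (scale F h) = -T) := by
    rcases hM with hM | hM
    · exact ⟨_, hM, hSr'⟩
    · exact ⟨_, hM, hSr'.symm.imp id fun e => by rw [e, neg_neg]⟩
  -- off a compact set both cobordisms are constant, so that their ends agree
  have e : T = epstein F r (scale F h) := by
    rcases hTr with e | e
    · exact e.symm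
    · exfalso
      obtain ⟨K₁, hK₁, c₁⟩ := hT.constant
      obtain ⟨K₂, hK₂, c₂⟩ := L.constant
      obtain ⟨p, hp⟩ := exists_notMem_of_isCompact (hK₁.union hK₂)
      have one : (1 : ℝ) ∈ Icc (0 : ℝ) 1 := ⟨zero_le_one, le_rfl⟩
      have a₁ := c₁ p (fun h => hp (Or.inl h)) 1 one
      have a₂ := c₂ p (fun h => hp (Or.inr h)) 1 one
      rw [hT.start, hT.finish] at a₁
      rw [L.start, L.finish, e, Pi.neg_apply, ← a₁] at a₂
      have hm := hT.mem p 1 one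
      rw [hT.finish] at hm
      exact eq_zero_of_neg_mem hm a₂.symm
  rw [← V, hT.wVolume_eq, L.wVolume_eq, e]

end SplitLiouville

end

open SplitLiouville in
theorem mainTheorem1 :
    -- Chasles relation
    (∀ b g h k : Metric, InSClass b g → InSClass b h → InSClass b k →
      Integrable (fun p => g.factor k p * g.curvForm p) →
      Integrable (fun p => k.factor h p * k.curvForm p) →
      ActionConverges g k ∧ ActionConverges k h ∧ ActionConverges g h ∧
        action g h = action g k + action k h) ∧
    -- monotonicity formula
    (∀ b g h : Metric, InSClass b g → InSClass b h →
      Integrable (fun p => g.factor h p * g.curvForm p) →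
      ActionConverges g h ∧
        Integrable (fun p => g.factor h p * (g.curvForm p + h.curvForm p)) ∧
        action g h = -(1 / 4) * ∫ p, g.factor h p * (g.curvForm p + h.curvForm p)) ∧
    -- metrics of constant curvature, in particular uniformizing metrics
    (∀ (c : ℝ) (hc : 0 < c),
      (∀ h : Metric, IsUniformizing c hc h →
        InSClass (deSitter c hc) h ∧ ∀ p, h.curvature p = c) ∧
      ∀ g h : Metric, InSClass (deSitter c hc) g → InSClass (deSitter c hc) h →
        (∀ p, g.curvature p = c) → (∀ p, h.curvature p = c) →
        ActionConverges g h ∧ action g h = 0) ∧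
    -- metrics that agree outside a compact set
    (∀ (g h : Metric) (φ : Annulus → Projectivization ℝ W) (S S' : Annulus → W × W),
      g.IsCn 2 → h.IsCn 2 →
      (∃ K : Set Annulus, IsCompact K ∧ ∀ p ∉ K, g.form p = h.form p) →
      IsSplitImmersion φ → IsEpsteinSurface φ g S → IsEpsteinSurface φ h S' →
      ActionConverges g h ∧
        (∃ M, IsLensCobordism S S' M ∨ IsLensCobordism S (-S') M) ∧
        ∀ M, IsLensCobordism S S' M ∨ IsLensCobordism S (-S') M →
          wVolume M = action g h) := by
  refine ⟨fun b g h k Hg Hh Hk hi hi' => ?_, fun b g h Hg Hh hi => ?_, fun c hc =>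
    ⟨fun h hh => hh.inSClass, fun g h Hg Hh hg hh => action_of_curvature hc Hg Hh hg hh⟩,
    fun g h φ S S' hg hh hgh hφ hS hS' => wVolume_eq_action hg hh hgh hφ hS hS'⟩
  · have Hgk := Hg.asymptotic.symm.trans Hk.asymptotic
    have Hkh := Hk.asymptotic.symm.trans Hh.asymptotic
    obtain ⟨h1, h2⟩ := Hgk.chasles Hkh hi hi'
    exact ⟨Hgk.actionConverges hi, Hkh.actionConverges hi', h1, h2⟩
  · have H := Hg.asymptotic.symm.trans Hh.asymptotic
    exact ⟨H.actionConverges hi, H.monotonicity hi⟩
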